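/- **Conventions.** Let $(M,g)$ be a smooth oriented Riemannian four-manifold with Levi-Civita connection $\nabla$. The curvature convention is $(\nabla_a\nabla_b-\nabla_b\nabla_a)V^d=R_{abc}{}^{d}V^c$, $R_{ab}=R_{acb}{}^{c}$, $R=g^{ab}R_{ab}$. Two-component spinors are used: $\mathbb C\otimes TM\cong\mathbb S\otimes\mathbb S'$ locally, $g_{ab}=\varepsilon_{AB}\varepsilon_{A'B'}$, $\varepsilon_{01}=\varepsilon_{0'1'}=1$, $\mu_A=\mu^B\varepsilon_{BA}$, $\mu^A=\varepsilon^{AB}\mu_B$ (similarly for primed indices), and round brackets denote symmetrisation. The self-dual two-forms are those of the form $\omega_{A'B'}\varepsilon_{AB}$ and the anti-self-dual ones those of the form $\rho_{AB}\varepsilon_{A'B'}$, with $\omega_{A'B'}$, $\rho_{AB}$ symmetric. The Weyl tensor is $C_{abcd}=\psi_{ABCD}\varepsilon_{A'B'}\varepsilon_{C'D'}+\psi_{A'B'C'D'}\varepsilon_{AB}\varepsilon_{CD}$, the conformal curvature is *anti-self-dual* if $\psi_{A'B'C'D'}=0$, and $$P_{ABA'B'}=\phi_{ABA'B'}-\Lambda\,\varepsilon_{AB}\varepsilon_{A'B'},\qquad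 \phi_{ABA'B'}=-\tfrac12\big(R_{ab}-\tfrac14Rg_{ab}\big),\qquad \Lambda=\tfrac{1}{24}R .$$ Let $E=\Lambda^2_+(M)\oplus\Lambda^1(M)\oplus\Lambda^2_-(M)$, a real vector bundle of rank $10$ whose sections are written $X=(\omega_{A'B'},K_{AA'},\rho_{AB})$, and let $\mathcal D$ be the connection on $E$ given by $$\mathcal D_{AA'}X=\begin{pmatrix}\nabla_{AA'}\omega_{B'C'}-\varepsilon_{A'B'}K_{C'A}-\varepsilon_{A'C'}K_{B'A}\\ \nabla_{AA'}K_{BB'}+P_{ABA'C'}\,\omega_{B'}{}^{C'}-\varepsilon_{A'B'}\rho_{AB}\\ \nabla_{AA'}\rho_{BC}-\omega_{A'}{}^{E'}\nabla_{E'}{}^{D}\psi_{ABCD}+K_{A'}{}^{D}\psi_{ABCD}+2P_{A'E'A(B}K_{C)}{}^{E'}\end{pmatrix}.$$ For a smooth positive function $\Omega$, put $\hat g=\Omega^2g$, $\hat\varepsilon_{AB}=\Omega\varepsilon_{AB}$, $\hat\varepsilon_{A'B'}=\Omega\varepsilon_{A'B'}$, $\Upsilon_a=\Omega^{-1}\nabla_a\Omega$.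 A triple $X$ formed with respect to $g$ corresponds to the triple $\hat X$ formed with respect to $\hat g$ with $$\hat X=\begin{pmatrix}\hat\omega_{A'B'}\\ \hat K_{AA'}\\ \hat\rho_{AB}\end{pmatrix}=\begin{pmatrix}\Omega^2\omega_{A'B'}\\ \Omega\,(K_{AA'}+\Upsilon_{AB'}\omega_{A'}{}^{B'})\\ \rho_{AB}+2\Upsilon_{C'(A}K_{B)}{}^{C'}+\omega^{C'D'}\Upsilon_{C'A}\Upsilon_{D'B}\end{pmatrix}.$$ For an open set $U\subseteq M$ we say that $g$ is *conformal to Kähler on $U$* if there are a smooth function $\Omega>0$ and a complex structure $J$ on $U$ such that $\Omega^2g$ is a Kähler metric for $J$ whose Kähler form is self-dual, i.e. induces the given orientation. We say that $(M,g)$ is *locally conformal to Kähler* if every point of $M$ has an open neighbourhood on which $g$ is conformal to Kähler. **Theorem.** Let $(M,g)$ be a smooth oriented Riemannian four-manifold with anti-self-dual conformal curvature. 1. $(M,g)$ is locally conformal to Kähler if and only if every point of $M$ has an open neighbourhood over which there is a real smooth section $X=(\omega_{A'B'},K_{AA'},\rho_{AB})$ of $E$ that is parallel, $\mathcal D_aX=0$,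 and satisfies $\omega_{A'B'}\omega^{A'B'}\neq0$ at every point (so that $X$ is nowhere zero). 2. More precisely, for every open set $U\subseteq M$, the metric $g$ is conformal to Kähler on $U$ if and only if such a section $X$ exists over $U$. 3. The connection $\mathcal D$ is conformally invariant: over every open set and for every smooth $\Omega>0$ there, the connection $\hat{\mathcal D}$ formed with $\hat g=\Omega^2g$ satisfies $\hat{\mathcal D}_a\hat X=\widehat{\mathcal D_aX}$ for every smooth section $X$ of $E$, where on the right-hand side the transformation rule above is applied to the values of $\mathcal D_aX$ in $E$, the index $a$ being a spectator. -/

import Mathlib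

open scoped Manifold ContDiff

noncomputable section

namespace ConfKahler

/-- The model space of a four-manifold. -/
abbrev E4 := EuclideanSpace ℝ (Fin 4)

/-! ### Riemannian geometry in local coordinates

Coordinate components of tensor fields are functions of a point of `E4`; `g i j` are the
components of a metric. -/

/-- The partial derivative `∂ᵢ f`. -/
def pd (i : Fin 4) (f : E4 → ℝ) (y : E4) : ℝ :=
  fderiv ℝ f y (EuclideanSpace.single i 1)

/-- The components `g^{ij}` of the inverse metric. -/
def metricInv (g : Fin 4 → Fin 4 → E4 → ℝ) (i j : Fin 4) (y : E4) : ℝ :=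
  (Matrix.of fun k l => g k l y)⁻¹ i j

/-- The Christoffel symbols `Γ^k_{ij}` of the Levi-Civita connection. -/
def christoffel (g : Fin 4 → Fin 4 → E4 → ℝ) (k i j : Fin 4) (y : E4) : ℝ :=
  (1 / 2) * ∑ l, metricInv g k l y * (pd i (g l j) y + pd j (g l i) y - pd l (g i j) y)

/-- `∇ᵢ Kⱼ` for a one-form `K`. -/
def nabla1 (g : Fin 4 → Fin 4 → E4 → ℝ) (K : Fin 4 → E4 → ℝ) (i j : Fin 4) (y : E4) : ℝ :=
  pd i (K j) y - ∑ m, christoffel g m i j y * K m y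

/-- `∇ᵢ F_{jk}` for a covariant two-tensor `F`. -/
def nabla2 (g F : Fin 4 → Fin 4 → E4 → ℝ) (i j k : Fin 4) (y : E4) : ℝ :=
  pd i (F j k) y
    - ∑ m, (christoffel g m i j y * F m k y + christoffel g m i k y * F j m y)

/-- `∇ₑ W_{abcd}` for a covariant four-tensor `W`. -/
def nabla4 (g : Fin 4 → Fin 4 → E4 → ℝ) (W : Fin 4 → Fin 4 → Fin 4 → Fin 4 → E4 → ℝ)
    (e a b c d : Fin 4) (y : E4) : ℝ :=
  pd e (W a b c d) y
    - ∑ m, (christoffel g m e a y * W m b c d y + christoffel g m e b y * W a m c d y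
      + christoffel g m e c y * W a b m d y + christoffel g m e d y * W a b c m y)

/-- The curvature `R_{abc}{}^d`, with the convention
`(∇ₐ∇_b - ∇_b∇ₐ) V^d = R_{abc}{}^d V^c`. -/
def riemannUp (g : Fin 4 → Fin 4 → E4 → ℝ) (a b c d : Fin 4) (y : E4) : ℝ :=
  pd a (christoffel g d b c) y - pd b (christoffel g d a c) y
    + ∑ m, (christoffel g d a m y * christoffel g m b c y
      - christoffel g d b m y * christoffel g m a c y)

/-- `R_{abcd} = R_{abc}{}^e g_{ed}`. -/
def riemann (g : Fin 4 → Fin 4 → E4 → ℝ) (a b c d : Fin 4) (y : E4) : ℝ :=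
  ∑ e, riemannUp g a b c e y * g e d y

/-- The Ricci tensor `R_{ab} = R_{acb}{}^c`. -/
def ricci (g : Fin 4 → Fin 4 → E4 → ℝ) (a b : Fin 4) (y : E4) : ℝ :=
  ∑ c, riemannUp g a c b c y

/-- The scalar curvature `R = g^{ab} R_{ab}`. -/
def scalarCurv (g : Fin 4 → Fin 4 → E4 → ℝ) (y : E4) : ℝ :=
  ∑ a, ∑ b, metricInv g a b y * ricci g a b y

/-- The Weyl tensor `C_{abcd}`, the totally trace-free part of `R_{abcd}`. -/
def weyl (g : Fin 4 → Fin 4 → E4 → ℝ) (a b c d : Fin 4) (y : E4) : ℝ :=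
  riemann g a b c d y
    - (1 / 2) * (g a c y * ricci g b d y - g a d y * ricci g b c y
      + g b d y * ricci g a c y - g b c y * ricci g a d y)
    + (scalarCurv g y / 6) * (g a c y * g b d y - g a d y * g b c y)

/-- The tensor `φ_{ab} = -(1/2) (R_{ab} - (1/4) R g_{ab})`, whose spinor components
`φ_{ABA'B'}` are the trace-free Ricci spinor in the decomposition of `R_{abcd}`. -/
def tfRicci (g : Fin 4 → Fin 4 → E4 → ℝ) (a b : Fin 4) (y : E4) : ℝ :=
  -(1 / 2) * (ricci g a b y - (1 / 4) * scalarCurv g y * g a b y)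

/-- `Λ = R / 24`. -/
def lam (g : Fin 4 → Fin 4 → E4 → ℝ) (y : E4) : ℝ := scalarCurv g y / 24

/-! ### Two-component spinors -/

/-- `ε_{AB}` (and `ε_{A'B'}`), with `ε_{01} = 1`; `ε^{AB}` has the same components. -/
def eps : Matrix (Fin 2) (Fin 2) ℂ := !![0, 1; -1, 0]

/-- Raising of an index: `μ^A = ε^{AB} μ_B`. -/
def raise (μ : Fin 2 → ℂ) (A : Fin 2) : ℂ := ∑ B, eps A B * μ B

/-- The constants expressing the null tetrad `e_{AA'}` through an oriented orthonormal frame: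
`e_{00'} = (E₀ + iE₁)/√2`, `e_{01'} = (-E₂ + iE₃)/√2`, `e_{10'} = (E₂ + iE₃)/√2`,
`e_{11'} = (E₀ - iE₁)/√2`. They satisfy `g(e_{AA'}, e_{BB'}) = ε_{AB} ε_{A'B'}`, and
`ω_{A'B'} ε_{AB}` is self-dual for the orientation `E⁰ ∧ E¹ ∧ E² ∧ E³`. -/
def sigma (A A' : Fin 2) (a : Fin 4) : ℂ :=
  (![![![1, Complex.I, 0, 0], ![0, 0, -1, Complex.I]],
     ![![0, 0, 1, Complex.I], ![1, -Complex.I, 0, 0]]] A A' a) / (Real.sqrt 2 : ℂ)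

/-- `E a i` is the `i`-th coordinate component of the `a`-th vector of a frame at the point `y` of
a positively oriented chart: the frame is orthonormal and positively oriented. -/
def IsOrientedFrame (g : Fin 4 → Fin 4 → E4 → ℝ) (y : E4) (E : Fin 4 → Fin 4 → ℝ) : Prop :=
  (∀ a b, ∑ i, ∑ j, g i j y * E a i * E b j = if a = b then 1 else 0) ∧
    0 < (Matrix.of E).det

/-- The coordinate components of the null tetrad `e_{AA'}` of a frame. -/
def tetrad (E : Fin 4 → Fin 4 → ℝ) (A A' : Fin 2) (i : Fin 4) : ℂ :=
  ∑ a, sigma A A' a * (E a i : ℂ)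

/-- `K_{AA'} = K(e_{AA'})`. -/
def spin1 (E : Fin 4 → Fin 4 → ℝ) (K : Fin 4 → ℂ) (A A' : Fin 2) : ℂ :=
  ∑ i, tetrad E A A' i * K i

/-- `T_{AA'BB'} = T(e_{AA'}, e_{BB'})`. -/
def spin2 (E : Fin 4 → Fin 4 → ℝ) (T : Fin 4 → Fin 4 → ℂ) (A A' B B' : Fin 2) : ℂ :=
  ∑ i, ∑ j, tetrad E A A' i * tetrad E B B' j * T i j

/-- `W_{AA'BB'CC'DD'}`. -/
def spin4 (E : Fin 4 → Fin 4 → ℝ) (W : Fin 4 → Fin 4 → Fin 4 → Fin 4 → ℂ)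
    (A A' B B' C C' D D' : Fin 2) : ℂ :=
  ∑ i, ∑ j, ∑ k, ∑ l,
    tetrad E A A' i * tetrad E B B' j * tetrad E C C' k * tetrad E D D' l * W i j k l

/-- The primed (self-dual) part `f̃_{A'B'} = (1/2) ε^{AB} F_{AA'BB'}` of a two-form
`F = f_{AB} ε_{A'B'} + f̃_{A'B'} ε_{AB}`. -/
def sdPart (E : Fin 4 → Fin 4 → ℝ) (F : Fin 4 → Fin 4 → ℂ) (A' B' : Fin 2) : ℂ :=
  (1 / 2) * ∑ A, ∑ B, eps A B * spin2 E F A A' B B'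

/-- The unprimed (anti-self-dual) part `f_{AB} = (1/2) ε^{A'B'} F_{AA'BB'}` of a two-form
`F = f_{AB} ε_{A'B'} + f̃_{A'B'} ε_{AB}`. -/
def asdPart (E : Fin 4 → Fin 4 → ℝ) (F : Fin 4 → Fin 4 → ℂ) (A B : Fin 2) : ℂ :=
  (1 / 2) * ∑ A', ∑ B', eps A' B' * spin2 E F A A' B B'

/-- The unprimed part `ψ_{ABCD} = (1/4) ε^{A'B'} ε^{C'D'} W_{AA'BB'CC'DD'}` of
`W = ψ_{ABCD} ε_{A'B'} ε_{C'D'} + ψ_{A'B'C'D'} ε_{AB} ε_{CD}`. -/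
def weylASD (E : Fin 4 → Fin 4 → ℝ) (W : Fin 4 → Fin 4 → Fin 4 → Fin 4 → ℂ)
    (A B C D : Fin 2) : ℂ :=
  (1 / 4) * ∑ A', ∑ B', ∑ C', ∑ D', eps A' B' * eps C' D' * spin4 E W A A' B B' C C' D D'

/-- The primed part `ψ_{A'B'C'D'} = (1/4) ε^{AB} ε^{CD} W_{AA'BB'CC'DD'}` of
`W = ψ_{ABCD} ε_{A'B'} ε_{C'D'} + ψ_{A'B'C'D'} ε_{AB} ε_{CD}`. -/
def weylSD (E : Fin 4 → Fin 4 → ℝ) (W : Fin 4 → Fin 4 → Fin 4 → Fin 4 → ℂ)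
    (A' B' C' D' : Fin 2) : ℂ :=
  (1 / 4) * ∑ A, ∑ B, ∑ C, ∑ D, eps A B * eps C D * spin4 E W A A' B B' C C' D D'

/-- The ASD Weyl spinor `ψ_{ABCD}` of `g` at `y`. -/
def psi (g : Fin 4 → Fin 4 → E4 → ℝ) (E : Fin 4 → Fin 4 → ℝ) (y : E4) (A B C D : Fin 2) : ℂ :=
  weylASD E (fun a b c d => (weyl g a b c d y : ℂ)) A B C D

/-- The SD Weyl spinor `ψ_{A'B'C'D'}` of `g` at `y`. -/
def psiPrimed (g : Fin 4 → Fin 4 → E4 → ℝ) (E : Fin 4 → Fin 4 → ℝ) (y : E4)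
    (A' B' C' D' : Fin 2) : ℂ :=
  weylSD E (fun a b c d => (weyl g a b c d y : ℂ)) A' B' C' D'

/-- `∇_{FF'} ψ_{ABCD}` at `y`. -/
def nablaPsi (g : Fin 4 → Fin 4 → E4 → ℝ) (E : Fin 4 → Fin 4 → ℝ) (y : E4)
    (F F' A B C D : Fin 2) : ℂ :=
  weylASD E (fun a b c d => ∑ e, tetrad E F F' e * (nabla4 g (weyl g) e a b c d y : ℂ)) A B C D

/-- `P_{ABA'B'} = φ_{ABA'B'} - Λ ε_{AB} ε_{A'B'}` at `y`. -/
def pSpinor (g : Fin 4 → Fin 4 → E4 → ℝ) (E : Fin 4 → Fin 4 → ℝ) (y : E4)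
    (A B A' B' : Fin 2) : ℂ :=
  spin2 E (fun a b => (tfRicci g a b y : ℂ)) A A' B B' - (lam g y : ℂ) * eps A B * eps A' B'

/-- Spinor components `(ω_{A'B'}, K_{AA'}, ρ_{AB})` of an element of (the complexification of) the
fibre of `E = Λ²₊ ⊕ Λ¹ ⊕ Λ²₋`. The first and third components of such elements are symmetric. -/
abbrev Tractor :=
  (Fin 2 → Fin 2 → ℂ) × (Fin 2 → Fin 2 → ℂ) × (Fin 2 → Fin 2 → ℂ)

/-- The spinor components at `y` of a triple `(ω, K, ρ)` of a self-dual two-form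
`ω = ω_{A'B'} ε_{AB}`, a one-form and an anti-self-dual two-form `ρ = ρ_{AB} ε_{A'B'}`. -/
def tractorAt (om : Fin 4 → Fin 4 → E4 → ℝ) (K : Fin 4 → E4 → ℝ) (rho : Fin 4 → Fin 4 → E4 → ℝ)
    (E : Fin 4 → Fin 4 → ℝ) (y : E4) : Tractor :=
  (sdPart E fun i j => (om i j y : ℂ), spin1 E fun i => (K i y : ℂ),
    asdPart E fun i j => (rho i j y : ℂ))

/-- The prolongation connection: the component of `𝒟 X` in the direction `e_{AA'}`, for
`X = (ω, K, ρ)`. Its three entries are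
* `∇_{AA'} ω_{B'C'} - ε_{A'B'} K_{C'A} - ε_{A'C'} K_{B'A}`,
* `∇_{AA'} K_{BB'} + P_{ABA'C'} ω_{B'}{}^{C'} - ε_{A'B'} ρ_{AB}`,
* `∇_{AA'} ρ_{BC} - ω_{A'}{}^{E'} ∇_{E'}{}^D ψ_{ABCD} + K_{A'}{}^D ψ_{ABCD}
  + 2 P_{A'E'A(B} K_{C)}{}^{E'}`. -/
def tractorD (g om : Fin 4 → Fin 4 → E4 → ℝ) (K : Fin 4 → E4 → ℝ) (rho : Fin 4 → Fin 4 → E4 → ℝ)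
    (E : Fin 4 → Fin 4 → ℝ) (y : E4) (A A' : Fin 2) : Tractor :=
  let w := (tractorAt om K rho E y).1
  let k := (tractorAt om K rho E y).2.1
  let r := (tractorAt om K rho E y).2.2
  (fun B' C' =>
      sdPart E (fun j l => ∑ i, tetrad E A A' i * (nabla2 g om i j l y : ℂ)) B' C'
        - eps A' B' * k A C' - eps A' C' * k A B',
   fun B B' =>
      spin2 E (fun i j => (nabla1 g K i j y : ℂ)) A A' B B'
        + ∑ C', pSpinor g E y A B A' C' * raise (w B') C'
        - eps A' B' * r A B,
   fun B C =>
      asdPart E (fun j l => ∑ i, tetrad E A A' i * (nabla2 g rho i j l y : ℂ)) B C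
        - ∑ E', ∑ D, raise (w A') E' * raise (fun F => nablaPsi g E y F E' A B C D) D
        + ∑ D, raise (fun F => k F A') D * psi g E y A B C D
        + ∑ E', (pSpinor g E y A B A' E' * raise (k C) E'
          + pSpinor g E y A C A' E' * raise (k B) E'))

/-- `ω_{A'B'} ω^{A'B'}`. -/
def normSq (w : Fin 2 → Fin 2 → ℂ) : ℂ :=
  ∑ A', ∑ B', w A' B' * raise (fun C' => raise (w C') B') A'

/-- The behaviour of `(ω_{A'B'}, K_{AA'}, ρ_{AB})` under the rescaling `ĝ = Ω² g`, with
`Υ = Ω⁻¹ dΩ`. The three entries of the result are `Ω² ω_{A'B'}`,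
`Ω (K_{AA'} + Υ_{AB'} ω_{A'}{}^{B'})` and
`ρ_{AB} + 2 Υ_{C'(A} K_{B)}{}^{C'} + ω^{C'D'} Υ_{C'A} Υ_{D'B}`. -/
def rescale (Om : ℂ) (Up : Fin 2 → Fin 2 → ℂ) (X : Tractor) : Tractor :=
  (fun A' B' => Om ^ 2 * X.1 A' B',
   fun A A' => Om * (X.2.1 A A' + ∑ B', Up A B' * raise (X.1 A') B'),
   fun A B => X.2.2 A B
      + ∑ C', (Up A C' * raise (X.2.1 B) C' + Up B C' * raise (X.2.1 A) C')
      + ∑ C', ∑ D', raise (fun F' => raise (X.1 F') D') C' * Up A C' * Up B D')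

/-! ### Four-manifolds -/

section Manifold

variable (M : Type*) [TopologicalSpace M] [ChartedSpace E4 M]

/-- An orientation of a smooth four-manifold: a family of smooth charts that cover the manifold and
whose transition maps have positive Jacobian determinant. -/
structure OrientedAtlas where
  /-- The positively oriented charts. -/
  charts : Set (OpenPartialHomeomorph M E4)
  smooth : ∀ e ∈ charts, e ∈ IsManifold.maximalAtlas (𝓡 4) ∞ M
  cover : ∀ x : M, ∃ e ∈ charts, x ∈ e.source
  det_pos : ∀ e ∈ charts, ∀ e' ∈ charts, ∀ y ∈ (e.symm.trans e').source,
    0 < (fderiv ℝ (e.symm.trans e') y).det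

/-- One-forms on `M`, without regularity. -/
abbrev OneForm := (x : M) → TangentSpace (𝓡 4) x →L[ℝ] ℝ

/-- Covariant two-tensors on `M`, without regularity. -/
abbrev TwoTensor :=
  (x : M) → TangentSpace (𝓡 4) x →L[ℝ] TangentSpace (𝓡 4) x →L[ℝ] ℝ

/-- Fields of endomorphisms of the tangent spaces of `M`, without regularity. -/
abbrev EndField := (x : M) → TangentSpace (𝓡 4) x →L[ℝ] TangentSpace (𝓡 4) x

variable {M}

/-- The coordinate vector `∂ᵢ` of the chart `e` at the point with coordinates `y`. -/
def coordVec (e : OpenPartialHomeomorph M E4) (i : Fin 4) (y : E4) :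
    TangentSpace (𝓡 4) (e.symm y) :=
  mfderiv (𝓡 4) (𝓡 4) e.symm y (EuclideanSpace.single i (1 : ℝ) : E4)

/-- The coordinate components of a one-form. -/
def comp1 (e : OpenPartialHomeomorph M E4) (K : OneForm M) (i : Fin 4) (y : E4) : ℝ :=
  K (e.symm y) (coordVec e i y)

/-- The coordinate components of a covariant two-tensor. -/
def comp2 (e : OpenPartialHomeomorph M E4) (T : TwoTensor M) (i j : Fin 4) (y : E4) : ℝ :=
  T (e.symm y) (coordVec e i y) (coordVec e j y)

/-- The coordinate components `J^k_i = dx^k (J ∂ᵢ)` of a field of endomorphisms. -/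
def compEnd (e : OpenPartialHomeomorph M E4) (J : EndField M) (k i : Fin 4) (y : E4) : ℝ :=
  let v : E4 := mfderiv (𝓡 4) (𝓡 4) e (e.symm y) (J (e.symm y) (coordVec e i y))
  v k

/-- The set of coordinates of points of `U` in the chart `e`. -/
def coordSet (e : OpenPartialHomeomorph M E4) (U : Set M) : Set E4 :=
  e.target ∩ e.symm ⁻¹' U

/-- The conformally rescaled metric `Ω² g`. -/
def rescaledMetric (Om : M → ℝ) (g : TwoTensor M) : TwoTensor M :=
  fun x => (Om x) ^ 2 • g x

/-- `Ω` is a smooth positive function on `U`. -/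
def IsConformalFactorOn (U : Set M) (Om : M → ℝ) : Prop :=
  ContMDiffOn (𝓡 4) 𝓘(ℝ, ℝ) ∞ Om U ∧ ∀ x ∈ U, 0 < Om x

/-- The components of `Υ = Ω⁻¹ dΩ`. -/
def upsilon (e : OpenPartialHomeomorph M E4) (Om : M → ℝ) (i : Fin 4) (y : E4) : ℝ :=
  (Om (e.symm y))⁻¹ * pd i (fun z => Om (e.symm z)) y

/-- The two-form `Σ(v, w) = h(Jv, w)`. -/
def kahlerForm (h : TwoTensor M) (J : EndField M) : TwoTensor M :=
  fun x => (h x).comp (J x)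

variable (O : OrientedAtlas M)

/-- The conformal curvature is anti-self-dual: `ψ_{A'B'C'D'} = 0`. -/
def IsAntiSelfDual (g : TwoTensor M) : Prop :=
  ∀ e ∈ O.charts, ∀ y ∈ e.target, ∀ E, IsOrientedFrame (comp2 e g) y E →
    ∀ A' B' C' D', psiPrimed (comp2 e g) E y A' B' C' D' = 0

/-- For a Riemannian metric `h` on the open set `U`: `(h, J)` is a Kähler structure on `U` inducing
the given orientation. That is, `J` is a smooth almost complex structure for which `h` is Hermitian,
its Nijenhuis tensor vanishes, and the Kähler form `h(J·, ·)` is closed and self-dual. -/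
structure IsKahlerOn (U : Set M) (h : TwoTensor M) (J : EndField M) : Prop where
  smooth : ∀ e ∈ O.charts, ∀ k i, ContDiffOn ℝ ∞ (compEnd e J k i) (coordSet e U)
  sq : ∀ x ∈ U, ∀ v, J x (J x v) = -v
  hermitian : ∀ x ∈ U, ∀ v w, h x (J x v) (J x w) = h x v w
  integrable : ∀ e ∈ O.charts, ∀ y ∈ coordSet e U, ∀ i j k,
    ∑ l, (compEnd e J l i y * pd l (compEnd e J k j) y
      - compEnd e J l j y * pd l (compEnd e J k i) y
      - compEnd e J k l y * (pd i (compEnd e J l j) y - pd j (compEnd e J l i) y)) = 0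
  closed : ∀ e ∈ O.charts, ∀ y ∈ coordSet e U, ∀ i j k,
    pd i (comp2 e (kahlerForm h J) j k) y + pd j (comp2 e (kahlerForm h J) k i) y
      + pd k (comp2 e (kahlerForm h J) i j) y = 0
  selfDual : ∀ e ∈ O.charts, ∀ y ∈ coordSet e U, ∀ E, IsOrientedFrame (comp2 e h) y E →
    ∀ A B, asdPart E (fun i j => (comp2 e (kahlerForm h J) i j y : ℂ)) A B = 0

/-- On `U`, the metric `g` is conformal to a Kähler metric inducing the given orientation. -/
def IsConformalToKahlerOn (U : Set M) (g : TwoTensor M) : Prop :=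
  ∃ (Om : M → ℝ) (J : EndField M),
    IsConformalFactorOn U Om ∧ IsKahlerOn O U (rescaledMetric Om g) J

/-- `X = (ω, K, ρ)` is a smooth section over `U` of `E = Λ²₊ ⊕ Λ¹ ⊕ Λ²₋`. -/
structure IsSectionOn (U : Set M) (g : TwoTensor M) (om : TwoTensor M) (K : OneForm M)
    (rho : TwoTensor M) : Prop where
  smooth_om : ∀ e ∈ O.charts, ∀ i j, ContDiffOn ℝ ∞ (comp2 e om i j) (coordSet e U)
  smooth_K : ∀ e ∈ O.charts, ∀ i, ContDiffOn ℝ ∞ (comp1 e K i) (coordSet e U)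
  smooth_rho : ∀ e ∈ O.charts, ∀ i j, ContDiffOn ℝ ∞ (comp2 e rho i j) (coordSet e U)
  alt_om : ∀ x ∈ U, ∀ v, om x v v = 0
  alt_rho : ∀ x ∈ U, ∀ v, rho x v v = 0
  selfDual_om : ∀ e ∈ O.charts, ∀ y ∈ coordSet e U, ∀ E, IsOrientedFrame (comp2 e g) y E →
    ∀ A B, asdPart E (fun i j => (comp2 e om i j y : ℂ)) A B = 0
  antiSelfDual_rho : ∀ e ∈ O.charts, ∀ y ∈ coordSet e U, ∀ E, IsOrientedFrame (comp2 e g) y E →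
    ∀ A' B', sdPart E (fun i j => (comp2 e rho i j y : ℂ)) A' B' = 0

/-- `𝒟 X = 0` over `U`. -/
def IsParallelOn (U : Set M) (g : TwoTensor M) (om : TwoTensor M) (K : OneForm M)
    (rho : TwoTensor M) : Prop :=
  ∀ e ∈ O.charts, ∀ y ∈ coordSet e U, ∀ E, IsOrientedFrame (comp2 e g) y E →
    ∀ A A', tractorD (comp2 e g) (comp2 e om) (comp1 e K) (comp2 e rho) E y A A' = 0

/-- `ω_{A'B'} ω^{A'B'} ≠ 0` at every point of `U`. -/
def IsNondegenerateOn (U : Set M) (g : TwoTensor M) (om : TwoTensor M) : Prop :=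
  ∀ e ∈ O.charts, ∀ y ∈ coordSet e U, ∀ E, IsOrientedFrame (comp2 e g) y E →
    normSq (sdPart E fun i j => (comp2 e om i j y : ℂ)) ≠ 0

/-- Over `U` there is a smooth section `X = (ω, K, ρ)` of `E` with `𝒟 X = 0` and
`ω_{A'B'} ω^{A'B'} ≠ 0`. -/
def HasParallelSectionOn (U : Set M) (g : TwoTensor M) : Prop :=
  ∃ (om : TwoTensor M) (K : OneForm M) (rho : TwoTensor M),
    IsSectionOn O U g om K rho ∧ IsParallelOn O U g om K rho ∧ IsNondegenerateOn O U g om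

/-- The section `X' = (ω', K', ρ')` of the bundle of `Ω² g` is the rescaling `X̂` of the section
`X = (ω, K, ρ)` of the bundle of `g`.

If `E` is an oriented orthonormal frame for `g`, then `Ω⁻¹ E` is one for `Ω² g`. The spin frame it
defines is normalised for `ε̂ = Ω ε`, so that components with respect to it carry a factor `Ω^{-1/2}`
for every spinor index. -/
def IsRescalingOn (U : Set M) (g : TwoTensor M) (Om : M → ℝ) (om : TwoTensor M) (K : OneForm M)
    (rho : TwoTensor M) (om' : TwoTensor M) (K' : OneForm M) (rho' : TwoTensor M) : Prop :=
  ∀ e ∈ O.charts, ∀ y ∈ coordSet e U, ∀ E, IsOrientedFrame (comp2 e g) y E →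
    tractorAt (comp2 e om') (comp1 e K') (comp2 e rho') ((Om (e.symm y))⁻¹ • E) y =
      (Om (e.symm y) : ℂ)⁻¹ •
        rescale (Om (e.symm y)) (spin1 E fun i => (upsilon e Om i y : ℂ))
          (tractorAt (comp2 e om) (comp1 e K) (comp2 e rho) E y)

/-- `𝒟̂ X' = (𝒟 X)^`: the derivative of `X'` formed with `Ω² g` is the rescaling of the derivative of
`X` formed with `g`. The derivatives have two more spinor indices than the sections. -/
def IsRescalingDOn (U : Set M) (g : TwoTensor M) (Om : M → ℝ) (om : TwoTensor M) (K : OneForm M)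
    (rho : TwoTensor M) (om' : TwoTensor M) (K' : OneForm M) (rho' : TwoTensor M) : Prop :=
  ∀ e ∈ O.charts, ∀ y ∈ coordSet e U, ∀ E, IsOrientedFrame (comp2 e g) y E → ∀ A A',
    tractorD (comp2 e (rescaledMetric Om g)) (comp2 e om') (comp1 e K') (comp2 e rho')
        ((Om (e.symm y))⁻¹ • E) y A A' =
      ((Om (e.symm y) : ℂ)⁻¹) ^ 2 •
        rescale (Om (e.symm y)) (spin1 E fun i => (upsilon e Om i y : ℂ))
          (tractorD (comp2 e g) (comp2 e om) (comp1 e K) (comp2 e rho) E y A A')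

end Manifold

end ConfKahler

end

/-! From a parallel section to a Kähler metric. The first row of 𝒟X = 0 says that the self-dual form
ω satisfies ∇_{A(A'}ω_{B'C')} = 0, with K the remaining part of ∇ω. This equation is conformally
invariant when the two-form ω is replaced by Ω³ω under g ↦ Ω²g. Where ω has no zeros, Ω = |ω|⁻¹
gives the rescaled form unit length. Differentiating the length then yields a nondegenerate linear
system for K̂, so K̂ = 0 and the rescaled form is parallel. Raising an index gives an orthogonal
almost complex structure; it is integrable and its form is closed, because both conditions are
expressed by the covariant derivative. The lemmas are `NormalAt.pd_eq_zero`,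
`SectionOn.nabla2_conf_eq_zero` and `HasParallelSectionOn.isConformalToKahlerOn`.

From a Kähler metric h with form Σ to a parallel section. Closedness and integrability give ∇Σ = 0
(`eq_zero_of_closed_of_integrable`), so the curvature commutes with Σ. An anti-self-dual Weyl tensor
commutes with every self-dual form, hence only the part of the curvature built from P is
constrained. `schouten_commute` turns the constraint into R = 0 together with the statement that ρ =
P·Σ is an anti-self-dual two-form. The triple (Σ, 0, ρ) is then parallel. The first row is ∇Σ = 0
and the second is the definition of ρ. For the third, R = 0 makes P divergence-free, so ρ is
coclosed and, being anti-self-dual, closed; together with the Bianchi identity (the divergence of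
the Weyl tensor is the curl of P) this expresses ∇ρ through ∇ψ. See `KahlerLike.curvature`,
`KahlerLike.tractorD_thd` and `KahlerLike.tractorD_eq_zero`. Conformal invariance carries the triple
from h back to g (`KahlerLike.tractorD_conf_eq_zero`).

Conformal invariance is a pointwise identity. All ingredients of 𝒟 are natural under
orientation-preserving changes of coordinates (`CoordChange.tractorD_pb`), and any oriented
orthonormal frame at a point is the coordinate frame of suitable normal coordinates
(`MetricOn.exists_normal`). At the origin of these, g is the identity matrix, the Christoffel
symbols vanish, and the changes of Γ, P, ψ and ∇ψ are explicit. What remains are polynomial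
identities between two-component spinors, `conf_fst`, `conf_snd`, `conf_thd` and `conf_thd_psi`,
verified component by component. They are assembled in `tractorD_conf`.

The analysis takes place on open subsets of `E4`. The manifold enters only at the end, through
charts and through the gluing of components that transform as tensors. -/

noncomputable section

namespace ConfKahler

/-! ### Partial derivatives -/

/-- Smoothness of a function on a set. -/
abbrev Sm (V : Set E4) (f : E4 → ℝ) : Prop := ContDiffOn ℝ ∞ f V

/-- The function `f` is differentiable at `y` with partial derivative `d` in the direction `i`. -/
def HasPd (i : Fin 4) (f : E4 → ℝ) (d : ℝ) (y : E4) : Prop :=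
  DifferentiableAt ℝ f y ∧ pd i f y = d

section HasPd

variable {i : Fin 4} {f h : E4 → ℝ} {a b : ℝ} {y : E4} {V : Set E4}

theorem HasPd.pd_eq (hf : HasPd i f a y) : pd i f y = a := hf.2

/-- The rules below produce derivatives in unsimplified form. This exchanges the value for an equal
one, so that computing a derivative usually reduces to a `ring` goal. -/
theorem HasPd.congr_val (hf : HasPd i f a y) (hab : a = b) : HasPd i f b y := hab ▸ hf

theorem HasPd.add (hf : HasPd i f a y) (hh : HasPd i h b y) :
    HasPd i (fun z => f z + h z) (a + b) y :=
  ⟨hf.1.add hh.1, by simp only [pd, fderiv_fun_add hf.1 hh.1, ← hf.2, ← hh.2]; rfl⟩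

theorem HasPd.sub (hf : HasPd i f a y) (hh : HasPd i h b y) :
    HasPd i (fun z => f z - h z) (a - b) y :=
  ⟨hf.1.sub hh.1, by simp only [pd, fderiv_fun_sub hf.1 hh.1, ← hf.2, ← hh.2]; rfl⟩

theorem HasPd.neg (hf : HasPd i f a y) : HasPd i (fun z => -f z) (-a) y :=
  ⟨hf.1.neg, by simp only [pd, fderiv_fun_neg, ← hf.2]; rfl⟩

theorem HasPd.mul (hf : HasPd i f a y) (hh : HasPd i h b y) :
    HasPd i (fun z => f z * h z) (a * h y + f y * b) y :=
  ⟨hf.1.mul hh.1, by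
    simp only [pd, fderiv_fun_mul hf.1 hh.1, ← hf.2, ← hh.2]
    simp; ring⟩

theorem HasPd.const (c : ℝ) : HasPd i (fun _ => c) 0 y :=
  ⟨differentiableAt_const c, by simp [pd]⟩

theorem HasPd.const_mul (c : ℝ) (hf : HasPd i f a y) : HasPd i (fun z => c * f z) (c * a) y :=
  ((HasPd.const c).mul hf).congr_val (by ring)

theorem HasPd.sum {ι : Type*} {s : Finset ι} {F : ι → E4 → ℝ} {d : ι → ℝ}
    (hF : ∀ k ∈ s, HasPd i (F k) (d k) y) :
    HasPd i (fun z => ∑ k ∈ s, F k z) (∑ k ∈ s, d k) y := by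
  classical
  induction s using Finset.induction_on with
  | empty => simpa using HasPd.const (i := i) (y := y) 0
  | insert k s hk ih =>
    simp only [Finset.sum_insert hk]
    exact (hF k (Finset.mem_insert_self k s)).add
      (ih fun l hl => hF l (Finset.mem_insert_of_mem hl))

/-- Meant for determinants at the origin of normal coordinates, where all entries are stationary. -/
theorem HasPd.prod_zero {ι : Type*} {s : Finset ι} {F : ι → E4 → ℝ}
    (hF : ∀ k ∈ s, HasPd i (F k) 0 y) : HasPd i (fun z => ∏ k ∈ s, F k z) 0 y := by
  classical
  induction s using Finset.induction_on with
  | empty => simpa using HasPd.const (i := i) (y := y) 1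
  | insert k s hk ih =>
    simp only [Finset.prod_insert hk]
    exact ((hF k (Finset.mem_insert_self k s)).mul
      (ih fun l hl => hF l (Finset.mem_insert_of_mem hl))).congr_val (by ring)

theorem HasPd.comp_deriv {φ : ℝ → ℝ} {c : ℝ} (hφ : HasDerivAt φ c (f y)) (hf : HasPd i f a y) :
    HasPd i (fun z => φ (f z)) (c * a) y := by
  have h := hφ.comp_hasFDerivAt y hf.1.hasFDerivAt
  refine ⟨h.differentiableAt, ?_⟩
  have h2 : fderiv ℝ (fun z => φ (f z)) y = c • fderiv ℝ f y := h.fderiv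
  rw [← hf.2, pd, pd, h2]; rfl

theorem HasPd.inv (hf : HasPd i f a y) (h0 : f y ≠ 0) :
    HasPd i (fun z => (f z)⁻¹) (-(f y ^ 2)⁻¹ * a) y :=
  hf.comp_deriv (by simpa using hasDerivAt_inv h0)

theorem HasPd.pow (hf : HasPd i f a y) (n : ℕ) :
    HasPd i (fun z => f z ^ n) (n * f y ^ (n - 1) * a) y :=
  hf.comp_deriv (hasDerivAt_pow n (f y))

theorem HasPd.congr_of_eventuallyEq (hf : HasPd i f a y) (h' : h =ᶠ[nhds y] f) : HasPd i h a y :=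
  ⟨hf.1.congr_of_eventuallyEq h', by rw [← hf.2, pd, pd, h'.fderiv_eq]⟩

theorem HasPd.congr_on (hf : HasPd i f a y) (hV : IsOpen V) (hy : y ∈ V)
    (h' : ∀ z ∈ V, h z = f z) : HasPd i h a y :=
  hf.congr_of_eventuallyEq (Filter.eventuallyEq_of_mem (hV.mem_nhds hy) h')

theorem pd_congr_on (hV : IsOpen V) (hy : y ∈ V) (h' : ∀ z ∈ V, h z = f z) :
    pd i h y = pd i f y := by
  rw [pd, pd, (Filter.eventuallyEq_of_mem (hV.mem_nhds hy) h').fderiv_eq]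

theorem Sm.hasPd (hf : Sm V f) (hV : IsOpen V) (hy : y ∈ V) : HasPd i f (pd i f y) y :=
  ⟨(hf.contDiffAt (hV.mem_nhds hy)).differentiableAt (by simp), rfl⟩

theorem hasPd_coord (k : Fin 4) : HasPd i (fun z : E4 => z k) (if k = i then 1 else 0) y := by
  have h : HasFDerivAt (fun z : E4 => z k) (EuclideanSpace.proj k : E4 →L[ℝ] ℝ) y :=
    (EuclideanSpace.proj k : E4 →L[ℝ] ℝ).hasFDerivAt
  refine ⟨h.differentiableAt, ?_⟩
  rw [pd, h.fderiv]
  simp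

theorem Sm.pd (hf : Sm V f) (hV : IsOpen V) (i : Fin 4) : Sm V (pd i f) :=
  (hf.fderiv_of_isOpen hV (m := ∞) (by simp)).clm_apply contDiffOn_const

theorem pd_comm (hf : Sm V f) (hV : IsOpen V) (hy : y ∈ V) (i j : Fin 4) :
    ConfKahler.pd i (ConfKahler.pd j f) y = ConfKahler.pd j (ConfKahler.pd i f) y := by
  have hs : IsSymmSndFDerivAt ℝ f y :=
    (hf.contDiffAt (hV.mem_nhds hy)).isSymmSndFDerivAt (by simpa using ENat.LEInfty.out)
  have hd : DifferentiableAt ℝ (fderiv ℝ f) y :=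
    ((hf.fderiv_of_isOpen hV (m := ∞) (by simp)).contDiffAt (hV.mem_nhds hy)).differentiableAt
      (by simp)
  -- Both mixed partials are values of the second Fréchet derivative, whose symmetry then applies.
  have key : ∀ i j : Fin 4, ConfKahler.pd i (ConfKahler.pd j f) y
      = fderiv ℝ (fderiv ℝ f) y (EuclideanSpace.single i 1) (EuclideanSpace.single j 1) := by
    intro i j
    have : fderiv ℝ (fun z => fderiv ℝ f z (EuclideanSpace.single j 1)) y
        = (fderiv ℝ (fderiv ℝ f) y).flip (EuclideanSpace.single j 1) := by
      have := fderiv_clm_apply hd (differentiableAt_const (EuclideanSpace.single j (1 : ℝ)))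
      simpa using this
    change fderiv ℝ (fun z => fderiv ℝ f z (EuclideanSpace.single j 1)) y _ = _
    rw [this]; rfl
  rw [key, key]
  exact hs _ _

theorem sum_single_smul (v : E4) : ∑ k, v k • EuclideanSpace.single k (1 : ℝ) = v := by
  ext j
  simp [Finset.sum_apply, Pi.single_apply]

theorem fderiv_apply_eq_sum (v : E4) : fderiv ℝ f y v = ∑ k, v k * pd k f y := by
  conv_lhs => rw [← sum_single_smul v]
  simp [pd, map_sum]

/-- The chain rule. -/
theorem hasPd_comp {F : E4 → E4} {J : Fin 4 → ℝ} (hf : DifferentiableAt ℝ f (F y))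
    (hF : ∀ k, HasPd i (fun z => F z k) (J k) y) :
    HasPd i (fun z => f (F z)) (∑ k, J k * ConfKahler.pd k f (F y)) y := by
  have hFd : DifferentiableAt ℝ F y := by
    rw [differentiableAt_euclidean]
    exact fun k => (hF k).1
  refine ⟨hf.comp y hFd, ?_⟩
  have h1 : fderiv ℝ (fun z => f (F z)) y = (fderiv ℝ f (F y)).comp (fderiv ℝ F y) :=
    fderiv_comp y hf hFd
  have h2 : ∀ k, (fderiv ℝ F y (EuclideanSpace.single i 1)) k = J k := by
    intro k
    rw [← (hF k).2]
    have h3 : HasFDerivAt (fun z => F z k)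
        ((EuclideanSpace.proj k : E4 →L[ℝ] ℝ).comp (fderiv ℝ F y)) y :=
      (EuclideanSpace.proj k : E4 →L[ℝ] ℝ).hasFDerivAt.comp y hFd.hasFDerivAt
    rw [ConfKahler.pd, h3.fderiv]; rfl
  rw [ConfKahler.pd, h1, ContinuousLinearMap.comp_apply, fderiv_apply_eq_sum]
  simp only [h2]

theorem Sm.sum {ι : Type*} {s : Finset ι} {F : ι → E4 → ℝ} (hF : ∀ k ∈ s, Sm V (F k)) :
    Sm V (fun z => ∑ k ∈ s, F k z) :=
  ContDiffOn.sum hF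

end HasPd

/-! ### Metrics in coordinates -/

/-- The functions `g i j` are the components of a smooth Riemannian metric on the open set `V`. -/
structure MetricOn (g : Fin 4 → Fin 4 → E4 → ℝ) (V : Set E4) : Prop where
  isOpen : IsOpen V
  smooth : ∀ i j, Sm V (g i j)
  symm : ∀ y ∈ V, ∀ i j, g i j y = g j i y
  pos : ∀ y ∈ V, ∀ v : Fin 4 → ℝ, v ≠ 0 → 0 < ∑ i, ∑ j, g i j y * v i * v j

theorem Sm.det {V : Set E4} {A : Fin 4 → Fin 4 → E4 → ℝ} (hA : ∀ i j, Sm V (A i j)) :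
    Sm V fun y => (Matrix.of fun k l => A k l y).det := by
  simp only [Matrix.det_apply]
  refine Sm.sum fun σ _ => ?_
  exact ContDiffOn.const_smul _ (contDiffOn_prod fun i _ => hA _ _)

/-- Cramer's rule: the inverse is the adjugate divided by the determinant, and each entry of the
adjugate is again the determinant of a matrix of smooth functions. -/
theorem Sm.matrix_inv {V : Set E4} {A : Fin 4 → Fin 4 → E4 → ℝ} (hA : ∀ i j, Sm V (A i j))
    (hdet : ∀ y ∈ V, (Matrix.of fun k l => A k l y).det ≠ 0) (i j : Fin 4) :
    Sm V fun y => (Matrix.of fun k l => A k l y)⁻¹ i j := by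
  have h1 : ∀ y, (Matrix.of fun k l => A k l y)⁻¹ i j
      = (Matrix.of fun k l => A k l y).det⁻¹ * (Matrix.of fun k l => A k l y).adjugate i j := by
    intro y
    rw [Matrix.inv_def, Matrix.smul_apply, Ring.inverse_eq_inv', smul_eq_mul]
  simp only [h1]
  refine ContDiffOn.mul (ContDiffOn.inv (Sm.det hA) hdet) ?_
  simp only [Matrix.adjugate_apply]
  have h2 : ∀ y, ((Matrix.of fun k l => A k l y).updateRow j (Pi.single i 1))
      = Matrix.of fun k l => (if k = j then (Pi.single i (1 : ℝ) : Fin 4 → ℝ) l else A k l y) := by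
    intro y; ext k l
    simp only [Matrix.updateRow_apply, Matrix.of_apply]
  simp only [h2]
  refine Sm.det (A := fun k l y => if k = j then (Pi.single i (1 : ℝ) : Fin 4 → ℝ) l else A k l y)
    fun k l => ?_
  by_cases hk : k = j
  · simp only [hk, if_true]; exact contDiffOn_const
  · simp only [hk, if_false]; exact hA k l

section Metric

variable {g : Fin 4 → Fin 4 → E4 → ℝ} {V : Set E4} {y : E4}

/-- The matrix of components of a metric. -/
abbrev metricMatrix (g : Fin 4 → Fin 4 → E4 → ℝ) (y : E4) : Matrix (Fin 4) (Fin 4) ℝ :=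
  Matrix.of fun k l => g k l y

theorem MetricOn.mono (hg : MetricOn g V) {W : Set E4} (hW : IsOpen W) (h : W ⊆ V) :
    MetricOn g W :=
  ⟨hW, fun i j => (hg.smooth i j).mono h, fun y hy => hg.symm y (h hy),
    fun y hy => hg.pos y (h hy)⟩

theorem MetricOn.posDef (hg : MetricOn g V) (hy : y ∈ V) : (metricMatrix g y).PosDef := by
  refine Matrix.PosDef.of_dotProduct_mulVec_pos ?_ ?_
  · ext i j
    simp only [Matrix.conjTranspose_apply, Matrix.of_apply, star_trivial]
    exact hg.symm y hy j i
  · intro v hv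
    have := hg.pos y hy v hv
    simp only [dotProduct, Matrix.mulVec, Matrix.of_apply, star_trivial, Finset.mul_sum]
    refine lt_of_lt_of_eq this (Finset.sum_congr rfl fun i _ => Finset.sum_congr rfl fun j _ => ?_)
    ring

theorem MetricOn.det_pos (hg : MetricOn g V) (hy : y ∈ V) : 0 < (metricMatrix g y).det :=
  (hg.posDef hy).det_pos

theorem MetricOn.sm_inv (hg : MetricOn g V) (i j : Fin 4) : Sm V (metricInv g i j) :=
  Sm.matrix_inv hg.smooth (fun _ hy => (hg.det_pos hy).ne') i j

theorem MetricOn.sm_christoffel (hg : MetricOn g V) (k i j : Fin 4) : Sm V (christoffel g k i j) :=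
  contDiffOn_const.mul (Sm.sum fun l _ => (hg.sm_inv k l).mul
    ((((hg.smooth l j).pd hg.isOpen i).add ((hg.smooth l i).pd hg.isOpen j)).sub
      ((hg.smooth i j).pd hg.isOpen l)))

theorem MetricOn.inv_mul (hg : MetricOn g V) (hy : y ∈ V) (i j : Fin 4) :
    ∑ k, metricInv g i k y * g k j y = if i = j then 1 else 0 := by
  have h : (metricMatrix g y)⁻¹ * metricMatrix g y = 1 :=
    Matrix.nonsing_inv_mul _ (isUnit_iff_ne_zero.2 (hg.det_pos hy).ne')
  have := congrFun (congrFun h i) j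
  rwa [Matrix.mul_apply, Matrix.one_apply] at this

theorem MetricOn.mul_inv (hg : MetricOn g V) (hy : y ∈ V) (i j : Fin 4) :
    ∑ k, g i k y * metricInv g k j y = if i = j then 1 else 0 := by
  have h : metricMatrix g y * (metricMatrix g y)⁻¹ = 1 :=
    Matrix.mul_nonsing_inv _ (isUnit_iff_ne_zero.2 (hg.det_pos hy).ne')
  have := congrFun (congrFun h i) j
  rwa [Matrix.mul_apply, Matrix.one_apply] at this

theorem MetricOn.inv_symm (hg : MetricOn g V) (hy : y ∈ V) (i j : Fin 4) :
    metricInv g i j y = metricInv g j i y := by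
  have h : (metricMatrix g y).transpose = metricMatrix g y := by
    ext i j; exact hg.symm y hy j i
  have := congrFun (congrFun (Matrix.transpose_nonsing_inv (metricMatrix g y)) j) i
  rw [h] at this
  exact this

/-- Lowering an index of a vector raised with the inverse metric. -/
theorem MetricOn.lower_raise (hg : MetricOn g V) (hy : y ∈ V) (v : Fin 4 → ℝ) (k : Fin 4) :
    ∑ m, g k m y * ∑ l, metricInv g m l y * v l = v k := by
  simp only [Finset.mul_sum]
  rw [Finset.sum_comm]
  simp only [← mul_assoc, ← Finset.sum_mul, hg.mul_inv hy]
  simp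

theorem MetricOn.raise_lower (hg : MetricOn g V) (hy : y ∈ V) (v : Fin 4 → ℝ) (k : Fin 4) :
    ∑ m, metricInv g k m y * ∑ l, g m l y * v l = v k := by
  simp only [Finset.mul_sum]
  rw [Finset.sum_comm]
  simp only [← mul_assoc, ← Finset.sum_mul, hg.inv_mul hy]
  simp

theorem MetricOn.pd_symm (hg : MetricOn g V) (hy : y ∈ V) (i j k : Fin 4) :
    pd i (g j k) y = pd i (g k j) y :=
  pd_congr_on hg.isOpen hy fun z hz => hg.symm z hz j k

theorem MetricOn.christoffel_symm (hg : MetricOn g V) (hy : y ∈ V) (k i j : Fin 4) :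
    christoffel g k i j y = christoffel g k j i y := by
  simp only [christoffel]
  congr 1
  refine Finset.sum_congr rfl fun l _ => ?_
  rw [hg.pd_symm hy l i j]; ring

theorem MetricOn.lower_christoffel (hg : MetricOn g V) (hy : y ∈ V) (k i j : Fin 4) :
    ∑ m, g k m y * christoffel g m i j y
      = (1 / 2) * (pd i (g k j) y + pd j (g k i) y - pd k (g i j) y) := by
  have := hg.lower_raise hy
    (fun l => (1 / 2) * (pd i (g l j) y + pd j (g l i) y - pd l (g i j) y)) k
  rw [← this]
  refine Finset.sum_congr rfl fun m _ => ?_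
  simp only [christoffel, Finset.mul_sum]
  refine Finset.sum_congr rfl fun l _ => ?_
  ring

/-- The Levi-Civita connection is metric. -/
theorem MetricOn.compat (hg : MetricOn g V) (hy : y ∈ V) (i j k : Fin 4) :
    pd i (g j k) y
      = ∑ m, (christoffel g m i j y * g m k y + christoffel g m i k y * g j m y) := by
  have h1 := hg.lower_christoffel hy k i j
  have h2 := hg.lower_christoffel hy j i k
  rw [Finset.sum_add_distrib]
  have h3 : ∑ m, christoffel g m i j y * g m k y = ∑ m, g k m y * christoffel g m i j y :=
    Finset.sum_congr rfl fun m _ => by rw [hg.symm y hy m k]; ring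
  have h4 : ∑ m, christoffel g m i k y * g j m y = ∑ m, g j m y * christoffel g m i k y :=
    Finset.sum_congr rfl fun m _ => by ring
  rw [h3, h4, h1, h2, hg.pd_symm hy i k j, hg.pd_symm hy j k i, hg.pd_symm hy j i k,
    hg.pd_symm hy k i j, hg.pd_symm hy k j i]
  ring

/-- The Levi-Civita connection is the only torsion-free metric connection. -/
theorem MetricOn.christoffel_unique (hg : MetricOn g V) (hy : y ∈ V)
    (C : Fin 4 → Fin 4 → Fin 4 → ℝ) (hs : ∀ k i j, C k i j = C k j i)
    (hc : ∀ i j k, pd i (g j k) y = ∑ m, (C m i j * g m k y + C m i k * g j m y))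
    (k i j : Fin 4) : christoffel g k i j y = C k i j := by
  rw [← hg.raise_lower hy (fun m => C m i j) k]
  simp only [christoffel, Finset.mul_sum (s := Finset.univ) (a := (1 / 2 : ℝ))]
  refine Finset.sum_congr rfl fun l _ => ?_
  -- The Koszul combination: of the six terms obtained from metric compatibility, four cancel by the
  -- symmetry of `C`.
  have h : pd i (g l j) y + pd j (g l i) y - pd l (g i j) y = 2 * ∑ m, g l m y * C m i j := by
    rw [hc i l j, hc j l i, hc l i j]
    rw [← Finset.sum_add_distrib, ← Finset.sum_sub_distrib, Finset.mul_sum]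
    refine Finset.sum_congr rfl fun m _ => ?_
    rw [hs m l i, hs m l j, hs m j i, hg.symm y hy m j, hg.symm y hy m i]
    ring
  rw [h]; ring

/-- Differentiating g⁻¹g = 1 gives (∂g⁻¹)g = 0 when ∂g = 0, and g is invertible. -/
theorem HasPd.metricInv_zero (hg : MetricOn g V) (hy : y ∈ V) {i : Fin 4}
    (h0 : ∀ j k, pd i (g j k) y = 0) (k l : Fin 4) : HasPd i (metricInv g k l) 0 y := by
  have h := (hg.sm_inv k l).hasPd hg.isOpen hy (i := i)
  refine h.congr_val ?_
  have key : ∀ k j, ∑ m, pd i (metricInv g k m) y * g m j y = 0 := by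
    intro k j
    have h1 : HasPd i (fun z => ∑ m, metricInv g k m z * g m j z)
        (∑ m, (pd i (metricInv g k m) y * g m j y + metricInv g k m y * pd i (g m j) y)) y :=
      HasPd.sum fun m _ => ((hg.sm_inv k m).hasPd hg.isOpen hy).mul
        ((hg.smooth m j).hasPd hg.isOpen hy)
    have h2 : HasPd i (fun z => ∑ m, metricInv g k m z * g m j z) 0 y :=
      (HasPd.const (if k = j then 1 else 0)).congr_on hg.isOpen hy
        fun z hz => hg.inv_mul hz k j
    have := h1.pd_eq.symm.trans h2.pd_eq
    simpa [h0] using this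
  have h3 : pd i (metricInv g k l) y
      = ∑ j, (∑ m, pd i (metricInv g k m) y * g m j y) * metricInv g j l y := by
    simp only [Finset.sum_mul, mul_assoc]
    rw [Finset.sum_comm]
    simp only [← Finset.mul_sum, hg.mul_inv hy]
    simp
  rw [h3]
  simp [key]

end Metric

/-! ### Symmetries of the curvature -/

section Curvature

variable {g : Fin 4 → Fin 4 → E4 → ℝ} {V : Set E4} {y : E4}

theorem MetricOn.sm_riemannUp (hg : MetricOn g V) (a b c d : Fin 4) :
    Sm V (riemannUp g a b c d) :=
  (((hg.sm_christoffel _ _ _).pd hg.isOpen _).sub ((hg.sm_christoffel _ _ _).pd hg.isOpen _)).add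
    (Sm.sum fun _ _ => ((hg.sm_christoffel _ _ _).mul (hg.sm_christoffel _ _ _)).sub
      ((hg.sm_christoffel _ _ _).mul (hg.sm_christoffel _ _ _)))

theorem MetricOn.sm_riemann (hg : MetricOn g V) (a b c d : Fin 4) : Sm V (riemann g a b c d) :=
  Sm.sum fun _ _ => (hg.sm_riemannUp _ _ _ _).mul (hg.smooth _ _)

theorem MetricOn.sm_ricci (hg : MetricOn g V) (a b : Fin 4) : Sm V (ricci g a b) :=
  Sm.sum fun _ _ => hg.sm_riemannUp _ _ _ _

theorem MetricOn.sm_scalarCurv (hg : MetricOn g V) : Sm V (scalarCurv g) :=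
  Sm.sum fun _ _ => Sm.sum fun _ _ => (hg.sm_inv _ _).mul (hg.sm_ricci _ _)

/-- The tensor `P_{ab} = φ_{ab} - Λ g_{ab}`. -/
def schouten (g : Fin 4 → Fin 4 → E4 → ℝ) (a b : Fin 4) (y : E4) : ℝ :=
  tfRicci g a b y - lam g y * g a b y

/-- In the present convention `ricci` is the negative of the usual Ricci tensor, so this is the
usual Schouten tensor of a four-dimensional metric, with its usual sign. -/
theorem schouten_eq (g : Fin 4 → Fin 4 → E4 → ℝ) (a b : Fin 4) (y : E4) :
    schouten g a b y = -(1 / 2) * ricci g a b y + scalarCurv g y / 12 * g a b y := by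
  simp only [schouten, tfRicci, lam]; ring

theorem weyl_eq (g : Fin 4 → Fin 4 → E4 → ℝ) (a b c d : Fin 4) (y : E4) :
    weyl g a b c d y = riemann g a b c d y
      + (g a c y * schouten g b d y - g a d y * schouten g b c y
      + g b d y * schouten g a c y - g b c y * schouten g a d y) := by
  simp only [schouten_eq, weyl]; ring

theorem MetricOn.sm_schouten (hg : MetricOn g V) (a b : Fin 4) : Sm V (schouten g a b) := by
  have : Sm V fun y => -(1 / 2) * ricci g a b y + scalarCurv g y / 12 * g a b y :=
    (contDiffOn_const.mul (hg.sm_ricci a b)).add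
      ((hg.sm_scalarCurv.div_const 12).mul (hg.smooth a b))
  exact this.congr fun y _ => schouten_eq g a b y

theorem MetricOn.sm_weyl (hg : MetricOn g V) (a b c d : Fin 4) : Sm V (weyl g a b c d) := by
  refine ContDiffOn.congr ?_ fun y _ => weyl_eq g a b c d y
  exact (hg.sm_riemann _ _ _ _).add (((((hg.smooth _ _).mul (hg.sm_schouten _ _)).sub
    ((hg.smooth _ _).mul (hg.sm_schouten _ _))).add ((hg.smooth _ _).mul (hg.sm_schouten _ _))).sub
    ((hg.smooth _ _).mul (hg.sm_schouten _ _)))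

/-- The Ricci identity for a parallel two-tensor. -/
theorem MetricOn.ricci_identity (hg : MetricOn g V) {F : Fin 4 → Fin 4 → E4 → ℝ}
    (hF : ∀ i j, Sm V (F i j))
    (hp : ∀ z ∈ V, ∀ i j k, pd i (F j k) z
      = ∑ m, (christoffel g m i j z * F m k z + christoffel g m i k z * F j m z))
    (hy : y ∈ V) (a b c d : Fin 4) :
    ∑ m, (riemannUp g a b c m y * F m d y + riemannUp g a b d m y * F c m y) = 0 := by
  have key : ∀ a b, pd a (pd b (F c d)) y
      = ∑ m, ((pd a (christoffel g m b c) y * F m d y + christoffel g m b c y * pd a (F m d) y)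
        + (pd a (christoffel g m b d) y * F c m y + christoffel g m b d y * pd a (F c m) y)) := by
    intro a b
    rw [pd_congr_on hg.isOpen hy fun z hz => hp z hz b c d]
    exact (HasPd.sum fun m _ =>
      (((hg.sm_christoffel m b c).hasPd hg.isOpen hy).mul ((hF m d).hasPd hg.isOpen hy)).add
      (((hg.sm_christoffel m b d).hasPd hg.isOpen hy).mul ((hF c m).hasPd hg.isOpen hy))).pd_eq
  -- Equality of the mixed second derivatives, with each first derivative replaced by Christoffel
  -- terms, says that the curvature annihilates `F`.
  have h := pd_comm (hF c d) hg.isOpen hy a b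
  rw [key, key] at h
  simp only [hp y hy] at h
  simp only [riemannUp]
  simp only [Fin.sum_univ_four] at h ⊢
  linear_combination h

/-- The Ricci identity for the parallel tensor g itself. -/
theorem MetricOn.riemann_antisymm_right (hg : MetricOn g V) (hy : y ∈ V) (a b c d : Fin 4) :
    riemann g a b c d y = -riemann g a b d c y := by
  have h := hg.ricci_identity hg.smooth (fun z hz => hg.compat hz) hy a b c d
  rw [Finset.sum_add_distrib] at h
  have h2 : ∑ m, riemannUp g a b d m y * g c m y = riemann g a b d c y :=
    Finset.sum_congr rfl fun m _ => by rw [hg.symm y hy c m]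
  rw [h2] at h
  simp only [riemann] at h ⊢
  linarith

theorem riemannUp_antisymm (g : Fin 4 → Fin 4 → E4 → ℝ) (a b c d : Fin 4) (y : E4) :
    riemannUp g a b c d y = -riemannUp g b a c d y := by
  simp only [riemannUp, Finset.sum_sub_distrib]; ring

theorem riemann_antisymm_left (g : Fin 4 → Fin 4 → E4 → ℝ) (a b c d : Fin 4) (y : E4) :
    riemann g a b c d y = -riemann g b a c d y := by
  simp only [riemann, riemannUp_antisymm g a b, neg_mul, Finset.sum_neg_distrib]

theorem MetricOn.riemannUp_cyclic (hg : MetricOn g V) (hy : y ∈ V) (a b c d : Fin 4) :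
    riemannUp g a b c d y + riemannUp g b c a d y + riemannUp g c a b d y = 0 := by
  have h : ∀ i j k, pd i (christoffel g d j k) y = pd i (christoffel g d k j) y := fun i j k =>
    pd_congr_on hg.isOpen hy fun z hz => hg.christoffel_symm hz d j k
  have hs := fun m => hg.christoffel_symm hy m
  simp only [riemannUp, Finset.sum_sub_distrib]
  rw [h a c b, h b a c, h c b a]
  have e1 : ∑ m, christoffel g d b m y * christoffel g m a c y
      = ∑ m, christoffel g d b m y * christoffel g m c a y := by simp only [hs _ a c]
  have e2 : ∑ m, christoffel g d a m y * christoffel g m b c y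
      = ∑ m, christoffel g d a m y * christoffel g m c b y := by simp only [hs _ b c]
  have e3 : ∑ m, christoffel g d c m y * christoffel g m b a y
      = ∑ m, christoffel g d c m y * christoffel g m a b y := by simp only [hs _ a b]
  rw [e1, e2, e3]
  ring

theorem MetricOn.riemann_cyclic (hg : MetricOn g V) (hy : y ∈ V) (a b c d : Fin 4) :
    riemann g a b c d y + riemann g b c a d y + riemann g c a b d y = 0 := by
  simp only [riemann, ← Finset.sum_add_distrib, ← add_mul, hg.riemannUp_cyclic hy, zero_mul,
    Finset.sum_const_zero]

/-- The classical combination of four instances of the cyclic identity with the antisymmetries in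
each pair. -/
theorem MetricOn.riemann_pair (hg : MetricOn g V) (hy : y ∈ V) (a b c d : Fin 4) :
    riemann g a b c d y = riemann g c d a b y := by
  have r := hg.riemann_antisymm_right hy
  have l := fun a b c d => riemann_antisymm_left g a b c d y
  have c1 := hg.riemann_cyclic hy a b c d
  have c2 := hg.riemann_cyclic hy b c d a
  have c3 := hg.riemann_cyclic hy c d a b
  have c4 := hg.riemann_cyclic hy d a b c
  linarith [r a b c d, r b c a d, r c a b d, r b c d a, r c d b a, r d b c a, r c d a b, r d a c b,
    r a c d b, r d a b c, r a b d c, r b d a c, l a b c d, l b c a d, l c a b d, l b c d a,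
    l c d b a, l d b c a, l c d a b, l d a c b, l a c d b, l d a b c, l a b d c, l b d a c]

theorem MetricOn.ricci_eq (hg : MetricOn g V) (hy : y ∈ V) (a b : Fin 4) :
    ricci g a b y = ∑ c, ∑ d, metricInv g c d y * riemann g a c b d y := by
  refine Finset.sum_congr rfl fun c _ => ?_
  rw [← hg.raise_lower hy (fun e => riemannUp g a c b e y) c]
  refine Finset.sum_congr rfl fun d _ => ?_
  rw [riemann]
  congr 1
  exact Finset.sum_congr rfl fun e _ => by rw [hg.symm y hy d e]; ring

theorem MetricOn.ricci_symm (hg : MetricOn g V) (hy : y ∈ V) (a b : Fin 4) :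
    ricci g a b y = ricci g b a y := by
  rw [hg.ricci_eq hy, hg.ricci_eq hy, Finset.sum_comm]
  refine Finset.sum_congr rfl fun c _ => Finset.sum_congr rfl fun d _ => ?_
  rw [hg.inv_symm hy, hg.riemann_pair hy]

theorem MetricOn.schouten_symm (hg : MetricOn g V) (hy : y ∈ V) (a b : Fin 4) :
    schouten g a b y = schouten g b a y := by
  rw [schouten_eq, schouten_eq, hg.ricci_symm hy, hg.symm y hy]

theorem weyl_antisymm_left (g : Fin 4 → Fin 4 → E4 → ℝ) (a b c d : Fin 4) (y : E4) :
    weyl g a b c d y = -weyl g b a c d y := by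
  rw [weyl_eq, weyl_eq, riemann_antisymm_left]; ring

theorem MetricOn.weyl_antisymm_right (hg : MetricOn g V) (hy : y ∈ V) (a b c d : Fin 4) :
    weyl g a b c d y = -weyl g a b d c y := by
  rw [weyl_eq, weyl_eq, hg.riemann_antisymm_right hy]; ring

theorem MetricOn.weyl_pair (hg : MetricOn g V) (hy : y ∈ V) (a b c d : Fin 4) :
    weyl g a b c d y = weyl g c d a b y := by
  rw [weyl_eq, weyl_eq, hg.riemann_pair hy, hg.symm y hy a c, hg.symm y hy b d, hg.symm y hy a d,
    hg.symm y hy b c, hg.schouten_symm hy b d, hg.schouten_symm hy a c, hg.schouten_symm hy b c,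
    hg.schouten_symm hy a d]
  ring

/-- The trace of the Schouten tensor. -/
theorem MetricOn.trace_schouten (hg : MetricOn g V) (hy : y ∈ V) :
    ∑ a, ∑ b, metricInv g a b y * schouten g a b y = -scalarCurv g y / 6 := by
  have h1 : ∑ a, ∑ b, metricInv g a b y * g a b y = 4 := by
    have : ∀ a, ∑ b, metricInv g a b y * g a b y = 1 := by
      intro a
      have := hg.inv_mul hy a a
      rw [if_pos rfl] at this
      rw [← this]
      exact Finset.sum_congr rfl fun b _ => by rw [hg.symm y hy a b]
    simp [this]
  have h2 : ∑ a, ∑ b, metricInv g a b y * schouten g a b y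
      = -(1 / 2) * (∑ a, ∑ b, metricInv g a b y * ricci g a b y)
        + scalarCurv g y / 12 * ∑ a, ∑ b, metricInv g a b y * g a b y := by
    simp only [Finset.mul_sum, ← Finset.sum_add_distrib]
    refine Finset.sum_congr rfl fun c _ => Finset.sum_congr rfl fun d _ => ?_
    rw [schouten_eq]; ring
  rw [h2, h1, ← scalarCurv]; ring

/-- The Weyl tensor is trace-free. -/
theorem MetricOn.weyl_trace (hg : MetricOn g V) (hy : y ∈ V) (a c : Fin 4) :
    ∑ b, ∑ d, metricInv g b d y * weyl g a b c d y = 0 := by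
  have e1 : ∑ b, ∑ d, metricInv g b d y * weyl g a b c d y
      = (∑ b, ∑ d, metricInv g b d y * riemann g a b c d y)
        + g a c y * (∑ b, ∑ d, metricInv g b d y * schouten g b d y)
        - (∑ b, (∑ d, metricInv g b d y * g d a y) * schouten g b c y)
        + (∑ b, ∑ d, metricInv g b d y * g d b y) * schouten g a c y
        - (∑ d, (∑ b, metricInv g d b y * g b c y) * schouten g a d y) := by
    have h5 : ∑ d, (∑ b, metricInv g d b y * g b c y) * schouten g a d y
        = ∑ b, ∑ d, metricInv g b d y * g b c y * schouten g a d y := by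
      rw [Finset.sum_comm]
      refine Finset.sum_congr rfl fun d _ => ?_
      rw [Finset.sum_mul]
      exact Finset.sum_congr rfl fun b _ => by rw [hg.inv_symm hy]
    rw [h5]
    simp only [Finset.mul_sum, Finset.sum_mul, ← Finset.sum_add_distrib, ← Finset.sum_sub_distrib]
    refine Finset.sum_congr rfl fun b _ => Finset.sum_congr rfl fun d _ => ?_
    rw [weyl_eq, hg.symm y hy d a, hg.symm y hy d b]; ring
  rw [e1, ← hg.ricci_eq hy, hg.trace_schouten hy]
  simp only [hg.inv_mul hy, ite_mul, one_mul, zero_mul, Finset.sum_ite_eq', Finset.mem_univ,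
    if_true, Finset.sum_const, Finset.card_univ, Fintype.card_fin]
  rw [schouten_eq, nsmul_eq_mul]
  push_cast
  ring

end Curvature

/-! ### Change of coordinates -/

/-- The matrix-valued function `A` has the partial derivative `D` in the direction `i`. -/
def HasPdM (i : Fin 4) (A : E4 → Matrix (Fin 4) (Fin 4) ℝ) (D : Matrix (Fin 4) (Fin 4) ℝ)
    (y : E4) : Prop :=
  ∀ k l, HasPd i (fun z => A z k l) (D k l) y

section HasPdM

variable {i : Fin 4} {A B : E4 → Matrix (Fin 4) (Fin 4) ℝ} {C D : Matrix (Fin 4) (Fin 4) ℝ}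
  {y : E4}

theorem HasPdM.mul (hA : HasPdM i A C y) (hB : HasPdM i B D y) :
    HasPdM i (fun z => A z * B z) (C * B y + A y * D) y := by
  intro k l
  simp only [Matrix.mul_apply, Matrix.add_apply, ← Finset.sum_add_distrib]
  exact HasPd.sum fun m _ => (hA k m).mul (hB m l)

theorem HasPdM.sub (hA : HasPdM i A C y) (hB : HasPdM i B D y) :
    HasPdM i (fun z => A z - B z) (C - D) y := fun k l => (hA k l).sub (hB k l)

theorem HasPdM.transpose (hA : HasPdM i A C y) :
    HasPdM i (fun z => (A z).transpose) C.transpose y := fun k l => hA l k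

end HasPdM

/-- `F` is a smooth map from the open set `V'` to the open set `V` with positive Jacobian
determinant. -/
structure CoordChange (F : E4 → E4) (V' V : Set E4) : Prop where
  isOpen : IsOpen V'
  isOpen_target : IsOpen V
  smooth : ∀ k, Sm V' (fun z => F z k)
  mapsTo : Set.MapsTo F V' V
  det_pos : ∀ z ∈ V', 0 < (Matrix.of fun k a => pd a (fun x => F x k) z).det

/-- The Jacobian matrix of a map. -/
def jac (F : E4 → E4) (k a : Fin 4) (z : E4) : ℝ := pd a (fun x => F x k) z

/-- The pullback of a one-form. -/
def pb1 (F : E4 → E4) (K : Fin 4 → E4 → ℝ) (a : Fin 4) (z : E4) : ℝ :=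
  ∑ i, jac F i a z * K i (F z)

/-- The pullback of a covariant two-tensor. -/
def pb2 (F : E4 → E4) (T : Fin 4 → Fin 4 → E4 → ℝ) (a b : Fin 4) (z : E4) : ℝ :=
  ∑ i, jac F i a z * ∑ j, jac F j b z * T i j (F z)

/-- The pullback of a covariant four-tensor. -/
def pb4 (F : E4 → E4) (W : Fin 4 → Fin 4 → Fin 4 → Fin 4 → E4 → ℝ) (a b c d : Fin 4)
    (z : E4) : ℝ :=
  ∑ i, jac F i a z * ∑ j, jac F j b z * ∑ k, jac F k c z * ∑ l, jac F l d z * W i j k l (F z)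

/-- The Jacobian as a matrix. -/
abbrev jacM (F : E4 → E4) (z : E4) : Matrix (Fin 4) (Fin 4) ℝ := Matrix.of fun k a => jac F k a z

/-- The Christoffel symbols as matrices. -/
abbrev chrM (g : Fin 4 → Fin 4 → E4 → ℝ) (e : Fin 4) (y : E4) : Matrix (Fin 4) (Fin 4) ℝ :=
  Matrix.of fun k j => christoffel g k e j y

/-- The curvature as matrices. -/
abbrev riemM (g : Fin 4 → Fin 4 → E4 → ℝ) (a b : Fin 4) (y : E4) : Matrix (Fin 4) (Fin 4) ℝ :=
  Matrix.of fun d c => riemannUp g a b c d y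

/-- The matrices of the pulled back connection with respect to the old coordinate frame. -/
def pbConn (F : E4 → E4) (g : Fin 4 → Fin 4 → E4 → ℝ) (e : Fin 4) (z : E4) :
    Matrix (Fin 4) (Fin 4) ℝ :=
  Matrix.of fun i p => ∑ q, jac F q e z * christoffel g i q p (F z)

section CoordChange

variable {F : E4 → E4} {g : Fin 4 → Fin 4 → E4 → ℝ} {V V' : Set E4} {z : E4}

theorem CoordChange.sm_jac (hF : CoordChange F V' V) (k a : Fin 4) : Sm V' (jac F k a) :=
  (hF.smooth k).pd hF.isOpen a

theorem CoordChange.contDiffOn (hF : CoordChange F V' V) : ContDiffOn ℝ ∞ F V' := by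
  rw [contDiffOn_euclidean]; exact hF.smooth

theorem CoordChange.sm_comp (hF : CoordChange F V' V) {f : E4 → ℝ} (hf : Sm V f) :
    Sm V' (fun z => f (F z)) :=
  ContDiffOn.comp hf hF.contDiffOn hF.mapsTo

theorem CoordChange.hasPd_comp (hF : CoordChange F V' V) {f : E4 → ℝ} (hf : Sm V f)
    (hz : z ∈ V') (e : Fin 4) :
    HasPd e (fun z => f (F z)) (∑ q, jac F q e z * pd q f (F z)) z :=
  ConfKahler.hasPd_comp (hf.hasPd hF.isOpen_target (hF.mapsTo hz) (i := 0)).1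
    fun k => (hF.smooth k).hasPd hF.isOpen hz

theorem CoordChange.isUnit_jac (hF : CoordChange F V' V) (hz : z ∈ V') :
    IsUnit (jacM F z).det := isUnit_iff_ne_zero.2 (hF.det_pos z hz).ne'

theorem CoordChange.sm_pb1 (hF : CoordChange F V' V) {K : Fin 4 → E4 → ℝ}
    (hK : ∀ i, Sm V (K i)) (a : Fin 4) : Sm V' (pb1 F K a) :=
  Sm.sum fun _ _ => (hF.sm_jac _ _).mul (hF.sm_comp (hK _))

theorem CoordChange.sm_pb2 (hF : CoordChange F V' V) {T : Fin 4 → Fin 4 → E4 → ℝ}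
    (hT : ∀ i j, Sm V (T i j)) (a b : Fin 4) : Sm V' (pb2 F T a b) :=
  Sm.sum fun _ _ => (hF.sm_jac _ _).mul (Sm.sum fun _ _ =>
    (hF.sm_jac _ _).mul (hF.sm_comp (hT _ _)))

theorem metricMatrix_pb2 (F : E4 → E4) (g : Fin 4 → Fin 4 → E4 → ℝ) (z : E4) :
    metricMatrix (pb2 F g) z = (jacM F z).transpose * metricMatrix g (F z) * jacM F z := by
  ext a b
  simp only [Matrix.of_apply, pb2, Matrix.mul_apply, Matrix.transpose_apply, Finset.sum_mul,
    Finset.mul_sum]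
  rw [Finset.sum_comm]
  refine Finset.sum_congr rfl fun i _ => Finset.sum_congr rfl fun j _ => ?_
  ring

theorem CoordChange.metricOn_pb2 (hF : CoordChange F V' V) (hg : MetricOn g V) :
    MetricOn (pb2 F g) V' where
  isOpen := hF.isOpen
  smooth := hF.sm_pb2 hg.smooth
  symm := by
    intro z hz a b
    simp only [pb2, Finset.mul_sum]
    rw [Finset.sum_comm]
    refine Finset.sum_congr rfl fun i _ => Finset.sum_congr rfl fun j _ => ?_
    rw [hg.symm _ (hF.mapsTo hz) i j]; ring
  pos := by
    intro z hz v hv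
    have hw : (jacM F z).mulVec v ≠ 0 := by
      intro h0
      apply hv
      have := congrArg ((jacM F z)⁻¹.mulVec) h0
      rwa [Matrix.mulVec_mulVec, Matrix.nonsing_inv_mul _ (hF.isUnit_jac hz), Matrix.one_mulVec,
        Matrix.mulVec_zero] at this
    refine lt_of_lt_of_eq (hg.pos _ (hF.mapsTo hz) _ hw) ?_
    simp only [Matrix.mulVec, dotProduct, Matrix.of_apply, pb2, Fin.sum_univ_four]
    ring

/-- The transformation law of the Christoffel symbols. -/
theorem CoordChange.hasPdM_jac (hF : CoordChange F V' V) (hg : MetricOn g V) (hz : z ∈ V')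
    (e : Fin 4) :
    HasPdM e (jacM F) (jacM F z * chrM (pb2 F g) e z - pbConn F g e z * jacM F z) z := by
  set J := jacM F z with hJ
  set G := metricMatrix g (F z) with hG
  set A := fun e => pbConn F g e z with hA
  have hJi : J * J⁻¹ = 1 := Matrix.mul_nonsing_inv _ (hF.isUnit_jac hz)
  let dJ : Fin 4 → Matrix (Fin 4) (Fin 4) ℝ := fun e => Matrix.of fun k a => pd e (jac F k a) z
  have hdJ : ∀ e, HasPdM e (jacM F) (dJ e) z := fun e k a =>
    (hF.sm_jac k a).hasPd hF.isOpen hz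
  -- `X e` is the derivative of the Jacobian, corrected by the pulled back connection. `C e = J⁻¹ X
  -- e` is the candidate for the new Christoffel symbols; uniqueness of the Levi-Civita connection
  -- will identify them.
  let X : Fin 4 → Matrix (Fin 4) (Fin 4) ℝ := fun e => dJ e + A e * J
  let C : Fin 4 → Matrix (Fin 4) (Fin 4) ℝ := fun e => J⁻¹ * X e
  have hJC : ∀ e, J * C e = X e := fun e => by
    simp only [C]; rw [← Matrix.mul_assoc, hJi, Matrix.one_mul]
  -- Freedom from torsion: second derivatives of `F` and the Christoffel symbols of `g` are both
  -- symmetric.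
  have hXs : ∀ e i a, X e i a = X a i e := by
    intro e i a
    simp only [X, Matrix.add_apply, Matrix.mul_apply, A, pbConn, hJ, Matrix.of_apply, dJ]
    congr 1
    · exact pd_comm (hF.smooth i) hF.isOpen hz e a
    · simp only [Finset.sum_mul]
      rw [Finset.sum_comm]
      refine Finset.sum_congr rfl fun p _ => Finset.sum_congr rfl fun q _ => ?_
      rw [hg.christoffel_symm (hF.mapsTo hz) i p q]; ring
  have hdG : ∀ e, HasPdM e (fun z => metricMatrix g (F z)) ((A e).transpose * G + G * A e) z := by
    intro e k l
    refine (hF.hasPd_comp (hg.smooth k l) hz e).congr_val ?_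
    simp only [hg.compat (hF.mapsTo hz), Matrix.add_apply, Matrix.mul_apply, A, pbConn, hG,
      Matrix.of_apply, Matrix.transpose_apply, Finset.sum_mul, Finset.mul_sum]
    rw [Finset.sum_comm, ← Finset.sum_add_distrib]
    refine Finset.sum_congr rfl fun i _ => ?_
    rw [← Finset.sum_add_distrib]
    refine Finset.sum_congr rfl fun j _ => ?_
    ring
  have hC : ∀ k e a, christoffel (pb2 F g) k e a z = C e k a := by
    refine (hF.metricOn_pb2 hg).christoffel_unique hz (fun k e a => C e k a) ?_ ?_
    · intro k i j
      simp only [C, Matrix.mul_apply, hXs i _ j]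
    · intro e a b
      -- Metric compatibility: the Leibniz rule for JᵗGJ, rewritten by `h2` as Cᵗg' + g'C with g'
      -- the pulled back metric.
      have h1 : HasPdM e (metricMatrix (pb2 F g))
          (((dJ e).transpose * G + J.transpose * ((A e).transpose * G + G * A e)) * J
            + J.transpose * G * dJ e) z := by
        have := ((hdJ e).transpose.mul (hdG e)).mul (hdJ e)
        intro k l
        refine (this k l).congr_of_eventuallyEq (Filter.Eventually.of_forall fun x => ?_)
        exact congrFun (congrFun (metricMatrix_pb2 F g x) k) l
      have h2 : ((dJ e).transpose * G + J.transpose * ((A e).transpose * G + G * A e)) * J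
            + J.transpose * G * dJ e
          = (C e).transpose * metricMatrix (pb2 F g) z + metricMatrix (pb2 F g) z * C e := by
        rw [metricMatrix_pb2, ← hJ, ← hG, Matrix.mul_assoc _ J, hJC, ← Matrix.mul_assoc,
          ← Matrix.mul_assoc, ← Matrix.transpose_mul, hJC]
        simp only [X, Matrix.transpose_add, Matrix.transpose_mul]
        noncomm_ring
      refine (h1 a b).pd_eq.trans ?_
      rw [h2]
      simp only [Matrix.add_apply, Matrix.mul_apply, Matrix.transpose_apply, Matrix.of_apply,
        ← Finset.sum_add_distrib]
      refine Finset.sum_congr rfl fun m _ => ?_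
      ring
  have hCM : chrM (pb2 F g) e z = C e := by ext k a; exact hC k e a
  rw [hCM, hJC]
  have : X e - pbConn F g e z * J = dJ e := by simp only [X, A]; abel
  rw [this]
  exact hdJ e

theorem CoordChange.pd_jac (hF : CoordChange F V' V) (hg : MetricOn g V) (hz : z ∈ V')
    (e i a : Fin 4) :
    pd e (jac F i a) z = ∑ m, jac F i m z * christoffel (pb2 F g) m e a z
      - ∑ p, pbConn F g e z i p * jac F p a z :=
  (hF.hasPdM_jac hg hz e i a).pd_eq

theorem hasPdM_chrM (hg : MetricOn g V) (hz : z ∈ V) (a b : Fin 4) :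
    HasPdM a (chrM g b) (Matrix.of fun k j => pd a (christoffel g k b j) z) z :=
  fun _ _ => (hg.sm_christoffel _ _ _).hasPd hg.isOpen hz

theorem riemM_eq (g : Fin 4 → Fin 4 → E4 → ℝ) (a b : Fin 4) (y : E4) :
    riemM g a b y = (Matrix.of fun k j => pd a (christoffel g k b j) y)
      - (Matrix.of fun k j => pd b (christoffel g k a j) y)
      + (chrM g a y * chrM g b y - chrM g b y * chrM g a y) := by
  ext d c
  simp only [Matrix.of_apply, Matrix.add_apply, Matrix.sub_apply, Matrix.mul_apply, riemannUp,
    Finset.sum_sub_distrib]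

theorem CoordChange.hasPd_pbConn (hF : CoordChange F V' V) (hg : MetricOn g V) (hz : z ∈ V')
    (f e : Fin 4) :
    HasPdM f (pbConn F g e) (Matrix.of fun i p => ∑ q, (pd f (jac F q e) z
      * christoffel g i q p (F z)
      + jac F q e z * ∑ r, jac F r f z * pd r (christoffel g i q p) (F z))) z :=
  fun i p => HasPd.sum (s := Finset.univ) (F := fun q z => jac F q e z * christoffel g i q p (F z))
    (d := fun q => pd f (jac F q e) z * christoffel g i q p (F z)
      + jac F q e z * ∑ r, jac F r f z * pd r (christoffel g i q p) (F z)) fun q _ =>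
    ((hF.sm_jac q e).hasPd hF.isOpen hz).mul (hF.hasPd_comp (hg.sm_christoffel i q p) hz f)

/-- The transformation law of the curvature. -/
theorem CoordChange.riemM_pb2 (hF : CoordChange F V' V) (hg : MetricOn g V) (hz : z ∈ V')
    (f e : Fin 4) :
    jacM F z * riemM (pb2 F g) f e z
      = (Matrix.of fun i p => ∑ q, jac F q f z * ∑ r, jac F r e z * riemannUp g q r p i (F z))
        * jacM F z := by
  set J := jacM F z with hJ
  let Γ := fun e => chrM (pb2 F g) e z
  let A := fun e => pbConn F g e z
  let dΓ := fun f e => (Matrix.of fun k j => pd f (christoffel (pb2 F g) k e j) z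
    : Matrix (Fin 4) (Fin 4) ℝ)
  let dA := fun f e => (Matrix.of fun i p => ∑ q, (pd f (jac F q e) z
      * christoffel g i q p (F z)
      + jac F q e z * ∑ r, jac F r f z * pd r (christoffel g i q p) (F z))
    : Matrix (Fin 4) (Fin 4) ℝ)
  have hg' := hF.metricOn_pb2 hg
  have h2 : ∀ f e, HasPdM f (fun x => jacM F x * chrM (pb2 F g) e x - pbConn F g e x * jacM F x)
      (((J * Γ f - A f * J) * Γ e + J * dΓ f e) - (dA f e * J + A e * (J * Γ f - A f * J))) z :=
    fun f e => ((hF.hasPdM_jac hg hz f).mul (hasPdM_chrM hg' hz f e)).sub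
      ((hF.hasPd_pbConn hg hz f e).mul (hF.hasPdM_jac hg hz f))
  -- The equation ∂ₑJ = JΓₑ − AₑJ holds on all of `V'` and can be differentiated again. The symmetry
  -- of the second derivatives of J is its integrability condition, which amounts to the
  -- intertwining by J of the two curvatures.
  have hsymm : ((J * Γ f - A f * J) * Γ e + J * dΓ f e) - (dA f e * J + A e * (J * Γ f - A f * J))
      = ((J * Γ e - A e * J) * Γ f + J * dΓ e f)
        - (dA e f * J + A f * (J * Γ e - A e * J)) := by
    ext i a
    have h3 : ∀ f e, pd f (pd e (jac F i a)) z
        = (((J * Γ f - A f * J) * Γ e + J * dΓ f e)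
          - (dA f e * J + A e * (J * Γ f - A f * J))) i a := by
      intro f e
      rw [← (h2 f e i a).pd_eq]
      exact pd_congr_on hF.isOpen hz fun x hx => (hF.hasPdM_jac hg hx e i a).pd_eq
    rw [← h3, ← h3]
    exact pd_comm (hF.sm_jac i a) hF.isOpen hz f e
  -- The pulled back curvature is the curvature of the connection matrices `A`; the terms with
  -- second derivatives of `F` cancel by symmetry.
  have hRA : (Matrix.of fun i p => ∑ q, jac F q f z * ∑ r, jac F r e z * riemannUp g q r p i (F z))
      = dA f e - dA e f + (A f * A e - A e * A f) := by
    have hpd : ∀ q, pd f (jac F q e) z = pd e (jac F q f) z := fun q =>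
      pd_comm (hF.smooth q) hF.isOpen hz f e
    ext i p
    simp only [dA, A, pbConn, Matrix.add_apply, Matrix.sub_apply, Matrix.mul_apply,
      Matrix.of_apply, hpd, riemannUp]
    rw [← Finset.sum_sub_distrib]
    have e1 : ∀ x, (pd e (jac F x f) z * christoffel g i x p (F z)
          + jac F x e z * ∑ r, jac F r f z * pd r (christoffel g i x p) (F z)
        - (pd e (jac F x f) z * christoffel g i x p (F z)
          + jac F x f z * ∑ r, jac F r e z * pd r (christoffel g i x p) (F z)))
        = jac F x e z * ∑ r, jac F r f z * pd r (christoffel g i x p) (F z)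
          - jac F x f z * ∑ r, jac F r e z * pd r (christoffel g i x p) (F z) := fun x => by ring
    simp only [e1, Finset.sum_sub_distrib]
    have e2 : ∑ x, jac F x e z * ∑ r, jac F r f z * pd r (christoffel g i x p) (F z)
        = ∑ q, jac F q f z * ∑ r, jac F r e z * pd q (christoffel g i r p) (F z) := by
      simp only [Finset.mul_sum]
      rw [Finset.sum_comm]
      exact Finset.sum_congr rfl fun _ _ => Finset.sum_congr rfl fun _ _ => by ring
    have e3 : ∀ f e, ∑ x, (∑ q, jac F q f z * christoffel g i q x (F z))
          * (∑ q, jac F q e z * christoffel g x q p (F z))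
        = ∑ q, jac F q f z * ∑ r, jac F r e z
          * ∑ m, christoffel g i q m (F z) * christoffel g m r p (F z) := by
      intro f e
      simp only [Finset.mul_sum, Finset.sum_mul]
      rw [Finset.sum_comm_cycle]
      refine Finset.sum_congr rfl fun q _ => ?_
      rw [Finset.sum_comm]
      exact Finset.sum_congr rfl fun _ _ => Finset.sum_congr rfl fun _ _ => by ring
    have e4 : ∑ q, jac F q e z * ∑ r, jac F r f z
          * ∑ m, christoffel g i q m (F z) * christoffel g m r p (F z)
        = ∑ q, jac F q f z * ∑ r, jac F r e z
          * ∑ m, christoffel g i r m (F z) * christoffel g m q p (F z) := by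
      simp only [Finset.mul_sum]
      rw [Finset.sum_comm]
      exact Finset.sum_congr rfl fun _ _ => Finset.sum_congr rfl fun _ _ =>
        Finset.sum_congr rfl fun _ _ => by ring
    rw [e2, e3, e3, e4]
    simp only [mul_add, mul_sub, Finset.sum_add_distrib, Finset.sum_sub_distrib]
  rw [riemM_eq, hRA]
  have h5 : J * (dΓ f e - dΓ e f + (Γ f * Γ e - Γ e * Γ f))
      - (dA f e - dA e f + (A f * A e - A e * A f)) * J
      = (((J * Γ f - A f * J) * Γ e + J * dΓ f e) - (dA f e * J + A e * (J * Γ f - A f * J)))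
        - (((J * Γ e - A e * J) * Γ f + J * dΓ e f)
        - (dA e f * J + A f * (J * Γ e - A e * J))) := by noncomm_ring
  rw [hsymm, sub_self, sub_eq_zero] at h5
  exact h5

end CoordChange

/-! ### Naturality of the curvature and of covariant derivatives -/

theorem sum_mul_sum_swap {R ι κ : Type*} [CommSemiring R] [Fintype ι] [Fintype κ] (s : ι → R)
    (t : κ → R) (X : ι → κ → R) :
    ∑ i, s i * ∑ k, t k * X i k = ∑ k, t k * ∑ i, s i * X i k := by
  simp only [Finset.mul_sum]
  rw [Finset.sum_comm]
  exact Finset.sum_congr rfl fun _ _ => Finset.sum_congr rfl fun _ _ => by ring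

section Naturality

variable {F : E4 → E4} {g : Fin 4 → Fin 4 → E4 → ℝ} {V V' : Set E4} {z : E4}

theorem CoordChange.riemannUp_pb (hF : CoordChange F V' V) (hg : MetricOn g V) (hz : z ∈ V')
    (a b c i : Fin 4) :
    ∑ d, jac F i d z * riemannUp (pb2 F g) a b c d z
      = ∑ q, jac F q a z * ∑ r, jac F r b z * ∑ p, jac F p c z * riemannUp g q r p i (F z) := by
  have h := congrFun (congrFun (hF.riemM_pb2 hg hz a b) i) c
  simp only [Matrix.mul_apply, Matrix.of_apply, Finset.sum_mul, mul_assoc] at h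
  rw [h, Finset.sum_comm]
  refine Finset.sum_congr rfl fun q _ => ?_
  rw [← Finset.mul_sum]
  congr 1
  simp only [Finset.mul_sum]
  rw [Finset.sum_comm]
  exact Finset.sum_congr rfl fun _ _ => Finset.sum_congr rfl fun _ _ => by ring

theorem CoordChange.riemann_pb (hF : CoordChange F V' V) (hg : MetricOn g V) (hz : z ∈ V')
    (a b c d : Fin 4) : riemann (pb2 F g) a b c d z = pb4 F (riemann g) a b c d z := by
  have h1 : riemann (pb2 F g) a b c d z
      = ∑ i, (∑ e, jac F i e z * riemannUp (pb2 F g) a b c e z)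
        * ∑ j, jac F j d z * g i j (F z) := by
    simp only [riemann, pb2, Finset.mul_sum, Finset.sum_mul]
    rw [Finset.sum_comm]
    refine Finset.sum_congr rfl fun i _ => ?_
    rw [Finset.sum_comm]
    exact Finset.sum_congr rfl fun _ _ => Finset.sum_congr rfl fun _ _ => by ring
  rw [h1]
  simp only [hF.riemannUp_pb hg hz, pb4, riemann]
  simp only [mul_comm _ (∑ j, jac F j d z * _)]
  rw [sum_mul_sum_swap]
  refine Finset.sum_congr rfl fun q _ => congrArg _ ?_
  rw [sum_mul_sum_swap]
  refine Finset.sum_congr rfl fun r _ => congrArg _ ?_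
  rw [sum_mul_sum_swap]
  refine Finset.sum_congr rfl fun p _ => ?_
  simp only [Finset.mul_sum, Finset.sum_mul]
  rw [Finset.sum_comm]
  exact Finset.sum_congr rfl fun _ _ => Finset.sum_congr rfl fun _ _ => by ring

theorem CoordChange.metricInv_pb (hF : CoordChange F V' V) (hz : z ∈ V')
    (i j : Fin 4) :
    ∑ a, jac F i a z * ∑ b, jac F j b z * metricInv (pb2 F g) a b z = metricInv g i j (F z) := by
  have h0 := metricMatrix_pb2 F g z
  set J := jacM F z with hJ
  have hu := hF.isUnit_jac hz
  have hJi : J * J⁻¹ = 1 := Matrix.mul_nonsing_inv _ hu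
  have hut : IsUnit J.transpose.det := by rwa [Matrix.det_transpose]
  have hJt : J.transpose⁻¹ * J.transpose = 1 := Matrix.nonsing_inv_mul _ hut
  have h : J * (metricMatrix (pb2 F g) z)⁻¹ * J.transpose = (metricMatrix g (F z))⁻¹ := by
    rw [h0, Matrix.mul_inv_rev, Matrix.mul_inv_rev, ← Matrix.mul_assoc, hJi, Matrix.one_mul,
      Matrix.mul_assoc, hJt, Matrix.mul_one]
  have h' := congrFun (congrFun h i) j
  change _ = metricInv g i j (F z) at h'
  rw [← h']
  simp only [Matrix.mul_apply, Matrix.transpose_apply, Matrix.of_apply, hJ, Finset.sum_mul,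
    Finset.mul_sum, metricInv]
  rw [Finset.sum_comm]
  exact Finset.sum_congr rfl fun _ _ => Finset.sum_congr rfl fun _ _ => by ring

/-- Contraction of two pulled back indices. -/
theorem CoordChange.contract_pb (hF : CoordChange F V' V) (hz : z ∈ V')
    (T : Fin 4 → Fin 4 → ℝ) :
    ∑ a, ∑ b, metricInv (pb2 F g) a b z * ∑ i, jac F i a z * ∑ j, jac F j b z * T i j
      = ∑ i, ∑ j, metricInv g i j (F z) * T i j := by
  simp only [← hF.metricInv_pb hz, Finset.sum_mul, Finset.mul_sum]
  calc _ = ∑ a, ∑ i, ∑ b, ∑ j, metricInv (pb2 F g) a b z * (jac F i a z * (jac F j b z * T i j)) :=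
        Finset.sum_congr rfl fun a _ => Finset.sum_comm
    _ = ∑ i, ∑ a, ∑ j, ∑ b, metricInv (pb2 F g) a b z * (jac F i a z * (jac F j b z * T i j)) := by
        rw [Finset.sum_comm]
        exact Finset.sum_congr rfl fun i _ => Finset.sum_congr rfl fun a _ => Finset.sum_comm
    _ = _ := by
        refine Finset.sum_congr rfl fun i _ => ?_
        rw [Finset.sum_comm]
        exact Finset.sum_congr rfl fun _ _ => Finset.sum_congr rfl fun _ _ =>
          Finset.sum_congr rfl fun _ _ => by ring

theorem CoordChange.ricci_pb (hF : CoordChange F V' V) (hg : MetricOn g V) (hz : z ∈ V')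
    (a b : Fin 4) : ricci (pb2 F g) a b z = pb2 F (ricci g) a b z := by
  rw [(hF.metricOn_pb2 hg).ricci_eq hz]
  simp only [hF.riemann_pb hg hz, pb4]
  have h1 : ∀ c d, ∑ i, jac F i a z * ∑ j, jac F j c z * ∑ k, jac F k b z
        * ∑ l, jac F l d z * riemann g i j k l (F z)
      = ∑ j, jac F j c z * ∑ l, jac F l d z * ∑ i, jac F i a z * ∑ k, jac F k b z
        * riemann g i j k l (F z) := by
    intro c d
    rw [sum_mul_sum_swap]
    refine Finset.sum_congr rfl fun j _ => congrArg _ ?_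
    simp only [sum_mul_sum_swap (fun k => jac F k b z) (fun l => jac F l d z)]
    rw [sum_mul_sum_swap]
  simp only [h1]
  rw [hF.contract_pb hz]
  simp only [pb2, hg.ricci_eq (hF.mapsTo hz)]
  simp only [Finset.mul_sum]
  calc _ = ∑ j, ∑ i, ∑ l, ∑ k, metricInv g j l (F z) * (jac F i a z * (jac F k b z
          * riemann g i j k l (F z))) := Finset.sum_congr rfl fun _ _ => Finset.sum_comm
    _ = ∑ i, ∑ j, ∑ k, ∑ l, metricInv g j l (F z) * (jac F i a z * (jac F k b z
          * riemann g i j k l (F z))) := by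
        rw [Finset.sum_comm]
        exact Finset.sum_congr rfl fun _ _ => Finset.sum_congr rfl fun _ _ => Finset.sum_comm
    _ = _ := by
        refine Finset.sum_congr rfl fun i _ => ?_
        rw [Finset.sum_comm]
        exact Finset.sum_congr rfl fun _ _ => Finset.sum_congr rfl fun _ _ =>
          Finset.sum_congr rfl fun _ _ => by ring

theorem CoordChange.scalarCurv_pb (hF : CoordChange F V' V) (hg : MetricOn g V) (hz : z ∈ V') :
    scalarCurv (pb2 F g) z = scalarCurv g (F z) := by
  simp only [scalarCurv, hF.ricci_pb hg hz, pb2]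
  exact hF.contract_pb hz fun i j => ricci g i j (F z)

theorem CoordChange.schouten_pb (hF : CoordChange F V' V) (hg : MetricOn g V) (hz : z ∈ V')
    (a b : Fin 4) : schouten (pb2 F g) a b z = pb2 F (schouten g) a b z := by
  rw [schouten_eq, hF.ricci_pb hg hz, hF.scalarCurv_pb hg hz]
  simp only [pb2, Finset.mul_sum, ← Finset.sum_add_distrib, schouten_eq]
  exact Finset.sum_congr rfl fun _ _ => Finset.sum_congr rfl fun _ _ => by ring

theorem CoordChange.tfRicci_pb (hF : CoordChange F V' V) (hg : MetricOn g V) (hz : z ∈ V')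
    (a b : Fin 4) : tfRicci (pb2 F g) a b z = pb2 F (tfRicci g) a b z := by
  rw [tfRicci, hF.ricci_pb hg hz, hF.scalarCurv_pb hg hz]
  simp only [pb2, Finset.mul_sum, ← Finset.sum_sub_distrib, tfRicci]
  exact Finset.sum_congr rfl fun _ _ => Finset.sum_congr rfl fun _ _ => by ring

theorem pb4_add (F : E4 → E4) (W W' : Fin 4 → Fin 4 → Fin 4 → Fin 4 → E4 → ℝ) (a b c d : Fin 4)
    (z : E4) : pb4 F (fun i j k l y => W i j k l y + W' i j k l y) a b c d z
      = pb4 F W a b c d z + pb4 F W' a b c d z := by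
  simp only [pb4, mul_add, Finset.sum_add_distrib]

theorem pb4_sub (F : E4 → E4) (W W' : Fin 4 → Fin 4 → Fin 4 → Fin 4 → E4 → ℝ) (a b c d : Fin 4)
    (z : E4) : pb4 F (fun i j k l y => W i j k l y - W' i j k l y) a b c d z
      = pb4 F W a b c d z - pb4 F W' a b c d z := by
  simp only [pb4, mul_sub, Finset.sum_sub_distrib]

theorem pb4_prod (F : E4 → E4) (S T : Fin 4 → Fin 4 → E4 → ℝ) (a b c d : Fin 4) (z : E4) :
    pb4 F (fun i j k l y => S i j y * T k l y) a b c d z = pb2 F S a b z * pb2 F T c d z := by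
  simp only [pb4, pb2, Finset.sum_mul, mul_assoc]
  refine Finset.sum_congr rfl fun i _ => ?_
  congr 1
  refine Finset.sum_congr rfl fun j _ => ?_
  congr 1
  simp only [Finset.mul_sum]
  exact Finset.sum_congr rfl fun _ _ => Finset.sum_congr rfl fun _ _ => by ring

theorem pb4_swap23 (F : E4 → E4) (W : Fin 4 → Fin 4 → Fin 4 → Fin 4 → E4 → ℝ) (a b c d : Fin 4)
    (z : E4) : pb4 F (fun i j k l y => W i k j l y) a b c d z = pb4 F W a c b d z := by
  simp only [pb4]
  exact Finset.sum_congr rfl fun _ _ => congrArg _ (sum_mul_sum_swap _ _ _)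

theorem pb4_swap34 (F : E4 → E4) (W : Fin 4 → Fin 4 → Fin 4 → Fin 4 → E4 → ℝ) (a b c d : Fin 4)
    (z : E4) : pb4 F (fun i j k l y => W i j l k y) a b c d z = pb4 F W a b d c z := by
  simp only [pb4]
  exact Finset.sum_congr rfl fun _ _ => congrArg _ (Finset.sum_congr rfl fun _ _ =>
    congrArg _ (sum_mul_sum_swap _ _ _))

theorem CoordChange.weyl_pb (hF : CoordChange F V' V) (hg : MetricOn g V) (hz : z ∈ V')
    (a b c d : Fin 4) : weyl (pb2 F g) a b c d z = pb4 F (weyl g) a b c d z := by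
  have e : weyl g = fun a b c d y => riemann g a b c d y
      + (g a c y * schouten g b d y - g a d y * schouten g b c y
      + schouten g a c y * g b d y - schouten g a d y * g b c y) := by
    funext a b c d y; rw [weyl_eq]; ring
  rw [weyl_eq, e, pb4_add, pb4_sub, pb4_add, pb4_sub, hF.riemann_pb hg hz]
  have p1 : ∀ S T : Fin 4 → Fin 4 → E4 → ℝ, pb4 F (fun i j k l y => S i k y * T j l y) a b c d z
      = pb2 F S a c z * pb2 F T b d z := fun S T => by
    rw [pb4_swap23 F (fun i j k l y => S i j y * T k l y), pb4_prod]
  have p2 : ∀ S T : Fin 4 → Fin 4 → E4 → ℝ, pb4 F (fun i j k l y => S i l y * T j k y) a b c d z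
      = pb2 F S a d z * pb2 F T b c z := fun S T => by
    rw [pb4_swap34 F (fun i j k l y => S i k y * T j l y),
      pb4_swap23 F (fun i j k l y => S i j y * T k l y), pb4_prod]
  rw [p1, p1, p2, p2]
  simp only [hF.schouten_pb hg hz]
  ring

/-- The covariant Leibniz rule for one pulled back index. -/
theorem CoordChange.hasPd_slot (hF : CoordChange F V' V) (hg : MetricOn g V) (hz : z ∈ V')
    (e a : Fin 4) {S : Fin 4 → E4 → ℝ} {D : Fin 4 → ℝ}
    (hS : ∀ i, HasPd e (S i) (D i + ∑ p, pbConn F g e z p i * S p z) z) :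
    HasPd e (fun x => ∑ i, jac F i a x * S i x)
      (∑ i, jac F i a z * D i + ∑ m, christoffel (pb2 F g) m e a z * ∑ i, jac F i m z * S i z) z := by
  refine (HasPd.sum fun i _ => ((hF.sm_jac i a).hasPd hF.isOpen hz).mul (hS i)).congr_val ?_
  simp only [hF.pd_jac hg hz, sub_mul, mul_add, Finset.sum_add_distrib, Finset.sum_sub_distrib]
  have e1 : ∑ i, (∑ m, jac F i m z * christoffel (pb2 F g) m e a z) * S i z
      = ∑ m, christoffel (pb2 F g) m e a z * ∑ i, jac F i m z * S i z := by
    simp only [Finset.sum_mul, Finset.mul_sum]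
    rw [Finset.sum_comm]
    exact Finset.sum_congr rfl fun _ _ => Finset.sum_congr rfl fun _ _ => by ring
  have e2 : ∑ i, (∑ p, pbConn F g e z i p * jac F p a z) * S i z
      = ∑ i, jac F i a z * ∑ p, pbConn F g e z p i * S p z := by
    simp only [Finset.sum_mul, Finset.mul_sum]
    rw [Finset.sum_comm]
    exact Finset.sum_congr rfl fun _ _ => Finset.sum_congr rfl fun _ _ => by ring
  rw [e1, e2]; ring

theorem sum_pbConn_mul (F : E4 → E4) (g : Fin 4 → Fin 4 → E4 → ℝ) (e i : Fin 4) (z : E4)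
    (X : Fin 4 → ℝ) : ∑ p, pbConn F g e z p i * X p
      = ∑ q, jac F q e z * ∑ p, christoffel g p q i (F z) * X p := by
  simp only [pbConn, Matrix.of_apply, Finset.sum_mul, Finset.mul_sum]
  rw [Finset.sum_comm]
  exact Finset.sum_congr rfl fun _ _ => Finset.sum_congr rfl fun _ _ => by ring

theorem CoordChange.nabla1_pb (hF : CoordChange F V' V) (hg : MetricOn g V) (hz : z ∈ V')
    {K : Fin 4 → E4 → ℝ} (hK : ∀ i, Sm V (K i)) (e a : Fin 4) :
    nabla1 (pb2 F g) (pb1 F K) e a z = pb2 F (nabla1 g K) e a z := by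
  have h : ∀ i, HasPd e (fun z => K i (F z)) ((∑ q, jac F q e z * nabla1 g K q i (F z))
      + ∑ p, pbConn F g e z p i * K p (F z)) z := fun i => by
    refine (hF.hasPd_comp (hK i) hz e).congr_val ?_
    rw [sum_pbConn_mul, ← Finset.sum_add_distrib]
    refine Finset.sum_congr rfl fun q _ => ?_
    rw [nabla1]; ring
  have h1 := (hF.hasPd_slot hg hz e a h).pd_eq
  rw [nabla1]
  have h2 : pd e (pb1 F K a) z = _ := h1
  rw [h2]
  simp only [pb1, pb2, add_sub_cancel_right]
  exact sum_mul_sum_swap _ _ _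

theorem CoordChange.nabla2_pb (hF : CoordChange F V' V) (hg : MetricOn g V) (hz : z ∈ V')
    {T : Fin 4 → Fin 4 → E4 → ℝ} (hT : ∀ i j, Sm V (T i j)) (e a b : Fin 4) :
    nabla2 (pb2 F g) (pb2 F T) e a b z = ∑ q, jac F q e z * pb2 F (nabla2 g T q) a b z := by
  have h0 : ∀ i j, HasPd e (fun z => T i j (F z)) (((∑ q, jac F q e z * nabla2 g T q i j (F z))
      + ∑ p, pbConn F g e z p i * T p j (F z))
      + ∑ p, pbConn F g e z p j * T i p (F z)) z := fun i j => by
    refine (hF.hasPd_comp (hT i j) hz e).congr_val ?_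
    rw [sum_pbConn_mul, sum_pbConn_mul, ← Finset.sum_add_distrib, ← Finset.sum_add_distrib]
    refine Finset.sum_congr rfl fun q _ => ?_
    rw [nabla2, Finset.sum_add_distrib]; ring
  have h1 : ∀ i, HasPd e (fun z => ∑ j, jac F j b z * T i j (F z))
      ((∑ j, jac F j b z * (∑ q, jac F q e z * nabla2 g T q i j (F z))
        + ∑ m, christoffel (pb2 F g) m e b z * ∑ j, jac F j m z * T i j (F z))
      + ∑ p, pbConn F g e z p i * ∑ j, jac F j b z * T p j (F z)) z := fun i => by
    refine (hF.hasPd_slot hg hz e b (h0 i)).congr_val ?_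
    simp only [mul_add, Finset.sum_add_distrib]
    rw [sum_mul_sum_swap (fun j => jac F j b z) (fun p => pbConn F g e z p i)]
    ring
  have h2 := (hF.hasPd_slot hg hz e a h1).pd_eq
  have h3 : pd e (pb2 F T a b) z = _ := h2
  rw [nabla2, h3]
  simp only [mul_add, Finset.sum_add_distrib]
  rw [sum_mul_sum_swap (fun i => jac F i a z) (fun m => christoffel (pb2 F g) m e b z)]
  simp only [pb2]
  rw [sum_mul_sum_swap (fun q => jac F q e z)]
  simp only [sum_mul_sum_swap (fun q => jac F q e z) (fun j => jac F j b z)]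
  ring

theorem CoordChange.nabla4_pb (hF : CoordChange F V' V) (hg : MetricOn g V) (hz : z ∈ V')
    {W : Fin 4 → Fin 4 → Fin 4 → Fin 4 → E4 → ℝ} (hW : ∀ i j k l, Sm V (W i j k l))
    (e a b c d : Fin 4) :
    nabla4 (pb2 F g) (pb4 F W) e a b c d z
      = ∑ q, jac F q e z * pb4 F (nabla4 g W q) a b c d z := by
  -- The slots are contracted with the Jacobian one at a time, beginning with the last. Each use of
  -- `hasPd_slot` trades the `pbConn` term of that slot for a Christoffel term of the pulled back
  -- metric, while the other slots are carried along.
  have h0 : ∀ i j k l, HasPd e (fun z => W i j k l (F z))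
      ((((∑ q, jac F q e z * nabla4 g W q i j k l (F z))
      + ∑ p, pbConn F g e z p i * W p j k l (F z))
      + ∑ p, pbConn F g e z p j * W i p k l (F z)
      + ∑ p, pbConn F g e z p k * W i j p l (F z))
      + ∑ p, pbConn F g e z p l * W i j k p (F z)) z := fun i j k l => by
    refine (hF.hasPd_comp (hW i j k l) hz e).congr_val ?_
    simp only [sum_pbConn_mul, ← Finset.sum_add_distrib]
    refine Finset.sum_congr rfl fun q _ => ?_
    simp only [nabla4, Finset.sum_add_distrib]; ring
  have h1 : ∀ i j k, HasPd e (fun z => ∑ l, jac F l d z * W i j k l (F z))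
      ((((∑ l, jac F l d z * (∑ q, jac F q e z * nabla4 g W q i j k l (F z))
        + ∑ m, christoffel (pb2 F g) m e d z * ∑ l, jac F l m z * W i j k l (F z))
      + ∑ p, pbConn F g e z p i * ∑ l, jac F l d z * W p j k l (F z))
      + ∑ p, pbConn F g e z p j * ∑ l, jac F l d z * W i p k l (F z))
      + ∑ p, pbConn F g e z p k * ∑ l, jac F l d z * W i j p l (F z)) z := fun i j k => by
    refine (hF.hasPd_slot hg hz e d (h0 i j k)).congr_val ?_
    simp only [mul_add, Finset.sum_add_distrib]
    simp only [sum_mul_sum_swap (fun l => jac F l d z) (fun p => pbConn F g e z p _)]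
    ring
  have h2 : ∀ i j, HasPd e (fun z => ∑ k, jac F k c z * ∑ l, jac F l d z * W i j k l (F z))
      (((∑ k, jac F k c z * (∑ l, jac F l d z * (∑ q, jac F q e z * nabla4 g W q i j k l (F z)))
        + ∑ m, christoffel (pb2 F g) m e c z
          * ∑ k, jac F k m z * ∑ l, jac F l d z * W i j k l (F z)
        + ∑ m, christoffel (pb2 F g) m e d z
          * ∑ k, jac F k c z * ∑ l, jac F l m z * W i j k l (F z))
      + ∑ p, pbConn F g e z p i * ∑ k, jac F k c z * ∑ l, jac F l d z * W p j k l (F z))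
      + ∑ p, pbConn F g e z p j * ∑ k, jac F k c z * ∑ l, jac F l d z * W i p k l (F z)) z :=
    fun i j => by
    refine (hF.hasPd_slot hg hz e c (h1 i j)).congr_val ?_
    simp only [mul_add, Finset.sum_add_distrib]
    simp only [sum_mul_sum_swap (fun k => jac F k c z) (fun p => pbConn F g e z p _),
      sum_mul_sum_swap (fun k => jac F k c z) (fun m => christoffel (pb2 F g) m e d z)]
    ring
  have h3 : ∀ i, HasPd e (fun z => ∑ j, jac F j b z * ∑ k, jac F k c z * ∑ l, jac F l d z
        * W i j k l (F z))
      ((∑ j, jac F j b z * (∑ k, jac F k c z * (∑ l, jac F l d z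
          * (∑ q, jac F q e z * nabla4 g W q i j k l (F z))))
        + ∑ m, christoffel (pb2 F g) m e b z * ∑ j, jac F j m z
          * ∑ k, jac F k c z * ∑ l, jac F l d z * W i j k l (F z)
        + ∑ m, christoffel (pb2 F g) m e c z * ∑ j, jac F j b z
          * ∑ k, jac F k m z * ∑ l, jac F l d z * W i j k l (F z)
        + ∑ m, christoffel (pb2 F g) m e d z * ∑ j, jac F j b z
          * ∑ k, jac F k c z * ∑ l, jac F l m z * W i j k l (F z))
      + ∑ p, pbConn F g e z p i * ∑ j, jac F j b z * ∑ k, jac F k c z * ∑ l, jac F l d z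
        * W p j k l (F z)) z :=
    fun i => by
    refine (hF.hasPd_slot hg hz e b (h2 i)).congr_val ?_
    simp only [mul_add, Finset.sum_add_distrib]
    simp only [sum_mul_sum_swap (fun j => jac F j b z) (fun p => pbConn F g e z p _),
      sum_mul_sum_swap (fun j => jac F j b z) (fun m => christoffel (pb2 F g) m e c z),
      sum_mul_sum_swap (fun j => jac F j b z) (fun m => christoffel (pb2 F g) m e d z)]
    ring
  have h4 : pd e (pb4 F W a b c d) z = _ := (hF.hasPd_slot hg hz e a h3).pd_eq
  rw [nabla4, h4]
  simp only [mul_add, Finset.sum_add_distrib]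
  simp only [sum_mul_sum_swap (fun i => jac F i a z) (fun m => christoffel (pb2 F g) m e b z),
    sum_mul_sum_swap (fun i => jac F i a z) (fun m => christoffel (pb2 F g) m e c z),
    sum_mul_sum_swap (fun i => jac F i a z) (fun m => christoffel (pb2 F g) m e d z)]
  simp only [pb4]
  rw [sum_mul_sum_swap (fun q => jac F q e z)]
  simp only [sum_mul_sum_swap (fun q => jac F q e z) (fun j => jac F j b z)]
  simp only [sum_mul_sum_swap (fun q => jac F q e z) (fun j => jac F j c z)]
  simp only [sum_mul_sum_swap (fun q => jac F q e z) (fun j => jac F j d z)]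
  ring

end Naturality

/-! ### Naturality of the spinor components and of the connection -/

/-- The image of a frame under the differential of a map. -/
def pushFrame (F : E4 → E4) (z : E4) (E : Fin 4 → Fin 4 → ℝ) (a i : Fin 4) : ℝ :=
  ∑ b, jac F i b z * E a b

theorem tetrad_pushFrame (F : E4 → E4) (z : E4) (E : Fin 4 → Fin 4 → ℝ) (A A' : Fin 2)
    (i : Fin 4) : tetrad (pushFrame F z E) A A' i = ∑ b, tetrad E A A' b * (jac F i b z : ℂ) := by
  simp only [tetrad, pushFrame, Complex.ofReal_sum, Complex.ofReal_mul, Finset.mul_sum,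
    Finset.sum_mul]
  rw [Finset.sum_comm]
  exact Finset.sum_congr rfl fun _ _ => Finset.sum_congr rfl fun _ _ => by ring

theorem sum_tetrad_jac (F : E4 → E4) (z : E4) (E : Fin 4 → Fin 4 → ℝ) (A A' : Fin 2)
    (X : Fin 4 → ℂ) : ∑ a, tetrad E A A' a * ∑ i, (jac F i a z : ℂ) * X i
      = ∑ i, tetrad (pushFrame F z E) A A' i * X i := by
  simp only [tetrad_pushFrame, Finset.mul_sum, Finset.sum_mul]
  rw [Finset.sum_comm]
  exact Finset.sum_congr rfl fun _ _ => Finset.sum_congr rfl fun _ _ => by ring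

theorem spin2_eq (E : Fin 4 → Fin 4 → ℝ) (T : Fin 4 → Fin 4 → ℂ) (A A' B B' : Fin 2) :
    spin2 E T A A' B B' = ∑ i, tetrad E A A' i * ∑ j, tetrad E B B' j * T i j := by
  simp only [spin2, Finset.mul_sum, mul_assoc]

theorem spin4_eq (E : Fin 4 → Fin 4 → ℝ) (W : Fin 4 → Fin 4 → Fin 4 → Fin 4 → ℂ)
    (A A' B B' C C' D D' : Fin 2) :
    spin4 E W A A' B B' C C' D D' = ∑ i, tetrad E A A' i * ∑ j, tetrad E B B' j
      * ∑ k, tetrad E C C' k * ∑ l, tetrad E D D' l * W i j k l := by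
  simp only [spin4, Finset.mul_sum, mul_assoc]

theorem spin1_pb (F : E4 → E4) (z : E4) (E : Fin 4 → Fin 4 → ℝ) (X : Fin 4 → ℂ) :
    spin1 E (fun a => ∑ i, (jac F i a z : ℂ) * X i) = spin1 (pushFrame F z E) X := by
  funext A A'
  exact sum_tetrad_jac F z E A A' X

theorem spin2_pb (F : E4 → E4) (z : E4) (E : Fin 4 → Fin 4 → ℝ) (X : Fin 4 → Fin 4 → ℂ) :
    spin2 E (fun a b => ∑ i, (jac F i a z : ℂ) * ∑ j, (jac F j b z : ℂ) * X i j)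
      = spin2 (pushFrame F z E) X := by
  funext A A' B B'
  rw [spin2_eq, spin2_eq]
  rw [← sum_tetrad_jac]
  refine Finset.sum_congr rfl fun a _ => congrArg _ ?_
  rw [sum_mul_sum_swap]
  refine Finset.sum_congr rfl fun i _ => congrArg _ ?_
  exact sum_tetrad_jac F z E B B' _

theorem spin4_pb (F : E4 → E4) (z : E4) (E : Fin 4 → Fin 4 → ℝ)
    (X : Fin 4 → Fin 4 → Fin 4 → Fin 4 → ℂ) :
    spin4 E (fun a b c d => ∑ i, (jac F i a z : ℂ) * ∑ j, (jac F j b z : ℂ)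
      * ∑ k, (jac F k c z : ℂ) * ∑ l, (jac F l d z : ℂ) * X i j k l)
      = spin4 (pushFrame F z E) X := by
  funext A A' B B' C C' D D'
  rw [spin4_eq, spin4_eq]
  simp only [← sum_tetrad_jac]
  refine Finset.sum_congr rfl fun a _ => congrArg _ ?_
  simp only [sum_mul_sum_swap (fun d => tetrad E D D' d) (fun i => (jac F i a z : ℂ))]
  simp only [sum_mul_sum_swap (fun c => tetrad E C C' c) (fun i => (jac F i a z : ℂ))]
  rw [sum_mul_sum_swap]
  refine Finset.sum_congr rfl fun i _ => congrArg _ ?_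
  refine Finset.sum_congr rfl fun b _ => congrArg _ ?_
  simp only [sum_mul_sum_swap (fun d => tetrad E D D' d) (fun i => (jac F i b z : ℂ))]
  rw [sum_mul_sum_swap]
  refine Finset.sum_congr rfl fun j _ => congrArg _ ?_
  refine Finset.sum_congr rfl fun c _ => congrArg _ ?_
  rw [sum_mul_sum_swap]

theorem sdPart_pb (F : E4 → E4) (z : E4) (E : Fin 4 → Fin 4 → ℝ) (X : Fin 4 → Fin 4 → ℂ) :
    sdPart E (fun a b => ∑ i, (jac F i a z : ℂ) * ∑ j, (jac F j b z : ℂ) * X i j)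
      = sdPart (pushFrame F z E) X := by
  funext A' B'; simp only [sdPart, spin2_pb]

theorem asdPart_pb (F : E4 → E4) (z : E4) (E : Fin 4 → Fin 4 → ℝ) (X : Fin 4 → Fin 4 → ℂ) :
    asdPart E (fun a b => ∑ i, (jac F i a z : ℂ) * ∑ j, (jac F j b z : ℂ) * X i j)
      = asdPart (pushFrame F z E) X := by
  funext A' B'; simp only [asdPart, spin2_pb]

theorem ofReal_pb1 (F : E4 → E4) (K : Fin 4 → E4 → ℝ) (a : Fin 4) (z : E4) :
    (pb1 F K a z : ℂ) = ∑ i, (jac F i a z : ℂ) * (K i (F z) : ℂ) := by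
  simp only [pb1, Complex.ofReal_sum, Complex.ofReal_mul]

theorem ofReal_pb2 (F : E4 → E4) (T : Fin 4 → Fin 4 → E4 → ℝ) (a b : Fin 4) (z : E4) :
    (pb2 F T a b z : ℂ)
      = ∑ i, (jac F i a z : ℂ) * ∑ j, (jac F j b z : ℂ) * (T i j (F z) : ℂ) := by
  simp only [pb2, Complex.ofReal_sum, Complex.ofReal_mul]

theorem ofReal_pb4 (F : E4 → E4) (W : Fin 4 → Fin 4 → Fin 4 → Fin 4 → E4 → ℝ) (a b c d : Fin 4)
    (z : E4) : (pb4 F W a b c d z : ℂ) = ∑ i, (jac F i a z : ℂ) * ∑ j, (jac F j b z : ℂ)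
      * ∑ k, (jac F k c z : ℂ) * ∑ l, (jac F l d z : ℂ) * (W i j k l (F z) : ℂ) := by
  simp only [pb4, Complex.ofReal_sum, Complex.ofReal_mul]

theorem tractorAt_pb (F : E4 → E4) (om : Fin 4 → Fin 4 → E4 → ℝ) (K : Fin 4 → E4 → ℝ)
    (rho : Fin 4 → Fin 4 → E4 → ℝ) (E : Fin 4 → Fin 4 → ℝ) (z : E4) :
    tractorAt (pb2 F om) (pb1 F K) (pb2 F rho) E z
      = tractorAt om K rho (pushFrame F z E) (F z) := by
  simp only [tractorAt, ofReal_pb1, ofReal_pb2]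
  rw [sdPart_pb, asdPart_pb, spin1_pb]

section Naturality

variable {F : E4 → E4} {g : Fin 4 → Fin 4 → E4 → ℝ} {V V' : Set E4} {z : E4}

theorem CoordChange.psi_pb (hF : CoordChange F V' V) (hg : MetricOn g V) (hz : z ∈ V')
    (E : Fin 4 → Fin 4 → ℝ) : psi (pb2 F g) E z = psi g (pushFrame F z E) (F z) := by
  funext A B C D
  simp only [psi, weylASD, hF.weyl_pb hg hz, ofReal_pb4, spin4_pb]

theorem CoordChange.psiPrimed_pb (hF : CoordChange F V' V) (hg : MetricOn g V) (hz : z ∈ V')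
    (E : Fin 4 → Fin 4 → ℝ) : psiPrimed (pb2 F g) E z = psiPrimed g (pushFrame F z E) (F z) := by
  funext A B C D
  simp only [psiPrimed, weylSD, hF.weyl_pb hg hz, ofReal_pb4, spin4_pb]

theorem CoordChange.nablaPsi_pb (hF : CoordChange F V' V) (hg : MetricOn g V) (hz : z ∈ V')
    (E : Fin 4 → Fin 4 → ℝ) : nablaPsi (pb2 F g) E z = nablaPsi g (pushFrame F z E) (F z) := by
  funext P P' A B C D
  have h0 : ∀ e a b c d, nabla4 (pb2 F g) (weyl (pb2 F g)) e a b c d z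
      = ∑ q, jac F q e z * pb4 F (nabla4 g (weyl g) q) a b c d z := by
    intro e a b c d
    rw [← hF.nabla4_pb hg hz hg.sm_weyl e a b c d]
    simp only [nabla4, hF.weyl_pb hg hz]
    rw [pd_congr_on hF.isOpen hz fun x hx => hF.weyl_pb hg hx a b c d]
  have h : (fun a b c d => ∑ e, tetrad E P P' e
        * (nabla4 (pb2 F g) (weyl (pb2 F g)) e a b c d z : ℂ))
      = fun a b c d => ∑ i, (jac F i a z : ℂ) * ∑ j, (jac F j b z : ℂ)
      * ∑ k, (jac F k c z : ℂ) * ∑ l, (jac F l d z : ℂ)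
        * ∑ e, tetrad (pushFrame F z E) P P' e * (nabla4 g (weyl g) e i j k l (F z) : ℂ) := by
    funext a b c d
    simp only [h0, Complex.ofReal_sum, Complex.ofReal_mul]
    rw [sum_tetrad_jac]
    simp only [ofReal_pb4]
    rw [sum_mul_sum_swap]
    refine Finset.sum_congr rfl fun i _ => congrArg _ ?_
    rw [sum_mul_sum_swap]
    refine Finset.sum_congr rfl fun j _ => congrArg _ ?_
    rw [sum_mul_sum_swap]
    refine Finset.sum_congr rfl fun k _ => congrArg _ ?_
    rw [sum_mul_sum_swap]
  simp only [nablaPsi, h, weylASD, spin4_pb]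

theorem CoordChange.pSpinor_pb (hF : CoordChange F V' V) (hg : MetricOn g V) (hz : z ∈ V')
    (E : Fin 4 → Fin 4 → ℝ) : pSpinor (pb2 F g) E z = pSpinor g (pushFrame F z E) (F z) := by
  funext A B A' B'
  simp only [pSpinor, lam, hF.scalarCurv_pb hg hz, hF.tfRicci_pb hg hz, ofReal_pb2, spin2_pb]

theorem CoordChange.sum_tetrad_nabla2_pb (hF : CoordChange F V' V) (hg : MetricOn g V)
    (hz : z ∈ V') {T : Fin 4 → Fin 4 → E4 → ℝ} (hT : ∀ i j, Sm V (T i j))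
    (E : Fin 4 → Fin 4 → ℝ) (A A' : Fin 2) :
    (fun j l => ∑ i, tetrad E A A' i * (nabla2 (pb2 F g) (pb2 F T) i j l z : ℂ))
      = fun a b => ∑ i, (jac F i a z : ℂ) * ∑ j, (jac F j b z : ℂ)
        * ∑ e, tetrad (pushFrame F z E) A A' e * (nabla2 g T e i j (F z) : ℂ) := by
  funext a b
  simp only [hF.nabla2_pb hg hz hT, Complex.ofReal_sum, Complex.ofReal_mul]
  rw [sum_tetrad_jac]
  simp only [ofReal_pb2]
  rw [sum_mul_sum_swap]
  refine Finset.sum_congr rfl fun i _ => congrArg _ ?_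
  rw [sum_mul_sum_swap]

/-- Naturality of 𝒟. Because of it, pointwise statements about 𝒟 in an arbitrary frame need only be
verified at the origin of normal coordinates, in the coordinate frame. -/
theorem CoordChange.tractorD_pb (hF : CoordChange F V' V) (hg : MetricOn g V) (hz : z ∈ V')
    {om rho : Fin 4 → Fin 4 → E4 → ℝ} {K : Fin 4 → E4 → ℝ} (hom : ∀ i j, Sm V (om i j))
    (hK : ∀ i, Sm V (K i)) (hrho : ∀ i j, Sm V (rho i j)) (E : Fin 4 → Fin 4 → ℝ) :
    tractorD (pb2 F g) (pb2 F om) (pb1 F K) (pb2 F rho) E z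
      = tractorD g om K rho (pushFrame F z E) (F z) := by
  funext A A'
  simp only [tractorD, tractorAt_pb, hF.sum_tetrad_nabla2_pb hg hz hom,
    hF.sum_tetrad_nabla2_pb hg hz hrho, sdPart_pb, asdPart_pb, hF.pSpinor_pb hg hz,
    hF.nablaPsi_pb hg hz, hF.psi_pb hg hz, hF.nabla1_pb hg hz hK, ofReal_pb2, spin2_pb]

theorem CoordChange.isOrientedFrame_push (hF : CoordChange F V' V) (hz : z ∈ V')
    {E : Fin 4 → Fin 4 → ℝ} (hE : IsOrientedFrame (pb2 F g) z E) :
    IsOrientedFrame g (F z) (pushFrame F z E) := by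
  refine ⟨fun a b => ?_, ?_⟩
  · rw [← hE.1 a b]
    have e1 : ∑ i, ∑ j, g i j (F z) * pushFrame F z E a i * pushFrame F z E b j
        = ∑ i, (∑ k, E a k * jac F i k z) * ∑ j, (∑ l, E b l * jac F j l z) * g i j (F z) := by
      simp only [pushFrame, Finset.mul_sum, mul_comm (E _ _)]
      exact Finset.sum_congr rfl fun _ _ => Finset.sum_congr rfl fun _ _ => by
        rw [← Finset.mul_sum, ← Finset.mul_sum]; ring
    have e2 : ∑ i, ∑ j, pb2 F g i j z * E a i * E b j
        = ∑ i, E a i * ∑ j, E b j * pb2 F g i j z := by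
      simp only [Finset.mul_sum]
      exact Finset.sum_congr rfl fun _ _ => Finset.sum_congr rfl fun _ _ => by ring
    have s1 : ∀ (a : Fin 4) (X : Fin 4 → ℝ), ∑ i, (∑ k, E a k * jac F i k z) * X i
        = ∑ k, E a k * ∑ i, jac F i k z * X i := by
      intro a X
      simp only [Finset.sum_mul, Finset.mul_sum]
      rw [Finset.sum_comm]
      exact Finset.sum_congr rfl fun _ _ => Finset.sum_congr rfl fun _ _ => by ring
    rw [e1, e2, s1]
    refine Finset.sum_congr rfl fun k _ => congrArg _ ?_
    simp only [s1, pb2]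
    rw [sum_mul_sum_swap]
  · have : Matrix.of (pushFrame F z E) = Matrix.of E * (jacM F z).transpose := by
      ext a i
      simp only [Matrix.of_apply, pushFrame, Matrix.mul_apply, Matrix.transpose_apply]
      exact Finset.sum_congr rfl fun _ _ => by ring
    rw [this, Matrix.det_mul, Matrix.det_transpose]
    exact mul_pos hE.2 (hF.det_pos z hz)

end Naturality

theorem pushFrame_smul (F : E4 → E4) (z : E4) (c : ℝ) (E : Fin 4 → Fin 4 → ℝ) :
    pushFrame F z (c • E) = c • pushFrame F z E := by
  funext a i
  simp only [pushFrame, Pi.smul_apply, smul_eq_mul, Finset.mul_sum]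
  exact Finset.sum_congr rfl fun _ _ => by ring

/-! ### Normal coordinates -/

/-- The origin lies in `V` and the coordinates are normal there, up to second order. -/
structure NormalAt (g : Fin 4 → Fin 4 → E4 → ℝ) (V : Set E4) : Prop where
  metricOn : MetricOn g V
  zero_mem : (0 : E4) ∈ V
  g_zero : ∀ i j, g i j 0 = if i = j then 1 else 0
  christoffel_zero : ∀ k i j, christoffel g k i j 0 = 0

/-- The coordinate frame. -/
def unitFrame (a i : Fin 4) : ℝ := if a = i then 1 else 0

/-- A quadratic map F(z) = y + zE − ½Γ(zE, zE) suffices. Its linear part sends the coordinate frame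
to `E`, and its quadratic part cancels the Christoffel symbols at the origin. No geodesics are
needed, since only the first derivatives of the metric must vanish. -/
theorem MetricOn.exists_normal {g : Fin 4 → Fin 4 → E4 → ℝ} {V : Set E4} {y : E4}
    (hg : MetricOn g V) (hy : y ∈ V) {E : Fin 4 → Fin 4 → ℝ} (hE : IsOrientedFrame g y E) :
    ∃ (F : E4 → E4) (V' : Set E4), CoordChange F V' V ∧ F 0 = y ∧
      pushFrame F 0 unitFrame = E ∧ NormalAt (pb2 F g) V' := by
  let F : E4 → E4 := fun z => WithLp.toLp 2 fun k => y k + ∑ a, z a * E a k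
    - (1 / 2) * ∑ i, ∑ j, christoffel g k i j y * ((∑ a, z a * E a i) * (∑ a, z a * E a j))
  have hlin : ∀ i (z : E4) (e : Fin 4), HasPd e (fun z : E4 => ∑ a, z a * E a i) (E e i) z := by
    intro i z e
    refine (HasPd.sum fun a _ => (hasPd_coord a).mul (HasPd.const (E a i))).congr_val ?_
    simp
  have hFk : ∀ (z : E4) (k e : Fin 4), HasPd e (fun x => F x k)
      (E e k - ∑ i, ∑ j, christoffel g k i j y * (E e i * (∑ a, z a * E a j))) z := by
    intro z k e
    refine (((HasPd.const (y k)).add (hlin k z e)).sub ((HasPd.sum fun i _ => HasPd.sum fun j _ =>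
      ((hlin i z e).mul (hlin j z e)).const_mul (christoffel g k i j y)).const_mul
        (1 / 2))).congr_val ?_
    have : ∑ i, ∑ j, christoffel g k i j y * (∑ a, z a * E a i) * E e j
        = ∑ i, ∑ j, christoffel g k i j y * E e i * (∑ a, z a * E a j) := by
      rw [Finset.sum_comm]
      refine Finset.sum_congr rfl fun i _ => Finset.sum_congr rfl fun j _ => ?_
      rw [hg.christoffel_symm hy k j i]; ring
    simp only [mul_add, Finset.sum_add_distrib, ← mul_assoc, this]
    ring
  have hlins : ∀ i, ContDiff ℝ ∞ (fun z : E4 => ∑ a, z a * E a i) := fun i =>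
    ContDiff.sum fun a _ => (by fun_prop)
  have hFs : ∀ k, ContDiff ℝ ∞ (fun z => F z k) := fun k =>
    (contDiff_const.add (hlins k)).sub (contDiff_const.mul (ContDiff.sum fun i _ =>
      ContDiff.sum fun j _ => contDiff_const.mul ((hlins i).mul (hlins j))))
  have hJ : ∀ (z : E4) (k e : Fin 4), jac F k e z
      = E e k - ∑ i, ∑ j, christoffel g k i j y * (E e i * (∑ a, z a * E a j)) :=
    fun z k e => (hFk z k e).pd_eq
  have hJ0 : ∀ k e, jac F k e 0 = E e k := fun k e => by simp [hJ]
  have hF0 : F 0 = y := by ext k; simp [F]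
  -- The Jacobian determinant is only known to be positive at the origin, where it is det E, so the
  -- domain is cut down to the open set where it stays positive.
  let V' : Set E4 := F ⁻¹' V ∩ {z | 0 < (jacM F z).det}
  have hFc : Continuous F := by
    have : ContDiff ℝ ∞ F := by rw [contDiff_euclidean]; exact hFs
    exact this.continuous
  have hJc : Continuous fun z => (jacM F z).det := by
    refine Continuous.matrix_det (continuous_matrix fun k e => ?_)
    simp only [Matrix.of_apply, hJ]
    fun_prop
  have hF : CoordChange F V' V :=
    { isOpen := (hg.isOpen.preimage hFc).inter (isOpen_lt continuous_const hJc)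
      isOpen_target := hg.isOpen
      smooth := fun k => (hFs k).contDiffOn
      mapsTo := fun z hz => hz.1
      det_pos := fun z hz => hz.2 }
  have h0 : (0 : E4) ∈ V' := by
    refine ⟨by simpa [hF0] using hy, ?_⟩
    have : jacM F 0 = (Matrix.of E).transpose := by ext k e; exact hJ0 k e
    change 0 < (jacM F 0).det
    rw [this, Matrix.det_transpose]
    exact hE.2
  have hpush : pushFrame F 0 unitFrame = E := by
    funext a i
    simp [pushFrame, unitFrame, hJ0]
  refine ⟨F, V', hF, hF0, hpush, hF.metricOn_pb2 hg, h0, fun a b => ?_, fun k e a => ?_⟩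
  · rw [← hE.1 a b]
    simp only [pb2, hJ0, hF0, Finset.mul_sum]
    exact Finset.sum_congr rfl fun _ _ => Finset.sum_congr rfl fun _ _ => by ring
  · have h1 := fun i => hF.pd_jac hg h0 e i a
    -- By the choice of the quadratic term, the derivative of the Jacobian at the origin is exactly
    -- the inhomogeneous term of the transformation law. The law then leaves JΓ' = 0, hence Γ' = 0.
    have h2 : ∀ i, pd e (jac F i a) 0 = -∑ p, pbConn F g e 0 i p * jac F p a 0 := by
      intro i
      have h3 : HasPd e (jac F i a)
          (0 - ∑ p, ∑ j, christoffel g i p j y * (0 * (∑ a, (0 : E4) a * E a j)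
            + E a p * E e j)) 0 := by
        have h4 : jac F i a = fun z => E a i - ∑ p, ∑ j, christoffel g i p j y
            * (E a p * (∑ a, z a * E a j)) := by funext z; exact hJ z i a
        rw [h4]
        exact (HasPd.const _).sub (HasPd.sum fun p _ => HasPd.sum fun j _ =>
          ((HasPd.const _).mul (hlin j 0 e)).const_mul _)
      rw [h3.pd_eq]
      simp only [pbConn, Matrix.of_apply, hJ0, hF0, zero_mul, zero_add, zero_sub, Finset.sum_mul]
      congr 1
      refine Finset.sum_congr rfl fun p _ => Finset.sum_congr rfl fun j _ => ?_
      rw [hg.christoffel_symm hy i p j]; ring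
    have h5 : (jacM F 0).mulVec (fun m => christoffel (pb2 F g) m e a 0) = 0 := by
      funext i
      have := h1 i
      rw [h2 i] at this
      simp only [Matrix.mulVec, dotProduct, Matrix.of_apply, Pi.zero_apply]
      linarith
    have h6 := congrArg ((jacM F 0)⁻¹.mulVec) h5
    rw [Matrix.mulVec_mulVec, Matrix.nonsing_inv_mul _ (hF.isUnit_jac h0), Matrix.one_mulVec,
      Matrix.mulVec_zero] at h6
    exact congrFun h6 k

/-! ### Spinor components in an orthonormal coordinate frame -/

/-- The components of a two-tensor in a frame. -/
def frameComp (E : Fin 4 → Fin 4 → ℝ) (T : Fin 4 → Fin 4 → ℝ) (a b : Fin 4) : ℝ :=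
  ∑ i, E a i * ∑ j, E b j * T i j

theorem tetrad_unitFrame (A A' : Fin 2) (i : Fin 4) : tetrad unitFrame A A' i = sigma A A' i := by
  simp [tetrad, unitFrame, apply_ite Complex.ofReal]

theorem sqrt_two_mul_sqrt_two : ((Real.sqrt 2 : ℝ) : ℂ) * ((Real.sqrt 2 : ℝ) : ℂ) = 2 := by
  rw [← Complex.ofReal_mul, Real.mul_self_sqrt (by norm_num)]; norm_num

theorem sqrt_two_inv_mul : ((Real.sqrt 2 : ℝ) : ℂ)⁻¹ * ((Real.sqrt 2 : ℝ) : ℂ)⁻¹ = 1 / 2 := by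
  rw [← mul_inv, sqrt_two_mul_sqrt_two]; norm_num

/-- The components of `spin2` in the coordinate frame without the factor `1/2`. -/
def tau (A A' : Fin 2) (a : Fin 4) : ℂ :=
  ![![![1, Complex.I, 0, 0], ![0, 0, -1, Complex.I]],
    ![![0, 0, 1, Complex.I], ![1, -Complex.I, 0, 0]]] A A' a

/-- The two factors 1/√2 combine, so components with two vector indices involve no roots. -/
theorem sigma_mul_sigma (A A' B B' : Fin 2) (i j : Fin 4) :
    sigma A A' i * sigma B B' j = (1 / 2) * (tau A A' i * tau B B' j) := by
  have h : ∀ A A' i, sigma A A' i = tau A A' i * ((Real.sqrt 2 : ℝ) : ℂ)⁻¹ := fun _ _ _ => by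
    rw [sigma, div_eq_mul_inv]; rfl
  rw [h, h, ← sqrt_two_inv_mul]; ring

theorem spin2_unitFrame (T : Fin 4 → Fin 4 → ℂ) (A A' B B' : Fin 2) :
    spin2 unitFrame T A A' B B' = (1 / 2) * ∑ i, tau A A' i * ∑ j, tau B B' j * T i j := by
  simp only [spin2, tetrad_unitFrame, sigma_mul_sigma, Finset.mul_sum]
  exact Finset.sum_congr rfl fun _ _ => Finset.sum_congr rfl fun _ _ => by ring

theorem spin2_frameComp (E : Fin 4 → Fin 4 → ℝ) (T : Fin 4 → Fin 4 → ℝ) (A A' B B' : Fin 2) :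
    spin2 E (fun i j => (T i j : ℂ)) A A' B B'
      = spin2 unitFrame (fun a b => (frameComp E T a b : ℂ)) A A' B B' := by
  have s1 : ∀ (A A' : Fin 2) (X : Fin 4 → ℂ), ∑ i, tetrad E A A' i * X i
      = ∑ a, sigma A A' a * ∑ i, (E a i : ℂ) * X i := by
    intro A A' X
    simp only [tetrad, Finset.sum_mul, Finset.mul_sum]
    rw [Finset.sum_comm]
    exact Finset.sum_congr rfl fun _ _ => Finset.sum_congr rfl fun _ _ => by ring
  simp only [spin2_eq, frameComp, Complex.ofReal_sum, Complex.ofReal_mul, tetrad_unitFrame, s1]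
  refine Finset.sum_congr rfl fun a _ => congrArg _ ?_
  rw [sum_mul_sum_swap]

section Antisymmetric

variable {T : Fin 4 → Fin 4 → ℂ}

theorem asdPart_unitFrame_zero_zero (h : ∀ i j, T i j = -T j i) :
    asdPart unitFrame T 0 0
      = (1 / 2) * (-(T 0 2 + T 1 3) + Complex.I * (T 0 3 - T 1 2)) := by
  simp [asdPart, spin2_unitFrame, tau, eps, Fin.sum_univ_four, Fin.sum_univ_two]
  rw [h 2 0, h 3 0, h 2 1, h 3 1]
  linear_combination T 1 3 * Complex.I_sq

theorem asdPart_unitFrame_one_one (h : ∀ i j, T i j = -T j i) :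
    asdPart unitFrame T 1 1
      = (1 / 2) * (-(T 0 2 + T 1 3) - Complex.I * (T 0 3 - T 1 2)) := by
  simp [asdPart, spin2_unitFrame, tau, eps, Fin.sum_univ_four, Fin.sum_univ_two]
  rw [h 2 0, h 3 0, h 2 1, h 3 1]
  linear_combination T 1 3 * Complex.I_sq

theorem asdPart_unitFrame_zero_one (h : ∀ i j, T i j = -T j i) :
    asdPart unitFrame T 0 1 = -(Complex.I / 2) * (T 0 1 - T 2 3) := by
  have h0 : ∀ i, T i i = 0 := fun i => by have := h i i; linear_combination (1 / 2) * this
  simp [asdPart, spin2_unitFrame, tau, eps, Fin.sum_univ_four, Fin.sum_univ_two, h0]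
  rw [h 1 0, h 3 2]
  ring

theorem asdPart_symm (E : Fin 4 → Fin 4 → ℝ) (h : ∀ i j, T i j = -T j i) (A B : Fin 2) :
    asdPart E T A B = asdPart E T B A := by
  have hs : ∀ A A' B B', spin2 E T A A' B B' = -spin2 E T B B' A A' := by
    intro A A' B B'
    simp only [spin2, ← Finset.sum_neg_distrib]
    rw [Finset.sum_comm]
    refine Finset.sum_congr rfl fun i _ => Finset.sum_congr rfl fun j _ => ?_
    rw [h j i]; ring
  simp [asdPart, eps, Fin.sum_univ_two]
  rw [hs A 0 B 1, hs A 1 B 0]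
  ring

theorem sdPart_symm (E : Fin 4 → Fin 4 → ℝ) (h : ∀ i j, T i j = -T j i) (A B : Fin 2) :
    sdPart E T A B = sdPart E T B A := by
  have hs : ∀ A A' B B', spin2 E T A A' B B' = -spin2 E T B B' A A' := by
    intro A A' B B'
    simp only [spin2, ← Finset.sum_neg_distrib]
    rw [Finset.sum_comm]
    refine Finset.sum_congr rfl fun i _ => Finset.sum_congr rfl fun j _ => ?_
    rw [h j i]; ring
  simp [sdPart, eps, Fin.sum_univ_two]
  rw [hs 0 A 1 B, hs 1 A 0 B]
  ring

theorem sdPart_unitFrame_zero_zero (h : ∀ i j, T i j = -T j i) :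
    sdPart unitFrame T 0 0
      = (1 / 2) * ((T 0 2 - T 1 3) + Complex.I * (T 0 3 + T 1 2)) := by
  simp [sdPart, spin2_unitFrame, tau, eps, Fin.sum_univ_four, Fin.sum_univ_two]
  rw [h 2 0, h 3 0, h 2 1, h 3 1]
  linear_combination T 1 3 * Complex.I_sq

theorem sdPart_unitFrame_one_one (h : ∀ i j, T i j = -T j i) :
    sdPart unitFrame T 1 1
      = (1 / 2) * ((T 0 2 - T 1 3) - Complex.I * (T 0 3 + T 1 2)) := by
  simp [sdPart, spin2_unitFrame, tau, eps, Fin.sum_univ_four, Fin.sum_univ_two]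
  rw [h 2 0, h 3 0, h 2 1, h 3 1]
  linear_combination T 1 3 * Complex.I_sq

theorem sdPart_unitFrame_zero_one (h : ∀ i j, T i j = -T j i) :
    sdPart unitFrame T 0 1 = -(Complex.I / 2) * (T 0 1 + T 2 3) := by
  have h0 : ∀ i, T i i = 0 := fun i => by have := h i i; linear_combination (1 / 2) * this
  simp [sdPart, spin2_unitFrame, tau, eps, Fin.sum_univ_four, Fin.sum_univ_two, h0]
  rw [h 1 0, h 3 2]
  ring

/-- The form is complex here, so the components 00 and 11 are not conjugate; their sum and
difference recover two of the relations, and the component 01 the third. -/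
theorem asdPart_unitFrame_eq_zero_iff (h : ∀ i j, T i j = -T j i) :
    (∀ A B, asdPart unitFrame T A B = 0) ↔
      T 0 1 = T 2 3 ∧ T 0 2 = -T 1 3 ∧ T 0 3 = T 1 2 := by
  have e0 := asdPart_unitFrame_zero_zero h
  have e1 := asdPart_unitFrame_one_one h
  have e2 := asdPart_unitFrame_zero_one h
  have hs := asdPart_symm unitFrame h 1 0
  have hI := Complex.I_sq
  constructor
  · intro h0
    rw [h0] at e0 e1 e2
    refine ⟨?_, ?_, ?_⟩
    · linear_combination (-2 * Complex.I) * e2 + (T 0 1 - T 2 3) * hI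
    · linear_combination e0 + e1
    · linear_combination Complex.I * (e0 - e1) + (T 0 3 - T 1 2) * hI
  · rintro ⟨h1, h2, h3⟩
    simp only [h1, h2, h3] at e0 e1 e2
    have f0 : asdPart unitFrame T 0 0 = 0 := by rw [e0]; ring
    have f1 : asdPart unitFrame T 1 1 = 0 := by rw [e1]; ring
    have f2 : asdPart unitFrame T 0 1 = 0 := by rw [e2]; ring
    have f3 := hs.trans f2
    exact Fin.forall_fin_two.2 ⟨Fin.forall_fin_two.2 ⟨f0, f2⟩, Fin.forall_fin_two.2 ⟨f3, f1⟩⟩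

theorem sdPart_unitFrame_eq_zero_iff (h : ∀ i j, T i j = -T j i) :
    (∀ A B, sdPart unitFrame T A B = 0) ↔
      T 0 1 = -T 2 3 ∧ T 0 2 = T 1 3 ∧ T 0 3 = -T 1 2 := by
  have e0 := sdPart_unitFrame_zero_zero h
  have e1 := sdPart_unitFrame_one_one h
  have e2 := sdPart_unitFrame_zero_one h
  have hs := sdPart_symm unitFrame h 1 0
  have hI := Complex.I_sq
  constructor
  · intro h0
    rw [h0] at e0 e1 e2
    refine ⟨?_, ?_, ?_⟩
    · linear_combination (-2 * Complex.I) * e2 + (T 0 1 + T 2 3) * hI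
    · linear_combination -e0 - e1
    · linear_combination Complex.I * (e0 - e1) + (T 0 3 + T 1 2) * hI
  · rintro ⟨h1, h2, h3⟩
    simp only [h1, h2, h3] at e0 e1 e2
    have f0 : sdPart unitFrame T 0 0 = 0 := by rw [e0]; ring
    have f1 : sdPart unitFrame T 1 1 = 0 := by rw [e1]; ring
    have f2 : sdPart unitFrame T 0 1 = 0 := by rw [e2]; ring
    have f3 := hs.trans f2
    exact Fin.forall_fin_two.2 ⟨Fin.forall_fin_two.2 ⟨f0, f2⟩, Fin.forall_fin_two.2 ⟨f3, f1⟩⟩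

end Antisymmetric

open scoped MatrixOrder Matrix.Norms.L2Operator in
theorem Matrix.PosDef.exists_sqrt {G : Matrix (Fin 4) (Fin 4) ℝ} (hG : G.PosDef) :
    ∃ B : Matrix (Fin 4) (Fin 4) ℝ, B * B = G ∧ B.transpose = B ∧ 0 < B.det := by
  have h0 : 0 ≤ G := hG.posSemidef.nonneg
  have hBB : CFC.sqrt G * CFC.sqrt G = G := CFC.sqrt_mul_sqrt_self G h0
  have hBp : (CFC.sqrt G).PosSemidef := Matrix.nonneg_iff_posSemidef.1 (CFC.sqrt_nonneg G)
  have hdet : (CFC.sqrt G).det * (CFC.sqrt G).det = G.det := by rw [← Matrix.det_mul, hBB]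
  have hd0 : (CFC.sqrt G).det ≠ 0 := fun h => by
    rw [h] at hdet; have := hG.det_pos; linarith
  refine ⟨CFC.sqrt G, hBB, ?_, lt_of_le_of_ne hBp.det_nonneg hd0.symm⟩
  have := hBp.isHermitian
  rwa [Matrix.IsHermitian, Matrix.conjTranspose_eq_transpose_of_trivial] at this

/-- The rows of g^{-1/2} are orthonormal, and the determinant of the positive square root is
positive, which settles the orientation. Existence matters because most conditions are quantified
over oriented frames and would otherwise be vacuous. -/
theorem MetricOn.exists_frame {g : Fin 4 → Fin 4 → E4 → ℝ} {V : Set E4} {y : E4}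
    (hg : MetricOn g V) (hy : y ∈ V) : ∃ E, IsOrientedFrame g y E := by
  obtain ⟨B, hBB, hBt, hdp⟩ := Matrix.PosDef.exists_sqrt (hg.posDef hy)
  have hu : IsUnit B.det := isUnit_iff_ne_zero.2 hdp.ne'
  obtain ⟨C, hC⟩ : ∃ C, C = B⁻¹ := ⟨_, rfl⟩
  refine ⟨fun a i => C a i, fun a b => ?_, ?_⟩
  · have h1 : C * metricMatrix g y * C.transpose = 1 := by
      rw [hC, Matrix.transpose_nonsing_inv, hBt, ← hBB, ← Matrix.mul_assoc,
        Matrix.nonsing_inv_mul _ hu, Matrix.one_mul, Matrix.mul_nonsing_inv _ hu]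
    have h2 := congrFun (congrFun h1 a) b
    rw [Matrix.one_apply] at h2
    rw [← h2]
    simp only [Matrix.mul_apply, Matrix.transpose_apply, Finset.sum_mul, Matrix.of_apply]
    rw [Finset.sum_comm]
    refine Finset.sum_congr rfl fun i _ => Finset.sum_congr rfl fun j _ => ?_
    ring
  · have : Matrix.of (fun a i => C a i) = B⁻¹ := hC
    rw [this, Matrix.det_nonsing_inv, Ring.inverse_eq_inv']
    exact inv_pos.2 hdp

/-! ### Self-duality in coordinates -/

/-- The (anti-)self-duality relations, for the sign `s`, of the components of a two-form in an
oriented orthonormal frame. -/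
def DualRel (s : ℝ) (b : Fin 4 → Fin 4 → ℝ) : Prop :=
  b 0 1 = s * b 2 3 ∧ b 0 2 = -s * b 1 3 ∧ b 0 3 = s * b 1 2

theorem frameComp_antisymm {E T : Fin 4 → Fin 4 → ℝ} (h : ∀ i j, T i j = -T j i) (a b : Fin 4) :
    frameComp E T a b = -frameComp E T b a := by
  simp only [frameComp]
  rw [sum_mul_sum_swap]
  simp only [← Finset.sum_neg_distrib, ← mul_neg]
  exact Finset.sum_congr rfl fun i _ => congrArg _ (Finset.sum_congr rfl fun j _ => by rw [h])

/-- Trades a condition on complex spinor components for three real linear relations, which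
`linarith` and `ring` can use. -/
theorem asdPart_eq_zero_iff {E T : Fin 4 → Fin 4 → ℝ} (h : ∀ i j, T i j = -T j i) :
    (∀ A B, asdPart E (fun i j => (T i j : ℂ)) A B = 0) ↔ DualRel 1 (frameComp E T) := by
  have h1 : asdPart E (fun i j => (T i j : ℂ))
      = asdPart unitFrame (fun i j => (frameComp E T i j : ℂ)) := by
    funext A B; simp only [asdPart, spin2_frameComp E T]
  rw [h1, asdPart_unitFrame_eq_zero_iff
    (fun i j => by rw [frameComp_antisymm h]; push_cast; rfl), DualRel]
  norm_cast
  simp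

theorem sdPart_eq_zero_iff {E T : Fin 4 → Fin 4 → ℝ} (h : ∀ i j, T i j = -T j i) :
    (∀ A B, sdPart E (fun i j => (T i j : ℂ)) A B = 0) ↔ DualRel (-1) (frameComp E T) := by
  have h1 : sdPart E (fun i j => (T i j : ℂ))
      = sdPart unitFrame (fun i j => (frameComp E T i j : ℂ)) := by
    funext A B; simp only [sdPart, spin2_frameComp E T]
  rw [h1, sdPart_unitFrame_eq_zero_iff
    (fun i j => by rw [frameComp_antisymm h]; push_cast; rfl), DualRel]
  norm_cast
  simp

theorem frameComp_unitFrame (T : Fin 4 → Fin 4 → ℝ) : frameComp unitFrame T = T := by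
  funext a b; simp [frameComp, unitFrame]

theorem IsOrientedFrame.inv_eq {g : Fin 4 → Fin 4 → E4 → ℝ} {y : E4}
    {E : Fin 4 → Fin 4 → ℝ} (hE : IsOrientedFrame g y E) (i j : Fin 4) :
    metricInv g i j y = ∑ a, E a i * E a j := by
  have h1 : Matrix.of E * (metricMatrix g y * (Matrix.of E).transpose) = 1 := by
    ext a b
    rw [Matrix.one_apply, ← hE.1 a b]
    simp only [Matrix.mul_apply, Matrix.transpose_apply, Matrix.of_apply, Finset.mul_sum]
    refine Finset.sum_congr rfl fun i _ => Finset.sum_congr rfl fun j _ => ?_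
    ring
  have h2 := mul_eq_one_comm.1 h1
  rw [Matrix.mul_assoc] at h2
  have h3 := Matrix.inv_eq_right_inv h2
  rw [metricInv, h3]
  simp only [Matrix.mul_apply, Matrix.transpose_apply, Matrix.of_apply]

/-- Orthonormality gives det g = (det E)⁻², and the orientation selects the positive root. -/
theorem IsOrientedFrame.sqrt_det {g : Fin 4 → Fin 4 → E4 → ℝ} {y : E4}
    {E : Fin 4 → Fin 4 → ℝ} (hE : IsOrientedFrame g y E) :
    Real.sqrt (metricMatrix g y).det * (Matrix.of E).det = 1 := by
  have h1 : Matrix.of E * (metricMatrix g y * (Matrix.of E).transpose) = 1 := by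
    ext a b
    rw [Matrix.one_apply, ← hE.1 a b]
    simp only [Matrix.mul_apply, Matrix.transpose_apply, Matrix.of_apply, Finset.mul_sum]
    refine Finset.sum_congr rfl fun i _ => Finset.sum_congr rfl fun j _ => ?_
    ring
  have h2 := congrArg Matrix.det h1
  rw [Matrix.det_mul, Matrix.det_mul, Matrix.det_transpose, Matrix.det_one] at h2
  have h3 := hE.2
  set d := (Matrix.of E).det
  have h4 : (metricMatrix g y).det = (d⁻¹) ^ 2 := by
    have : d ≠ 0 := h3.ne'
    field_simp
    linear_combination h2
  rw [h4, Real.sqrt_sq (inv_pos.2 h3).le, inv_mul_cancel₀ h3.ne']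

/-- Raising both indices of a two-tensor. -/
def raise2 (g T : Fin 4 → Fin 4 → E4 → ℝ) (i j : Fin 4) (y : E4) : ℝ :=
  ∑ k, metricInv g i k y * ∑ l, metricInv g j l y * T k l y

theorem det_fin_four (E : Fin 4 → Fin 4 → ℝ) : (Matrix.of E).det =
    E 0 0 * (E 1 1 * (E 2 2 * E 3 3 - E 2 3 * E 3 2) - E 1 2 * (E 2 1 * E 3 3 - E 2 3 * E 3 1)
      + E 1 3 * (E 2 1 * E 3 2 - E 2 2 * E 3 1))
    - E 0 1 * (E 1 0 * (E 2 2 * E 3 3 - E 2 3 * E 3 2) - E 1 2 * (E 2 0 * E 3 3 - E 2 3 * E 3 0)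
      + E 1 3 * (E 2 0 * E 3 2 - E 2 2 * E 3 0))
    + E 0 2 * (E 1 0 * (E 2 1 * E 3 3 - E 2 3 * E 3 1) - E 1 1 * (E 2 0 * E 3 3 - E 2 3 * E 3 0)
      + E 1 3 * (E 2 0 * E 3 1 - E 2 1 * E 3 0))
    - E 0 3 * (E 1 0 * (E 2 1 * E 3 2 - E 2 2 * E 3 1) - E 1 1 * (E 2 0 * E 3 2 - E 2 2 * E 3 0)
      + E 1 2 * (E 2 0 * E 3 1 - E 2 1 * E 3 0)) := by
  simp [Matrix.det_succ_row_zero, Fin.sum_univ_succ, Fin.succAbove]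
  ring

/-- The duality relations in coordinates: `√det g` times the two-form with raised indices is the
dual of the two-form. -/
theorem IsOrientedFrame.dualRel_coord {g : Fin 4 → Fin 4 → E4 → ℝ} {y : E4}
    {E : Fin 4 → Fin 4 → ℝ} (hE : IsOrientedFrame g y E) {T : Fin 4 → Fin 4 → E4 → ℝ}
    (h : ∀ i j, T i j y = -T j i y) {s : ℝ} (hss : s * s = 1)
    (hs : DualRel s (frameComp E fun i j => T i j y)) :
    Real.sqrt (metricMatrix g y).det * raise2 g T 0 1 y = s * T 2 3 y ∧
    Real.sqrt (metricMatrix g y).det * raise2 g T 0 2 y = -s * T 1 3 y ∧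
    Real.sqrt (metricMatrix g y).det * raise2 g T 0 3 y = s * T 1 2 y := by
  set c := Real.sqrt (metricMatrix g y).det with hc
  have hcd := hE.sqrt_det
  rw [← hc] at hcd
  set b := frameComp E fun i j => T i j y with hb
  have hba : ∀ i j, b i j = -b j i := frameComp_antisymm h
  have hb0 : ∀ i, b i i = 0 := fun i => by have := hba i i; linarith
  have h0 : ∀ i, T i i y = 0 := fun i => by have := h i i; linarith
  have hr : ∀ i j, raise2 g T i j y = ∑ p, E p i * ∑ q, E q j * b p q := by
    intro i j
    simp only [raise2, hE.inv_eq, hb, frameComp]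
    have s1 : ∀ (i : Fin 4) (X : Fin 4 → ℝ), ∑ k, (∑ a, E a i * E a k) * X k
        = ∑ a, E a i * ∑ k, E a k * X k := by
      intro i X
      simp only [Finset.sum_mul, Finset.mul_sum, mul_assoc]
      rw [Finset.sum_comm]
    simp only [s1]
    refine Finset.sum_congr rfl fun p _ => congrArg _ ?_
    rw [sum_mul_sum_swap]
  have hd : DualRel s b := hs
  have g1 : b 2 3 = s * b 0 1 := by rw [hd.1]; linear_combination (-b 2 3) * hss
  have g2 : b 1 3 = -s * b 0 2 := by rw [hd.2.1]; linear_combination (-b 1 3) * hss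
  have g3 : b 1 2 = s * b 0 3 := by rw [hd.2.2]; linear_combination (-b 1 2) * hss
  -- Replacing each frame component by its dual turns the raised form into a sum of 2×2 minors of
  -- `E` in the columns i, j, multiplied by the components on the complementary pair of rows.
  have key : ∀ i j, raise2 g T i j y
      = s * ((E 0 i * E 1 j - E 1 i * E 0 j) * b 2 3 - (E 0 i * E 2 j - E 2 i * E 0 j) * b 1 3
        + (E 0 i * E 3 j - E 3 i * E 0 j) * b 1 2 + (E 1 i * E 2 j - E 2 i * E 1 j) * b 0 3
        - (E 1 i * E 3 j - E 3 i * E 1 j) * b 0 2 + (E 2 i * E 3 j - E 3 i * E 2 j) * b 0 1) := by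
    intro i j
    rw [hr]
    simp only [Fin.sum_univ_four, hb0]
    rw [hba 1 0, hba 2 0, hba 3 0, hba 2 1, hba 3 1, hba 3 2]
    linear_combination (E 0 i * E 1 j - E 1 i * E 0 j) * hd.1
      + (E 0 i * E 2 j - E 2 i * E 0 j) * hd.2.1 + (E 0 i * E 3 j - E 3 i * E 0 j) * hd.2.2
      + (E 1 i * E 2 j - E 2 i * E 1 j) * g3 + (E 1 i * E 3 j - E 3 i * E 1 j) * g2
      + (E 2 i * E 3 j - E 3 i * E 2 j) * g1
  have hbT : ∀ p q, b p q = (E p 0 * E q 1 - E p 1 * E q 0) * T 0 1 y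
      + (E p 0 * E q 2 - E p 2 * E q 0) * T 0 2 y + (E p 0 * E q 3 - E p 3 * E q 0) * T 0 3 y
      + (E p 1 * E q 2 - E p 2 * E q 1) * T 1 2 y + (E p 1 * E q 3 - E p 3 * E q 1) * T 1 3 y
      + (E p 2 * E q 3 - E p 3 * E q 2) * T 2 3 y := by
    intro p q
    simp only [hb, frameComp, Fin.sum_univ_four, h0]
    rw [h 1 0, h 2 0, h 3 0, h 2 1, h 3 1, h 3 2]
    ring
  -- After inserting `hbT`, the coefficients are Laplace expansions along complementary 2×2 minors:
  -- one of them is ± det E and the others are determinants with a repeated column.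
  have k01 : raise2 g T 0 1 y = s * (Matrix.of E).det * T 2 3 y := by
    rw [key, det_fin_four]; simp only [hbT]; ring
  have k02 : raise2 g T 0 2 y = -(s * (Matrix.of E).det * T 1 3 y) := by
    rw [key, det_fin_four]; simp only [hbT]; ring
  have k03 : raise2 g T 0 3 y = s * (Matrix.of E).det * T 1 2 y := by
    rw [key, det_fin_four]; simp only [hbT]; ring
  rw [k01, k02, k03]
  refine ⟨?_, ?_, ?_⟩
  · linear_combination s * T 2 3 y * hcd
  · linear_combination -s * T 1 3 y * hcd
  · linear_combination s * T 1 2 y * hcd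

section Normal

variable {g : Fin 4 → Fin 4 → E4 → ℝ} {V : Set E4}

theorem NormalAt.pd_g (hn : NormalAt g V) (i j k : Fin 4) : pd i (g j k) 0 = 0 := by
  rw [hn.metricOn.compat hn.zero_mem]
  simp [hn.christoffel_zero]

theorem NormalAt.hasPd_g (hn : NormalAt g V) (i j k : Fin 4) : HasPd i (g j k) 0 0 :=
  ((hn.metricOn.smooth j k).hasPd hn.metricOn.isOpen hn.zero_mem).congr_val (hn.pd_g i j k)

theorem NormalAt.hasPd_inv (hn : NormalAt g V) (i j k : Fin 4) : HasPd i (metricInv g j k) 0 0 :=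
  HasPd.metricInv_zero hn.metricOn hn.zero_mem (hn.pd_g i) j k

theorem NormalAt.isOrientedFrame (hn : NormalAt g V) : IsOrientedFrame g 0 unitFrame := by
  refine ⟨fun a b => ?_, ?_⟩
  · simp [hn.g_zero, unitFrame]
  · have : Matrix.of unitFrame = (1 : Matrix (Fin 4) (Fin 4) ℝ) := by
      ext a b; simp [unitFrame, Matrix.one_apply]
    rw [this]; simp

theorem NormalAt.inv_zero (hn : NormalAt g V) (i j : Fin 4) :
    metricInv g i j 0 = if i = j then 1 else 0 := by
  rw [hn.isOrientedFrame.inv_eq]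
  simp [unitFrame, eq_comm]

theorem NormalAt.hasPd_sqrt_det (hn : NormalAt g V) (i : Fin 4) :
    HasPd i (fun y => Real.sqrt (metricMatrix g y).det) 0 0 := by
  have h1 : HasPd i (fun y => (metricMatrix g y).det) 0 0 := by
    simp only [Matrix.det_apply]
    refine (HasPd.sum (d := fun _ => 0) fun σ _ => ?_).congr_val (by simp)
    simp only [zsmul_eq_mul, Units.smul_def]
    exact ((HasPd.prod_zero fun k _ => hn.hasPd_g i _ _).const_mul _).congr_val (by simp)
  exact (h1.comp_deriv (Real.hasDerivAt_sqrt
    (hn.metricOn.det_pos hn.zero_mem).ne')).congr_val (by simp)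

/-- The duality relations of a two-form persist for its derivatives at the origin of normal
coordinates. -/
theorem NormalAt.dualRel_pd (hn : NormalAt g V) {T : Fin 4 → Fin 4 → E4 → ℝ}
    (hT : ∀ i j, Sm V (T i j)) (h : ∀ z ∈ V, ∀ i j, T i j z = -T j i z) {s : ℝ} (hss : s * s = 1)
    (hs : ∀ z ∈ V, ∀ E, IsOrientedFrame g z E → DualRel s (frameComp E fun i j => T i j z))
    (e : Fin 4) : DualRel s fun i j => pd e (T i j) 0 := by
  have hV := hn.metricOn.isOpen
  have hpd : ∀ i j, HasPd e (T i j) (pd e (T i j) 0) 0 := fun i j => (hT i j).hasPd hV hn.zero_mem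
  have hc0 : Real.sqrt (metricMatrix g 0).det = 1 := by
    have := hn.isOrientedFrame.sqrt_det
    have h1 : Matrix.of unitFrame = (1 : Matrix (Fin 4) (Fin 4) ℝ) := by
      ext a b; simp [unitFrame, Matrix.one_apply]
    rwa [h1, Matrix.det_one, mul_one] at this
  -- In coordinates the duality relations have the variable coefficients √det g and g⁻¹. These are
  -- stationary at the origin, so there the relations for T become the same relations for its
  -- derivatives.
  have hr : ∀ i j, HasPd e (fun y => Real.sqrt (metricMatrix g y).det * raise2 g T i j y)
      (pd e (T i j) 0) 0 := by
    intro i j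
    refine ((hn.hasPd_sqrt_det e).mul (HasPd.sum fun k _ => (hn.hasPd_inv e i k).mul
      (HasPd.sum fun l _ => (hn.hasPd_inv e j l).mul (hpd k l)))).congr_val ?_
    simp [hc0, hn.inv_zero]
  have hco := fun z (hz : z ∈ V) =>
    (hn.metricOn.exists_frame hz).choose_spec.dualRel_coord (h z hz) hss
      (hs z hz _ (hn.metricOn.exists_frame hz).choose_spec)
  refine ⟨?_, ?_, ?_⟩
  · beta_reduce
    rw [← (hr 0 1).pd_eq, pd_congr_on hV hn.zero_mem fun z hz => (hco z hz).1]
    exact ((hpd 2 3).const_mul s).pd_eq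
  · beta_reduce
    rw [← (hr 0 2).pd_eq, pd_congr_on hV hn.zero_mem fun z hz => (hco z hz).2.1]
    exact ((hpd 1 3).const_mul (-s)).pd_eq
  · beta_reduce
    rw [← (hr 0 3).pd_eq, pd_congr_on hV hn.zero_mem fun z hz => (hco z hz).2.2]
    exact ((hpd 1 2).const_mul s).pd_eq

end Normal

/-! ### Conformal rescaling in coordinates -/

/-- The components of the metric `u² g`. -/
def confMetric (u : E4 → ℝ) (g : Fin 4 → Fin 4 → E4 → ℝ) (i j : Fin 4) (y : E4) : ℝ :=
  u y ^ 2 * g i j y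

/-- The logarithmic derivative `u⁻¹ ∂ᵢ u`. -/
def logPd (u : E4 → ℝ) (i : Fin 4) (y : E4) : ℝ := (u y)⁻¹ * pd i u y

theorem sum_unitFrame_mul (a : Fin 4) (X : Fin 4 → ℝ) : ∑ m, unitFrame a m * X m = X a := by
  simp [unitFrame]

theorem unitFrame_symm (a b : Fin 4) : unitFrame a b = unitFrame b a := by
  simp only [unitFrame, eq_comm]

theorem sum_unitFrame_mul' (a : Fin 4) (X : Fin 4 → ℝ) : ∑ m, unitFrame m a * X m = X a := by
  simp [unitFrame]

theorem sum_mul_unitFrame (a : Fin 4) (X : Fin 4 → ℝ) : ∑ m, X m * unitFrame m a = X a := by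
  simp [unitFrame]

section Conformal

variable {g : Fin 4 → Fin 4 → E4 → ℝ} {V : Set E4} {u : E4 → ℝ} {y : E4}

theorem MetricOn.conf (hg : MetricOn g V) (hu : Sm V u) (hpos : ∀ z ∈ V, 0 < u z) :
    MetricOn (confMetric u g) V where
  isOpen := hg.isOpen
  smooth i j := (hu.pow 2).mul (hg.smooth i j)
  symm z hz i j := by simp only [confMetric, hg.symm z hz i j]
  pos z hz v hv := by
    have h1 := mul_pos (pow_pos (hpos z hz) 2) (hg.pos z hz v hv)
    refine lt_of_lt_of_eq h1 ?_
    simp only [confMetric, Finset.mul_sum]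
    exact Finset.sum_congr rfl fun _ _ => Finset.sum_congr rfl fun _ _ => by ring

theorem Sm.logPd (hu : Sm V u) (hV : IsOpen V) (hpos : ∀ z ∈ V, 0 < u z) (i : Fin 4) :
    Sm V (logPd u i) :=
  (hu.inv fun z hz => (hpos z hz).ne').mul (hu.pd hV i)

theorem pd_eq_mul_logPd (h : u y ≠ 0) (i : Fin 4) : pd i u y = u y * logPd u i y := by
  rw [ConfKahler.logPd]; field_simp

theorem MetricOn.metricInv_conf (hg : MetricOn g V) (hy : y ∈ V) (hu : u y ≠ 0) (i j : Fin 4) :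
    metricInv (confMetric u g) i j y = (u y ^ 2)⁻¹ * metricInv g i j y := by
  have h1 : metricMatrix (confMetric u g) y = (u y ^ 2) • metricMatrix g y := by
    ext i j; simp [confMetric]
  have h2 : metricMatrix g y * (metricMatrix g y)⁻¹ = 1 :=
    Matrix.mul_nonsing_inv _ (isUnit_iff_ne_zero.2 (hg.det_pos hy).ne')
  have h3 : metricMatrix (confMetric u g) y * ((u y ^ 2)⁻¹ • (metricMatrix g y)⁻¹) = 1 := by
    rw [h1, Matrix.smul_mul, Matrix.mul_smul, h2, smul_smul,
      mul_inv_cancel₀ (pow_ne_zero 2 hu), one_smul]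
  have h4 := Matrix.inv_eq_right_inv h3
  have := congrFun (congrFun h4 i) j
  simpa [metricInv] using this

/-- The right-hand side is symmetric in its lower indices and compatible with u²g, so uniqueness of
the Levi-Civita connection applies. -/
theorem MetricOn.christoffel_conf (hg : MetricOn g V) (hu : Sm V u) (hpos : ∀ z ∈ V, 0 < u z)
    (hy : y ∈ V) (k i j : Fin 4) :
    christoffel (confMetric u g) k i j y = christoffel g k i j y + unitFrame k i * logPd u j y
      + unitFrame k j * logPd u i y - g i j y * ∑ l, metricInv g k l y * logPd u l y := by
  have hu0 := (hpos y hy).ne'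
  refine (hg.conf hu hpos).christoffel_unique hy (fun k i j => christoffel g k i j y
    + unitFrame k i * logPd u j y + unitFrame k j * logPd u i y
      - g i j y * ∑ l, metricInv g k l y * logPd u l y) ?_ ?_ k i j
  · intro k i j
    simp only [hg.christoffel_symm hy k i j, hg.symm y hy i j]; ring
  · intro i j k
    have h1 : pd i (confMetric u g j k) y
        = 2 * u y ^ 2 * logPd u i y * g j k y + u y ^ 2 * pd i (g j k) y := by
      have := ((hu.hasPd hg.isOpen hy (i := i)).pow 2).mul
        ((hg.smooth j k).hasPd hg.isOpen hy (i := i))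
      refine this.pd_eq.trans ?_
      rw [pd_eq_mul_logPd hu0]; push_cast; ring
    rw [h1, hg.compat hy]
    have e1 : ∀ j, ∑ m, (∑ l, metricInv g m l y * logPd u l y) * g m j y = logPd u j y := by
      intro j
      rw [← hg.lower_raise hy (fun l => logPd u l y) j]
      exact Finset.sum_congr rfl fun m _ => by rw [hg.symm y hy m j]; ring
    have e2 : ∀ i j k : Fin 4, ∑ m, (christoffel g m i j y + unitFrame m i * logPd u j y
        + unitFrame m j * logPd u i y - g i j y * ∑ l, metricInv g m l y * logPd u l y) * g m k y
        = ∑ m, christoffel g m i j y * g m k y + logPd u j y * g i k y + logPd u i y * g j k y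
          - g i j y * logPd u k y := by
      intro i j k
      simp only [add_mul, sub_mul, Finset.sum_add_distrib, Finset.sum_sub_distrib, mul_assoc,
        sum_unitFrame_mul' _ (fun m => logPd u _ y * g m k y), ← Finset.mul_sum, e1]
    have e3 : ∑ m, ((christoffel g m i j y + unitFrame m i * logPd u j y
        + unitFrame m j * logPd u i y - g i j y * ∑ l, metricInv g m l y * logPd u l y)
          * confMetric u g m k y
        + (christoffel g m i k y + unitFrame m i * logPd u k y
        + unitFrame m k * logPd u i y - g i k y * ∑ l, metricInv g m l y * logPd u l y)
          * confMetric u g j m y)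
        = u y ^ 2 * (∑ m, (christoffel g m i j y + unitFrame m i * logPd u j y
        + unitFrame m j * logPd u i y - g i j y * ∑ l, metricInv g m l y * logPd u l y) * g m k y
        + ∑ m, (christoffel g m i k y + unitFrame m i * logPd u k y
        + unitFrame m k * logPd u i y - g i k y * ∑ l, metricInv g m l y * logPd u l y)
          * g m j y) := by
      rw [← Finset.sum_add_distrib, Finset.mul_sum]
      refine Finset.sum_congr rfl fun m _ => ?_
      simp only [confMetric, hg.symm y hy j m]; ring
    rw [e3, e2, e2, Finset.sum_add_distrib]
    have e4 : ∑ m, christoffel g m i k y * g m j y = ∑ m, christoffel g m i k y * g j m y :=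
      Finset.sum_congr rfl fun m _ => by rw [hg.symm y hy m j]
    rw [e4, hg.symm y hy k j]
    ring

end Conformal

/-! ### Conformal change of the curvature at the origin of normal coordinates -/

section ConformalNormal

variable {g : Fin 4 → Fin 4 → E4 → ℝ} {V : Set E4} {u : E4 → ℝ}

theorem NormalAt.g_eq (hn : NormalAt g V) (i j : Fin 4) : g i j 0 = unitFrame i j := hn.g_zero i j

theorem NormalAt.inv_eq (hn : NormalAt g V) (i j : Fin 4) :
    metricInv g i j 0 = unitFrame i j := hn.inv_zero i j

/-- The change of the Christoffel symbols at the origin of normal coordinates. -/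
def confConn (U : Fin 4 → ℝ) (k i j : Fin 4) : ℝ :=
  unitFrame k i * U j + unitFrame k j * U i - unitFrame i j * U k

theorem NormalAt.christoffel_conf (hn : NormalAt g V) (hu : Sm V u) (hpos : ∀ z ∈ V, 0 < u z)
    (k i j : Fin 4) :
    christoffel (confMetric u g) k i j 0 = confConn (fun l => logPd u l 0) k i j := by
  rw [hn.metricOn.christoffel_conf hu hpos hn.zero_mem, hn.christoffel_zero]
  simp only [hn.g_eq, hn.inv_eq, sum_unitFrame_mul, confConn, zero_add]

theorem sum_confConn_mul (U X : Fin 4 → ℝ) (i j : Fin 4) :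
    ∑ m, confConn U m i j * X m = U j * X i + U i * X j - unitFrame i j * ∑ m, U m * X m := by
  simp only [confConn, add_mul, sub_mul, Finset.sum_add_distrib, Finset.sum_sub_distrib, mul_assoc,
    ← Finset.mul_sum]
  simp only [← mul_assoc, mul_comm (unitFrame _ _) (U _)]
  simp only [mul_assoc, ← Finset.mul_sum, sum_unitFrame_mul']

theorem sum_mul_confConn (U X : Fin 4 → ℝ) (d a : Fin 4) :
    ∑ m, confConn U d a m * X m
      = unitFrame d a * ∑ m, U m * X m + U a * X d - U d * X a := by
  simp only [confConn, add_mul, sub_mul, Finset.sum_add_distrib, Finset.sum_sub_distrib, mul_assoc,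
    ← Finset.mul_sum]
  congr 1
  · congr 1
    rw [sum_unitFrame_mul d (fun m => U a * X m)]
  · rw [sum_unitFrame_mul a (fun m => U d * X m)]

/-- The derivatives of g and g⁻¹ vanish at the origin, so the difference of the two connections
contributes only through the derivative of Υ. -/
theorem NormalAt.pd_christoffel_conf (hn : NormalAt g V) (hu : Sm V u) (hpos : ∀ z ∈ V, 0 < u z)
    (a k i j : Fin 4) :
    pd a (christoffel (confMetric u g) k i j) 0 = pd a (christoffel g k i j) 0
      + unitFrame k i * pd a (logPd u j) 0 + unitFrame k j * pd a (logPd u i) 0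
      - unitFrame i j * pd a (logPd u k) 0 := by
  have hV := hn.metricOn.isOpen
  have hU : ∀ i, HasPd a (logPd u i) (pd a (logPd u i) 0) 0 := fun i =>
    (hu.logPd hV hpos i).hasPd hV hn.zero_mem
  rw [pd_congr_on hV hn.zero_mem fun z hz => hn.metricOn.christoffel_conf hu hpos hz k i j]
  have h := ((((hn.metricOn.sm_christoffel k i j).hasPd hV hn.zero_mem (i := a)).add
    ((hU j).const_mul (unitFrame k i))).add ((hU i).const_mul (unitFrame k j))).sub
    ((hn.hasPd_g a i j).mul (HasPd.sum (s := Finset.univ) fun l _ =>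
      (hn.hasPd_inv a k l).mul (hU l)))
  refine h.pd_eq.trans ?_
  simp only [hn.g_eq, hn.inv_eq, zero_mul, zero_add, sum_unitFrame_mul]

/-- Υ = d log u is closed. -/
theorem pd_logPd_symm (hu : Sm V u) (hV : IsOpen V) (hpos : ∀ z ∈ V, 0 < u z) {y : E4}
    (hy : y ∈ V) (a b : Fin 4) : pd a (logPd u b) y = pd b (logPd u a) y := by
  have h : ∀ a b, pd a (logPd u b) y
      = -(u y ^ 2)⁻¹ * pd a u y * pd b u y + (u y)⁻¹ * pd a (pd b u) y := fun a b =>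
    (((hu.hasPd hV hy).inv (hpos y hy).ne').mul ((hu.pd hV b).hasPd hV hy)).pd_eq
  rw [h, h, pd_comm hu hV hy a b]; ring

/-- The tensor by which the Schouten tensor changes. -/
def confQ (u : E4 → ℝ) (a b : Fin 4) : ℝ :=
  pd a (logPd u b) 0 - logPd u a 0 * logPd u b 0
    + (1 / 2) * (∑ m, logPd u m 0 * logPd u m 0) * unitFrame a b

/-- At the origin the terms ΓΓ of g and the mixed terms vanish. The terms quadratic in Υ combine
with ∂Υ into `confQ`, so that the change of the curvature is made of g and one symmetric tensor. -/
theorem NormalAt.riemannUp_conf (hn : NormalAt g V) (hu : Sm V u) (hpos : ∀ z ∈ V, 0 < u z)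
    (a b c d : Fin 4) :
    riemannUp (confMetric u g) a b c d 0 = riemannUp g a b c d 0
      + unitFrame d b * confQ u a c - unitFrame b c * confQ u a d
      - unitFrame d a * confQ u b c + unitFrame a c * confQ u b d := by
  have hs := pd_logPd_symm hu hn.metricOn.isOpen hpos hn.zero_mem
  simp only [riemannUp, hn.pd_christoffel_conf hu hpos, hn.christoffel_conf hu hpos,
    hn.christoffel_zero, Finset.sum_sub_distrib, mul_zero, sub_zero, Finset.sum_const_zero]
  rw [sum_mul_confConn _ (fun m => confConn _ m b c), sum_mul_confConn _ (fun m => confConn _ m a c)]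
  have h1 : ∀ b c, ∑ m, logPd u m 0 * confConn (fun l => logPd u l 0) m b c
      = 2 * logPd u b 0 * logPd u c 0
        - unitFrame b c * ∑ m, logPd u m 0 * logPd u m 0 := by
    intro b c
    simp only [mul_comm (logPd u _ 0) (confConn _ _ _ _), sum_confConn_mul]
    ring
  rw [h1, h1]
  simp only [confConn, confQ, hs b a, unitFrame_symm b a, unitFrame_symm d a, unitFrame_symm d b]
  ring

theorem NormalAt.ricci_conf (hn : NormalAt g V) (hu : Sm V u) (hpos : ∀ z ∈ V, 0 < u z)
    (a b : Fin 4) : ricci (confMetric u g) a b 0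
      = ricci g a b 0 + 2 * confQ u a b + unitFrame a b * ∑ c, confQ u c c := by
  have h1 : ∑ c : Fin 4, unitFrame c c = 4 := by simp [unitFrame]
  simp only [ricci, hn.riemannUp_conf hu hpos, Finset.sum_add_distrib, Finset.sum_sub_distrib,
    sum_unitFrame_mul', ← Finset.sum_mul, ← Finset.mul_sum, h1]
  ring

theorem NormalAt.scalarCurv_conf (hn : NormalAt g V) (hu : Sm V u) (hpos : ∀ z ∈ V, 0 < u z) :
    scalarCurv (confMetric u g) 0
      = (u 0 ^ 2)⁻¹ * (scalarCurv g 0 + 6 * ∑ c, confQ u c c) := by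
  have h1 : ∑ c : Fin 4, unitFrame c c = 4 := by simp [unitFrame]
  simp only [scalarCurv, hn.metricOn.metricInv_conf hn.zero_mem (hpos 0 hn.zero_mem).ne',
    hn.ricci_conf hu hpos, hn.inv_eq, mul_assoc, ← Finset.mul_sum, sum_unitFrame_mul]
  simp only [Finset.sum_add_distrib, ← Finset.mul_sum, ← Finset.sum_mul, h1]
  ring

/-- The coefficients −½ and 1/12 are those for which the trace of `confQ` drops out. -/
theorem NormalAt.schouten_conf (hn : NormalAt g V) (hu : Sm V u) (hpos : ∀ z ∈ V, 0 < u z)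
    (a b : Fin 4) : schouten (confMetric u g) a b 0 = schouten g a b 0 - confQ u a b := by
  have hu0 := (hpos 0 hn.zero_mem).ne'
  rw [schouten_eq, schouten_eq, hn.ricci_conf hu hpos, hn.scalarCurv_conf hu hpos, confMetric,
    hn.g_eq]
  field_simp
  ring

/-- The changes of the Riemann tensor and of the trace terms cancel; the factor u² comes from
lowering the last index. -/
theorem NormalAt.weyl_conf (hn : NormalAt g V) (hu : Sm V u) (hpos : ∀ z ∈ V, 0 < u z)
    (a b c d : Fin 4) : weyl (confMetric u g) a b c d 0 = u 0 ^ 2 * weyl g a b c d 0 := by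
  have hR : ∀ g : Fin 4 → Fin 4 → E4 → ℝ, ∀ k : ℝ, (∀ i j, g i j 0 = k * unitFrame i j) →
      riemann g a b c d 0 = k * riemannUp g a b c d 0 := by
    intro g k hk
    simp only [riemann, hk]
    rw [← sum_unitFrame_mul' d (fun e => riemannUp g a b c e 0), Finset.mul_sum]
    exact Finset.sum_congr rfl fun _ _ => by ring
  have hc : ∀ i j, confMetric u g i j 0 = u 0 ^ 2 * unitFrame i j := fun i j => by
    rw [confMetric, hn.g_eq]
  rw [weyl_eq, weyl_eq, hR _ _ hc, hR g 1 fun i j => by rw [hn.g_eq, one_mul]]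
  simp only [hn.schouten_conf hu hpos, hc, hn.g_eq, hn.riemannUp_conf hu hpos]
  rw [unitFrame_symm d b, unitFrame_symm d a]
  ring

end ConformalNormal

/-! ### Descent of identities from normal coordinates -/

section PullbackInjective

variable {F : E4 → E4} {V V' : Set E4} {z : E4}

/-- The Jacobian is invertible. Applied to one index after another, this recovers a tensor at F(z)
from its pullback at z. -/
theorem CoordChange.eq_of_sum_jac (hF : CoordChange F V' V) (hz : z ∈ V') {X Y : Fin 4 → ℝ}
    (h : ∀ a, ∑ i, jac F i a z * X i = ∑ i, jac F i a z * Y i) : X = Y := by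
  have hu : IsUnit (jacM F z).transpose.det := by
    rw [Matrix.det_transpose]; exact hF.isUnit_jac hz
  have h1 : (jacM F z).transpose.mulVec X = (jacM F z).transpose.mulVec Y := by
    funext a
    simpa only [Matrix.mulVec, dotProduct, Matrix.transpose_apply, Matrix.of_apply] using h a
  have h2 := congrArg ((jacM F z).transpose⁻¹.mulVec) h1
  rwa [Matrix.mulVec_mulVec, Matrix.mulVec_mulVec, Matrix.nonsing_inv_mul _ hu,
    Matrix.one_mulVec, Matrix.one_mulVec] at h2

theorem CoordChange.eq_of_pb2 (hF : CoordChange F V' V) (hz : z ∈ V')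
    {S T : Fin 4 → Fin 4 → E4 → ℝ} (h : ∀ a b, pb2 F S a b z = pb2 F T a b z) (i j : Fin 4) :
    S i j (F z) = T i j (F z) := by
  have h1 := fun b => hF.eq_of_sum_jac hz (fun a => h a b)
  have h2 := fun i => hF.eq_of_sum_jac hz (X := fun j => S i j (F z)) (Y := fun j => T i j (F z))
    (fun b => congrFun (h1 b) i)
  exact congrFun (h2 i) j

theorem CoordChange.eq_of_pb4 (hF : CoordChange F V' V) (hz : z ∈ V')
    {S T : Fin 4 → Fin 4 → Fin 4 → Fin 4 → E4 → ℝ}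
    (h : ∀ a b c d, pb4 F S a b c d z = pb4 F T a b c d z) (i j k l : Fin 4) :
    S i j k l (F z) = T i j k l (F z) := by
  have h1 := fun b c d => hF.eq_of_sum_jac hz (fun a => h a b c d)
  have h2 := fun i c d => hF.eq_of_sum_jac hz (fun b => congrFun (h1 b c d) i)
  have h3 := fun i j d => hF.eq_of_sum_jac hz (fun c => congrFun (h2 i c d) j)
  have h4 := fun i j k => hF.eq_of_sum_jac hz (X := fun l => S i j k l (F z))
    (Y := fun l => T i j k l (F z)) (fun d => congrFun (h3 i j d) k)
  exact congrFun (h4 i j k) l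

theorem pb2_confMetric (F : E4 → E4) (u : E4 → ℝ) (g : Fin 4 → Fin 4 → E4 → ℝ) :
    pb2 F (confMetric u g) = confMetric (fun z => u (F z)) (pb2 F g) := by
  funext a b z
  simp only [pb2, confMetric, Finset.mul_sum]
  exact Finset.sum_congr rfl fun _ _ => Finset.sum_congr rfl fun _ _ => by ring

/-- Validity on an open set is needed, beyond the origin, because ∇ψ for the rescaled metric
involves derivatives of its Weyl tensor. -/
theorem MetricOn.weyl_conf {g : Fin 4 → Fin 4 → E4 → ℝ} {u : E4 → ℝ} {y : E4}
    (hg : MetricOn g V) (hu : Sm V u) (hpos : ∀ z ∈ V, 0 < u z) (hy : y ∈ V) (a b c d : Fin 4) :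
    weyl (confMetric u g) a b c d y = u y ^ 2 * weyl g a b c d y := by
  obtain ⟨E, hE⟩ := hg.exists_frame hy
  obtain ⟨F, V', hF, hF0, -, hn⟩ := hg.exists_normal hy hE
  have h := hF.eq_of_pb4 hn.zero_mem (S := weyl (confMetric u g))
    (T := fun a b c d y => u y ^ 2 * weyl g a b c d y) (fun a b c d => by
      rw [← hF.weyl_pb (hg.conf hu hpos) hn.zero_mem, pb2_confMetric,
        hn.weyl_conf (hF.sm_comp hu) (fun z hz => hpos _ (hF.mapsTo hz)),
        hF.weyl_pb hg hn.zero_mem]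
      simp only [pb4, Finset.mul_sum]
      exact Finset.sum_congr rfl fun _ _ => Finset.sum_congr rfl fun _ _ =>
        Finset.sum_congr rfl fun _ _ => Finset.sum_congr rfl fun _ _ => by ring) a b c d
  rwa [hF0] at h

end PullbackInjective

/-! ### Spinor algebra -/

/-! ### Linearity and scaling of spinor components -/

section Linear

variable (E : Fin 4 → Fin 4 → ℝ)

theorem spin1_add (X Y : Fin 4 → ℂ) (A A' : Fin 2) :
    spin1 E (fun i => X i + Y i) A A' = spin1 E X A A' + spin1 E Y A A' := by
  simp only [spin1, mul_add, Finset.sum_add_distrib]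

theorem spin1_mul_left (c : ℂ) (X : Fin 4 → ℂ) (A A' : Fin 2) :
    spin1 E (fun i => c * X i) A A' = c * spin1 E X A A' := by
  simp only [spin1, Finset.mul_sum]
  exact Finset.sum_congr rfl fun _ _ => by ring

theorem spin2_add (X Y : Fin 4 → Fin 4 → ℂ) (A A' B B' : Fin 2) :
    spin2 E (fun i j => X i j + Y i j) A A' B B' = spin2 E X A A' B B' + spin2 E Y A A' B B' := by
  simp only [spin2, mul_add, Finset.sum_add_distrib]

theorem spin2_sub (X Y : Fin 4 → Fin 4 → ℂ) (A A' B B' : Fin 2) :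
    spin2 E (fun i j => X i j - Y i j) A A' B B' = spin2 E X A A' B B' - spin2 E Y A A' B B' := by
  simp only [spin2, mul_sub, Finset.sum_sub_distrib]

theorem spin2_mul_left (c : ℂ) (X : Fin 4 → Fin 4 → ℂ) (A A' B B' : Fin 2) :
    spin2 E (fun i j => c * X i j) A A' B B' = c * spin2 E X A A' B B' := by
  simp only [spin2, Finset.mul_sum]
  exact Finset.sum_congr rfl fun _ _ => Finset.sum_congr rfl fun _ _ => by ring

theorem spin2_mul (X Y : Fin 4 → ℂ) (A A' B B' : Fin 2) :
    spin2 E (fun i j => X i * Y j) A A' B B' = spin1 E X A A' * spin1 E Y B B' := by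
  simp only [spin2, spin1, Finset.sum_mul, Finset.mul_sum]
  rw [Finset.sum_comm]
  exact Finset.sum_congr rfl fun _ _ => Finset.sum_congr rfl fun _ _ => by ring

theorem spin2_swap (X : Fin 4 → Fin 4 → ℂ) (A A' B B' : Fin 2) :
    spin2 E (fun i j => X j i) A A' B B' = spin2 E X B B' A A' := by
  simp only [spin2]
  rw [Finset.sum_comm]
  exact Finset.sum_congr rfl fun _ _ => Finset.sum_congr rfl fun _ _ => by ring

theorem asdPart_add (X Y : Fin 4 → Fin 4 → ℂ) (A B : Fin 2) :
    asdPart E (fun i j => X i j + Y i j) A B = asdPart E X A B + asdPart E Y A B := by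
  simp only [asdPart, spin2_add, mul_add, Finset.sum_add_distrib]

theorem asdPart_sub (X Y : Fin 4 → Fin 4 → ℂ) (A B : Fin 2) :
    asdPart E (fun i j => X i j - Y i j) A B = asdPart E X A B - asdPart E Y A B := by
  simp only [asdPart, spin2_sub, mul_sub, Finset.sum_sub_distrib]

theorem asdPart_mul_left (c : ℂ) (X : Fin 4 → Fin 4 → ℂ) (A B : Fin 2) :
    asdPart E (fun i j => c * X i j) A B = c * asdPart E X A B := by
  simp only [asdPart, spin2_mul_left, Finset.mul_sum]
  exact Finset.sum_congr rfl fun _ _ => Finset.sum_congr rfl fun _ _ => by ring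

theorem sdPart_add (X Y : Fin 4 → Fin 4 → ℂ) (A B : Fin 2) :
    sdPart E (fun i j => X i j + Y i j) A B = sdPart E X A B + sdPart E Y A B := by
  simp only [sdPart, spin2_add, mul_add, Finset.sum_add_distrib]

theorem sdPart_sub (X Y : Fin 4 → Fin 4 → ℂ) (A B : Fin 2) :
    sdPart E (fun i j => X i j - Y i j) A B = sdPart E X A B - sdPart E Y A B := by
  simp only [sdPart, spin2_sub, mul_sub, Finset.sum_sub_distrib]

theorem sdPart_mul_left (c : ℂ) (X : Fin 4 → Fin 4 → ℂ) (A B : Fin 2) :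
    sdPart E (fun i j => c * X i j) A B = c * sdPart E X A B := by
  simp only [sdPart, spin2_mul_left, Finset.mul_sum]
  exact Finset.sum_congr rfl fun _ _ => Finset.sum_congr rfl fun _ _ => by ring

theorem spin1_sum {ι : Type*} (s : Finset ι) (X : ι → Fin 4 → ℂ) (A A' : Fin 2) :
    spin1 E (fun i => ∑ m ∈ s, X m i) A A' = ∑ m ∈ s, spin1 E (X m) A A' := by
  simp only [spin1, Finset.mul_sum]
  rw [Finset.sum_comm]

theorem spin2_sum {ι : Type*} (s : Finset ι) (X : ι → Fin 4 → Fin 4 → ℂ) (A A' B B' : Fin 2) :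
    spin2 E (fun i j => ∑ m ∈ s, X m i j) A A' B B' = ∑ m ∈ s, spin2 E (X m) A A' B B' := by
  simp only [spin2, Finset.mul_sum]
  rw [Finset.sum_comm_cycle]

theorem asdPart_sum {ι : Type*} (s : Finset ι) (X : ι → Fin 4 → Fin 4 → ℂ) (A B : Fin 2) :
    asdPart E (fun i j => ∑ m ∈ s, X m i j) A B = ∑ m ∈ s, asdPart E (X m) A B := by
  simp only [asdPart, spin2_sum, Finset.mul_sum]
  rw [Finset.sum_comm_cycle]

theorem sdPart_sum {ι : Type*} (s : Finset ι) (X : ι → Fin 4 → Fin 4 → ℂ) (A B : Fin 2) :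
    sdPart E (fun i j => ∑ m ∈ s, X m i j) A B = ∑ m ∈ s, sdPart E (X m) A B := by
  simp only [sdPart, spin2_sum, Finset.mul_sum]
  rw [Finset.sum_comm_cycle]

theorem tetrad_smul (c : ℝ) (A A' : Fin 2) (i : Fin 4) :
    tetrad (c • E) A A' i = c * tetrad E A A' i := by
  simp only [tetrad, Pi.smul_apply, smul_eq_mul, Complex.ofReal_mul, Finset.mul_sum]
  exact Finset.sum_congr rfl fun _ _ => by ring

theorem spin1_smul (c : ℝ) (X : Fin 4 → ℂ) (A A' : Fin 2) :
    spin1 (c • E) X A A' = c * spin1 E X A A' := by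
  simp only [spin1, tetrad_smul, Finset.mul_sum, mul_assoc]

theorem spin2_smul (c : ℝ) (X : Fin 4 → Fin 4 → ℂ) (A A' B B' : Fin 2) :
    spin2 (c • E) X A A' B B' = (c : ℂ) ^ 2 * spin2 E X A A' B B' := by
  simp only [spin2, tetrad_smul, Finset.mul_sum]
  exact Finset.sum_congr rfl fun _ _ => Finset.sum_congr rfl fun _ _ => by ring

theorem sdPart_smul (c : ℝ) (X : Fin 4 → Fin 4 → ℂ) (A B : Fin 2) :
    sdPart (c • E) X A B = (c : ℂ) ^ 2 * sdPart E X A B := by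
  simp only [sdPart, spin2_smul, Finset.mul_sum]
  exact Finset.sum_congr rfl fun _ _ => Finset.sum_congr rfl fun _ _ => by ring

theorem asdPart_smul (c : ℝ) (X : Fin 4 → Fin 4 → ℂ) (A B : Fin 2) :
    asdPart (c • E) X A B = (c : ℂ) ^ 2 * asdPart E X A B := by
  simp only [asdPart, spin2_smul, Finset.mul_sum]
  exact Finset.sum_congr rfl fun _ _ => Finset.sum_congr rfl fun _ _ => by ring

/-- Reads the Weyl spinor as an iterated anti-self-dual part, so that facts about two-forms apply to
each index pair separately. -/
theorem weylASD_eq (W : Fin 4 → Fin 4 → Fin 4 → Fin 4 → ℂ) (A B C D : Fin 2) :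
    weylASD E W A B C D = asdPart E (fun a b => asdPart E (fun c d => W a b c d) C D) A B := by
  have h : ∀ A' B' C' D', spin4 E W A A' B B' C C' D D'
      = spin2 E (fun a b => spin2 E (fun c d => W a b c d) C C' D D') A A' B B' := by
    intro A' B' C' D'
    simp only [spin4_eq, spin2_eq]
  simp only [weylASD, h]
  simp only [asdPart, spin2_mul_left, spin2_sum, Finset.mul_sum]
  exact Finset.sum_congr rfl fun _ _ => Finset.sum_congr rfl fun _ _ =>
    Finset.sum_congr rfl fun _ _ => Finset.sum_congr rfl fun _ _ => by ring

theorem asdPart_asdPart_swap (W : Fin 4 → Fin 4 → Fin 4 → Fin 4 → ℂ) (A B C D : Fin 2) :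
    asdPart E (fun a b => asdPart E (fun c d => W a b c d) C D) A B
      = asdPart E (fun c d => asdPart E (fun a b => W a b c d) A B) C D := by
  have h : ∀ C' D', asdPart E (fun a b => spin2 E (fun c d => W a b c d) C C' D D') A B
      = spin2 E (fun c d => asdPart E (fun a b => W a b c d) A B) C C' D D' := by
    intro C' D'
    change asdPart E (fun a b => ∑ i, ∑ j, tetrad E C C' i * tetrad E D D' j * W a b i j) A B = _
    simp only [asdPart_sum, asdPart_mul_left]
    rfl
  change asdPart E (fun a b => (1 / 2) * ∑ C', ∑ D', eps C' D' *
    spin2 E (fun c d => W a b c d) C C' D D') A B = _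
  simp only [asdPart_sum, asdPart_mul_left, h]
  rfl

theorem weylASD_eq_swap (W : Fin 4 → Fin 4 → Fin 4 → Fin 4 → ℂ) (A B C D : Fin 2) :
    weylASD E W A B C D = asdPart E (fun c d => asdPart E (fun a b => W a b c d) A B) C D := by
  rw [weylASD_eq, asdPart_asdPart_swap]

theorem weylASD_smul (c : ℝ) (W : Fin 4 → Fin 4 → Fin 4 → Fin 4 → ℂ) (A B C D : Fin 2) :
    weylASD (c • E) W A B C D = (c : ℂ) ^ 4 * weylASD E W A B C D := by
  simp only [weylASD_eq, asdPart_smul, asdPart_mul_left]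
  ring

end Linear

/-- On a two-dimensional space every antisymmetric bilinear form is a multiple of ε. A tensor that
is antisymmetric under exchange of index pairs is therefore symmetric ⊗ ε plus ε ⊗ symmetric. -/
theorem antisymm_decomp {Y : Fin 2 → Fin 2 → Fin 2 → Fin 2 → ℂ}
    (hY : ∀ A A' B B', Y A A' B B' = -Y B B' A A') (A A' B B' : Fin 2) :
    Y A A' B B' = (1 / 2) * (∑ C', ∑ D', eps C' D' * Y A C' B D') * eps A' B'
      + (1 / 2) * (∑ C, ∑ D, eps C D * Y C A' D B') * eps A B := by
  have h0 : ∀ A A', Y A A' A A' = 0 := fun A A' => by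
    have := hY A A' A A'; linear_combination (1 / 2) * this
  have h1 := hY 0 1 0 0
  have h2 := hY 1 0 0 0
  have h3 := hY 1 1 0 0
  have h4 := hY 1 0 0 1
  have h5 := hY 1 1 0 1
  have h6 := hY 1 1 1 0
  fin_cases A <;> fin_cases A' <;> fin_cases B <;> fin_cases B' <;>
    simp [eps, Fin.sum_univ_two, h0, h1, h2, h3, h4, h5, h6] <;> ring

theorem spin2_decomp (E : Fin 4 → Fin 4 → ℝ) {T : Fin 4 → Fin 4 → ℂ} (h : ∀ i j, T i j = -T j i)
    (A A' B B' : Fin 2) :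
    spin2 E T A A' B B' = asdPart E T A B * eps A' B' + sdPart E T A' B' * eps A B := by
  refine antisymm_decomp (Y := fun A A' B B' => spin2 E T A A' B B') (fun A A' B B' => ?_) A A' B B'
  rw [← spin2_swap, ← neg_one_mul, ← spin2_mul_left]
  congr 1
  funext i j
  rw [h j i]; ring

theorem spin2_unit (A A' B B' : Fin 2) :
    spin2 unitFrame (fun i j => (unitFrame i j : ℂ)) A A' B B' = eps A B * eps A' B' := by
  rw [spin2_unitFrame]
  fin_cases A <;> fin_cases A' <;> fin_cases B <;> fin_cases B' <;>
    simp [tau, unitFrame, eps, Fin.sum_univ_four] <;> norm_num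

/-- The metric in spinor form: contraction of two vectors. -/
def spinDot (X Y : Fin 2 → Fin 2 → ℂ) : ℂ :=
  ∑ A, ∑ B, eps A B * ∑ A', ∑ B', eps A' B' * (X A A' * Y B B')

/-- The inverse metric is ε^{AB}ε^{A'B'} in spinor form. -/
theorem sum_mul_eq_spinDot (X Y : Fin 4 → ℂ) :
    ∑ m, X m * Y m = spinDot (spin1 unitFrame X) (spin1 unitFrame Y) := by
  have h : ∀ A A' B B', spin1 unitFrame X A A' * spin1 unitFrame Y B B'
      = (1 / 2) * ∑ i, tau A A' i * ∑ j, tau B B' j * (X i * Y j) := fun A A' B B' => by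
    rw [← spin2_mul, spin2_unitFrame]
  simp only [spinDot, h, Fin.sum_univ_two, eps, tau, Fin.sum_univ_four]
  simp
  linear_combination (X 1 * Y 1 + X 3 * Y 3) * Complex.I_sq

/-! ### Spinor form of the change of connection -/

theorem spin1_unitFrame_tetrad (A A' B B' : Fin 2) :
    spin1 unitFrame (fun j => tetrad unitFrame A A' j) B B' = eps A B * eps A' B' := by
  rw [← spin2_unit, spin2, spin1, Finset.sum_comm]
  refine Finset.sum_congr rfl fun j _ => ?_
  have : ∀ i, tetrad unitFrame A A' i * tetrad unitFrame B B' j * (unitFrame i j : ℂ)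
      = tetrad unitFrame B B' j * if i = j then tetrad unitFrame A A' i else 0 := by
    intro i
    unfold unitFrame
    split_ifs <;> simp; ring
  simp only [this, ← Finset.mul_sum, Finset.sum_ite_eq', Finset.mem_univ, if_true]

theorem sum_spin1 (E : Fin 4 → Fin 4 → ℝ) (T : Fin 4 → Fin 4 → ℂ) (A A' B B' : Fin 2) :
    spin1 E (fun k => spin1 E (fun i => T i k) A A') B B' = spin2 E T A A' B B' := by
  simp only [spin1, spin2, Finset.mul_sum]
  rw [Finset.sum_comm]
  exact Finset.sum_congr rfl fun _ _ => Finset.sum_congr rfl fun _ _ => by ring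

theorem sum_spin1_right (E : Fin 4 → Fin 4 → ℝ) (T : Fin 4 → Fin 4 → ℂ) (A A' B B' : Fin 2) :
    spin1 E (fun k => spin1 E (fun i => T k i) A A') B B' = spin2 E T B B' A A' := by
  rw [← spin2_swap]; exact sum_spin1 _ _ _ _ _ _

/-- The change of `∇ₑ T_{jk}` under a conformal rescaling, up to a multiple of `Uₑ T_{jk}`. -/
def confTerm (U : Fin 4 → ℂ) (T : Fin 4 → Fin 4 → ℂ) (e j k : Fin 4) : ℂ :=
  U j * T e k + U k * T j e - (unitFrame e j : ℂ) * ∑ m, U m * T m k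
    - (unitFrame e k : ℂ) * ∑ m, U m * T j m

theorem sum_tetrad_confTerm (U : Fin 4 → ℂ) (T : Fin 4 → Fin 4 → ℂ) (A A' : Fin 2) (j k : Fin 4) :
    ∑ e, tetrad unitFrame A A' e * confTerm U T e j k
      = U j * spin1 unitFrame (fun i => T i k) A A' + spin1 unitFrame (fun i => T j i) A A' * U k
        - tetrad unitFrame A A' j * (∑ m, U m * T m k)
        - (∑ m, U m * T j m) * tetrad unitFrame A A' k := by
  have h : ∀ j, ∑ e, tetrad unitFrame A A' e * (unitFrame e j : ℂ) = tetrad unitFrame A A' j := by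
    intro j
    simp [unitFrame, apply_ite Complex.ofReal]
  rw [← h j, ← h k]
  simp only [confTerm, spin1, Finset.mul_sum, Finset.sum_mul, mul_add, mul_sub,
    Finset.sum_add_distrib, Finset.sum_sub_distrib]
  congr 1
  · congr 1
    · congr 1 <;> exact Finset.sum_congr rfl fun _ _ => by ring
    · rw [Finset.sum_comm]
      exact Finset.sum_congr rfl fun _ _ => Finset.sum_congr rfl fun _ _ => by ring
  · exact Finset.sum_congr rfl fun _ _ => Finset.sum_congr rfl fun _ _ => by ring

theorem spin2_confTerm (U : Fin 4 → ℂ) (T : Fin 4 → Fin 4 → ℂ) (A A' B B' C C' : Fin 2) :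
    spin2 unitFrame (fun j k => ∑ e, tetrad unitFrame A A' e * confTerm U T e j k) B B' C C'
      = spin1 unitFrame U B B' * spin2 unitFrame T A A' C C'
        + spin2 unitFrame T B B' A A' * spin1 unitFrame U C C'
        - eps A B * eps A' B' * spinDot (spin1 unitFrame U)
            (fun D D' => spin2 unitFrame T D D' C C')
        - spinDot (spin1 unitFrame U) (fun D D' => spin2 unitFrame T B B' D D')
            * (eps A C * eps A' C') := by
  simp only [sum_tetrad_confTerm, sum_mul_eq_spinDot]
  simp only [spin2_sub, spin2_add, spin2_mul, sum_spin1, spin1_unitFrame_tetrad]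
  have h2 : ∀ C C', spin1 unitFrame (fun k => spinDot (spin1 unitFrame U)
      (spin1 unitFrame fun m => T m k)) C C'
      = spinDot (spin1 unitFrame U) (fun D D' => spin2 unitFrame T D D' C C') := fun C C' => by
    simp only [spinDot, ← sum_spin1, spin1_sum, spin1_mul_left]
  have h3 : ∀ B B', spin1 unitFrame (fun j => spinDot (spin1 unitFrame U)
      (spin1 unitFrame fun m => T j m)) B B'
      = spinDot (spin1 unitFrame U) (fun D D' => spin2 unitFrame T B B' D D') := fun B B' => by
    simp only [spinDot, ← sum_spin1_right, spin1_sum, spin1_mul_left]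
  rw [h2, spin2_swap]
  linear_combination spin1 unitFrame U C C' * spin2_swap unitFrame T A A' B B'
    - eps A C * eps A' C' * h3 B B'

/-- Together with the scaling of ε_{B'C'}, this is the rule ∇̂_{AA'}μ_B = ∇_{AA'}μ_B − Υ_{BA'}μ_A
applied to both indices of the form: the direction index is exchanged with each spinor index in
turn. -/
theorem asdPart_confTerm (U : Fin 4 → ℂ) {T : Fin 4 → Fin 4 → ℂ} (h : ∀ i j, T i j = -T j i)
    (hsd : ∀ A B, sdPart unitFrame T A B = 0) (A A' B C : Fin 2) :
    asdPart unitFrame (fun j k => ∑ e, tetrad unitFrame A A' e * confTerm U T e j k) B C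
      = -spin1 unitFrame U A A' * asdPart unitFrame T B C
        + spin1 unitFrame U B A' * asdPart unitFrame T A C
        + spin1 unitFrame U C A' * asdPart unitFrame T A B := by
  have hT : ∀ A A' B B', spin2 unitFrame T A A' B B' = asdPart unitFrame T A B * eps A' B' := by
    intro A A' B B'; rw [spin2_decomp _ h, hsd]; ring
  have hs := asdPart_symm unitFrame h 1 0
  rw [asdPart]
  simp only [spin2_confTerm, hT, spinDot, Fin.sum_univ_two]
  fin_cases A <;> fin_cases A' <;> fin_cases B <;> fin_cases C <;> simp [eps, hs] <;> ring

theorem sdPart_confTerm (U : Fin 4 → ℂ) {T : Fin 4 → Fin 4 → ℂ} (h : ∀ i j, T i j = -T j i)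
    (hsd : ∀ A B, asdPart unitFrame T A B = 0) (A A' B C : Fin 2) :
    sdPart unitFrame (fun j k => ∑ e, tetrad unitFrame A A' e * confTerm U T e j k) B C
      = -spin1 unitFrame U A A' * sdPart unitFrame T B C
        + spin1 unitFrame U A B * sdPart unitFrame T A' C
        + spin1 unitFrame U A C * sdPart unitFrame T A' B := by
  have hT : ∀ A A' B B', spin2 unitFrame T A A' B B' = sdPart unitFrame T A' B' * eps A B := by
    intro A A' B B'; rw [spin2_decomp _ h, hsd]; ring
  have hs := sdPart_symm unitFrame h 1 0
  rw [sdPart]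
  simp only [spin2_confTerm, hT, spinDot, Fin.sum_univ_two]
  fin_cases A <;> fin_cases A' <;> fin_cases B <;> fin_cases C <;> simp [eps, hs] <;> ring

/-- Gives the contraction of two one-forms over a primed index, symmetrised in the unprimed ones, a
tensorial meaning; the terms Υ K in the rescaled ρ are of this kind. -/
theorem asdPart_wedge (E : Fin 4 → Fin 4 → ℝ) (X Y : Fin 4 → ℂ) (A B : Fin 2) :
    asdPart E (fun i j => X i * Y j - Y i * X j) A B
      = (1 / 2) * ∑ C', (spin1 E X A C' * raise (spin1 E Y B) C'
        + spin1 E X B C' * raise (spin1 E Y A) C') := by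
  rw [asdPart]
  simp only [spin2_sub, spin2_mul, raise, Fin.sum_univ_two]
  fin_cases A <;> fin_cases B <;> simp [eps] <;> ring

theorem MetricOn.weyl_cyclic {g : Fin 4 → Fin 4 → E4 → ℝ} {V : Set E4} {y : E4}
    (hg : MetricOn g V) (hy : y ∈ V) (a b c d : Fin 4) :
    weyl g a b c d y + weyl g b c a d y + weyl g c a b d y = 0 := by
  simp only [weyl_eq]
  rw [hg.symm y hy b a, hg.symm y hy c a, hg.symm y hy c b, hg.schouten_symm hy b a,
    hg.schouten_symm hy c a, hg.schouten_symm hy c b]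
  linear_combination hg.riemann_cyclic hy a b c d

/-! ### Algebraic Weyl tensors -/

/-- The algebraic symmetries of a Weyl tensor in an orthonormal frame. -/
structure WeylLike (W : Fin 4 → Fin 4 → Fin 4 → Fin 4 → ℝ) : Prop where
  antisymm_left : ∀ a b c d, W a b c d = -W b a c d
  antisymm_right : ∀ a b c d, W a b c d = -W a b d c
  pair : ∀ a b c d, W a b c d = W c d a b
  cyclic : ∀ a b c d, W a b c d + W b c a d + W c a b d = 0
  trace : ∀ a c, ∑ b, W a b c b = 0

/-- Given the symmetries inside and between the pairs, the only index pattern on which total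
symmetry could fail is two zeros and two ones. The single identity `e` settles it. -/
theorem swap_mid_of_swap_left {f : Fin 2 → Fin 2 → Fin 2 → Fin 2 → ℂ}
    (s : ∀ A B C D, f A B C D = f B A C D) (p : ∀ A B C D, f A B C D = f C D A B)
    (e : f 0 0 1 1 = f 0 1 0 1) (A B C D : Fin 2) : f A B C D = f A C B D := by
  have q : f 1 1 0 0 = f 1 0 1 0 := by rw [p 1 1, e, s 1 0, p 0 1 1 0, s 1 0]
  have q1 : f 0 0 1 0 = f 0 1 0 0 := by rw [p 0 0, s]
  have q3 : f 1 0 1 1 = f 1 1 0 1 := by rw [p 1 1 0 1, s]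
  fin_cases A <;> fin_cases B <;> fin_cases C <;> fin_cases D
  exacts [rfl, rfl, q1, e, q1.symm, e.symm, rfl, rfl, rfl, rfl, q.symm, q3, q, q3.symm, rfl, rfl]

namespace WeylLike

variable {W : Fin 4 → Fin 4 → Fin 4 → Fin 4 → ℝ} (h : WeylLike W)

include h

/-- Trace and cyclic equations solved for the redundant entries of W, viewed as a symmetric matrix
on the six index pairs. Of the 21 entries these eleven relations leave ten. -/
theorem relations : W 2 3 2 3 = W 0 1 0 1 ∧ W 1 3 1 3 = W 0 2 0 2 ∧ W 1 2 1 2 = W 0 3 0 3 ∧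
    W 0 3 0 3 = -W 0 1 0 1 - W 0 2 0 2 ∧ W 1 3 2 3 = -W 0 1 0 2 ∧ W 1 2 2 3 = W 0 1 0 3 ∧
    W 1 2 1 3 = -W 0 2 0 3 ∧ W 0 2 1 2 = -W 0 3 1 3 ∧ W 0 1 1 2 = W 0 3 2 3 ∧
    W 0 1 1 3 = -W 0 2 2 3 ∧ W 0 3 1 2 = W 0 2 1 3 - W 0 1 2 3 := by
  have a1 := h.trace 0 0
  have a2 := h.trace 1 1
  have a3 := h.trace 2 2
  have a4 := h.trace 3 3
  have b1 := h.trace 1 2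
  have b2 := h.trace 1 3
  have b3 := h.trace 2 3
  have b4 := h.trace 0 1
  have b5 := h.trace 0 2
  have b6 := h.trace 0 3
  have c1 := h.cyclic 0 1 2 3
  have l := h.antisymm_left
  have r := h.antisymm_right
  have p := h.pair
  have z : ∀ a c d, W a a c d = 0 := fun a c d => by linarith [l a a c d]
  have z' : ∀ a b c, W a b c c = 0 := fun a b c => by linarith [r a b c c]
  have lr : ∀ a b, W a b a b = W b a b a := fun a b => by rw [l, r]; ring
  simp only [Fin.sum_univ_four, z, z', zero_add] at a1 a2 a3 a4 b1 b2 b3 b4 b5 b6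
  have e1 := lr 0 1
  have e2 := lr 0 2
  have e3 := lr 0 3
  have e4 := lr 1 2
  have e5 := lr 1 3
  have e6 := lr 2 3
  refine ⟨by linarith, by linarith, by linarith, by linarith, ?_, ?_, ?_, ?_, ?_, ?_, ?_⟩
  · linarith [l 1 0 2 0, r 0 1 2 0]
  · linarith [l 1 0 3 0, r 0 1 3 0, r 1 2 3 2]
  · linarith [l 2 0 3 0, r 0 2 3 0, l 2 1 3 1, r 1 2 3 1]
  · linarith
  · linarith [r 0 2 1 2, r 0 1 2 1, r 0 3 2 3]
  · linarith [r 0 1 3 1, r 0 2 3 2]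
  · linarith [l 2 0 1 3, p 1 2 0 3]

/-- The mixed block of a curvature operator between Λ²₊ and Λ²₋ is its trace-free Ricci part, which
a Weyl tensor lacks. -/
theorem sdPart_asdPart (A' B' C D : Fin 2) :
    sdPart unitFrame (fun a b => asdPart unitFrame (fun c d => (W a b c d : ℂ)) C D) A' B' = 0 := by
  have l : ∀ a b C D, asdPart unitFrame (fun c d => (W a b c d : ℂ)) C D
      = -asdPart unitFrame (fun c d => (W b a c d : ℂ)) C D := by
    intro a b C D
    rw [← neg_one_mul, ← asdPart_mul_left]
    congr 1; funext c d; rw [h.antisymm_left]; push_cast; ring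
  have r : ∀ a b c d, W a b c d = -W a b d c := h.antisymm_right
  obtain ⟨r1, r2, r3, r4, r5, r6, r7, r8, r9, r10, r11⟩ := h.relations
  have p := h.pair
  -- If X + sY is self-dual, then the anti-self-dual parts of X and Y agree up to the factor −s.
  -- This is used for the pairs of rows (01, 23), (02, 13) and (03, 12).
  have key : ∀ (s : ℝ) (X Y : Fin 4 → Fin 4 → ℝ), (∀ i j, X i j = -X j i) →
      (∀ i j, Y i j = -Y j i) → X 0 1 + s * Y 0 1 = X 2 3 + s * Y 2 3 →
      X 0 2 + s * Y 0 2 = -(X 1 3 + s * Y 1 3) → X 0 3 + s * Y 0 3 = X 1 2 + s * Y 1 2 →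
      asdPart unitFrame (fun c d => (X c d : ℂ)) C D
        = -s * asdPart unitFrame (fun c d => (Y c d : ℂ)) C D := by
    intro s X Y hX hY e1 e2 e3
    have := (asdPart_unitFrame_eq_zero_iff (T := fun c d => (X c d : ℂ) + (s : ℂ) * (Y c d : ℂ))
      (fun i j => by rw [hX, hY]; push_cast; ring)).2
      ⟨by exact_mod_cast e1, by exact_mod_cast e2, by exact_mod_cast e3⟩ C D
    rw [asdPart_add, asdPart_mul_left] at this
    linear_combination this
  refine (sdPart_unitFrame_eq_zero_iff fun a b => l a b C D).2 ⟨?_, ?_, ?_⟩ A' B'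
  · have := key 1 (W 0 1) (W 2 3) (r _ _) (r _ _) (by linarith [p 2 3 0 1])
      (by linarith [p 2 3 0 2, p 2 3 1 3]) (by linarith [p 2 3 0 3, p 2 3 1 2])
    simpa using this
  · have := key (-1) (W 0 2) (W 1 3) (r _ _) (r _ _) (by linarith [p 0 2 0 1, p 1 3 0 1])
      (by linarith [p 1 3 0 2]) (by linarith [p 1 3 0 3, p 1 3 1 2])
    simpa using this
  · have := key 1 (W 0 3) (W 1 2) (r _ _) (r _ _) (by linarith [p 0 3 0 1, p 1 2 0 1])
      (by linarith [p 1 2 0 2, p 0 3 0 2]) (by linarith [p 1 2 0 3])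
    simpa using this

theorem weylASD_swap_left (A B C D : Fin 2) :
    weylASD unitFrame (fun a b c d => (W a b c d : ℂ)) A B C D
      = weylASD unitFrame (fun a b c d => (W a b c d : ℂ)) B A C D := by
  rw [weylASD_eq, weylASD_eq]
  refine asdPart_symm _ (fun a b => ?_) _ _
  rw [← neg_one_mul, ← asdPart_mul_left]
  congr 1; funext c d; rw [h.antisymm_left]; push_cast; ring

theorem weylASD_pair (A B C D : Fin 2) :
    weylASD unitFrame (fun a b c d => (W a b c d : ℂ)) A B C D
      = weylASD unitFrame (fun a b c d => (W a b c d : ℂ)) C D A B := by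
  rw [weylASD_eq, weylASD_eq_swap]
  simp only [h.pair]

theorem weylASD_swap_mid (A B C D : Fin 2) :
    weylASD unitFrame (fun a b c d => (W a b c d : ℂ)) A B C D
      = weylASD unitFrame (fun a b c d => (W a b c d : ℂ)) A C B D := by
  have l : ∀ a b C D, asdPart unitFrame (fun c d => (W a b c d : ℂ)) C D
      = -asdPart unitFrame (fun c d => (W b a c d : ℂ)) C D := by
    intro a b C D
    rw [← neg_one_mul, ← asdPart_mul_left]
    congr 1; funext c d; rw [h.antisymm_left]; push_cast; ring
  have r : ∀ a b c d, (W a b c d : ℂ) = -(W a b d c : ℂ) := fun a b c d => by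
    rw [h.antisymm_right]; push_cast; ring
  -- This is the vanishing of the trace of the anti-self-dual block of W, the place where a scalar
  -- curvature would appear.
  have e : weylASD unitFrame (fun a b c d => (W a b c d : ℂ)) 0 0 1 1
      = weylASD unitFrame (fun a b c d => (W a b c d : ℂ)) 0 1 0 1 := by
    rw [weylASD_eq, weylASD_eq, asdPart_unitFrame_zero_zero fun a b => l a b _ _,
      asdPart_unitFrame_zero_one fun a b => l a b _ _]
    simp only [asdPart_unitFrame_one_one (r _ _), asdPart_unitFrame_zero_one (r _ _)]
    obtain ⟨r1, r2, r3, r4, -, -, -, -, -, -, r11⟩ := h.relations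
    rw [h.pair 1 3 0 2, h.pair 1 2 0 3, h.pair 2 3 0 1, h.pair 1 3 0 3, h.pair 1 3 1 2,
      h.pair 0 3 0 2, h.pair 1 2 0 2, r1, r2, r3, r4, r11]
    push_cast
    ring_nf
    simp only [Complex.I_sq]
    ring
  exact swap_mid_of_swap_left h.weylASD_swap_left h.weylASD_pair e A B C D

end WeylLike

theorem NormalAt.weylLike {g : Fin 4 → Fin 4 → E4 → ℝ} {V : Set E4} (hn : NormalAt g V) :
    WeylLike fun a b c d => weyl g a b c d 0 where
  antisymm_left a b c d := weyl_antisymm_left g a b c d 0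
  antisymm_right a b c d := hn.metricOn.weyl_antisymm_right hn.zero_mem a b c d
  pair a b c d := hn.metricOn.weyl_pair hn.zero_mem a b c d
  cyclic a b c d := hn.metricOn.weyl_cyclic hn.zero_mem a b c d
  trace a c := by
    have := hn.metricOn.weyl_trace hn.zero_mem a c
    simpa only [hn.inv_eq, sum_unitFrame_mul] using this

/-! ### Frame components -/

theorem spin1_eq_unitFrame (E : Fin 4 → Fin 4 → ℝ) (X : Fin 4 → ℂ) :
    spin1 E X = spin1 unitFrame fun a => ∑ i, (E a i : ℂ) * X i := by
  funext A A'
  simp only [spin1, tetrad_unitFrame]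
  simp only [tetrad, Finset.mul_sum, Finset.sum_mul]
  rw [Finset.sum_comm]
  exact Finset.sum_congr rfl fun _ _ => Finset.sum_congr rfl fun _ _ => by ring

theorem sdPart_eq_unitFrame (E T : Fin 4 → Fin 4 → ℝ) :
    sdPart E (fun i j => (T i j : ℂ)) = sdPart unitFrame fun i j => (frameComp E T i j : ℂ) := by
  funext A B; simp only [sdPart, spin2_frameComp E T]

theorem asdPart_eq_unitFrame (E T : Fin 4 → Fin 4 → ℝ) :
    asdPart E (fun i j => (T i j : ℂ)) = asdPart unitFrame fun i j => (frameComp E T i j : ℂ) := by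
  funext A B; simp only [asdPart, spin2_frameComp E T]

theorem eq_zero_of_sum_frame {E : Fin 4 → Fin 4 → ℝ} (hE : 0 < (Matrix.of E).det)
    {X : Fin 4 → ℝ} (h : ∀ a, ∑ i, E a i * X i = 0) : X = 0 := by
  have : IsUnit (Matrix.of E).det := isUnit_iff_ne_zero.2 hE.ne'
  have h1 : (Matrix.of E).mulVec X = (Matrix.of E).mulVec 0 := by
    funext a; rw [Matrix.mulVec_zero]; exact h a
  exact Matrix.mulVec_injective_of_isUnit ((Matrix.isUnit_iff_isUnit_det _).2 this) h1

/-- For a real one-form, the real and imaginary parts of the components 00' and 01' already give all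
four components. -/
theorem spin1_unitFrame_eq_zero {X : Fin 4 → ℝ}
    (h : ∀ A A', spin1 unitFrame (fun i => (X i : ℂ)) A A' = 0) : X = 0 := by
  have h2 : ((Real.sqrt 2 : ℝ) : ℂ) ≠ 0 := by
    rw [Complex.ofReal_ne_zero]; positivity
  have h00 := h 0 0
  have h01 := h 0 1
  simp [spin1, tetrad_unitFrame, sigma, Fin.sum_univ_four] at h00 h01
  field_simp at h00 h01
  have a0 := congrArg Complex.re h00
  have a1 := congrArg Complex.im h00
  have a2 := congrArg Complex.re h01
  have a3 := congrArg Complex.im h01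
  simp at a0 a1 a2 a3
  funext i
  fin_cases i
  exacts [a0, a1, a2, a3]

theorem eq_of_spin1_eq {E : Fin 4 → Fin 4 → ℝ} (hE : 0 < (Matrix.of E).det) {X Y : Fin 4 → ℝ}
    (h : ∀ A A', spin1 E (fun i => (X i : ℂ)) A A' = spin1 E (fun i => (Y i : ℂ)) A A') :
    X = Y := by
  refine sub_eq_zero.1 (eq_zero_of_sum_frame hE (congrFun (spin1_unitFrame_eq_zero (fun A A' => ?_))))
  have h1 := sub_eq_zero.2 (h A A')
  rw [spin1_eq_unitFrame E, spin1_eq_unitFrame E, sub_eq_add_neg, ← neg_one_mul, ← spin1_mul_left,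
    ← spin1_add] at h1
  rw [← h1]
  congr 1
  funext i
  simp [mul_add, Finset.sum_add_distrib, sub_eq_add_neg]

theorem eq_zero_of_dualRel {b : Fin 4 → Fin 4 → ℝ} (h : ∀ i j, b i j = -b j i) (h1 : DualRel 1 b)
    (h2 : DualRel (-1) b) : b = 0 := by
  obtain ⟨p1, p2, p3⟩ := h1
  obtain ⟨q1, q2, q3⟩ := h2
  have z : ∀ i, b i i = 0 := fun i => by linarith [h i i]
  funext i j
  fin_cases i <;> fin_cases j <;> simp [z] <;>
    linarith [h 0 1, h 0 2, h 0 3, h 1 2, h 1 3, h 2 3]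

theorem eq_zero_of_frameComp {E T : Fin 4 → Fin 4 → ℝ} (hE : 0 < (Matrix.of E).det)
    (h : frameComp E T = 0) : T = 0 := by
  have h1 : ∀ b, (fun i => ∑ j, E b j * T i j) = 0 := fun b =>
    eq_zero_of_sum_frame hE fun a => congrFun (congrFun h a) b
  funext i
  exact eq_zero_of_sum_frame hE fun b => congrFun (h1 b) i

/-- A two-form is determined by its self-dual and anti-self-dual parts. -/
theorem eq_of_parts_eq {E S T : Fin 4 → Fin 4 → ℝ} (hE : 0 < (Matrix.of E).det)
    (hS : ∀ i j, S i j = -S j i) (hT : ∀ i j, T i j = -T j i)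
    (h1 : ∀ A B, sdPart E (fun i j => (S i j : ℂ)) A B = sdPart E (fun i j => (T i j : ℂ)) A B)
    (h2 : ∀ A B, asdPart E (fun i j => (S i j : ℂ)) A B = asdPart E (fun i j => (T i j : ℂ)) A B) :
    S = T := by
  have ha : ∀ i j, S i j - T i j = -(S j i - T j i) := fun i j => by rw [hS, hT]; ring
  have h0 := eq_zero_of_frameComp hE (T := fun i j => S i j - T i j)
    (eq_zero_of_dualRel (frameComp_antisymm ha)
      ((asdPart_eq_zero_iff ha).1 fun A B => by
        push_cast; rw [asdPart_sub, h2, sub_self])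
      ((sdPart_eq_zero_iff ha).1 fun A B => by
        push_cast; rw [sdPart_sub, h1, sub_self]))
  funext i j
  exact sub_eq_zero.1 (congrFun (congrFun h0 i) j)

/-- In spinors a self-dual form is a symmetric primed spinor times ε_{AB}, so contraction with it
acts on the primed index alone. -/
theorem spin1_contract {T : Fin 4 → Fin 4 → ℂ} (h : ∀ i j, T i j = -T j i)
    (hsd : ∀ A B, asdPart unitFrame T A B = 0) (X : Fin 4 → ℂ) (A A' : Fin 2) :
    spin1 unitFrame (fun j => ∑ k, T j k * X k) A A'
      = ∑ C', spin1 unitFrame X A C' * raise (sdPart unitFrame T A') C' := by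
  have hT : ∀ A A' B B', spin2 unitFrame T A A' B B' = sdPart unitFrame T A' B' * eps A B := by
    intro A A' B B'; rw [spin2_decomp _ h, hsd]; ring
  simp only [sum_mul_eq_spinDot]
  have h3 : spin1 unitFrame (fun j => spinDot (spin1 unitFrame fun k => T j k)
      (spin1 unitFrame X)) A A'
      = spinDot (fun D D' => spin2 unitFrame T A A' D D') (spin1 unitFrame X) := by
    simp only [spinDot, ← sum_spin1_right, spin1_sum, spin1_mul_left, mul_comm _
      (spin1 unitFrame X _ _)]
  refine h3.trans ?_
  have hs := sdPart_symm unitFrame h 1 0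
  simp only [hT, spinDot, raise, Fin.sum_univ_two]
  fin_cases A <;> fin_cases A' <;> simp [eps, hs] <;> ring

/-- The contraction `ω_{jk} g^{kl} U_l` of a two-form with a one-form. -/
def contract (g om : Fin 4 → Fin 4 → E4 → ℝ) (U : Fin 4 → E4 → ℝ) (j : Fin 4) (z : E4) : ℝ :=
  ∑ k, ∑ l, metricInv g k l z * (om j k z * U l z)

theorem IsOrientedFrame.sum_contract {g om : Fin 4 → Fin 4 → E4 → ℝ} {z : E4}
    {E : Fin 4 → Fin 4 → ℝ} (hE : IsOrientedFrame g z E) (U : Fin 4 → E4 → ℝ) (a : Fin 4) :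
    ∑ j, E a j * contract g om U j z
      = ∑ b, frameComp E (fun i j => om i j z) a b * ∑ l, E b l * U l z := by
  simp only [contract, hE.inv_eq, frameComp, Finset.mul_sum, Finset.sum_mul]
  have h : ∀ f : Fin 4 → Fin 4 → Fin 4 → Fin 4 → ℝ,
      ∑ j, ∑ k, ∑ l, ∑ b, f j k l b = ∑ b, ∑ l, ∑ j, ∑ k, f j k l b := by
    intro f
    rw [Finset.sum_comm]
    simp only [Fin.sum_univ_four]
    ring
  rw [h]
  exact Finset.sum_congr rfl fun _ _ => Finset.sum_congr rfl fun _ _ =>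
    Finset.sum_congr rfl fun _ _ => Finset.sum_congr rfl fun _ _ => by ring

theorem IsOrientedFrame.spin1_contract {g om : Fin 4 → Fin 4 → E4 → ℝ} {z : E4}
    {E : Fin 4 → Fin 4 → ℝ} (hE : IsOrientedFrame g z E) (h : ∀ i j, om i j z = -om j i z)
    (hsd : ∀ A B, asdPart E (fun i j => (om i j z : ℂ)) A B = 0) (U : Fin 4 → E4 → ℝ)
    (A A' : Fin 2) :
    spin1 E (fun j => (contract g om U j z : ℂ)) A A'
      = ∑ C', spin1 E (fun i => (U i z : ℂ)) A C'
        * raise (sdPart E (fun i j => (om i j z : ℂ)) A') C' := by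
  rw [spin1_eq_unitFrame E, spin1_eq_unitFrame E, sdPart_eq_unitFrame]
  rw [← ConfKahler.spin1_contract (fun i j => by rw [frameComp_antisymm h]; push_cast; rfl)
    (fun A B => by rw [← asdPart_eq_unitFrame, hsd])]
  congr 1
  funext a
  exact_mod_cast hE.sum_contract U a

/-! ### Algebraic identities for the conformal change of the prolongation connection -/

section Algebra

/-- The contraction `U_{BC'} ω_{B'}{}^{C'}`. -/
def spinContract (U w : Fin 2 → Fin 2 → ℂ) (B B' : Fin 2) : ℂ := ∑ C', U B C' * raise (w B') C'

/-- The anti-self-dual part of the wedge product of two one-forms. -/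
def spinWedge (X Y : Fin 2 → Fin 2 → ℂ) (A B : Fin 2) : ℂ :=
  (1 / 2) * ∑ C', (X A C' * raise (Y B) C' + X B C' * raise (Y A) C')

variable {U k w r : Fin 2 → Fin 2 → ℂ} {DU dw dk p : Fin 2 → Fin 2 → Fin 2 → Fin 2 → ℂ}

/-- Collects the terms of the third transformation rule into the anti-self-dual part of one wedge
product, Υ ∧ (2K + Υ⌟ω). In this form the rule can be differentiated as an identity of tensors. -/
theorem rescale_snd_snd (hw : w 1 0 = w 0 1) (A B : Fin 2) :
    r A B + ∑ C', (U A C' * raise (k B) C' + U B C' * raise (k A) C')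
      + ∑ C', ∑ D', raise (fun F' => raise (w F') D') C' * U A C' * U B D'
    = r A B + spinWedge U (fun B B' => 2 * k B B' + spinContract U w B B') A B := by
  simp only [spinWedge, spinContract, raise, Fin.sum_univ_two]
  fin_cases A <;> fin_cases B <;> simp [eps, hw] <;> ring

/-- Antisymmetrising U_{AB'}ω_{A'C'} in A'B' gives a multiple of ε_{A'B'}, the coefficient being the
contraction of U with ω. The connection terms are therefore cancelled by the shift of K. -/
theorem conf_fst (hw : w 1 0 = w 0 1) (d : ℂ) (A A' B' C' : Fin 2) :
    d + U A A' * w B' C' - (-U A A' * w B' C' + U A B' * w A' C' + U A C' * w A' B')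
      - eps A' B' * (k A C' + spinContract U w A C') - eps A' C' * (k A B' + spinContract U w A B')
    = d - eps A' B' * k A C' - eps A' C' * k A B' := by
  simp only [spinContract, raise, Fin.sum_univ_two]
  fin_cases A <;> fin_cases A' <;> fin_cases B' <;> fin_cases C' <;> simp [eps, hw] <;> ring

/-- The derivative of Υ⌟ω produces Υ⌟∇ω and (∇Υ)⌟ω. The latter cancels against the change of P, as
do the quadratic terms; what survives is the second row plus Υ contracted with the first row, as the
transformation rule demands. -/
theorem conf_snd (hw : w 1 0 = w 0 1) (A A' B B' : Fin 2) :
    U A A' * (k B B' + spinContract U w B B')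
      + (dk A A' B B' + (spinContract U (dw A A') B B' + spinContract (DU A A') w B B'))
      - (k A A' + spinContract U w A A') * U B B' - U A A' * (k B B' + spinContract U w B B')
      + eps A B * eps A' B' * spinDot U (fun B B' => k B B' + spinContract U w B B')
      + ∑ C', (p A A' B C' - (DU A A' B C' - U A A' * U B C'
        + (1 / 2) * spinDot U U * (eps A B * eps A' C'))) * raise (w B') C'
      - eps A' B' * (r A B + spinWedge U (fun B B' => 2 * k B B' + spinContract U w B B') A B)
    = dk A A' B B' + ∑ C', p A A' B C' * raise (w B') C' - eps A' B' * r A B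
      + spinContract U (fun B' C' => dw A A' B' C' - eps A' B' * k A C' - eps A' C' * k A B')
        B B' := by
  simp only [spinContract, spinWedge, spinDot, raise, Fin.sum_univ_two]
  fin_cases A <;> fin_cases A' <;> fin_cases B <;> fin_cases B' <;> simp [eps, hw] <;> ring

/-- The change of ∇ψ, contracted with ω, cancels the term in which the shift Υ⌟ω of K is contracted
with ψ. Total symmetry reduces ψ to five components, and the identity is then a finite check. -/
theorem conf_thd_psi {ψ : Fin 2 → Fin 2 → Fin 2 → Fin 2 → ℂ}
    (s : ∀ A B C D, ψ A B C D = ψ B A C D) (hp : ∀ A B C D, ψ A B C D = ψ C D A B)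
    (hm : ∀ A B C D, ψ A B C D = ψ A C B D) (hw : w 1 0 = w 0 1) (A A' B C : Fin 2) :
    ∑ E', ∑ D, raise (w A') E' * raise (fun F => U A E' * ψ F B C D + U B E' * ψ A F C D
        + U C E' * ψ A B F D + U D E' * ψ A B C F) D
      + ∑ D, raise (fun F => spinContract U w F A') D * ψ A B C D = 0 := by
  have r : ∀ A B C D, ψ A B C D = ψ A B D C := fun A B C D => by rw [hp, s, hp]
  have e1 : ψ 0 0 1 0 = ψ 0 0 0 1 := r _ _ _ _
  have e2 : ψ 0 1 0 0 = ψ 0 0 0 1 := by rw [hm, e1]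
  have e3 : ψ 1 0 0 0 = ψ 0 0 0 1 := by rw [s, e2]
  have f1 : ψ 0 1 0 1 = ψ 0 0 1 1 := hm _ _ _ _
  have f2 : ψ 0 1 1 0 = ψ 0 0 1 1 := by rw [r, f1]
  have f3 : ψ 1 0 0 1 = ψ 0 0 1 1 := by rw [s, f1]
  have f4 : ψ 1 0 1 0 = ψ 0 0 1 1 := by rw [s, f2]
  have f5 : ψ 1 1 0 0 = ψ 0 0 1 1 := hp _ _ _ _
  have g1 : ψ 1 0 1 1 = ψ 0 1 1 1 := s _ _ _ _
  have g2 : ψ 1 1 0 1 = ψ 0 1 1 1 := by rw [hp]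
  have g3 : ψ 1 1 1 0 = ψ 0 1 1 1 := by rw [r, g2]
  simp only [spinContract, raise, Fin.sum_univ_two]
  fin_cases A <;> fin_cases A' <;> fin_cases B <;> fin_cases C <;>
    simp [eps, hw, e1, e2, e3, f1, f2, f3, f4, f5, g1, g2, g3] <;> ring

/-- The part of the third row that does not contain ψ. Terms with ∇Υ cancel against the change of P,
and the surviving terms linear and quadratic in Υ are contractions of the second and first rows. The
abbreviations `R`, `Y` and `Z` stand for ρ plus the wedge, for 2K + Υ⌟ω and for K + Υ⌟ω. -/
theorem conf_thd (hw : w 1 0 = w 0 1) (hr : r 1 0 = r 0 1) (hdw : ∀ A A', dw A A' 1 0 = dw A A' 0 1)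
    {R Y Z : Fin 2 → Fin 2 → ℂ}
    (hZ : ∀ B B', Z B B' = k B B' + spinContract U w B B')
    (hY : ∀ B B', Y B B' = 2 * k B B' + spinContract U w B B')
    (hR : ∀ A B, R A B = r A B + spinWedge U Y A B)
    (d : ℂ) (A A' B C : Fin 2) :
    U A A' * R B C + (d + (spinWedge (DU A A') Y B C + spinWedge U (fun B B' => 2 * dk A A' B B' +
        (spinContract U (dw A A') B B' + spinContract (DU A A') w B B')) B C))
      - 2 * U A A' * R B C - (-U A A' * R B C + U B A' * R A C + U C A' * R A B)
      + ∑ E', ((p A A' B E' - (DU A A' B E' - U A A' * U B E'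
          + (1 / 2) * spinDot U U * (eps A B * eps A' E'))) * raise (Z C) E'
        + (p A A' C E' - (DU A A' C E' - U A A' * U C E'
          + (1 / 2) * spinDot U U * (eps A C * eps A' E'))) * raise (Z B) E')
    = d + ∑ E', (p A A' B E' * raise (k C) E' + p A A' C E' * raise (k B) E')
      + ∑ C', (U B C' * raise (fun B' => dk A A' C B' + ∑ C', p A A' C C' * raise (w B') C'
          - eps A' B' * r A C) C'
        + U C C' * raise (fun B' => dk A A' B B' + ∑ C', p A A' B C' * raise (w B') C'
          - eps A' B' * r A B) C')
      + ∑ C', ∑ D', raise (fun F' => raise (fun C' => dw A A' F' C' - eps A' F' * k A C'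
          - eps A' C' * k A F') D') C' * U B C' * U C D' := by
  simp only [hR, hZ, hY, spinContract, spinWedge, spinDot, raise, Fin.sum_univ_two]
  fin_cases A <;> fin_cases A' <;> fin_cases B <;> fin_cases C <;>
    simp [eps, hw, hr, hdw] <;> ring

end Algebra

/-! ### Conformal change of the derivatives at the origin of normal coordinates -/

section Formulas

variable {g : Fin 4 → Fin 4 → E4 → ℝ} {V : Set E4} {u : E4 → ℝ}

theorem NormalAt.nabla1_eq (hn : NormalAt g V) (K : Fin 4 → E4 → ℝ) (i j : Fin 4) :
    nabla1 g K i j 0 = pd i (K j) 0 := by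
  simp [nabla1, hn.christoffel_zero]

theorem NormalAt.nabla2_eq (hn : NormalAt g V) (T : Fin 4 → Fin 4 → E4 → ℝ) (i j k : Fin 4) :
    nabla2 g T i j k 0 = pd i (T j k) 0 := by
  simp [nabla2, hn.christoffel_zero]

theorem NormalAt.nabla4_eq (hn : NormalAt g V) (W : Fin 4 → Fin 4 → Fin 4 → Fin 4 → E4 → ℝ)
    (e a b c d : Fin 4) : nabla4 g W e a b c d 0 = pd e (W a b c d) 0 := by
  simp [nabla4, hn.christoffel_zero]

theorem NormalAt.nabla1_conf (hn : NormalAt g V) (hu : Sm V u) (hpos : ∀ z ∈ V, 0 < u z)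
    (K : Fin 4 → E4 → ℝ) (i j : Fin 4) :
    nabla1 (confMetric u g) K i j 0 = pd i (K j) 0 - K i 0 * logPd u j 0 - logPd u i 0 * K j 0
      + unitFrame i j * ∑ m, logPd u m 0 * K m 0 := by
  simp only [nabla1, hn.christoffel_conf hu hpos]
  rw [sum_confConn_mul _ (fun m => K m 0)]
  ring

theorem NormalAt.nabla2_conf (hn : NormalAt g V) (hu : Sm V u) (hpos : ∀ z ∈ V, 0 < u z)
    (T : Fin 4 → Fin 4 → E4 → ℝ) (e j k : Fin 4) :
    (nabla2 (confMetric u g) T e j k 0 : ℂ)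
      = (pd e (T j k) 0 : ℂ) - 2 * (logPd u e 0 : ℂ) * (T j k 0 : ℂ)
        - confTerm (fun i => (logPd u i 0 : ℂ)) (fun i j => (T i j 0 : ℂ)) e j k := by
  have h : nabla2 (confMetric u g) T e j k 0 = pd e (T j k) 0 - 2 * logPd u e 0 * T j k 0
      - (logPd u j 0 * T e k 0 + logPd u k 0 * T j e 0
        - unitFrame e j * (∑ m, logPd u m 0 * T m k 0)
        - unitFrame e k * ∑ m, logPd u m 0 * T j m 0) := by
    simp only [nabla2, hn.christoffel_conf hu hpos, Finset.sum_add_distrib]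
    rw [sum_confConn_mul _ (fun m => T m k 0), sum_confConn_mul _ (fun m => T j m 0)]
    ring
  rw [h, confTerm]
  push_cast
  ring

theorem NormalAt.nabla4_conf (hn : NormalAt g V) (hu : Sm V u) (hpos : ∀ z ∈ V, 0 < u z)
    (W : Fin 4 → Fin 4 → Fin 4 → Fin 4 → E4 → ℝ) (e a b c d : Fin 4) :
    (nabla4 (confMetric u g) W e a b c d 0 : ℂ)
      = (pd e (W a b c d) 0 : ℂ) - 4 * (logPd u e 0 : ℂ) * (W a b c d 0 : ℂ)
        - confTerm (fun i => (logPd u i 0 : ℂ)) (fun a b => (W a b c d 0 : ℂ)) e a b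
        - confTerm (fun i => (logPd u i 0 : ℂ)) (fun c d => (W a b c d 0 : ℂ)) e c d := by
  have h : nabla4 (confMetric u g) W e a b c d 0
      = pd e (W a b c d) 0 - 4 * logPd u e 0 * W a b c d 0
      - (logPd u a 0 * W e b c d 0 + logPd u b 0 * W a e c d 0
        - unitFrame e a * (∑ m, logPd u m 0 * W m b c d 0)
        - unitFrame e b * ∑ m, logPd u m 0 * W a m c d 0)
      - (logPd u c 0 * W a b e d 0 + logPd u d 0 * W a b c e 0
        - unitFrame e c * (∑ m, logPd u m 0 * W a b m d 0)
        - unitFrame e d * ∑ m, logPd u m 0 * W a b c m 0) := by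
    simp only [nabla4, hn.christoffel_conf hu hpos, Finset.sum_add_distrib]
    rw [sum_confConn_mul _ (fun m => W m b c d 0), sum_confConn_mul _ (fun m => W a m c d 0),
      sum_confConn_mul _ (fun m => W a b m d 0), sum_confConn_mul _ (fun m => W a b c m 0)]
    ring
  rw [h, confTerm, confTerm]
  push_cast
  ring

/-- For a frame that is orthonormal at the point, ε_{AB}ε_{A'B'} is the spinor form of the metric,
so φ − Λεε is the spinor form of the Schouten tensor. -/
theorem pSpinor_eq_spin2 {c : ℝ} {y : E4}
    (h : ∀ i j, c ^ 2 * g i j y = unitFrame i j) (A B A' B' : Fin 2) :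
    pSpinor g (c • unitFrame) y A B A' B'
      = (c : ℂ) ^ 2 * spin2 unitFrame (fun i j => (schouten g i j y : ℂ)) A A' B B' := by
  have h1 : ∀ i j, (tfRicci g i j y : ℂ)
      = (schouten g i j y : ℂ) + (lam g y : ℂ) * (g i j y : ℂ) := fun i j => by
    rw [schouten]; push_cast; ring
  have h2 : (c : ℂ) ^ 2 * spin2 unitFrame (fun i j => (g i j y : ℂ)) A A' B B'
      = eps A B * eps A' B' := by
    rw [← spin2_unit, ← spin2_mul_left]
    congr 1
    funext i j
    rw [← h i j]; push_cast; ring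
  rw [pSpinor, spin2_smul]
  simp only [h1, spin2_add, spin2_mul_left]
  linear_combination (lam g y : ℂ) * h2

theorem NormalAt.pSpinor_eq (hn : NormalAt g V) (A B A' B' : Fin 2) :
    pSpinor g unitFrame 0 A B A' B'
      = spin2 unitFrame (fun i j => (schouten g i j 0 : ℂ)) A A' B B' := by
  have := pSpinor_eq_spin2 (g := g) (c := 1) (y := 0) (fun i j => by rw [hn.g_eq]; ring) A B A' B'
  simpa using this

theorem NormalAt.pSpinor_conf (hn : NormalAt g V) (hu : Sm V u) (hpos : ∀ z ∈ V, 0 < u z)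
    (A B A' B' : Fin 2) :
    pSpinor (confMetric u g) ((u 0)⁻¹ • unitFrame) 0 A B A' B'
      = ((u 0 : ℂ)⁻¹) ^ 2 * (pSpinor g unitFrame 0 A B A' B'
        - (spin2 unitFrame (fun i j => (pd i (logPd u j) 0 : ℂ)) A A' B B'
          - spin1 unitFrame (fun i => (logPd u i 0 : ℂ)) A A'
            * spin1 unitFrame (fun i => (logPd u i 0 : ℂ)) B B'
          + (1 / 2) * spinDot (spin1 unitFrame fun i => (logPd u i 0 : ℂ))
            (spin1 unitFrame fun i => (logPd u i 0 : ℂ)) * (eps A B * eps A' B'))) := by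
  have hu0 := (hpos 0 hn.zero_mem).ne'
  rw [pSpinor_eq_spin2 (fun i j => by rw [confMetric, hn.g_eq]; field_simp), hn.pSpinor_eq]
  have h : ∀ i j, (schouten (confMetric u g) i j 0 : ℂ) = (schouten g i j 0 : ℂ)
      - ((pd i (logPd u j) 0 : ℂ) - (logPd u i 0 : ℂ) * (logPd u j 0 : ℂ)
        + ((1 / 2) * ∑ m, (logPd u m 0 : ℂ) * (logPd u m 0 : ℂ)) * (unitFrame i j : ℂ)) := by
    intro i j
    rw [hn.schouten_conf hu hpos, confQ]; push_cast; ring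
  simp only [h, spin2_sub, spin2_add, spin2_mul, spin2_mul_left, spin2_unit]
  rw [sum_mul_eq_spinDot]
  push_cast
  ring

/-- The Weyl tensor contributes u² and the four frame vectors contribute u⁻⁴. -/
theorem NormalAt.psi_conf (hn : NormalAt g V) (hu : Sm V u) (hpos : ∀ z ∈ V, 0 < u z)
    (A B C D : Fin 2) :
    psi (confMetric u g) ((u 0)⁻¹ • unitFrame) 0 A B C D
      = ((u 0 : ℂ)⁻¹) ^ 2 * psi g unitFrame 0 A B C D := by
  have hu0 : (u 0 : ℂ) ≠ 0 := by exact_mod_cast (hpos 0 hn.zero_mem).ne'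
  simp only [psi, weylASD_smul, hn.weyl_conf hu hpos]
  push_cast
  simp only [weylASD_eq, asdPart_mul_left]
  field_simp

theorem asdPart_confTerm_comm (U : Fin 4 → ℂ) (W : Fin 4 → Fin 4 → Fin 4 → Fin 4 → ℂ)
    (E : Fin 4 → Fin 4 → ℝ) (C D : Fin 2) (e a b : Fin 4) :
    asdPart E (fun c d => confTerm U (fun a b => W a b c d) e a b) C D
      = confTerm U (fun a b => asdPart E (fun c d => W a b c d) C D) e a b := by
  simp only [confTerm, asdPart_sub, asdPart_add, asdPart_mul_left, asdPart_sum]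

/-- Once the second index pair is projected to its anti-self-dual part, the first pair is an
anti-self-dual two-form by `sdPart_asdPart`, and the formula for two-forms applies. -/
theorem WeylLike.weylASD_confTerm {W : Fin 4 → Fin 4 → Fin 4 → Fin 4 → ℝ} (hW : WeylLike W)
    (U : Fin 4 → ℂ) (F F' A B C D : Fin 2) :
    weylASD unitFrame (fun a b c d => ∑ e, tetrad unitFrame F F' e *
      confTerm U (fun a b => (W a b c d : ℂ)) e a b) A B C D
      = -spin1 unitFrame U F F' * weylASD unitFrame (fun a b c d => (W a b c d : ℂ)) A B C D
        + spin1 unitFrame U A F' * weylASD unitFrame (fun a b c d => (W a b c d : ℂ)) F B C D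
        + spin1 unitFrame U B F' * weylASD unitFrame (fun a b c d => (W a b c d : ℂ)) F A C D := by
  have h : (fun a b => asdPart unitFrame (fun c d => ∑ e, tetrad unitFrame F F' e *
      confTerm U (fun a b => (W a b c d : ℂ)) e a b) C D)
      = fun a b => ∑ e, tetrad unitFrame F F' e * confTerm U
        (fun a b => asdPart unitFrame (fun c d => (W a b c d : ℂ)) C D) e a b := by
    funext a b
    rw [asdPart_sum]
    simp only [asdPart_mul_left, asdPart_confTerm_comm]
  rw [weylASD_eq, h]
  simp only [weylASD_eq]
  refine asdPart_confTerm _ (fun a b => ?_) (fun A B => hW.sdPart_asdPart A B C D) F F' A B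
  rw [← neg_one_mul, ← asdPart_mul_left]
  congr 1; funext c d; rw [hW.antisymm_left]; push_cast; ring

theorem WeylLike.weylASD_confTerm_right {W : Fin 4 → Fin 4 → Fin 4 → Fin 4 → ℝ} (hW : WeylLike W)
    (U : Fin 4 → ℂ) (F F' A B C D : Fin 2) :
    weylASD unitFrame (fun a b c d => ∑ e, tetrad unitFrame F F' e *
      confTerm U (fun c d => (W a b c d : ℂ)) e c d) A B C D
      = -spin1 unitFrame U F F' * weylASD unitFrame (fun a b c d => (W a b c d : ℂ)) A B C D
        + spin1 unitFrame U C F' * weylASD unitFrame (fun a b c d => (W a b c d : ℂ)) A B F D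
        + spin1 unitFrame U D F' * weylASD unitFrame (fun a b c d => (W a b c d : ℂ)) A B F C := by
  rw [weylASD_eq_swap, ← weylASD_eq unitFrame (fun c d a b => ∑ e, tetrad unitFrame F F' e *
    confTerm U (fun c d => (W a b c d : ℂ)) e c d)]
  rw [hW.weylASD_pair A B C D, hW.weylASD_pair A B F D, hW.weylASD_pair A B F C,
    ← hW.weylASD_confTerm]
  congr 1
  funext c d a b
  refine Finset.sum_congr rfl fun e _ => ?_
  congr 2
  funext c d
  rw [hW.pair]

/-- Differentiating u² contributes 2Υ and the four connection slots −4Υ. The remaining −2Υ cancels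
against the two terms Υ_{FF'}ψ from the index pairs, leaving only the terms that exchange the
direction index with an index of ψ. -/
theorem NormalAt.nablaPsi_conf (hn : NormalAt g V) (hu : Sm V u) (hpos : ∀ z ∈ V, 0 < u z)
    (F F' A B C D : Fin 2) :
    nablaPsi (confMetric u g) ((u 0)⁻¹ • unitFrame) 0 F F' A B C D
      = ((u 0 : ℂ)⁻¹) ^ 3 * (nablaPsi g unitFrame 0 F F' A B C D
        - (spin1 unitFrame (fun i => (logPd u i 0 : ℂ)) A F' * psi g unitFrame 0 F B C D
          + spin1 unitFrame (fun i => (logPd u i 0 : ℂ)) B F' * psi g unitFrame 0 A F C D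
          + spin1 unitFrame (fun i => (logPd u i 0 : ℂ)) C F' * psi g unitFrame 0 A B F D
          + spin1 unitFrame (fun i => (logPd u i 0 : ℂ)) D F' * psi g unitFrame 0 A B C F)) := by
  have hu0 : (u 0 : ℂ) ≠ 0 := by exact_mod_cast (hpos 0 hn.zero_mem).ne'
  have hV := hn.metricOn.isOpen
  have hW : ∀ e a b c d, pd e (weyl (confMetric u g) a b c d) 0
      = u 0 ^ 2 * (pd e (weyl g a b c d) 0 + 2 * logPd u e 0 * weyl g a b c d 0) := by
    intro e a b c d
    rw [pd_congr_on hV hn.zero_mem fun z hz => hn.metricOn.weyl_conf hu hpos hz a b c d]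
    rw [(((hu.hasPd hV hn.zero_mem).pow 2).mul
      ((hn.metricOn.sm_weyl a b c d).hasPd hV hn.zero_mem)).pd_eq,
      pd_eq_mul_logPd (hpos 0 hn.zero_mem).ne']
    push_cast; ring
  have hT : ∀ e a b c d, (nabla4 (confMetric u g) (weyl (confMetric u g)) e a b c d 0 : ℂ)
      = (u 0 : ℂ) ^ 2 * ((nabla4 g (weyl g) e a b c d 0 : ℂ)
        - (logPd u e 0 : ℂ) * (2 * (weyl g a b c d 0 : ℂ))
        - confTerm (fun i => (logPd u i 0 : ℂ)) (fun a b => (weyl g a b c d 0 : ℂ)) e a b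
        - confTerm (fun i => (logPd u i 0 : ℂ)) (fun c d => (weyl g a b c d 0 : ℂ)) e c d) := by
    intro e a b c d
    rw [hn.nabla4_conf hu hpos, hW, hn.nabla4_eq]
    simp only [confTerm, hn.weyl_conf hu hpos]
    push_cast
    simp only [← mul_assoc, mul_comm _ ((u 0 : ℂ) ^ 2)]
    simp only [mul_assoc, ← Finset.mul_sum]
    ring
  have hs : ∀ a b c d, ∑ e, tetrad ((u 0)⁻¹ • unitFrame) F F' e
      * (nabla4 (confMetric u g) (weyl (confMetric u g)) e a b c d 0 : ℂ)
      = (u 0 : ℂ) * ((∑ e, tetrad unitFrame F F' e * (nabla4 g (weyl g) e a b c d 0 : ℂ))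
        - spin1 unitFrame (fun i => (logPd u i 0 : ℂ)) F F' * (2 * (weyl g a b c d 0 : ℂ))
        - (∑ e, tetrad unitFrame F F' e *
          confTerm (fun i => (logPd u i 0 : ℂ)) (fun a b => (weyl g a b c d 0 : ℂ)) e a b)
        - (∑ e, tetrad unitFrame F F' e *
          confTerm (fun i => (logPd u i 0 : ℂ)) (fun c d => (weyl g a b c d 0 : ℂ)) e c d)) := by
    intro a b c d
    simp only [hT, tetrad_smul, spin1, Finset.sum_mul, ← Finset.sum_sub_distrib, Finset.mul_sum]
    refine Finset.sum_congr rfl fun e _ => ?_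
    push_cast
    field_simp
  have c1 := hn.weylLike.weylASD_confTerm (fun i => (logPd u i 0 : ℂ)) F F' A B C D
  have c2 := hn.weylLike.weylASD_confTerm_right (fun i => (logPd u i 0 : ℂ)) F F' A B C D
  have p1 : psi g unitFrame 0 A F C D = psi g unitFrame 0 F A C D :=
    hn.weylLike.weylASD_swap_left _ _ _ _
  have p2 : psi g unitFrame 0 A B C F = psi g unitFrame 0 A B F C := by
    simp only [psi]
    rw [hn.weylLike.weylASD_pair, hn.weylLike.weylASD_swap_left, hn.weylLike.weylASD_pair]
  rw [nablaPsi, weylASD_smul]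
  simp only [hs]
  have lin : ∀ X Y Z T : Fin 4 → Fin 4 → Fin 4 → Fin 4 → ℂ, ∀ x y : ℂ,
      weylASD unitFrame (fun a b c d => x * (X a b c d - y * (2 * Y a b c d) - Z a b c d
        - T a b c d)) A B C D = x * (weylASD unitFrame X A B C D
          - y * (2 * weylASD unitFrame Y A B C D) - weylASD unitFrame Z A B C D
          - weylASD unitFrame T A B C D) := by
    intro X Y Z T x y
    simp only [weylASD_eq, asdPart_mul_left, asdPart_sub]
  rw [lin, c1, c2, p1, p2]
  simp only [psi, nablaPsi]
  push_cast
  field_simp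
  ring

end Formulas

/-! ### Conformal invariance in coordinates -/

/-- The coordinate form of `IsSectionOn`. -/
structure SectionOn (g om : Fin 4 → Fin 4 → E4 → ℝ) (K : Fin 4 → E4 → ℝ)
    (rho : Fin 4 → Fin 4 → E4 → ℝ) (V : Set E4) : Prop where
  sm_om : ∀ i j, Sm V (om i j)
  sm_K : ∀ i, Sm V (K i)
  sm_rho : ∀ i j, Sm V (rho i j)
  antisymm_om : ∀ z ∈ V, ∀ i j, om i j z = -om j i z
  antisymm_rho : ∀ z ∈ V, ∀ i j, rho i j z = -rho j i z
  selfDual : ∀ z ∈ V, ∀ E, IsOrientedFrame g z E →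
    ∀ A B, asdPart E (fun i j => (om i j z : ℂ)) A B = 0
  antiSelfDual : ∀ z ∈ V, ∀ E, IsOrientedFrame g z E →
    ∀ A B, sdPart E (fun i j => (rho i j z : ℂ)) A B = 0

/-- The one-form `2 K + U ⌟ ω`. -/
def shiftForm (g om : Fin 4 → Fin 4 → E4 → ℝ) (K U : Fin 4 → E4 → ℝ) (j : Fin 4) (z : E4) : ℝ :=
  2 * K j z + contract g om U j z

/-- The transformation rule of `E` in terms of tensors. -/
structure RescalingOn (g om : Fin 4 → Fin 4 → E4 → ℝ) (K : Fin 4 → E4 → ℝ)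
    (rho om' : Fin 4 → Fin 4 → E4 → ℝ) (K' : Fin 4 → E4 → ℝ)
    (rho' : Fin 4 → Fin 4 → E4 → ℝ) (u : E4 → ℝ) (V : Set E4) : Prop where
  -- The exponent three is the weight Ω² of ω_{A'B'} plus one factor from ε̂_{AB} = Ω ε_{AB}, since
  -- this is the two-form ω_{A'B'}ε_{AB}.
  om_eq : ∀ z ∈ V, ∀ i j, om' i j z = u z ^ 3 * om i j z
  K_eq : ∀ z ∈ V, ∀ j, K' j z = u z * (K j z + contract g om (logPd u) j z)
  -- The wedge product also has a self-dual part, so the rule can only be imposed on anti-self-dual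
  -- parts. The factor u is the scaling of ε_{A'B'}.
  rho_eq : ∀ z ∈ V, ∀ E, IsOrientedFrame g z E → ∀ A B,
    asdPart E (fun i j => ((rho' i j z - u z * (rho i j z
      + (logPd u i z * shiftForm g om K (logPd u) j z
        - shiftForm g om K (logPd u) i z * logPd u j z)) : ℝ) : ℂ)) A B = 0

/-! ### Spinor and tensor forms of the transformation rule -/

section

variable {g om rho om' rho' : Fin 4 → Fin 4 → E4 → ℝ} {K K' : Fin 4 → E4 → ℝ} {u : E4 → ℝ}
  {V : Set E4} {z : E4} {E : Fin 4 → Fin 4 → ℝ}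

theorem IsOrientedFrame.conf (hE : IsOrientedFrame g z E) (hu : 0 < u z) :
    IsOrientedFrame (confMetric u g) z ((u z)⁻¹ • E) := by
  refine ⟨fun a b => ?_, ?_⟩
  · rw [← hE.1 a b]
    refine Finset.sum_congr rfl fun i _ => Finset.sum_congr rfl fun j _ => ?_
    simp only [confMetric, Pi.smul_apply, smul_eq_mul]
    field_simp
  · have : Matrix.of ((u z)⁻¹ • E) = (u z)⁻¹ • Matrix.of E := rfl
    rw [this, Matrix.det_smul]
    exact mul_pos (pow_pos (inv_pos.2 hu) _) hE.2

theorem asdPart_inv_smul (hu : u z ≠ 0) (X : Fin 4 → Fin 4 → ℂ) (A B : Fin 2) :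
    asdPart E X A B = (u z : ℂ) ^ 2 * asdPart ((u z)⁻¹ • E) X A B := by
  have : (u z : ℂ) ≠ 0 := by exact_mod_cast hu
  rw [asdPart_smul]; push_cast; field_simp

theorem sdPart_inv_smul (hu : u z ≠ 0) (X : Fin 4 → Fin 4 → ℂ) (A B : Fin 2) :
    sdPart E X A B = (u z : ℂ) ^ 2 * sdPart ((u z)⁻¹ • E) X A B := by
  have : (u z : ℂ) ≠ 0 := by exact_mod_cast hu
  rw [sdPart_smul]; push_cast; field_simp

theorem spin1_inv_smul (hu : u z ≠ 0) (X : Fin 4 → ℂ) (A B : Fin 2) :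
    spin1 E X A B = (u z : ℂ) * spin1 ((u z)⁻¹ • E) X A B := by
  have : (u z : ℂ) ≠ 0 := by exact_mod_cast hu
  rw [spin1_smul]; push_cast; field_simp

theorem asdPart_rescaled_rho (hE : IsOrientedFrame g z E)
    (hom : ∀ i j, om i j z = -om j i z)
    (hsd : ∀ A B, asdPart E (fun i j => (om i j z : ℂ)) A B = 0) (A B : Fin 2) :
    asdPart E (fun i j => ((rho' i j z - u z * (rho i j z
      + (logPd u i z * shiftForm g om K (logPd u) j z
        - shiftForm g om K (logPd u) i z * logPd u j z)) : ℝ) : ℂ)) A B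
    = asdPart E (fun i j => (rho' i j z : ℂ)) A B
      - u z * (rescale (u z) (spin1 E fun i => (logPd u i z : ℂ)) (tractorAt om K rho E z)).2.2
        A B := by
  have hw := sdPart_symm (T := fun i j => (om i j z : ℂ)) E
    (fun i j => by rw [hom]; push_cast; rfl) 1 0
  simp only [rescale, tractorAt]
  rw [rescale_snd_snd hw]
  have hY : spin1 E (fun j => (shiftForm g om K (logPd u) j z : ℂ))
      = fun B B' => 2 * spin1 E (fun j => (K j z : ℂ)) B B'
        + spinContract (spin1 E fun i => (logPd u i z : ℂ))
          (sdPart E fun i j => (om i j z : ℂ)) B B' := by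
    funext B B'
    rw [spinContract, ← hE.spin1_contract hom hsd, ← spin1_mul_left, ← spin1_add]
    simp only [shiftForm]; push_cast; rfl
  rw [← hY]
  push_cast
  rw [asdPart_sub, asdPart_mul_left, asdPart_add, asdPart_wedge]
  rfl

/-- The transformation rule of spinor components is equivalent to that of tensors. -/
theorem rescalingOn_iff (hg : MetricOn g V) (hpos : ∀ z ∈ V, 0 < u z)
    (hs : SectionOn g om K rho V) (hs' : SectionOn (confMetric u g) om' K' rho' V) :
    RescalingOn g om K rho om' K' rho' u V ↔ ∀ z ∈ V, ∀ E, IsOrientedFrame g z E →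
      tractorAt om' K' rho' ((u z)⁻¹ • E) z = (u z : ℂ)⁻¹ •
        rescale (u z) (spin1 E fun i => (logPd u i z : ℂ)) (tractorAt om K rho E z) := by
  have hK : ∀ z ∈ V, ∀ E, IsOrientedFrame g z E → ∀ A A',
      spin1 E (fun j => ((u z * (K j z + contract g om (logPd u) j z) : ℝ) : ℂ)) A A'
        = (rescale (u z) (spin1 E fun i => (logPd u i z : ℂ)) (tractorAt om K rho E z)).2.1
          A A' := by
    intro z hz E hE A A'
    push_cast
    rw [spin1_mul_left, spin1_add, hE.spin1_contract (hs.antisymm_om z hz) (hs.selfDual z hz E hE)]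
    rfl
  constructor
  · intro h z hz E hE
    have hu0 := (hpos z hz).ne'
    have huc : (u z : ℂ) ≠ 0 := by exact_mod_cast hu0
    refine Prod.ext ?_ (Prod.ext ?_ ?_)
    · funext A' B'
      change sdPart _ _ _ _ = (u z : ℂ)⁻¹ * ((u z : ℂ) ^ 2 * sdPart _ _ _ _)
      simp only [h.om_eq z hz]
      push_cast
      rw [sdPart_smul, sdPart_mul_left]
      push_cast
      field_simp
    · funext A A'
      change spin1 ((u z)⁻¹ • E) (fun i => (K' i z : ℂ)) A A' = (u z : ℂ)⁻¹ * (rescale (u z)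
        (spin1 E fun i => (logPd u i z : ℂ)) (tractorAt om K rho E z)).2.1 A A'
      rw [← hK z hz E hE]
      simp only [h.K_eq z hz]
      rw [spin1_smul, Complex.ofReal_inv]
    · funext A B
      change asdPart _ _ _ _ = (u z : ℂ)⁻¹ * _
      have h1 := h.rho_eq z hz E hE A B
      rw [asdPart_rescaled_rho hE (hs.antisymm_om z hz) (hs.selfDual z hz E hE)] at h1
      rw [asdPart_smul]
      push_cast
      have h2 := sub_eq_zero.1 h1
      rw [h2]
      field_simp
  · intro h
    refine ⟨fun z hz i j => ?_, fun z hz j => ?_, fun z hz E hE A B => ?_⟩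
    · obtain ⟨E, hE⟩ := hg.exists_frame hz
      have hu0 := (hpos z hz).ne'
      have huc : (u z : ℂ) ≠ 0 := by exact_mod_cast hu0
      -- A two-form is recovered from its two parts: the self-dual ones agree by hypothesis, and the
      -- anti-self-dual ones both vanish.
      refine congrFun (congrFun (eq_of_parts_eq (S := fun i j => om' i j z)
        (T := fun i j => u z ^ 3 * om i j z) hE.2 (hs'.antisymm_om z hz)
        (fun i j => by rw [hs.antisymm_om z hz i j]; ring) (fun A B => ?_) (fun A B => ?_)) i) j
      · have h1 : sdPart _ _ _ _ = (u z : ℂ)⁻¹ * ((u z : ℂ) ^ 2 * sdPart _ _ _ _) :=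
          congrFun (congrFun (congrArg Prod.fst (h z hz E hE)) A) B
        rw [sdPart_inv_smul hu0, h1]
        push_cast
        rw [sdPart_mul_left]
        field_simp
      · rw [asdPart_inv_smul hu0, hs'.selfDual z hz _ (hE.conf (hpos z hz))]
        push_cast
        rw [asdPart_mul_left, hs.selfDual z hz E hE, mul_zero, mul_zero]
    · obtain ⟨E, hE⟩ := hg.exists_frame hz
      have hu0 := (hpos z hz).ne'
      have huc : (u z : ℂ) ≠ 0 := by exact_mod_cast hu0
      refine congrFun (eq_of_spin1_eq (X := fun j => K' j z)
        (Y := fun j => u z * (K j z + contract g om (logPd u) j z)) hE.2 fun A A' => ?_) j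
      have h1 : spin1 ((u z)⁻¹ • E) (fun i => (K' i z : ℂ)) A A' = (u z : ℂ)⁻¹ * (rescale (u z)
        (spin1 E fun i => (logPd u i z : ℂ)) (tractorAt om K rho E z)).2.1 A A' :=
        congrFun (congrFun (congrArg (fun X : Tractor => X.2.1) (h z hz E hE)) A) A'
      rw [spin1_inv_smul hu0, h1, hK z hz E hE]
      field_simp
    · have hu0 := (hpos z hz).ne'
      have huc : (u z : ℂ) ≠ 0 := by exact_mod_cast hu0
      have h1 : asdPart _ _ _ _ = (u z : ℂ)⁻¹ * _ :=
        congrFun (congrFun (congrArg (fun X : Tractor => X.2.2) (h z hz E hE)) A) B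
      rw [asdPart_rescaled_rho hE (hs.antisymm_om z hz) (hs.selfDual z hz E hE),
        asdPart_inv_smul hu0, h1]
      field_simp
      ring

end

/-! ### The first component of the rescaled derivative at the origin -/

section AtOrigin

variable {g om rho om' rho' : Fin 4 → Fin 4 → E4 → ℝ} {K K' : Fin 4 → E4 → ℝ} {u : E4 → ℝ}
  {V : Set E4}

theorem sum_tetrad_smul (c : ℝ) (A A' : Fin 2) (X : Fin 4 → ℂ) :
    ∑ i, tetrad (c • unitFrame) A A' i * X i = c * ∑ i, tetrad unitFrame A A' i * X i := by
  simp only [tetrad_smul, Finset.mul_sum, mul_assoc]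

theorem NormalAt.spin1_K_conf (hn : NormalAt g V) (hs : SectionOn g om K rho V)
    (hK : ∀ z ∈ V, ∀ j, K' j z = u z * (K j z + contract g om (logPd u) j z)) (B B' : Fin 2) :
    spin1 unitFrame (fun i => (K' i 0 : ℂ)) B B' = (u 0 : ℂ) *
      (spin1 unitFrame (fun i => (K i 0 : ℂ)) B B'
        + spinContract (spin1 unitFrame fun i => (logPd u i 0 : ℂ))
          (sdPart unitFrame fun i j => (om i j 0 : ℂ)) B B') := by
  have h0 := hn.zero_mem
  simp only [hK 0 h0]
  push_cast
  rw [spin1_mul_left, spin1_add, hn.isOrientedFrame.spin1_contract (hs.antisymm_om 0 h0)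
    (hs.selfDual 0 h0 _ hn.isOrientedFrame)]
  rfl

/-- Only the rules for ω and K enter, and `rho'` is arbitrary. The lemma can thus be reused where no
third component has been chosen. The weight of the derivative cancels the Ω² of the rule, so no
factor remains. -/
theorem NormalAt.tractorD_fst_conf (hn : NormalAt g V) (hu : Sm V u) (hpos : ∀ z ∈ V, 0 < u z)
    (hs : SectionOn g om K rho V) (hom : ∀ z ∈ V, ∀ i j, om' i j z = u z ^ 3 * om i j z)
    (hK : ∀ z ∈ V, ∀ j, K' j z = u z * (K j z + contract g om (logPd u) j z)) (A A' : Fin 2) :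
    (tractorD (confMetric u g) om' K' rho' ((u 0)⁻¹ • unitFrame) 0 A A').1
      = (tractorD g om K rho unitFrame 0 A A').1 := by
  have h0 := hn.zero_mem
  have hV := hn.metricOn.isOpen
  have hu0 := (hpos 0 h0).ne'
  have huc : (u 0 : ℂ) ≠ 0 := by exact_mod_cast hu0
  -- The 3Υ from u³ exceeds by one the 2Υ subtracted by the covariant derivative; the single Υ left
  -- over is the first term in `conf_fst`.
  have hpd : ∀ i j l, pd i (om' j l) 0
      = u 0 ^ 3 * (pd i (om j l) 0 + 3 * logPd u i 0 * om j l 0) := by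
    intro i j l
    rw [pd_congr_on hV h0 fun z hz => hom z hz j l,
      (((hu.hasPd hV h0).pow 3).mul ((hs.sm_om j l).hasPd hV h0)).pd_eq, pd_eq_mul_logPd hu0]
    push_cast; ring
  have h1 : ∀ i j l, (nabla2 (confMetric u g) om' i j l 0 : ℂ) = (u 0 : ℂ) ^ 3 *
      ((nabla2 g om i j l 0 : ℂ) + (logPd u i 0 : ℂ) * (om j l 0 : ℂ)
        - confTerm (fun i => (logPd u i 0 : ℂ)) (fun i j => (om i j 0 : ℂ)) i j l) := by
    intro i j l
    rw [hn.nabla2_conf hu hpos, hn.nabla2_eq, hpd]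
    simp only [confTerm, hom 0 h0]
    push_cast
    simp only [← mul_assoc, mul_comm _ ((u 0 : ℂ) ^ 3)]
    simp only [mul_assoc, ← Finset.mul_sum]
    ring
  have h2 : ∀ j l, ∑ i, tetrad ((u 0)⁻¹ • unitFrame) A A' i
      * (nabla2 (confMetric u g) om' i j l 0 : ℂ) = (u 0 : ℂ) ^ 2 *
      ((∑ i, tetrad unitFrame A A' i * (nabla2 g om i j l 0 : ℂ))
        + spin1 unitFrame (fun i => (logPd u i 0 : ℂ)) A A' * (om j l 0 : ℂ)
        - ∑ i, tetrad unitFrame A A' i *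
          confTerm (fun i => (logPd u i 0 : ℂ)) (fun i j => (om i j 0 : ℂ)) i j l) := by
    intro j l
    simp only [h1, sum_tetrad_smul, spin1, Finset.sum_mul, ← Finset.sum_sub_distrib,
      ← Finset.sum_add_distrib, Finset.mul_sum]
    refine Finset.sum_congr rfl fun e _ => ?_
    push_cast
    field_simp
  have ha : ∀ i j, (om i j 0 : ℂ) = -(om j i 0 : ℂ) := fun i j => by
    rw [hs.antisymm_om 0 h0]; push_cast; rfl
  have hw := sdPart_symm unitFrame ha 1 0
  have hc := sdPart_confTerm (fun i => (logPd u i 0 : ℂ)) ha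
    (hs.selfDual 0 h0 _ hn.isOrientedFrame) A A'
  funext B' C'
  simp only [tractorD, tractorAt, h2]
  rw [sdPart_smul, sdPart_mul_left, sdPart_sub, sdPart_add, sdPart_mul_left, hc,
    spin1_smul, spin1_smul, hn.spin1_K_conf hs hK, hn.spin1_K_conf hs hK]
  push_cast
  rw [← conf_fst (U := spin1 unitFrame fun i => (logPd u i 0 : ℂ)) hw]
  field_simp

end AtOrigin

/-! ### The second and third components at the origin -/

section AtOrigin

variable {g om rho om' rho' : Fin 4 → Fin 4 → E4 → ℝ} {K K' : Fin 4 → E4 → ℝ} {u : E4 → ℝ}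
  {V : Set E4}

theorem MetricOn.pd_antisymm {T : Fin 4 → Fin 4 → E4 → ℝ} {z : E4} (hg : MetricOn g V)
    (hz : z ∈ V) (ha : ∀ z ∈ V, ∀ i j, T i j z = -T j i z)
    (hT : ∀ i j, Sm V (T i j)) (e i j : Fin 4) : pd e (T i j) z = -pd e (T j i) z := by
  rw [pd_congr_on hg.isOpen hz fun z hz => ha z hz i j]
  exact ((hT j i).hasPd hg.isOpen hz).neg.pd_eq

/-- Self-duality is a parallel condition, and at the origin of normal coordinates covariant
derivatives are partial ones. -/
theorem NormalAt.asdPart_pd (hn : NormalAt g V) {T : Fin 4 → Fin 4 → E4 → ℝ}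
    (hT : ∀ i j, Sm V (T i j)) (ha : ∀ z ∈ V, ∀ i j, T i j z = -T j i z)
    (h : ∀ z ∈ V, ∀ E, IsOrientedFrame g z E → ∀ A B, asdPart E (fun i j => (T i j z : ℂ)) A B = 0)
    (e : Fin 4) (A B : Fin 2) : asdPart unitFrame (fun i j => (pd e (T i j) 0 : ℂ)) A B = 0 := by
  refine (asdPart_eq_zero_iff (hn.metricOn.pd_antisymm hn.zero_mem ha hT e)).2 ?_ A B
  rw [frameComp_unitFrame]
  exact hn.dualRel_pd hT ha (by norm_num)
    (fun z hz E hE => (asdPart_eq_zero_iff (ha z hz)).1 (h z hz E hE)) e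

theorem NormalAt.sm_contract (hn : NormalAt g V) (hs : SectionOn g om K rho V) (hu : Sm V u)
    (hpos : ∀ z ∈ V, 0 < u z) (j : Fin 4) : Sm V (contract g om (logPd u) j) :=
  Sm.sum fun k _ => Sm.sum fun l _ => (hn.metricOn.sm_inv k l).mul
    ((hs.sm_om j k).mul (hu.logPd hn.metricOn.isOpen hpos l))

theorem NormalAt.pd_contract (hn : NormalAt g V) (hs : SectionOn g om K rho V) (hu : Sm V u)
    (hpos : ∀ z ∈ V, 0 < u z) (i j : Fin 4) :
    pd i (contract g om (logPd u) j) 0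
      = ∑ k, (pd i (om j k) 0 * logPd u k 0 + om j k 0 * pd i (logPd u k) 0) := by
  have hV := hn.metricOn.isOpen
  have h := HasPd.sum (s := Finset.univ) fun k _ => HasPd.sum (s := Finset.univ) fun l _ =>
    (hn.hasPd_inv i k l).mul (((hs.sm_om j k).hasPd (i := i) hV hn.zero_mem).mul
      ((hu.logPd hV hpos l).hasPd hV hn.zero_mem))
  refine h.pd_eq.trans (Finset.sum_congr rfl fun k _ => ?_)
  simp only [hn.inv_eq, zero_mul, zero_add, sum_unitFrame_mul]

/-- The spinor form of the derivative of the contraction of `ω` and `Υ`. -/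
theorem NormalAt.spin2_pd_contract (hn : NormalAt g V) (hs : SectionOn g om K rho V) (hu : Sm V u)
    (hpos : ∀ z ∈ V, 0 < u z) (A A' B B' : Fin 2) :
    spin2 unitFrame (fun i j => (pd i (contract g om (logPd u) j) 0 : ℂ)) A A' B B'
      = spinContract (spin1 unitFrame fun i => (logPd u i 0 : ℂ))
          (sdPart unitFrame fun j l => ∑ i, tetrad unitFrame A A' i * (pd i (om j l) 0 : ℂ)) B B'
        + spinContract (spin2 unitFrame (fun i j => (pd i (logPd u j) 0 : ℂ)) A A')
          (sdPart unitFrame fun i j => (om i j 0 : ℂ)) B B' := by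
  have h0 := hn.zero_mem
  have h1 : ∀ j, spin1 unitFrame (fun i => (pd i (contract g om (logPd u) j) 0 : ℂ)) A A'
      = (∑ k, (∑ i, tetrad unitFrame A A' i * (pd i (om j k) 0 : ℂ)) * (logPd u k 0 : ℂ))
        + ∑ k, (om j k 0 : ℂ) * spin1 unitFrame (fun i => (pd i (logPd u k) 0 : ℂ)) A A' := by
    intro j
    simp only [hn.pd_contract hs hu hpos, spin1, Finset.sum_mul, Finset.mul_sum,
      Complex.ofReal_sum, Complex.ofReal_add, Complex.ofReal_mul]
    rw [Finset.sum_comm, ← Finset.sum_add_distrib]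
    refine Finset.sum_congr rfl fun k _ => ?_
    rw [← Finset.sum_add_distrib]
    exact Finset.sum_congr rfl fun i _ => by ring
  rw [← sum_spin1]
  simp only [h1]
  rw [spin1_add, spin1_contract, spin1_contract]
  · simp only [spinContract, sum_spin1]
  · intro i j; rw [hs.antisymm_om 0 h0]; push_cast; rfl
  · exact hs.selfDual 0 h0 _ hn.isOrientedFrame
  · intro i j
    simp only [hn.metricOn.pd_antisymm h0 hs.antisymm_om hs.sm_om _ i j]
    simp
  · intro C D
    simp only [asdPart_sum, asdPart_mul_left, hn.asdPart_pd hs.sm_om hs.antisymm_om hs.selfDual,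
      mul_zero, Finset.sum_const_zero]

/-- The changes of ∇K, P, ω and ρ are inserted and the result is `conf_snd`, up to powers of u. -/
theorem NormalAt.tractorD_snd_conf (hn : NormalAt g V) (hu : Sm V u) (hpos : ∀ z ∈ V, 0 < u z)
    (hs : SectionOn g om K rho V) (hs' : SectionOn (confMetric u g) om' K' rho' V)
    (h : RescalingOn g om K rho om' K' rho' u V) (A A' : Fin 2) :
    (tractorD (confMetric u g) om' K' rho' ((u 0)⁻¹ • unitFrame) 0 A A').2.1
      = (((u 0 : ℂ)⁻¹) ^ 2 • rescale (u 0) (spin1 unitFrame fun i => (logPd u i 0 : ℂ))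
        (tractorD g om K rho unitFrame 0 A A')).2.1 := by
  have h0 := hn.zero_mem
  have hV := hn.metricOn.isOpen
  have hu0 := (hpos 0 h0).ne'
  have huc : (u 0 : ℂ) ≠ 0 := by exact_mod_cast hu0
  have hat := (rescalingOn_iff hn.metricOn hpos hs hs').1 h 0 h0 _ hn.isOrientedFrame
  have ha : ∀ i j, (om i j 0 : ℂ) = -(om j i 0 : ℂ) := fun i j => by
    rw [hs.antisymm_om 0 h0]; push_cast; rfl
  have hw := sdPart_symm unitFrame ha 1 0
  have hpd : ∀ i j, pd i (K' j) 0 = u 0 * (logPd u i 0 * (K j 0 + contract g om (logPd u) j 0)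
      + (pd i (K j) 0 + pd i (contract g om (logPd u) j) 0)) := by
    intro i j
    rw [pd_congr_on hV h0 fun z hz => h.K_eq z hz j,
      ((hu.hasPd hV h0).mul (((hs.sm_K j).hasPd hV h0).add
        ((hn.sm_contract hs hu hpos j).hasPd hV h0))).pd_eq, pd_eq_mul_logPd hu0]
    ring
  have h1 : ∀ i j, (nabla1 (confMetric u g) K' i j 0 : ℂ) = (u 0 : ℂ) *
      ((logPd u i 0 : ℂ) * ((K j 0 + contract g om (logPd u) j 0 : ℝ) : ℂ)
        + ((pd i (K j) 0 : ℂ) + (pd i (contract g om (logPd u) j) 0 : ℂ))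
        - ((K i 0 + contract g om (logPd u) i 0 : ℝ) : ℂ) * (logPd u j 0 : ℂ)
        - (logPd u i 0 : ℂ) * ((K j 0 + contract g om (logPd u) j 0 : ℝ) : ℂ)
        + (∑ m, (logPd u m 0 : ℂ) * ((K m 0 + contract g om (logPd u) m 0 : ℝ) : ℂ))
          * (unitFrame i j : ℂ)) := by
    intro i j
    rw [hn.nabla1_conf hu hpos, hpd]
    simp only [h.K_eq 0 h0, mul_left_comm _ (u 0), ← Finset.mul_sum]
    push_cast
    ring
  have hZ : spin1 unitFrame (fun j => ((K j 0 + contract g om (logPd u) j 0 : ℝ) : ℂ))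
      = fun B B' => spin1 unitFrame (fun i => (K i 0 : ℂ)) B B'
        + spinContract (spin1 unitFrame fun i => (logPd u i 0 : ℂ))
          (sdPart unitFrame fun i j => (om i j 0 : ℂ)) B B' := by
    funext B B'
    push_cast
    rw [spin1_add, hn.isOrientedFrame.spin1_contract (hs.antisymm_om 0 h0)
      (hs.selfDual 0 h0 _ hn.isOrientedFrame)]
    rfl
  have e1 := congrArg Prod.fst hat
  have e3 := congrArg (fun X : Tractor => X.2.2) hat
  have hom : (tractorAt om' K' rho' ((u 0)⁻¹ • unitFrame) 0).1
      = fun B' C' => (u 0 : ℂ) * sdPart unitFrame (fun i j => (om i j 0 : ℂ)) B' C' := by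
    rw [e1]
    funext B' C'
    change (u 0 : ℂ)⁻¹ * ((u 0 : ℂ) ^ 2 * sdPart _ _ _ _) = _
    field_simp
  have hrho : (tractorAt om' K' rho' ((u 0)⁻¹ • unitFrame) 0).2.2
      = fun A B => (u 0 : ℂ)⁻¹ * (asdPart unitFrame (fun i j => (rho i j 0 : ℂ)) A B
        + spinWedge (spin1 unitFrame fun i => (logPd u i 0 : ℂ))
          (fun B B' => 2 * spin1 unitFrame (fun i => (K i 0 : ℂ)) B B'
            + spinContract (spin1 unitFrame fun i => (logPd u i 0 : ℂ))
              (sdPart unitFrame fun i j => (om i j 0 : ℂ)) B B') A B) := by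
    refine e3.trans ?_
    funext A B
    rw [← rescale_snd_snd hw]
    rfl
  funext B B'
  change spin2 _ _ _ _ _ _ + _ - _ * (tractorAt om' K' rho' _ _).2.2 _ _ = _
  rw [hrho]
  rw [hom]
  simp only [h1]
  rw [spin2_smul, spin2_mul_left, spin2_add, spin2_sub, spin2_sub, spin2_add, spin2_mul,
    spin2_mul, spin2_mul_left, spin2_unit, spin2_add, hn.spin2_pd_contract hs hu hpos, hZ,
    sum_mul_eq_spinDot, hZ]
  simp only [hn.pSpinor_conf hu hpos]
  have key := conf_snd (U := spin1 unitFrame fun i => (logPd u i 0 : ℂ))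
    (k := spin1 unitFrame (fun i => (K i 0 : ℂ)))
    (w := sdPart unitFrame fun i j => (om i j 0 : ℂ))
    (r := asdPart unitFrame fun i j => (rho i j 0 : ℂ))
    (DU := spin2 unitFrame fun i j => (pd i (logPd u j) 0 : ℂ))
    (dw := fun A A' => sdPart unitFrame
      fun j l => ∑ i, tetrad unitFrame A A' i * (pd i (om j l) 0 : ℂ))
    (dk := spin2 unitFrame fun i j => (pd i (K j) 0 : ℂ))
    (p := fun A A' B B' => pSpinor g unitFrame 0 A B A' B') hw A A' B B'
  have hR : (((u 0 : ℂ)⁻¹) ^ 2 • rescale (u 0) (spin1 unitFrame fun i => (logPd u i 0 : ℂ))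
        (tractorD g om K rho unitFrame 0 A A')).2.1 B B' = (u 0 : ℂ)⁻¹ *
      (spin2 unitFrame (fun i j => (pd i (K j) 0 : ℂ)) A A' B B'
        + ∑ C', pSpinor g unitFrame 0 A B A' C'
          * raise (sdPart unitFrame (fun i j => (om i j 0 : ℂ)) B') C'
        - eps A' B' * asdPart unitFrame (fun i j => (rho i j 0 : ℂ)) A B
        + spinContract (spin1 unitFrame fun i => (logPd u i 0 : ℂ)) (fun B' C' =>
          sdPart unitFrame (fun j l => ∑ i, tetrad unitFrame A A' i * (pd i (om j l) 0 : ℂ)) B' C'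
          - eps A' B' * spin1 unitFrame (fun i => (K i 0 : ℂ)) A C'
          - eps A' C' * spin1 unitFrame (fun i => (K i 0 : ℂ)) A B') B B') := by
    change ((u 0 : ℂ)⁻¹) ^ 2 * ((u 0 : ℂ) * _) = _
    rw [← mul_assoc, show ((u 0 : ℂ)⁻¹) ^ 2 * (u 0 : ℂ) = (u 0 : ℂ)⁻¹ by field_simp]
    simp only [tractorD, tractorAt, hn.nabla2_eq, hn.nabla1_eq]
    rfl
  rw [hR, ← key]
  simp only [raise, Fin.sum_univ_two]
  push_cast
  field_simp

-- The rule for ρ' is differentiated as a rule for tensors; the outcome separates into `conf_thd`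
-- and `conf_thd_psi`.
set_option maxRecDepth 5000 in
theorem NormalAt.tractorD_thd_conf (hn : NormalAt g V) (hu : Sm V u) (hpos : ∀ z ∈ V, 0 < u z)
    (hs : SectionOn g om K rho V) (hs' : SectionOn (confMetric u g) om' K' rho' V)
    (h : RescalingOn g om K rho om' K' rho' u V) (A A' : Fin 2) :
    (tractorD (confMetric u g) om' K' rho' ((u 0)⁻¹ • unitFrame) 0 A A').2.2
      = (((u 0 : ℂ)⁻¹) ^ 2 • rescale (u 0) (spin1 unitFrame fun i => (logPd u i 0 : ℂ))
        (tractorD g om K rho unitFrame 0 A A')).2.2 := by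
  have h0 := hn.zero_mem
  have hV := hn.metricOn.isOpen
  have hu0 := (hpos 0 h0).ne'
  have huc : (u 0 : ℂ) ≠ 0 := by exact_mod_cast hu0
  have hat := (rescalingOn_iff hn.metricOn hpos hs hs').1 h 0 h0 _ hn.isOrientedFrame
  have ha : ∀ i j, (om i j 0 : ℂ) = -(om j i 0 : ℂ) := fun i j => by
    rw [hs.antisymm_om 0 h0]; push_cast; rfl
  have hap : ∀ e i j, (pd e (om i j) 0 : ℂ) = -(pd e (om j i) 0 : ℂ) := fun e i j => by
    rw [hn.metricOn.pd_antisymm h0 hs.antisymm_om hs.sm_om]; push_cast; rfl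
  have har : ∀ i j, (rho i j 0 : ℂ) = -(rho j i 0 : ℂ) := fun i j => by
    rw [hs.antisymm_rho 0 h0]; push_cast; rfl
  have har' : ∀ i j, (rho' i j 0 : ℂ) = -(rho' j i 0 : ℂ) := fun i j => by
    rw [hs'.antisymm_rho 0 h0]; push_cast; rfl
  set U := spin1 unitFrame fun i => (logPd u i 0 : ℂ) with hU
  set w := sdPart unitFrame fun i j => (om i j 0 : ℂ) with hwd
  set k := spin1 unitFrame (fun i => (K i 0 : ℂ)) with hk
  set r := asdPart unitFrame fun i j => (rho i j 0 : ℂ) with hrd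
  have hw : w 1 0 = w 0 1 := sdPart_symm unitFrame ha 1 0
  have hr : r 1 0 = r 0 1 := asdPart_symm unitFrame har 1 0
  have smY : ∀ j, Sm V (shiftForm g om K (logPd u) j) := fun j =>
    (contDiffOn_const.mul (hs.sm_K j)).add (hn.sm_contract hs hu hpos j)
  have smU := hu.logPd hV hpos
  have smX : ∀ j l, Sm V fun z => rho j l z + (logPd u j z * shiftForm g om K (logPd u) l z
      - shiftForm g om K (logPd u) j z * logPd u l z) := fun j l =>
    (hs.sm_rho j l).add (((smU j).mul (smY l)).sub ((smY j).mul (smU l)))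
  have hpX : ∀ i j l, pd i (fun z => u z * (rho j l z
      + (logPd u j z * shiftForm g om K (logPd u) l z
        - shiftForm g om K (logPd u) j z * logPd u l z))) 0 = u 0 * (logPd u i 0 *
      (rho j l 0 + (logPd u j 0 * shiftForm g om K (logPd u) l 0
        - shiftForm g om K (logPd u) j 0 * logPd u l 0)) + (pd i (rho j l) 0 +
      ((pd i (logPd u j) 0 * shiftForm g om K (logPd u) l 0
          - shiftForm g om K (logPd u) j 0 * pd i (logPd u l) 0)
        + (logPd u j 0 * pd i (shiftForm g om K (logPd u) l) 0
          - pd i (shiftForm g om K (logPd u) j) 0 * logPd u l 0)))) := by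
    intro i j l
    rw [((hu.hasPd hV h0).mul (((hs.sm_rho j l).hasPd hV h0).add
      ((((smU j).hasPd hV h0).mul ((smY l).hasPd hV h0)).sub
        (((smY j).hasPd hV h0).mul ((smU l).hasPd hV h0))))).pd_eq, pd_eq_mul_logPd hu0]
    ring
  -- The form ρ' is prescribed only up to a self-dual error. The error stays self-dual under
  -- differentiation, by `asdPart_pd`, so the anti-self-dual part of ∂ρ' may be computed from the
  -- explicit expression.
  have hpr : ∀ i A B, asdPart unitFrame (fun j l => (pd i (rho' j l) 0 : ℂ)) A B
      = asdPart unitFrame (fun j l => (pd i (fun z => u z * (rho j l z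
      + (logPd u j z * shiftForm g om K (logPd u) l z
        - shiftForm g om K (logPd u) j z * logPd u l z))) 0 : ℂ)) A B := by
    intro i A B
    rw [← sub_eq_zero, ← asdPart_sub]
    rw [← hn.asdPart_pd (fun i j => (hs'.sm_rho i j).sub (hu.mul (smX i j)))
      (fun z hz i j => by rw [hs'.antisymm_rho z hz i j, hs.antisymm_rho z hz i j]; ring)
      h.rho_eq i A B]
    congr 1
    funext j l
    rw [(((hs'.sm_rho j l).hasPd (i := i) hV h0).sub (Sm.hasPd (hu.mul (smX j l)) hV h0)).pd_eq]
    push_cast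
    rfl
  have hY : spin1 unitFrame (fun j => (shiftForm g om K (logPd u) j 0 : ℂ))
      = fun B B' => 2 * k B B' + spinContract U w B B' := by
    funext B B'
    rw [spinContract, ← hn.isOrientedFrame.spin1_contract (hs.antisymm_om 0 h0)
      (hs.selfDual 0 h0 _ hn.isOrientedFrame), ← spin1_mul_left, ← spin1_add]
    simp only [shiftForm]; push_cast; rfl
  have hdY : spin1 unitFrame (fun j => spin1 unitFrame
      (fun i => (pd i (shiftForm g om K (logPd u) j) 0 : ℂ)) A A')
      = fun B B' => 2 * spin2 unitFrame (fun i j => (pd i (K j) 0 : ℂ)) A A' B B'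
        + (spinContract U (sdPart unitFrame fun j l => ∑ i, tetrad unitFrame A A' i *
            (pd i (om j l) 0 : ℂ)) B B'
          + spinContract (spin2 unitFrame (fun i j => (pd i (logPd u j) 0 : ℂ)) A A') w B B') := by
    funext B B'
    rw [sum_spin1, ← hn.spin2_pd_contract hs hu hpos, ← spin2_mul_left, ← spin2_add]
    congr 1
    funext i j
    change ((pd i (fun z => 2 * K j z + contract g om (logPd u) j z) 0 : ℝ) : ℂ) = _
    rw [((((hs.sm_K j).hasPd hV h0).const_mul 2).add
      ((hn.sm_contract hs hu hpos j).hasPd hV h0)).pd_eq]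
    push_cast; rfl
  set Y : Fin 2 → Fin 2 → ℂ := fun B B' => 2 * k B B' + spinContract U w B B' with hYd
  set R : Fin 2 → Fin 2 → ℂ := fun A B => r A B + spinWedge U Y A B with hRd
  have hRx : ∀ A B, asdPart unitFrame (fun j l => (rho j l 0 : ℂ)
      + ((logPd u j 0 : ℂ) * (shiftForm g om K (logPd u) l 0 : ℂ)
        - (shiftForm g om K (logPd u) j 0 : ℂ) * (logPd u l 0 : ℂ))) A B = R A B := by
    intro A B
    rw [asdPart_add, asdPart_wedge, hY]
    rfl
  have hdr : ∀ B C, asdPart unitFrame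
      (fun j l => ∑ i, tetrad unitFrame A A' i * (pd i (rho' j l) 0 : ℂ)) B C
      = (u 0 : ℂ) * (U A A' * R B C + (asdPart unitFrame
          (fun j l => ∑ i, tetrad unitFrame A A' i * (pd i (rho j l) 0 : ℂ)) B C
        + (spinWedge (spin2 unitFrame (fun i j => (pd i (logPd u j) 0 : ℂ)) A A') Y B C
          + spinWedge U (fun B B' => 2 * spin2 unitFrame (fun i j => (pd i (K j) 0 : ℂ)) A A' B B'
        + (spinContract U (sdPart unitFrame fun j l => ∑ i, tetrad unitFrame A A' i *
            (pd i (om j l) 0 : ℂ)) B B'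
          + spinContract (spin2 unitFrame (fun i j => (pd i (logPd u j) 0 : ℂ)) A A') w B B'))
            B C))) := by
    intro B C
    have e : ∀ j l, ∑ i, tetrad unitFrame A A' i * (pd i (fun z => u z * (rho j l z
        + (logPd u j z * shiftForm g om K (logPd u) l z
          - shiftForm g om K (logPd u) j z * logPd u l z))) 0 : ℂ)
        = (u 0 : ℂ) * (U A A' * ((rho j l 0 : ℂ)
          + ((logPd u j 0 : ℂ) * (shiftForm g om K (logPd u) l 0 : ℂ)
            - (shiftForm g om K (logPd u) j 0 : ℂ) * (logPd u l 0 : ℂ)))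
          + ((∑ i, tetrad unitFrame A A' i * (pd i (rho j l) 0 : ℂ))
          + ((spin1 unitFrame (fun i => (pd i (logPd u j) 0 : ℂ)) A A'
              * (shiftForm g om K (logPd u) l 0 : ℂ)
            - (shiftForm g om K (logPd u) j 0 : ℂ)
              * spin1 unitFrame (fun i => (pd i (logPd u l) 0 : ℂ)) A A')
          + ((logPd u j 0 : ℂ)
              * spin1 unitFrame (fun i => (pd i (shiftForm g om K (logPd u) l) 0 : ℂ)) A A'
            - spin1 unitFrame (fun i => (pd i (shiftForm g om K (logPd u) j) 0 : ℂ)) A A'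
              * (logPd u l 0 : ℂ))))) := by
      intro j l
      rw [hU]
      simp only [hpX, spin1, Finset.sum_mul, Finset.mul_sum, ← Finset.sum_sub_distrib,
        ← Finset.sum_add_distrib]
      refine Finset.sum_congr rfl fun i _ => ?_
      push_cast
      ring
    rw [asdPart_sum]
    simp only [asdPart_mul_left, hpr]
    simp only [← asdPart_mul_left]
    rw [← asdPart_sum]
    simp only [e]
    rw [asdPart_mul_left, asdPart_add, asdPart_mul_left, hRx, asdPart_add, asdPart_add,
      asdPart_wedge, asdPart_wedge, hdY, hY]
    have : (spin1 unitFrame fun j => spin1 unitFrame (fun i => (pd i (logPd u j) 0 : ℂ)) A A')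
        = spin2 unitFrame (fun i j => (pd i (logPd u j) 0 : ℂ)) A A' := by
      funext B B'; rw [sum_spin1]
    rw [this]
    rfl
  have hK : (tractorAt om' K' rho' ((u 0)⁻¹ • unitFrame) 0).2.1
      = fun B B' => k B B' + spinContract U w B B' := by
    rw [hat]
    funext B B'
    change (u 0 : ℂ)⁻¹ * ((u 0 : ℂ) * (k B B' + spinContract U w B B')) = _
    field_simp
  have hom : (tractorAt om' K' rho' ((u 0)⁻¹ • unitFrame) 0).1
      = fun B' C' => (u 0 : ℂ) * w B' C' := by
    rw [hat]
    funext B' C'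
    change (u 0 : ℂ)⁻¹ * ((u 0 : ℂ) ^ 2 * w B' C') = _
    field_simp
  have hrho : ∀ A B, asdPart unitFrame (fun i j => (rho' i j 0 : ℂ)) A B = (u 0 : ℂ) * R A B := by
    intro A B
    have e3 := congrArg (fun X : Tractor => X.2.2) hat
    have e4 : asdPart ((u 0)⁻¹ • unitFrame) (fun i j => (rho' i j 0 : ℂ)) A B
        = (u 0 : ℂ)⁻¹ * R A B := by
      refine (congrFun (congrFun e3 A) B).trans ?_
      rw [hRd, hYd]
      beta_reduce
      rw [← rescale_snd_snd hw]
      rfl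
    rw [asdPart_inv_smul hu0, e4]
    field_simp
  -- Here the anti-self-duality of ρ' is used for the rescaled frame and carried to the coordinate
  -- frame, of which it is a multiple.
  have hconf := asdPart_confTerm (fun i => (logPd u i 0 : ℂ)) har' (fun A B => by
    rw [sdPart_inv_smul hu0, hs'.antiSelfDual 0 h0 _ (hn.isOrientedFrame.conf (hpos 0 h0)),
      mul_zero]) A A'
  have hn2 : ∀ j l, ∑ i, tetrad ((u 0)⁻¹ • unitFrame) A A' i
      * (nabla2 (confMetric u g) rho' i j l 0 : ℂ) = (u 0 : ℂ)⁻¹ *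
      ((∑ i, tetrad unitFrame A A' i * (pd i (rho' j l) 0 : ℂ))
        - 2 * U A A' * (rho' j l 0 : ℂ)
        - ∑ i, tetrad unitFrame A A' i *
          confTerm (fun i => (logPd u i 0 : ℂ)) (fun i j => (rho' i j 0 : ℂ)) i j l) := by
    intro j l
    rw [sum_tetrad_smul, Complex.ofReal_inv]
    congr 1
    rw [hU]
    simp only [hn.nabla2_conf hu hpos, spin1, Finset.sum_mul, Finset.mul_sum,
      ← Finset.sum_sub_distrib]
    exact Finset.sum_congr rfl fun i _ => by ring
  funext B C
  have key := conf_thd (U := U) (k := k) (w := w) (r := r)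
    (DU := spin2 unitFrame fun i j => (pd i (logPd u j) 0 : ℂ))
    (dw := fun A A' => sdPart unitFrame
      fun j l => ∑ i, tetrad unitFrame A A' i * (pd i (om j l) 0 : ℂ))
    (dk := spin2 unitFrame fun i j => (pd i (K j) 0 : ℂ))
    (p := fun A A' B B' => pSpinor g unitFrame 0 A B A' B') hw hr
    (fun A A' => sdPart_symm unitFrame (fun i j => by
      rw [← Finset.sum_neg_distrib]
      exact Finset.sum_congr rfl fun e _ => by rw [hap]; ring) 1 0)
    (R := R) (Y := Y) (Z := fun B B' => k B B' + spinContract U w B B') (fun _ _ => rfl)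
    (fun _ _ => rfl) (fun _ _ => rfl)
    (asdPart unitFrame (fun j l => ∑ i, tetrad unitFrame A A' i * (pd i (rho j l) 0 : ℂ)) B C)
    A A' B C
  have key2 := conf_thd_psi (U := U) (w := w) (ψ := psi g unitFrame 0)
    hn.weylLike.weylASD_swap_left hn.weylLike.weylASD_pair hn.weylLike.weylASD_swap_mid hw A A' B C
  have hRhs : (((u 0 : ℂ)⁻¹) ^ 2 • rescale (u 0) U
        (tractorD g om K rho unitFrame 0 A A')).2.2 B C = ((u 0 : ℂ)⁻¹) ^ 2 *
      (asdPart unitFrame (fun j l => ∑ i, tetrad unitFrame A A' i * (pd i (rho j l) 0 : ℂ)) B C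
        - ∑ E', ∑ D, raise (w A') E' * raise (fun F => nablaPsi g unitFrame 0 F E' A B C D) D
        + ∑ D, raise (fun F => k F A') D * psi g unitFrame 0 A B C D
        + ∑ E', (pSpinor g unitFrame 0 A B A' E' * raise (k C) E'
          + pSpinor g unitFrame 0 A C A' E' * raise (k B) E')
        + ∑ C', (U B C' * raise (fun B' => spin2 unitFrame (fun i j => (pd i (K j) 0 : ℂ)) A A' C B'
            + ∑ C', pSpinor g unitFrame 0 A C A' C' * raise (w B') C'
          - eps A' B' * r A C) C'
        + U C C' * raise (fun B' => spin2 unitFrame (fun i j => (pd i (K j) 0 : ℂ)) A A' B B'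
            + ∑ C', pSpinor g unitFrame 0 A B A' C' * raise (w B') C'
          - eps A' B' * r A B) C')
        + ∑ C', ∑ D', raise (fun F' => raise (fun C' => sdPart unitFrame
            (fun j l => ∑ i, tetrad unitFrame A A' i * (pd i (om j l) 0 : ℂ)) F' C'
          - eps A' F' * k A C' - eps A' C' * k A F') D') C' * U B C' * U C D') := by
    simp only [← hn.nabla2_eq, ← hn.nabla1_eq]
    rfl
  rw [hRhs]
  change asdPart _ _ _ _ - (∑ E', ∑ D, raise ((tractorAt om' K' rho' _ _).1 _) _ * _)
    + (∑ D, raise (fun F => (tractorAt om' K' rho' _ _).2.1 _ _) _ * _)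
    + (∑ E', (_ * raise ((tractorAt om' K' rho' _ _).2.1 _) _
      + _ * raise ((tractorAt om' K' rho' _ _).2.1 _) _)) = _
  rw [hK, hom]
  simp only [hn2]
  rw [asdPart_smul, asdPart_mul_left, asdPart_sub, asdPart_sub, hconf, hdr, asdPart_mul_left]
  simp only [hrho, hn.pSpinor_conf hu hpos, hn.psi_conf hu hpos, hn.nablaPsi_conf hu hpos]
  simp only [← hU]
  simp only [raise, Fin.sum_univ_two] at key key2 ⊢
  push_cast
  field_simp
  -- `key` accounts for the terms without ψ, `key2` for those with ψ.
  linear_combination 2 * key + 2 * key2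

end AtOrigin

/-! ### Conformal invariance at an arbitrary point -/

section Invariance

variable {g om rho om' rho' : Fin 4 → Fin 4 → E4 → ℝ} {K K' : Fin 4 → E4 → ℝ} {u : E4 → ℝ}
  {V V' : Set E4} {F : E4 → E4} {y : E4}

theorem pb2_antisymm {T : Fin 4 → Fin 4 → E4 → ℝ} {z : E4} (h : ∀ i j, T i j (F z) = -T j i (F z))
    (a b : Fin 4) : pb2 F T a b z = -pb2 F T b a z := by
  simp only [pb2]
  rw [sum_mul_sum_swap]
  simp only [← Finset.sum_neg_distrib, ← mul_neg]
  exact Finset.sum_congr rfl fun i _ => congrArg _ (Finset.sum_congr rfl fun j _ => by rw [h])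

theorem SectionOn.pb (hs : SectionOn g om K rho V) (hF : CoordChange F V' V) :
    SectionOn (pb2 F g) (pb2 F om) (pb1 F K) (pb2 F rho) V' where
  sm_om := hF.sm_pb2 hs.sm_om
  sm_K := hF.sm_pb1 hs.sm_K
  sm_rho := hF.sm_pb2 hs.sm_rho
  antisymm_om z hz := pb2_antisymm (hs.antisymm_om _ (hF.mapsTo hz))
  antisymm_rho z hz := pb2_antisymm (hs.antisymm_rho _ (hF.mapsTo hz))
  selfDual z hz E hE A B := by
    simp only [ofReal_pb2, asdPart_pb]
    exact hs.selfDual _ (hF.mapsTo hz) _ (hF.isOrientedFrame_push hz hE) A B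
  antiSelfDual z hz E hE A B := by
    simp only [ofReal_pb2, sdPart_pb]
    exact hs.antiSelfDual _ (hF.mapsTo hz) _ (hF.isOrientedFrame_push hz hE) A B

theorem CoordChange.logPd_pb (hF : CoordChange F V' V) (hu : Sm V u) {z : E4}
    (hz : z ∈ V') (a : Fin 4) : logPd (fun z => u (F z)) a z = pb1 F (logPd u) a z := by
  rw [logPd, (hF.hasPd_comp hu hz a).pd_eq, pb1, Finset.mul_sum]
  exact Finset.sum_congr rfl fun i _ => by rw [logPd]; ring

/-- The tensor rule is passed through its spinor form, for which naturality is the change of frame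
under the differential of `F`. -/
theorem RescalingOn.pb (hs : SectionOn g om K rho V)
    (hs' : SectionOn (confMetric u g) om' K' rho' V) (hg : MetricOn g V) (hu : Sm V u)
    (hpos : ∀ z ∈ V, 0 < u z)
    (h : RescalingOn g om K rho om' K' rho' u V) (hF : CoordChange F V' V) :
    RescalingOn (pb2 F g) (pb2 F om) (pb1 F K) (pb2 F rho) (pb2 F om') (pb1 F K') (pb2 F rho')
      (fun z => u (F z)) V' := by
  have hs2 := hs'.pb hF
  rw [pb2_confMetric] at hs2
  refine (rescalingOn_iff (hF.metricOn_pb2 hg) (fun z hz => hpos _ (hF.mapsTo hz)) (hs.pb hF)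
    hs2).2 fun z hz E hE => ?_
  rw [tractorAt_pb, tractorAt_pb, pushFrame_smul]
  simp only [hF.logPd_pb hu hz, ofReal_pb1, spin1_pb]
  exact (rescalingOn_iff hg hpos hs hs').1 h _ (hF.mapsTo hz) _ (hF.isOrientedFrame_push hz hE)

/-- Conformal invariance of the prolongation connection in coordinates. -/
theorem tractorD_conf (hg : MetricOn g V) (hu : Sm V u) (hpos : ∀ z ∈ V, 0 < u z)
    (hs : SectionOn g om K rho V) (hs' : SectionOn (confMetric u g) om' K' rho' V)
    (h : RescalingOn g om K rho om' K' rho' u V) (hy : y ∈ V) {E : Fin 4 → Fin 4 → ℝ}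
    (hE : IsOrientedFrame g y E) (A A' : Fin 2) :
    tractorD (confMetric u g) om' K' rho' ((u y)⁻¹ • E) y A A'
      = ((u y : ℂ)⁻¹) ^ 2 • rescale (u y) (spin1 E fun i => (logPd u i y : ℂ))
        (tractorD g om K rho E y A A') := by
  obtain ⟨F, V', hF, rfl, hEF, hn⟩ := hg.exists_normal hy hE
  have h0 := hn.zero_mem
  have hu' : Sm V' fun z => u (F z) := hF.sm_comp hu
  have hpos' : ∀ z ∈ V', 0 < u (F z) := fun z hz => hpos _ (hF.mapsTo hz)
  have hr := h.pb hs hs' hg hu hpos hF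
  have hs2 := hs'.pb hF
  rw [pb2_confMetric] at hs2
  have hfst := hn.tractorD_fst_conf (rho := pb2 F rho) (rho' := pb2 F rho') hu' hpos' (hs.pb hF)
    hr.om_eq hr.K_eq A A'
  have huc : (u (F 0) : ℂ) ≠ 0 := by exact_mod_cast (hpos _ hy).ne'
  have key : tractorD (confMetric (fun z => u (F z)) (pb2 F g)) (pb2 F om') (pb1 F K') (pb2 F rho')
      ((u (F 0))⁻¹ • unitFrame) 0 A A' = ((u (F 0) : ℂ)⁻¹) ^ 2 • rescale (u (F 0))
        (spin1 unitFrame fun i => (logPd (fun z => u (F z)) i 0 : ℂ))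
        (tractorD (pb2 F g) (pb2 F om) (pb1 F K) (pb2 F rho) unitFrame 0 A A') := by
    refine Prod.ext ?_ (Prod.ext ?_ ?_)
    · rw [hfst]
      funext B' C'
      change _ = ((u (F 0) : ℂ)⁻¹) ^ 2 * ((u (F 0) : ℂ) ^ 2 * _)
      field_simp
    · exact hn.tractorD_snd_conf hu' hpos' (hs.pb hF) hs2 hr A A'
    · exact hn.tractorD_thd_conf hu' hpos' (hs.pb hF) hs2 hr A A'
  rw [← pb2_confMetric, hF.tractorD_pb (hg.conf hu hpos) h0 hs'.sm_om hs'.sm_K hs'.sm_rho,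
    hF.tractorD_pb hg h0 hs.sm_om hs.sm_K hs.sm_rho, pushFrame_smul, hEF] at key
  simp only [hF.logPd_pb hu h0, ofReal_pb1, spin1_pb, hEF] at key
  exact key

end Invariance

/-! ### Contractions of pairs of two-tensors -/

/-- The contraction `g^{kl} S_{ik} T_{jl}`. -/
def pairContract (g S T : Fin 4 → Fin 4 → E4 → ℝ) (i j : Fin 4) (y : E4) : ℝ :=
  ∑ k, ∑ l, metricInv g k l y * (S i k y * T j l y)

theorem sum_mul_sum_nested {ι κ : Type*} [Fintype ι] [Fintype κ] (a X : ι → ℝ) (b Y : κ → ℝ) :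
    (∑ k, a k * X k) * (∑ l, b l * Y l) = ∑ k, a k * ∑ l, b l * (X k * Y l) := by
  simp only [Finset.sum_mul, Finset.mul_sum]
  rw [Finset.sum_comm]
  exact Finset.sum_congr rfl fun _ _ => Finset.sum_congr rfl fun _ _ => by ring

theorem CoordChange.pairContract_pb {F : E4 → E4} {V V' : Set E4} {z : E4}
    (hF : CoordChange F V' V) (hz : z ∈ V') (g S T : Fin 4 → Fin 4 → E4 → ℝ) (a b : Fin 4) :
    pairContract (pb2 F g) (pb2 F S) (pb2 F T) a b z = pb2 F (pairContract g S T) a b z := by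
  have h1 : ∀ c d, pb2 F S a c z * pb2 F T b d z = ∑ k, jac F k c z * ∑ l, jac F l d z *
      ((∑ i, jac F i a z * S i k (F z)) * ∑ j, jac F j b z * T j l (F z)) := by
    intro c d
    rw [pb2, pb2, sum_mul_sum_swap, sum_mul_sum_swap (fun j => jac F j b z), sum_mul_sum_nested]
  simp only [pairContract, h1]
  rw [hF.contract_pb hz fun k l => (∑ i, jac F i a z * S i k (F z)) * ∑ j, jac F j b z * T j l (F z)]
  simp only [sum_mul_sum_nested]
  simp only [pb2, pairContract, Finset.mul_sum]
  rw [Finset.sum_comm_cycle]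
  refine Finset.sum_congr rfl fun i _ => ?_
  rw [Finset.sum_comm_cycle]
  exact Finset.sum_congr rfl fun _ _ => Finset.sum_congr rfl fun _ _ =>
    Finset.sum_congr rfl fun _ _ => by ring

theorem NormalAt.pairContract_eq {g : Fin 4 → Fin 4 → E4 → ℝ} {V : Set E4} (hn : NormalAt g V)
    (S T : Fin 4 → Fin 4 → E4 → ℝ) (i j : Fin 4) :
    pairContract g S T i j 0 = ∑ k, S i k 0 * T j k 0 := by
  simp only [pairContract, hn.inv_eq, sum_unitFrame_mul]

theorem NormalAt.hasPd_pairContract {g : Fin 4 → Fin 4 → E4 → ℝ} {V : Set E4} (hn : NormalAt g V)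
    {S T : Fin 4 → Fin 4 → E4 → ℝ} (hS : ∀ i j, Sm V (S i j)) (hT : ∀ i j, Sm V (T i j))
    (e i j : Fin 4) : HasPd e (pairContract g S T i j)
      (∑ k, (pd e (S i k) 0 * T j k 0 + S i k 0 * pd e (T j k) 0)) 0 := by
  have hV := hn.metricOn.isOpen
  have h := HasPd.sum (s := Finset.univ) fun k _ => HasPd.sum (s := Finset.univ) fun l _ =>
    (hn.hasPd_inv e k l).mul (((hS i k).hasPd (i := e) hV hn.zero_mem).mul
      ((hT j l).hasPd hV hn.zero_mem))
  refine h.congr_val (Finset.sum_congr rfl fun k _ => ?_)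
  simp only [hn.inv_eq, zero_mul, zero_add, sum_unitFrame_mul]

/-! ### Anti-self-dual Weyl tensors -/

theorem weylSD_eq (E : Fin 4 → Fin 4 → ℝ) (W : Fin 4 → Fin 4 → Fin 4 → Fin 4 → ℂ)
    (A B C D : Fin 2) :
    weylSD E W A B C D = sdPart E (fun a b => sdPart E (fun c d => W a b c d) C D) A B := by
  have h : ∀ A' B' C' D', spin4 E W A' A B' B C' C D' D
      = spin2 E (fun a b => spin2 E (fun c d => W a b c d) C' C D' D) A' A B' B := by
    intro A' B' C' D'
    simp only [spin4_eq, spin2_eq]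
  simp only [weylSD, h]
  simp only [sdPart, spin2_mul_left, spin2_sum, Finset.mul_sum]
  exact Finset.sum_congr rfl fun _ _ => Finset.sum_congr rfl fun _ _ =>
    Finset.sum_congr rfl fun _ _ => Finset.sum_congr rfl fun _ _ => by ring

theorem sdPart_asdPart_swap (E : Fin 4 → Fin 4 → ℝ) (W : Fin 4 → Fin 4 → Fin 4 → Fin 4 → ℂ)
    (A B C D : Fin 2) :
    sdPart E (fun a b => asdPart E (fun c d => W a b c d) C D) A B
      = asdPart E (fun c d => sdPart E (fun a b => W a b c d) A B) C D := by
  have h : ∀ C' D', sdPart E (fun a b => spin2 E (fun c d => W a b c d) C C' D D') A B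
      = spin2 E (fun c d => sdPart E (fun a b => W a b c d) A B) C C' D D' := by
    intro C' D'
    change sdPart E (fun a b => ∑ i, ∑ j, tetrad E C C' i * tetrad E D D' j * W a b i j) A B = _
    simp only [sdPart_sum, sdPart_mul_left]
    rfl
  change sdPart E (fun a b => (1 / 2) * ∑ C', ∑ D', eps C' D' *
    spin2 E (fun c d => W a b c d) C C' D D') A B = _
  simp only [sdPart_sum, sdPart_mul_left, h]
  rfl

theorem eq_zero_of_parts {T : Fin 4 → Fin 4 → ℂ} (h : ∀ i j, T i j = -T j i)
    (h1 : ∀ A B, asdPart unitFrame T A B = 0) (h2 : ∀ A B, sdPart unitFrame T A B = 0) :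
    T = 0 := by
  obtain ⟨p1, p2, p3⟩ := (asdPart_unitFrame_eq_zero_iff h).1 h1
  obtain ⟨q1, q2, q3⟩ := (sdPart_unitFrame_eq_zero_iff h).1 h2
  have z : ∀ i, T i i = 0 := fun i => by linear_combination (1 / 2) * h i i
  have a1 : T 0 1 = 0 := by linear_combination (1 / 2) * p1 + (1 / 2) * q1
  have a2 : T 0 2 = 0 := by linear_combination (1 / 2) * p2 + (1 / 2) * q2
  have a3 : T 0 3 = 0 := by linear_combination (1 / 2) * p3 + (1 / 2) * q3
  have b1 : T 2 3 = 0 := by rw [← p1, a1]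
  have b2 : T 1 3 = 0 := by rw [← q2, a2]
  have b3 : T 1 2 = 0 := by rw [← p3, a3]
  funext i j
  fin_cases i <;> fin_cases j <;>
    simp [z, a1, a2, a3, b1, b2, b3, h 1 0, h 2 0, h 3 0, h 2 1, h 3 1, h 3 2]

/-- The self-dual part of W in its last pair is a two-form in the first pair. Its anti-self-dual
part vanishes by `sdPart_asdPart`, its self-dual part by hypothesis. -/
theorem WeylLike.dualRel {W : Fin 4 → Fin 4 → Fin 4 → Fin 4 → ℝ} (hW : WeylLike W)
    (h : ∀ A B C D, weylSD unitFrame (fun a b c d => (W a b c d : ℂ)) A B C D = 0) (a b : Fin 4) :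
    DualRel (-1) (W a b) := by
  have hr : ∀ a b i j, (W a b i j : ℂ) = -(W a b j i : ℂ) := fun a b i j => by
    rw [hW.antisymm_right]; push_cast; rfl
  have h0 : ∀ C D, (fun a b => sdPart unitFrame (fun c d => (W a b c d : ℂ)) C D) = 0 := by
    intro C D
    refine eq_zero_of_parts (fun a b => ?_) (fun A B => ?_) (fun A B => ?_)
    · rw [← neg_one_mul, ← sdPart_mul_left]
      congr 1; funext c d; rw [hW.antisymm_left]; push_cast; ring
    · rw [← hW.sdPart_asdPart C D A B, sdPart_asdPart_swap]
      congr 1; funext a b; congr 1; funext c d; rw [hW.pair]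
    · rw [← weylSD_eq]; exact h A B C D
  rw [← frameComp_unitFrame (W a b)]
  exact (sdPart_eq_zero_iff (hW.antisymm_right a b)).1 fun C D => congrFun (congrFun (h0 C D) a) b

/-- Anti-self-dual and self-dual two-forms commute. -/
theorem DualRel.commute {X s : Fin 4 → Fin 4 → ℝ} (hX : DualRel (-1) X) (hs : DualRel 1 s)
    (ha : ∀ i j, X i j = -X j i) (hb : ∀ i j, s i j = -s j i) (c d : Fin 4) :
    ∑ m, (X c m * s m d + X d m * s c m) = 0 := by
  obtain ⟨p1, p2, p3⟩ := hX
  obtain ⟨q1, q2, q3⟩ := hs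
  have z : ∀ i, X i i = 0 := fun i => by linarith [ha i i]
  have z' : ∀ i, s i i = 0 := fun i => by linarith [hb i i]
  simp only [Fin.sum_univ_four]
  fin_cases c <;> fin_cases d <;>
    simp [z, z', ha 1 0, ha 2 0, ha 3 0, ha 2 1, ha 3 1, ha 3 2, hb 1 0, hb 2 0, hb 3 0, hb 2 1,
      hb 3 1, hb 3 2, p1, p2, p3, q1, q2, q3]

/-! ### The curvature of Kähler metrics -/

/-- The curvature terms of the trace parts of the Riemann tensor commute with `s`; this is the
consequence for the symmetric tensor `P`. -/
theorem schouten_commute {P s : Fin 4 → Fin 4 → ℝ} (hP : ∀ i j, P i j = P j i)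
    (hs : DualRel 1 s) (hb : ∀ i j, s i j = -s j i)
    (hn : ∀ i j, ∑ k, s i k * s j k = if i = j then 1 else 0)
    (h : ∀ a b c d, ∑ m, ((unitFrame a c * P b m - unitFrame a m * P b c + unitFrame b m * P a c
        - unitFrame b c * P a m) * s m d
      + (unitFrame a d * P b m - unitFrame a m * P b d + unitFrame b m * P a d
        - unitFrame b d * P a m) * s c m) = 0) :
    ∑ i, P i i = 0 ∧ (∀ i j, ∑ k, P i k * s j k = -∑ k, P j k * s i k) ∧
      DualRel (-1) fun i j => ∑ k, P i k * s j k := by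
  obtain ⟨q1, q2, q3⟩ := hs
  have z' : ∀ i, s i i = 0 := fun i => by linarith [hb i i]
  -- The trace of the hypothesis over a = c reads [P, s] + (tr P) s = 0.
  have key : ∀ b d, (∑ k, P b k * s k d) - (∑ k, s b k * P k d) + s b d * ∑ i, P i i = 0 := by
    intro b d
    have h1 := Finset.sum_eq_zero fun c (_ : c ∈ Finset.univ) => h c b c d
    rw [← h1]
    simp only [Fin.sum_univ_four, unitFrame, hP 1 0, hP 2 0, hP 3 0, hP 2 1, hP 3 1, hP 3 2, z',
      hb 1 0, hb 2 0, hb 3 0, hb 2 1, hb 3 1, hb 3 2]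
    fin_cases b <;> fin_cases d <;>
      simp [hP 1 0, hP 2 0, hP 3 0, hP 2 1, hP 3 1, hP 3 2, z', hb 1 0, hb 2 0, hb 3 0, hb 2 1,
        hb 3 1, hb 3 2] <;> ring
  -- For symmetric P and antisymmetric s the commutator is symmetric while (tr P) s is
  -- antisymmetric, so both vanish; s itself does not.
  have tr : ∑ i, P i i = 0 := by
    have h1 : ∀ b d, s b d * ∑ i, P i i = 0 := by
      intro b d
      have k1 := key b d
      have k2 := key d b
      have e1 : ∑ k, P d k * s k b = ∑ k, s b k * P k d * (-1) :=
        Finset.sum_congr rfl fun k _ => by rw [hP d k, hb k b]; ring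
      have e2 : ∑ k, s d k * P k b = ∑ k, P b k * s k d * (-1) :=
        Finset.sum_congr rfl fun k _ => by rw [hP b k, hb d k]; ring
      rw [e1, e2, ← Finset.sum_mul, ← Finset.sum_mul, hb d b] at k2
      linarith
    have h2 := hn 0 0
    simp only [if_true] at h2
    calc ∑ i, P i i = (∑ k, s 0 k * s 0 k) * ∑ i, P i i := by rw [h2, one_mul]
      _ = ∑ k, s 0 k * (s 0 k * ∑ i, P i i) := by
        rw [Finset.sum_mul]; exact Finset.sum_congr rfl fun _ _ => by ring
      _ = 0 := Finset.sum_eq_zero fun k _ => by rw [h1, mul_zero]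
  have anti : ∀ i j, ∑ k, P i k * s j k = -∑ k, P j k * s i k := by
    intro i j
    have k1 := key i j
    rw [tr, mul_zero, add_zero] at k1
    have e1 : ∑ k, P i k * s j k = -∑ k, P i k * s k j := by
      rw [← Finset.sum_neg_distrib]; exact Finset.sum_congr rfl fun k _ => by rw [hb j k]; ring
    have e2 : ∑ k, P j k * s i k = ∑ k, s i k * P k j :=
      Finset.sum_congr rfl fun k _ => by rw [hP j k]; ring
    rw [e1, e2]
    linarith
  refine ⟨tr, anti, ?_⟩
  -- With the dual relations of s inserted, the self-dual part of P·s is a multiple of (tr P) s, up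
  -- to multiples of the antisymmetry relations.
  have a1 := anti 0 1
  have a2 := anti 0 2
  have a3 := anti 0 3
  have a4 := anti 2 3
  have a5 := anti 1 3
  have a6 := anti 1 2
  rw [DualRel]
  simp only [Fin.sum_univ_four, hP 1 0, hP 2 0, hP 3 0, hP 2 1, hP 3 1, hP 3 2, z',
      hb 1 0, hb 2 0, hb 3 0, hb 2 1, hb 3 1, hb 3 2, q1, q2, q3] at a1 a2 a3 a4 a5 a6 tr ⊢
  refine ⟨?_, ?_, ?_⟩
  · linear_combination (1 / 2) * a1 + (1 / 2) * a4 - (1 / 2) * s 2 3 * tr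
  · linear_combination (1 / 2) * a2 - (1 / 2) * a5 + (1 / 2) * s 1 3 * tr
  · linear_combination (1 / 2) * a3 + (1 / 2) * a6 - (1 / 2) * s 1 2 * tr

/-! ### The contracted Bianchi identity -/

section Bianchi

variable {g : Fin 4 → Fin 4 → E4 → ℝ} {V : Set E4}

theorem NormalAt.hasPd_riemannUp (hn : NormalAt g V) (e a b c d : Fin 4) :
    HasPd e (riemannUp g a b c d)
      (pd e (pd a (christoffel g d b c)) 0 - pd e (pd b (christoffel g d a c)) 0) 0 := by
  have hV := hn.metricOn.isOpen
  have hΓ : ∀ k i j, HasPd e (christoffel g k i j) (pd e (christoffel g k i j) 0) 0 :=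
    fun k i j => (hn.metricOn.sm_christoffel k i j).hasPd hV hn.zero_mem
  have h := ((((hn.metricOn.sm_christoffel d b c).pd hV a).hasPd hV hn.zero_mem (i := e)).sub
    (((hn.metricOn.sm_christoffel d a c).pd hV b).hasPd hV hn.zero_mem)).add
    (HasPd.sum (s := Finset.univ) fun m _ =>
      ((hΓ d a m).mul (hΓ m b c)).sub ((hΓ d b m).mul (hΓ m a c)))
  refine h.congr_val ?_
  simp [hn.christoffel_zero]

theorem NormalAt.hasPd_riemann (hn : NormalAt g V) (e a b c d : Fin 4) :
    HasPd e (riemann g a b c d)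
      (pd e (pd a (christoffel g d b c)) 0 - pd e (pd b (christoffel g d a c)) 0) 0 := by
  have h := HasPd.sum (s := Finset.univ) fun m _ =>
    (hn.hasPd_riemannUp e a b c m).mul (hn.hasPd_g e m d)
  refine h.congr_val ?_
  simp only [hn.g_eq, mul_zero, add_zero]
  rw [← sum_unitFrame_mul' d fun m =>
    pd e (pd a (christoffel g m b c)) 0 - pd e (pd b (christoffel g m a c)) 0]
  exact Finset.sum_congr rfl fun m _ => mul_comm _ _

/-- At the origin the derivative of the curvature consists of second derivatives of Γ, which cancel
in pairs in the cyclic sum. -/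
theorem NormalAt.bianchi (hn : NormalAt g V) (e a b c d : Fin 4) :
    pd e (riemann g a b c d) 0 + pd a (riemann g b e c d) 0 + pd b (riemann g e a c d) 0 = 0 := by
  have h := fun i j k l => pd_comm (hn.metricOn.sm_christoffel d k l) hn.metricOn.isOpen
    hn.zero_mem i j
  rw [(hn.hasPd_riemann e a b c d).pd_eq, (hn.hasPd_riemann a b e c d).pd_eq,
    (hn.hasPd_riemann b e a c d).pd_eq, h e a b c, h e b a c, h a b e c]
  ring

theorem NormalAt.hasPd_weyl (hn : NormalAt g V) (e a b c d : Fin 4) :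
    HasPd e (weyl g a b c d) (pd e (riemann g a b c d) 0
      + (unitFrame a c * pd e (schouten g b d) 0 - unitFrame a d * pd e (schouten g b c) 0
      + unitFrame b d * pd e (schouten g a c) 0 - unitFrame b c * pd e (schouten g a d) 0)) 0 := by
  have hV := hn.metricOn.isOpen
  have hP : ∀ i j, HasPd e (schouten g i j) (pd e (schouten g i j) 0) 0 :=
    fun i j => (hn.metricOn.sm_schouten i j).hasPd hV hn.zero_mem
  have h := (((hn.metricOn.sm_riemann a b c d).hasPd hV hn.zero_mem (i := e)).add
    (((((hn.hasPd_g e a c).mul (hP b d)).sub ((hn.hasPd_g e a d).mul (hP b c))).add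
    ((hn.hasPd_g e b d).mul (hP a c))).sub ((hn.hasPd_g e b c).mul (hP a d))))
  refine (h.congr_on hV hn.zero_mem fun z _ => weyl_eq g a b c d z).congr_val ?_
  simp only [hn.g_eq, zero_mul, zero_add]

/-- The symmetries of the Weyl tensor are linear, and the only variable coefficient, g⁻¹ in the
trace, is stationary at the origin. -/
theorem NormalAt.weylLike_pd (hn : NormalAt g V) (e : Fin 4) :
    WeylLike fun a b c d => pd e (weyl g a b c d) 0 where
  antisymm_left a b c d := by
    rw [pd_congr_on hn.metricOn.isOpen hn.zero_mem fun z _ => weyl_antisymm_left g a b c d z]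
    exact (Sm.hasPd (hn.metricOn.sm_weyl b a c d) hn.metricOn.isOpen hn.zero_mem).neg.pd_eq
  antisymm_right a b c d := by
    rw [pd_congr_on hn.metricOn.isOpen hn.zero_mem fun z hz =>
      hn.metricOn.weyl_antisymm_right hz a b c d]
    exact (Sm.hasPd (hn.metricOn.sm_weyl a b d c) hn.metricOn.isOpen hn.zero_mem).neg.pd_eq
  pair a b c d := pd_congr_on hn.metricOn.isOpen hn.zero_mem fun z hz =>
    hn.metricOn.weyl_pair hz a b c d
  cyclic a b c d := by
    have h := fun a b c d => Sm.hasPd (hn.metricOn.sm_weyl a b c d) hn.metricOn.isOpen hn.zero_mem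
      (i := e)
    rw [← (((h a b c d).add (h b c a d)).add (h c a b d)).pd_eq,
      pd_congr_on hn.metricOn.isOpen hn.zero_mem fun z hz => hn.metricOn.weyl_cyclic hz a b c d]
    exact (HasPd.const 0).pd_eq
  trace a c := by
    have h := fun a b c d => Sm.hasPd (hn.metricOn.sm_weyl a b c d) hn.metricOn.isOpen hn.zero_mem
      (i := e)
    have h1 := HasPd.sum (s := Finset.univ) fun b _ => HasPd.sum (s := Finset.univ) fun d _ =>
      (hn.hasPd_inv e b d).mul (h a b c d)
    have h2 := h1.pd_eq
    rw [pd_congr_on hn.metricOn.isOpen hn.zero_mem fun z hz => hn.metricOn.weyl_trace hz a c,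
      (HasPd.const 0).pd_eq] at h2
    simpa only [zero_mul, zero_add, hn.inv_eq, sum_unitFrame_mul] using h2.symm

/-- The divergence of the Weyl tensor of a scalar-flat metric. -/
theorem NormalAt.div_weyl (hn : NormalAt g V) (hs : ∀ z ∈ V, scalarCurv g z = 0) (a b c : Fin 4) :
    ∑ d, pd d (weyl g a b c d) 0 = pd a (schouten g b c) 0 - pd b (schouten g a c) 0 ∧
      ∑ d, pd d (schouten g a d) 0 = 0 := by
  have hV := hn.metricOn.isOpen
  have hP : ∀ e i j, HasPd e (schouten g i j) (pd e (schouten g i j) 0) 0 :=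
    fun e i j => (hn.metricOn.sm_schouten i j).hasPd hV hn.zero_mem
  -- The trace of P is −R/6 and vanishes identically near the origin, so it may be differentiated.
  have tr : ∀ e, ∑ i, pd e (schouten g i i) 0 = 0 := by
    intro e
    have h1 := (HasPd.sum (s := Finset.univ) fun b _ => HasPd.sum (s := Finset.univ) fun d _ =>
      (hn.hasPd_inv e b d).mul (hP e b d)).pd_eq
    rw [pd_congr_on (h := fun z => ∑ b, ∑ d, metricInv g b d z * schouten g b d z)
      (f := fun _ => 0) hV hn.zero_mem fun z hz => by
        rw [hn.metricOn.trace_schouten hz, hs z hz]; ring, (HasPd.const 0).pd_eq] at h1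
    simpa only [zero_mul, zero_add, hn.inv_eq, sum_unitFrame_mul] using h1.symm
  have hsym : ∀ e i j, pd e (schouten g i j) 0 = pd e (schouten g j i) 0 := fun e i j =>
    pd_congr_on hV hn.zero_mem fun z hz => hn.metricOn.schouten_symm hz i j
  have hW := fun e => hn.weylLike_pd e
  have key : ∀ a b c, ∑ d, pd d (weyl g a b c d) 0 = pd a (schouten g b c) 0
      - pd b (schouten g a c) 0 + unitFrame a c * (∑ d, pd d (schouten g b d) 0)
      - unitFrame b c * ∑ d, pd d (schouten g a d) 0 := by
    intro a b c
    have h4 : ∑ d : Fin 4, unitFrame d d = 4 := by simp [unitFrame]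
    -- The Bianchi identity contracted once; the traces of ∂W vanish by `weylLike_pd`.
    have h1 : ∑ d, (pd d (riemann g a b c d) 0 + pd a (riemann g b d c d) 0
        + pd b (riemann g d a c d) 0) = 0 := Finset.sum_eq_zero fun d _ => hn.bianchi d a b c d
    have hR : ∀ e a b c d, pd e (riemann g a b c d) 0 = pd e (weyl g a b c d) 0
      - (unitFrame a c * pd e (schouten g b d) 0 - unitFrame a d * pd e (schouten g b c) 0
      + unitFrame b d * pd e (schouten g a c) 0 - unitFrame b c * pd e (schouten g a d) 0) := by
      intro e a b c d
      rw [(hn.hasPd_weyl e a b c d).pd_eq]; ring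
    have t1 := (hW a).trace b c
    have t2 : ∑ d, pd b (weyl g d a c d) 0 = 0 := by
      rw [← neg_eq_zero, ← Finset.sum_neg_distrib, ← (hW b).trace a c]
      exact Finset.sum_congr rfl fun d _ => ((hW b).antisymm_left a d c d).symm
    have u1 : ∀ (a : Fin 4) (X : Fin 4 → ℝ), ∑ d, unitFrame a d * X d = X a :=
      fun a X => sum_unitFrame_mul a X
    have u2 : ∀ (a : Fin 4) (X : Fin 4 → ℝ), ∑ d, unitFrame d a * X d = X a :=
      fun a X => sum_unitFrame_mul' a X
    simp only [hR, Finset.sum_add_distrib, Finset.sum_sub_distrib, t1, t2, ← Finset.mul_sum,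
      ← Finset.sum_mul, tr, h4] at h1
    rw [u1 a fun d => pd d (schouten g b c) 0, u1 b fun d => pd d (schouten g a c) 0,
      u1 b fun d => pd a (schouten g d c) 0, u2 c fun d => pd a (schouten g b d) 0,
      u2 c fun d => pd b (schouten g a d) 0, u1 a fun d => pd b (schouten g d c) 0] at h1
    linarith
  -- A second contraction kills the Weyl term and leaves a nonzero multiple of the divergence of P.
  have hdiv : ∀ a, ∑ d, pd d (schouten g a d) 0 = 0 := by
    intro a
    have h4 : ∑ d : Fin 4, unitFrame d d = 4 := by simp [unitFrame]
    have h1 : ∑ b, ∑ d, pd d (weyl g a b b d) 0 = 0 := by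
      rw [Finset.sum_comm]
      refine Finset.sum_eq_zero fun d _ => ?_
      rw [← neg_eq_zero, ← Finset.sum_neg_distrib, ← (hW d).trace a d]
      exact Finset.sum_congr rfl fun b _ => ((hW d).antisymm_right a b d b).symm
    simp only [key, Finset.sum_add_distrib, Finset.sum_sub_distrib, ← Finset.sum_mul, tr, h4] at h1
    rw [sum_unitFrame_mul a fun b => ∑ d, pd d (schouten g b d) 0] at h1
    have h2 : ∑ b, pd b (schouten g a b) 0 = ∑ b, pd b (schouten g b a) 0 :=
      Finset.sum_congr rfl fun b _ => hsym b a b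
    linarith
  refine ⟨?_, hdiv a⟩
  rw [key, hdiv, hdiv]; ring

end Bianchi

/-! ### Kähler metrics with anti-self-dual Weyl tensor -/

theorem pushFrame_unitFrame (F : E4 → E4) (z : E4) (a i : Fin 4) :
    pushFrame F z unitFrame a i = jac F i a z := by
  simp [pushFrame, unitFrame]

theorem pb2_eq_frameComp (F : E4 → E4) (z : E4) (T : Fin 4 → Fin 4 → E4 → ℝ) (a b : Fin 4) :
    pb2 F T a b z = frameComp (pushFrame F z unitFrame) (fun i j => T i j (F z)) a b := by
  simp only [pb2, frameComp, pushFrame_unitFrame]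

theorem pb4_eq_frameComp (F : E4 → E4) (z : E4) (W : Fin 4 → Fin 4 → Fin 4 → Fin 4 → E4 → ℝ)
    (a b c d : Fin 4) : pb4 F W a b c d z = pb2 F (fun i j y =>
      frameComp (pushFrame F z unitFrame) (fun k l => W i j k l y) c d) a b z := by
  simp only [pb4, pb2, frameComp, pushFrame_unitFrame]

theorem pb2_const_mul (F : E4 → E4) (z : E4) (T : Fin 4 → Fin 4 → E4 → ℝ) (c : ℝ) (a b : Fin 4) :
    pb2 F (fun i j y => c * T i j y) a b z = c * pb2 F T a b z := by
  simp only [pb2, Finset.mul_sum]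
  exact Finset.sum_congr rfl fun _ _ => Finset.sum_congr rfl fun _ _ => by ring

/-- Each duality relation in the last two indices is a linear equation between two-tensors in the
first two, and such equations descend along an invertible Jacobian. -/
theorem CoordChange.dualRel_of_pb4 {F : E4 → E4} {V V' : Set E4} {z : E4}
    (hF : CoordChange F V' V) (hz : z ∈ V') {W : Fin 4 → Fin 4 → Fin 4 → Fin 4 → E4 → ℝ} {s : ℝ}
    (h : ∀ a b, DualRel s fun c d => pb4 F W a b c d z) (i j : Fin 4) :
    DualRel s (frameComp (pushFrame F z unitFrame) fun c d => W i j c d (F z)) := by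
  have key : ∀ c d c' d' (t : ℝ), (∀ a b, pb4 F W a b c d z = t * pb4 F W a b c' d' z) →
      frameComp (pushFrame F z unitFrame) (fun c d => W i j c d (F z)) c d
        = t * frameComp (pushFrame F z unitFrame) (fun c d => W i j c d (F z)) c' d' := by
    intro c d c' d' t ht
    exact hF.eq_of_pb2 hz (S := fun i j y =>
        frameComp (pushFrame F z unitFrame) (fun k l => W i j k l y) c d)
      (T := fun i j y => t * frameComp (pushFrame F z unitFrame) (fun k l => W i j k l y) c' d')
      (fun a b => by rw [pb2_const_mul, ← pb4_eq_frameComp, ← pb4_eq_frameComp, ht]) i j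
  exact ⟨key _ _ _ _ _ fun a b => (h a b).1, key _ _ _ _ _ fun a b => (h a b).2.1,
    key _ _ _ _ _ fun a b => (h a b).2.2⟩

/-- `Σ` is a parallel self-dual two-form of constant length for the metric `h`, the Weyl tensor of
which is anti-self-dual. -/
structure KahlerLike (h Sig : Fin 4 → Fin 4 → E4 → ℝ) (V : Set E4) : Prop where
  metricOn : MetricOn h V
  sm : ∀ i j, Sm V (Sig i j)
  antisymm : ∀ z ∈ V, ∀ i j, Sig i j z = -Sig j i z
  selfDual : ∀ z ∈ V, ∀ E, IsOrientedFrame h z E →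
    ∀ A B, asdPart E (fun i j => (Sig i j z : ℂ)) A B = 0
  norm : ∀ z ∈ V, ∀ i j, pairContract h Sig Sig i j z = h i j z
  parallel : ∀ z ∈ V, ∀ e i j, nabla2 h Sig e i j z = 0
  asd : ∀ z ∈ V, ∀ E, IsOrientedFrame h z E → ∀ A' B' C' D', psiPrimed h E z A' B' C' D' = 0

section Kahler

variable {h Sig : Fin 4 → Fin 4 → E4 → ℝ} {V V' : Set E4} {F : E4 → E4} {y : E4}

theorem KahlerLike.pb (hk : KahlerLike h Sig V) (hF : CoordChange F V' V) :
    KahlerLike (pb2 F h) (pb2 F Sig) V' where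
  metricOn := hF.metricOn_pb2 hk.metricOn
  sm := hF.sm_pb2 hk.sm
  antisymm z hz := pb2_antisymm (hk.antisymm _ (hF.mapsTo hz))
  selfDual z hz E hE A B := by
    simp only [ofReal_pb2, asdPart_pb]
    exact hk.selfDual _ (hF.mapsTo hz) _ (hF.isOrientedFrame_push hz hE) A B
  norm z hz i j := by
    rw [hF.pairContract_pb hz]
    simp only [pb2, hk.norm _ (hF.mapsTo hz)]
  parallel z hz e i j := by
    rw [hF.nabla2_pb hk.metricOn hz hk.sm]
    simp [pb2, hk.parallel _ (hF.mapsTo hz)]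
  asd z hz E hE := by
    rw [hF.psiPrimed_pb hk.metricOn hz]
    exact hk.asd _ (hF.mapsTo hz) _ (hF.isOrientedFrame_push hz hE)

/-- By the Ricci identity the curvature commutes with Σ. Its Weyl part does so automatically,
anti-self-dual and self-dual forms being commuting matrices. The remaining part is built from g and
P and falls under `schouten_commute`. -/
theorem KahlerLike.curvature_zero (hk : KahlerLike h Sig V) (hn : NormalAt h V) :
    scalarCurv h 0 = 0 ∧
    (∀ i j, pairContract h (schouten h) Sig i j 0 = -pairContract h (schouten h) Sig j i 0) ∧
    DualRel (-1) (fun i j => pairContract h (schouten h) Sig i j 0) ∧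
    ∀ a b, DualRel (-1) fun c d => weyl h a b c d 0 := by
  have h0 := hn.zero_mem
  have hW : ∀ a b, DualRel (-1) fun c d => weyl h a b c d 0 := fun a b =>
    hn.weylLike.dualRel (hk.asd 0 h0 _ hn.isOrientedFrame) a b
  have hs : DualRel 1 fun i j => Sig i j 0 := by
    rw [← frameComp_unitFrame fun i j => Sig i j 0]
    exact (asdPart_eq_zero_iff (hk.antisymm 0 h0)).1 (hk.selfDual 0 h0 _ hn.isOrientedFrame)
  have hnorm : ∀ i j, ∑ k, Sig i k 0 * Sig j k 0 = if i = j then 1 else 0 := fun i j => by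
    rw [← hn.pairContract_eq, hk.norm 0 h0, hn.g_zero]
  have hR : ∀ a b c d, riemannUp h a b c d 0 = weyl h a b c d 0
      - (unitFrame a c * schouten h b d 0 - unitFrame a d * schouten h b c 0
      + unitFrame b d * schouten h a c 0 - unitFrame b c * schouten h a d 0) := by
    intro a b c d
    rw [weyl_eq, riemann]
    simp only [hn.g_eq, sum_mul_unitFrame]
    ring
  have hc := schouten_commute (P := fun i j => schouten h i j 0) (s := fun i j => Sig i j 0)
    (hn.metricOn.schouten_symm h0) hs (hk.antisymm 0 h0) hnorm fun a b c d => by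
      have h1 := hn.metricOn.ricci_identity hk.sm
        (fun z hz i j k => by have := hk.parallel z hz i j k; rw [nabla2] at this; linarith)
        h0 a b c d
      have h2 := (hW a b).commute hs (hn.metricOn.weyl_antisymm_right h0 a b) (hk.antisymm 0 h0) c d
      rw [← sub_eq_zero.2 (h2.trans h1.symm), ← Finset.sum_sub_distrib]
      exact Finset.sum_congr rfl fun m _ => by rw [hR, hR]; ring
  simp only [← hn.pairContract_eq (schouten h) Sig] at hc
  refine ⟨?_, hc.2.1, hc.2.2, hW⟩
  have h3 := hn.metricOn.trace_schouten h0
  simp only [hn.inv_eq, sum_unitFrame_mul, hc.1] at h3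
  linarith

/-- The same conclusions at every point: differentiating ρ and R requires them on an open set. -/
theorem KahlerLike.curvature (hk : KahlerLike h Sig V) (hy : y ∈ V) {E : Fin 4 → Fin 4 → ℝ}
    (hE : IsOrientedFrame h y E) :
    scalarCurv h y = 0 ∧
    (∀ i j, pairContract h (schouten h) Sig i j y = -pairContract h (schouten h) Sig j i y) ∧
    DualRel (-1) (frameComp E fun i j => pairContract h (schouten h) Sig i j y) ∧
    ∀ a b, DualRel (-1) (frameComp E fun c d => weyl h a b c d y) := by
  obtain ⟨F, V', hF, rfl, rfl, hn⟩ := hk.metricOn.exists_normal hy hE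
  have h0 := hn.zero_mem
  obtain ⟨c1, c2, c3, c4⟩ := (hk.pb hF).curvature_zero hn
  have hP : ∀ a b, pairContract (pb2 F h) (schouten (pb2 F h)) (pb2 F Sig) a b 0
      = pb2 F (pairContract h (schouten h) Sig) a b 0 := by
    intro a b
    rw [← hF.pairContract_pb h0]
    simp only [pairContract, hF.schouten_pb hk.metricOn h0]
  rw [hF.scalarCurv_pb hk.metricOn h0] at c1
  simp only [hP] at c2 c3
  refine ⟨c1, fun i j => ?_, ?_, hF.dualRel_of_pb4 h0 fun a b => ?_⟩
  · exact hF.eq_of_pb2 h0 (S := pairContract h (schouten h) Sig)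
      (T := fun i j y => -pairContract h (schouten h) Sig j i y) (fun a b => by
        rw [c2 a b]
        simp only [pb2, mul_neg, Finset.sum_neg_distrib]
        rw [sum_mul_sum_swap]) i j
  · simpa only [pb2_eq_frameComp] using c3
  · simpa only [hF.weyl_pb hk.metricOn h0] using c4 a b

end Kahler

/-! ### The parallel section of a Kähler metric -/

theorem sum_diag_eq (M : Fin 4 → Fin 4 → ℂ) :
    ∑ m, M m m = ∑ A, ∑ B, eps A B * ∑ A', ∑ B', eps A' B' * spin2 unitFrame M A A' B B' := by
  have h1 : ∀ i j, M i j = ∑ m, (unitFrame m i : ℂ) * M m j := by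
    intro i j
    simp [unitFrame, apply_ite Complex.ofReal]
  have h2 : ∀ A A' B B', spin2 unitFrame M A A' B B' = ∑ m,
      spin1 unitFrame (fun i => (unitFrame m i : ℂ)) A A' * spin1 unitFrame (M m) B B' := by
    intro A A' B B'
    rw [show M = fun i j => ∑ m, (unitFrame m i : ℂ) * M m j from funext fun i => funext (h1 i)]
    simp only [spin2_sum, spin2_mul]
    exact Finset.sum_congr rfl fun m _ => by simp only [← h1]
  have h3 : ∑ m, M m m = ∑ m, spinDot (spin1 unitFrame fun i => (unitFrame m i : ℂ))
      (spin1 unitFrame (M m)) := by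
    refine Finset.sum_congr rfl fun m _ => ?_
    rw [← sum_mul_eq_spinDot]
    simp [unitFrame, apply_ite Complex.ofReal]
  rw [h3]
  simp only [spinDot, h2, Fin.sum_univ_two, Finset.mul_sum, ← Finset.sum_add_distrib]

/-- The contraction of the derivative of an anti-self-dual two-form. -/
theorem sum_spin1_asd {Z : Fin 4 → Fin 4 → Fin 4 → ℂ} (ha : ∀ e c d, Z e c d = -Z e d c)
    (h : ∀ e A B, sdPart unitFrame (Z e) A B = 0) (C C' : Fin 2) :
    ∑ D, raise (fun F => asdPart unitFrame
        (fun c d => ∑ e, tetrad unitFrame F C' e * Z e c d) C D) D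
      = -spin1 unitFrame (fun c => ∑ d, Z d c d) C C' := by
  have h1 : spin1 unitFrame (fun c => ∑ d, Z d c d) C C'
      = ∑ d, spin1 unitFrame (fun c => Z d c d) C C' := by rw [spin1_sum]
  have h2 : ∀ F F' D D', spin2 unitFrame (fun e d => spin1 unitFrame (fun c => Z e c d) C C')
      F F' D D' = asdPart unitFrame (fun c d => ∑ e, tetrad unitFrame F F' e * Z e c d) C D
        * eps C' D' := by
    intro F F' D D'
    have h3 : ∀ i j, ∑ e, tetrad unitFrame F F' e * Z e i j
        = -∑ e, tetrad unitFrame F F' e * Z e j i := by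
      intro i j
      rw [← Finset.sum_neg_distrib]
      exact Finset.sum_congr rfl fun e _ => by rw [ha]; ring
    have h4 : sdPart unitFrame (fun c d => ∑ e, tetrad unitFrame F F' e * Z e c d) C' D' = 0 := by
      simp only [sdPart_sum, sdPart_mul_left, h, mul_zero, Finset.sum_const_zero]
    have h5 := spin2_decomp unitFrame h3 C C' D D'
    rw [h4, zero_mul, add_zero] at h5
    rw [← h5]
    simp only [spin2_sum, spin2_mul_left]
    rw [← sum_spin1]
    simp only [← sum_spin1 unitFrame (Z _) C C' D D']
    simp only [spin1, Finset.mul_sum]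
    rw [Finset.sum_comm]
    exact Finset.sum_congr rfl fun _ _ => Finset.sum_congr rfl fun _ _ =>
      Finset.sum_congr rfl fun _ _ => by ring
  rw [h1, sum_diag_eq fun e d => spin1 unitFrame (fun c => Z e c d) C C']
  simp only [h2, raise]
  fin_cases C' <;> simp [eps, Fin.sum_univ_two]

/-- For t = ∇ρ with ρ anti-self-dual, dρ and the divergence of ρ carry the same information: a
coclosed form is closed. -/
theorem sum_cyclic_eq_zero {t : Fin 4 → Fin 4 → Fin 4 → ℝ} (ha : ∀ e i j, t e i j = -t e j i)
    (h : ∀ e, DualRel (-1) (t e)) (hd : ∀ j, ∑ i, t i i j = 0) (e i j : Fin 4) :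
    t e i j + t i j e + t j e i = 0 := by
  have h1 := fun e => (h e).1
  have h2 := fun e => (h e).2.1
  have h3 := fun e => (h e).2.2
  have z : ∀ e i, t e i i = 0 := fun e i => by linarith [ha e i i]
  have a1 := hd 0
  have a2 := hd 1
  have a3 := hd 2
  have a4 := hd 3
  simp only [Fin.sum_univ_four, z, ha _ 1 0, ha _ 2 0, ha _ 3 0, ha _ 2 1, ha _ 3 1, ha _ 3 2, h1,
    h2, h3] at a1 a2 a3 a4
  fin_cases e <;> fin_cases i <;> fin_cases j <;>
    simp only [Fin.zero_eta, Fin.mk_one, Fin.reduceFinMk, z, ha _ 1 0, ha _ 2 0, ha _ 3 0, ha _ 2 1,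
      ha _ 3 1, ha _ 3 2, h1, h2, h3] <;> linarith

section Kahler

variable {h Sig : Fin 4 → Fin 4 → E4 → ℝ} {V V' : Set E4} {F : E4 → E4} {y : E4}

theorem KahlerLike.sm_pairContract (hk : KahlerLike h Sig V) (i j : Fin 4) :
    Sm V (pairContract h (schouten h) Sig i j) :=
  Sm.sum fun k _ => Sm.sum fun l _ => (hk.metricOn.sm_inv k l).mul
    ((hk.metricOn.sm_schouten i k).mul (hk.sm j l))

theorem KahlerLike.sectionOn (hk : KahlerLike h Sig V) :
    SectionOn h Sig (fun _ _ => 0) (pairContract h (schouten h) Sig) V where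
  sm_om := hk.sm
  sm_K _ := contDiffOn_const
  sm_rho := hk.sm_pairContract
  antisymm_om := hk.antisymm
  antisymm_rho z hz := by
    obtain ⟨E, hE⟩ := hk.metricOn.exists_frame hz
    exact (hk.curvature hz hE).2.1
  selfDual := hk.selfDual
  antiSelfDual z hz E hE := (sdPart_eq_zero_iff (hk.curvature hz hE).2.1).2 (hk.curvature hz hE).2.2.1

/-- Contraction with Σ acts on the primed index only, so the left-hand side is the spinor form of
P·Σ = ρ, which is ρ_{AB}ε_{A'B'} because ρ is anti-self-dual. -/
theorem KahlerLike.tractorD_snd (hk : KahlerLike h Sig V) (hn : NormalAt h V) (A A' B B' : Fin 2) :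
    ∑ C', spin2 unitFrame (fun i j => (schouten h i j 0 : ℂ)) A A' B C'
        * raise (sdPart unitFrame (fun i j => (Sig i j 0 : ℂ)) B') C'
      = eps A' B' * asdPart unitFrame
        (fun i j => (pairContract h (schouten h) Sig i j 0 : ℂ)) A B := by
  have h0 := hn.zero_mem
  have hs := hk.sectionOn
  have hE := hn.isOrientedFrame
  have h1 := spin2_decomp unitFrame (T := fun i j => (pairContract h (schouten h) Sig i j 0 : ℂ))
    (fun i j => by rw [hs.antisymm_rho 0 h0]; push_cast; rfl) A A' B B'
  rw [hs.antiSelfDual 0 h0 _ hE, zero_mul, add_zero] at h1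
  rw [mul_comm, ← h1]
  simp only [hn.pairContract_eq]
  rw [← sum_spin1]
  have h2 : ∀ k, spin1 unitFrame (fun i => ((∑ m, schouten h i m 0 * Sig k m 0 : ℝ) : ℂ)) A A'
      = ∑ m, (Sig k m 0 : ℂ) * spin1 unitFrame (fun i => (schouten h i m 0 : ℂ)) A A' := by
    intro k
    simp only [Complex.ofReal_sum, Complex.ofReal_mul, spin1_sum, ← spin1_mul_left]
    exact Finset.sum_congr rfl fun m _ => by congr 1; funext i; ring
  simp only [h2]
  rw [spin1_contract (T := fun i j => (Sig i j 0 : ℂ))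
    (fun i j => by rw [hk.antisymm 0 h0]; push_cast; rfl) (hk.selfDual 0 h0 _ hE)]
  exact Finset.sum_congr rfl fun C' _ => by rw [sum_spin1]

/-- For a fixed direction, ∇W has the symmetries of a Weyl tensor at the origin, so its spinor is
totally symmetric. -/
theorem NormalAt.nablaPsi_symm (hn : NormalAt h V) (F F' A B C D : Fin 2) :
    nablaPsi h unitFrame 0 F F' A B C D = nablaPsi h unitFrame 0 F F' B C A D := by
  have h1 : ∀ A B C D, nablaPsi h unitFrame 0 F F' A B C D = ∑ e, tetrad unitFrame F F' e *
      weylASD unitFrame (fun a b c d => (pd e (weyl h a b c d) 0 : ℂ)) A B C D := by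
    intro A B C D
    simp only [nablaPsi, hn.nabla4_eq, weylASD_eq, asdPart_sum, asdPart_mul_left]
  rw [h1, h1]
  exact Finset.sum_congr rfl fun e _ => by
    rw [(hn.weylLike_pd e).weylASD_swap_left, (hn.weylLike_pd e).weylASD_swap_mid]

/-- The contraction ∇_{A'}{}^Dψ_{ABCD} is the divergence of the Weyl tensor. The last index pair
carries the divergence, and its anti-self-duality lets the spinor contraction stand for the full
trace. -/
theorem KahlerLike.sum_nablaPsi (hk : KahlerLike h Sig V) (hn : NormalAt h V)
    (A A' B C : Fin 2) :
    ∑ D, raise (fun F => nablaPsi h unitFrame 0 F A' A B C D) D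
      = -asdPart unitFrame (fun a b => spin1 unitFrame
        (fun c => ((∑ d, pd d (weyl h a b c d) 0 : ℝ) : ℂ)) A A') B C := by
  have hW := fun e => hn.weylLike_pd e
  have h1 := sum_spin1_asd
    (Z := fun e c d => asdPart unitFrame (fun a b => (pd e (weyl h a b c d) 0 : ℂ)) B C)
    (fun e c d => by
      rw [← neg_one_mul, ← asdPart_mul_left]
      congr 1; funext a b; rw [(hW e).antisymm_right]; push_cast; ring)
    (fun e P Q => by
      have h2 : ∀ a b, DualRel (-1) fun c d => pd e (weyl h a b c d) 0 := fun a b =>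
        hn.dualRel_pd (T := weyl h a b) (hn.metricOn.sm_weyl a b)
          (fun z hz => hn.metricOn.weyl_antisymm_right hz a b) (by norm_num)
          (fun z hz E hE => (hk.curvature hz hE).2.2.2 a b) e
      have h3 : ∀ a b, sdPart unitFrame (fun c d => (pd e (weyl h a b c d) 0 : ℂ)) P Q = 0 := by
        intro a b
        refine (sdPart_eq_zero_iff ((hW e).antisymm_right a b)).2 ?_ P Q
        rw [frameComp_unitFrame]; exact h2 a b
      rw [sdPart_asdPart_swap unitFrame fun c d a b => (pd e (weyl h a b c d) 0 : ℂ)]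
      simp only [h3]
      simp [asdPart, spin2]) A A'
  have h4 : ∀ F D, nablaPsi h unitFrame 0 F A' A B C D = asdPart unitFrame (fun c d => ∑ e,
      tetrad unitFrame F A' e * asdPart unitFrame (fun a b => (pd e (weyl h a b c d) 0 : ℂ)) B C)
        A D := by
    intro F D
    rw [hn.nablaPsi_symm]
    simp only [nablaPsi, hn.nabla4_eq, weylASD_eq_swap, asdPart_sum, asdPart_mul_left]
  simp only [h4, h1]
  simp only [spin1, asdPart_sum, asdPart_mul_left, Complex.ofReal_sum]

/-- The third component of the derivative of the section is the anti-self-dual part of the exterior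
derivative of a closed form. -/
theorem KahlerLike.tractorD_thd (hk : KahlerLike h Sig V) (hn : NormalAt h V)
    (A A' B C : Fin 2) :
    asdPart unitFrame (fun j l => ∑ i, tetrad unitFrame A A' i
        * (pd i (pairContract h (schouten h) Sig j l) 0 : ℂ)) B C
      = ∑ E', ∑ D, raise (sdPart unitFrame (fun i j => (Sig i j 0 : ℂ)) A') E'
        * raise (fun F => nablaPsi h unitFrame 0 F E' A B C D) D := by
  have h0 := hn.zero_mem
  have hV := hn.metricOn.isOpen
  have hs := hk.sectionOn
  have hE := hn.isOrientedFrame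
  have hsc : ∀ z ∈ V, scalarCurv h z = 0 := fun z hz =>
    (hk.curvature hz (hk.metricOn.exists_frame hz).choose_spec).1
  -- Σ is parallel, so only P is differentiated.
  have hdT : ∀ e i j, pd e (pairContract h (schouten h) Sig i j) 0
      = ∑ k, pd e (schouten h i k) 0 * Sig j k 0 := by
    intro e i j
    rw [(hn.hasPd_pairContract hk.metricOn.sm_schouten hk.sm e i j).pd_eq]
    refine Finset.sum_congr rfl fun k _ => ?_
    have h1 := hk.parallel 0 h0 e j k
    rw [hn.nabla2_eq] at h1
    rw [h1]; ring
  have hsym : ∀ e i j, pd e (schouten h i j) 0 = pd e (schouten h j i) 0 := fun e i j =>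
    pd_congr_on hV h0 fun z hz => hn.metricOn.schouten_symm hz i j
  have hanti := fun e i j => hn.metricOn.pd_antisymm h0 hs.antisymm_rho hs.sm_rho e i j
  -- The form ρ is closed: its divergence is the divergence of P contracted with Σ, which vanishes
  -- for a scalar-flat metric.
  have hd := sum_cyclic_eq_zero (t := fun e i j => pd e (pairContract h (schouten h) Sig i j) 0)
    hanti
    (fun e => hn.dualRel_pd hs.sm_rho hs.antisymm_rho (by norm_num)
      (fun z hz E hE => (hk.curvature hz hE).2.2.1) e)
    (fun j => by
      simp only [hdT]
      rw [Finset.sum_comm]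
      refine Finset.sum_eq_zero fun k _ => ?_
      rw [← Finset.sum_mul]
      simp only [hsym _ _ k]
      rw [(hn.div_weyl hsc k 0 0).2, zero_mul])
  -- By closedness ∂ₑρᵢⱼ = −(∂ᵢρⱼₑ − ∂ⱼρᵢₑ). The bracket is the curl of P contracted with Σ, and
  -- that curl is the divergence of the Weyl tensor.
  have hG : ∀ e i j, pd e (pairContract h (schouten h) Sig i j) 0
      = -∑ k, Sig e k 0 * ∑ d, pd d (weyl h i j k d) 0 := by
    intro e i j
    have h1 := hd e i j
    have h2 : ∑ k, Sig e k 0 * ∑ d, pd d (weyl h i j k d) 0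
        = pd i (pairContract h (schouten h) Sig j e) 0
          - pd j (pairContract h (schouten h) Sig i e) 0 := by
      rw [hdT, hdT, ← Finset.sum_sub_distrib]
      exact Finset.sum_congr rfl fun k _ => by rw [(hn.div_weyl hsc i j k).1]; ring
    rw [h2]
    have h3 := hanti j i e
    linarith
  have hc := fun X : Fin 4 → ℂ => spin1_contract (T := fun i j => (Sig i j 0 : ℂ))
    (fun i j => by rw [hk.antisymm 0 h0]; push_cast; rfl) (hk.selfDual 0 h0 _ hE) X A A'
  have h5 : ∀ j l, ∑ i, tetrad unitFrame A A' i
        * (pd i (pairContract h (schouten h) Sig j l) 0 : ℂ)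
      = -∑ E', raise (sdPart unitFrame (fun i j => (Sig i j 0 : ℂ)) A') E'
        * spin1 unitFrame (fun c => ((∑ d, pd d (weyl h j l c d) 0 : ℝ) : ℂ)) A E' := by
    intro j l
    have h6 := hc fun c => ((∑ d, pd d (weyl h j l c d) 0 : ℝ) : ℂ)
    simp only [mul_comm (raise _ _)]
    rw [← h6, spin1, ← Finset.sum_neg_distrib]
    refine Finset.sum_congr rfl fun i _ => ?_
    rw [hG]
    push_cast
    ring
  simp only [h5, ← Finset.mul_sum, hk.sum_nablaPsi hn]
  simp only [← neg_one_mul (∑ E', _), asdPart_mul_left, asdPart_sum, Finset.mul_sum]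
  exact Finset.sum_congr rfl fun _ _ => by ring

theorem KahlerLike.tractorD_eq_zero (hk : KahlerLike h Sig V) (hy : y ∈ V) {E : Fin 4 → Fin 4 → ℝ}
    (hE : IsOrientedFrame h y E) (A A' : Fin 2) :
    tractorD h Sig (fun _ _ => 0) (pairContract h (schouten h) Sig) E y A A' = 0 := by
  obtain ⟨F, V', hF, rfl, rfl, hn⟩ := hk.metricOn.exists_normal hy hE
  have h0 := hn.zero_mem
  have hs := hk.sectionOn
  have hk' := hk.pb hF
  rw [← hF.tractorD_pb hk.metricOn h0 hs.sm_om hs.sm_K hs.sm_rho]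
  have e1 : pb1 F (fun _ _ => 0) = fun _ _ => 0 := by funext i z; simp [pb1]
  -- Equality on all of `V'` is needed, since the third row differentiates ρ.
  have hP : ∀ a b, ∀ z ∈ V', pb2 F (pairContract h (schouten h) Sig) a b z
      = pairContract (pb2 F h) (schouten (pb2 F h)) (pb2 F Sig) a b z := by
    intro a b z hz
    rw [← hF.pairContract_pb hz]
    simp only [pairContract, hF.schouten_pb hk.metricOn hz]
  have hP' : ∀ i a b, pd i (pb2 F (pairContract h (schouten h) Sig) a b) 0
      = pd i (pairContract (pb2 F h) (schouten (pb2 F h)) (pb2 F Sig) a b) 0 :=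
    fun i a b => pd_congr_on hF.isOpen h0 (hP a b)
  rw [e1]
  have z1 : spin1 unitFrame (fun _ => (0 : ℂ)) = fun _ _ => 0 := by
    funext P Q; simp [spin1]
  have z2 : spin2 unitFrame (fun _ _ => (0 : ℂ)) = fun _ _ _ _ => 0 := by
    funext P Q R S; simp [spin2]
  have z3 : sdPart unitFrame (fun _ _ => (0 : ℂ)) = fun _ _ => 0 := by
    funext P Q; simp [sdPart, z2]
  have z4 : ∀ Q, raise (fun _ => (0 : ℂ)) Q = 0 := fun Q => by simp [raise]
  have n1 : ∀ i j, nabla1 (pb2 F h) (fun _ _ => 0) i j 0 = 0 := fun i j => by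
    rw [hn.nabla1_eq]; exact (HasPd.const 0).pd_eq
  refine Prod.ext ?_ (Prod.ext ?_ ?_)
  · funext B' C'
    simp only [tractorD, tractorAt, hk'.parallel 0 h0, Complex.ofReal_zero, mul_zero,
      Finset.sum_const_zero, z1, z3, sub_self]
    rfl
  · funext B B'
    simp only [tractorD, tractorAt, n1, hn.pSpinor_eq, hP _ _ 0 h0, Complex.ofReal_zero, z2]
    rw [hk'.tractorD_snd hn]
    simp
  · funext B C
    simp only [tractorD, tractorAt, hn.nabla2_eq, hP', Complex.ofReal_zero, z1, z4, mul_zero,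
      zero_mul, Finset.sum_const_zero, add_zero]
    rw [hk'.tractorD_thd hn]
    simp

end Kahler

/-! ### Kähler structures in coordinates -/

/-- The covariant derivative `∇ₑ J^k_i` of a field of endomorphisms. -/
def nablaEnd (g J : Fin 4 → Fin 4 → E4 → ℝ) (e k i : Fin 4) (y : E4) : ℝ :=
  pd e (J k i) y + ∑ m, christoffel g k e m y * J m i y - ∑ m, christoffel g m e i y * J k m y

/-- The Nijenhuis tensor, with the convention of `IsKahlerOn`. -/
def nijenhuis (J : Fin 4 → Fin 4 → E4 → ℝ) (i j k : Fin 4) (y : E4) : ℝ :=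
  ∑ l, (J l i y * pd l (J k j) y - J l j y * pd l (J k i) y
    - J k l y * (pd i (J l j) y - pd j (J l i) y))

section

variable {h Sig J : Fin 4 → Fin 4 → E4 → ℝ} {V : Set E4} {y : E4}

/-- The Levi-Civita connection has no torsion, so its Christoffel symbols cancel and partial
derivatives may be replaced by covariant ones. -/
theorem MetricOn.nijenhuis_eq (hg : MetricOn h V) (hy : y ∈ V) (J : Fin 4 → Fin 4 → E4 → ℝ)
    (i j k : Fin 4) :
    nijenhuis J i j k y = ∑ l, (J l i y * nablaEnd h J l k j y - J l j y * nablaEnd h J l k i y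
      - J k l y * (nablaEnd h J i l j y - nablaEnd h J j l i y)) := by
  have hΓ := hg.christoffel_symm hy
  have e1 : ∀ i j, ∑ l, J l i y * ∑ m, christoffel h k l m y * J m j y
      = ∑ l, J l j y * ∑ m, christoffel h k l m y * J m i y := by
    intro i j
    simp only [Finset.mul_sum]
    rw [Finset.sum_comm]
    exact Finset.sum_congr rfl fun l _ => Finset.sum_congr rfl fun m _ => by rw [hΓ k m l]; ring
  have e2 : ∀ i j, ∑ l, J l i y * ∑ m, christoffel h m l j y * J k m y
      = ∑ l, J k l y * ∑ m, christoffel h l j m y * J m i y := by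
    intro i j
    simp only [Finset.mul_sum]
    rw [Finset.sum_comm]
    exact Finset.sum_congr rfl fun l _ => Finset.sum_congr rfl fun m _ => by rw [hΓ l m j]; ring
  have e3 : ∑ l, J k l y * ∑ m, christoffel h m i j y * J l m y
      = ∑ l, J k l y * ∑ m, christoffel h m j i y * J l m y :=
    Finset.sum_congr rfl fun l _ => congrArg _ (Finset.sum_congr rfl fun m _ => by rw [hΓ m i j])
  simp only [nijenhuis, nablaEnd, mul_add, mul_sub, Finset.sum_add_distrib, Finset.sum_sub_distrib]
  linarith [e1 i j, e2 i j, e2 j i]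

/-- Lowering an index commutes with ∇, the metric being parallel. -/
theorem MetricOn.nabla2_eq_sum (hg : MetricOn h V) (hy : y ∈ V) (hJ : ∀ k i, Sm V (J k i))
    (hS : ∀ z ∈ V, ∀ i j, Sig i j z = ∑ k, J k i z * h k j z) (e i j : Fin 4) :
    nabla2 h Sig e i j y = ∑ k, nablaEnd h J e k i y * h k j y := by
  have h1 : pd e (Sig i j) y
      = ∑ k, (pd e (J k i) y * h k j y + J k i y * pd e (h k j) y) := by
    rw [pd_congr_on hg.isOpen hy fun z hz => hS z hz i j]
    exact (HasPd.sum (s := Finset.univ) fun k _ => ((hJ k i).hasPd hg.isOpen hy).mul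
      ((hg.smooth k j).hasPd hg.isOpen hy)).pd_eq
  have h2 : ∑ m, christoffel h m e i y * Sig m j y
      = ∑ k, (∑ m, christoffel h m e i y * J k m y) * h k j y := by
    simp only [hS y hy, Finset.mul_sum, Finset.sum_mul]
    rw [Finset.sum_comm]
    exact Finset.sum_congr rfl fun _ _ => Finset.sum_congr rfl fun _ _ => by ring
  have h3 : ∑ m, christoffel h m e j y * Sig i m y
      = ∑ k, J k i y * ∑ m, christoffel h m e j y * h k m y := by
    simp only [hS y hy, Finset.mul_sum]
    rw [Finset.sum_comm]
    exact Finset.sum_congr rfl fun _ _ => Finset.sum_congr rfl fun _ _ => by ring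
  have h4 : ∑ k, J k i y * ∑ m, christoffel h m e k y * h m j y
      = ∑ k, (∑ m, christoffel h k e m y * J m i y) * h k j y := by
    simp only [Finset.mul_sum, Finset.sum_mul]
    rw [Finset.sum_comm]
    exact Finset.sum_congr rfl fun _ _ => Finset.sum_congr rfl fun _ _ => by ring
  simp only [nabla2, nablaEnd, h1, hg.compat hy, add_mul, sub_mul, mul_add, Finset.sum_add_distrib,
    Finset.sum_sub_distrib, h2, h3, h4]
  ring

theorem MetricOn.cyclic_nabla2 (hg : MetricOn h V) (hy : y ∈ V)
    (ha : ∀ i j, Sig i j y = -Sig j i y) (i j k : Fin 4) :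
    nabla2 h Sig i j k y + nabla2 h Sig j k i y + nabla2 h Sig k i j y
      = pd i (Sig j k) y + pd j (Sig k i) y + pd k (Sig i j) y := by
  have h1 : ∀ i j k, ∑ m, christoffel h m i k y * Sig j m y
      = -∑ m, christoffel h m k i y * Sig m j y := by
    intro i j k
    rw [← Finset.sum_neg_distrib]
    exact Finset.sum_congr rfl fun m _ => by rw [hg.christoffel_symm hy m i k, ha j m]; ring
  simp only [nabla2, Finset.sum_add_distrib, h1]
  ring

theorem MetricOn.nabla2_antisymm (hg : MetricOn h V) (hy : y ∈ V) (hs : ∀ i j, Sm V (Sig i j))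
    (ha : ∀ z ∈ V, ∀ i j, Sig i j z = -Sig j i z) (e i j : Fin 4) :
    nabla2 h Sig e i j y = -nabla2 h Sig e j i y := by
  have h1 := hg.pd_antisymm hy ha hs e i j
  have h2 : ∀ i j, ∑ m, christoffel h m e i y * Sig m j y
      = -∑ m, christoffel h m e i y * Sig j m y := by
    intro i j
    rw [← Finset.sum_neg_distrib]
    exact Finset.sum_congr rfl fun m _ => by rw [ha y hy m j]; ring
  simp only [nabla2, Finset.sum_add_distrib, h2]
  rw [h1]
  ring

/-- The Leibniz rule for the constant tensor J² = −1. -/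
theorem MetricOn.nablaEnd_sq (hg : MetricOn h V) (hy : y ∈ V) (hJ : ∀ k i, Sm V (J k i))
    (hsq : ∀ z ∈ V, ∀ k i, ∑ l, J k l z * J l i z = -unitFrame k i) (e k i : Fin 4) :
    ∑ l, (nablaEnd h J e k l y * J l i y + J k l y * nablaEnd h J e l i y) = 0 := by
  have h1 : ∑ l, (pd e (J k l) y * J l i y + J k l y * pd e (J l i) y) = 0 := by
    rw [← (HasPd.sum (s := Finset.univ) fun l _ => ((hJ k l).hasPd hg.isOpen hy).mul
      ((hJ l i).hasPd hg.isOpen hy)).pd_eq, pd_congr_on hg.isOpen hy fun z hz => hsq z hz k i]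
    exact (HasPd.const _).pd_eq
  have h2 : ∑ l, (∑ m, christoffel h k e m y * J m l y) * J l i y = -christoffel h k e i y := by
    simp only [Finset.sum_mul, mul_assoc]
    rw [Finset.sum_comm]
    simp only [← Finset.mul_sum, hsq y hy, mul_neg, Finset.sum_neg_distrib, sum_mul_unitFrame]
  have h3 : ∑ l, J k l y * ∑ m, christoffel h m e i y * J l m y = -christoffel h k e i y := by
    rw [sum_mul_sum_swap]
    simp only [hsq y hy, mul_neg, Finset.sum_neg_distrib, unitFrame_symm k, sum_mul_unitFrame]
  have h4 : ∑ l, (∑ m, christoffel h m e l y * J k m y) * J l i y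
      = ∑ l, J k l y * ∑ m, christoffel h l e m y * J m i y := by
    simp only [Finset.sum_mul, Finset.mul_sum]
    rw [Finset.sum_comm]
    exact Finset.sum_congr rfl fun _ _ => Finset.sum_congr rfl fun _ _ => by ring
  simp only [nablaEnd, add_mul, sub_mul, mul_add, mul_sub, Finset.sum_add_distrib,
    Finset.sum_sub_distrib, h2, h3, h4] at h1 ⊢
  linarith

/-- The derivative of the Kähler form vanishes if the form is closed and the almost complex
structure is integrable. -/
theorem eq_zero_of_closed_of_integrable {A : Fin 4 → Fin 4 → Fin 4 → ℝ} {J : Fin 4 → Fin 4 → ℝ}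
    (ha : ∀ i j k, A i j k = -A i k j) (hsq : ∀ k i, ∑ l, J k l * J l i = -unitFrame k i)
    (hc : ∀ i j k, A i j k + A j k i + A k i j = 0)
    (hH : ∀ i j k, ∑ l, J l k * A i j l + ∑ l, J l j * A i k l = 0)
    (hN : ∀ i j p, ∑ l, J l i * A l j p - ∑ l, J l j * A l i p + ∑ l, J l p * A i j l
      - ∑ l, J l p * A j i l = 0) (i j k : Fin 4) : A k i j = 0 := by
  -- The integrability condition in its three cyclic permutations, with `hH` exchanging the last two
  -- slots, is solved for J acting on the differentiation slot.
  have hS : ∀ i j k, ∑ l, J l i * A l j k = -∑ l, J l k * A i j l := by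
    have e1 : ∀ i j k, ∑ l, J l i * A l j k = -∑ l, J l i * A l k j := fun i j k => by
      rw [← Finset.sum_neg_distrib]
      exact Finset.sum_congr rfl fun l _ => by rw [ha l j k]; ring
    intro i j k
    linarith [hN i j k, hN j k i, hN k i j, e1 i j k, e1 j k i, e1 k i j, hH i j k, hH j k i,
      hH k i j]
  have hsq' : ∀ (X : Fin 4 → ℝ) (k : Fin 4), ∑ l, J l k * ∑ m, J m l * X m = -X k := by
    intro X k
    simp only [Finset.mul_sum]
    rw [Finset.sum_comm]
    have : ∀ m, ∑ l, J l k * (J m l * X m) = -(unitFrame k m * X m) := by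
      intro m
      rw [unitFrame_symm, ← neg_mul, ← hsq, Finset.sum_mul]
      exact Finset.sum_congr rfl fun _ _ => by ring
    simp only [this, Finset.sum_neg_distrib, sum_unitFrame_mul]
  have hH' : ∀ i j l, ∑ m, J m j * A i m l = ∑ m, J m l * A i j m := by
    intro i j l
    have : ∑ m, J m j * A i m l = -∑ m, J m j * A i l m := by
      rw [← Finset.sum_neg_distrib]
      exact Finset.sum_congr rfl fun m _ => by rw [ha i m l]; ring
    linarith [hH i j l]
  have t1 : ∑ l, J l i * ∑ m, J m j * A l m k = A i j k := by
    rw [sum_mul_sum_swap]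
    simp only [hS, mul_neg, Finset.sum_neg_distrib]
    rw [sum_mul_sum_swap]
    simp only [hH', hsq', neg_neg]
  have t2 : ∑ l, J l i * ∑ m, J m j * A m k l = A j k i := by
    simp only [hS, mul_neg, Finset.sum_neg_distrib, hsq', neg_neg]
  have t3 : ∑ l, J l i * ∑ m, J m j * A k l m = -A k i j := by
    rw [sum_mul_sum_swap]
    simp only [hH', hsq']
  -- Letting J act on two slots of the cyclic identity changes the sign of one of its three terms.
  -- Compared with the identity itself, that term vanishes.
  have t4 : ∑ l, J l i * ∑ m, J m j * (A l m k + A m k l + A k l m) = 0 := by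
    simp [hc]
  simp only [mul_add, Finset.sum_add_distrib, t1, t2, t3] at t4
  linarith [hc i j k]

theorem MetricOn.nabla2_eq_zero (hg : MetricOn h V) (hy : y ∈ V) (hJ : ∀ k i, Sm V (J k i))
    (hS : ∀ z ∈ V, ∀ i j, Sig i j z = ∑ k, J k i z * h k j z)
    (hs : ∀ i j, Sm V (Sig i j)) (ha : ∀ z ∈ V, ∀ i j, Sig i j z = -Sig j i z)
    (hsq : ∀ z ∈ V, ∀ k i, ∑ l, J k l z * J l i z = -unitFrame k i)
    (hN : ∀ i j k, nijenhuis J i j k y = 0)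
    (hc : ∀ i j k, pd i (Sig j k) y + pd j (Sig k i) y + pd k (Sig i j) y = 0)
    (e i j : Fin 4) : nabla2 h Sig e i j y = 0 := by
  have hA := hg.nabla2_eq_sum hy hJ hS
  have haA := hg.nabla2_antisymm hy hs ha
  -- Moves J across the metric when an index is lowered; the sign is the antisymmetry of the Kähler
  -- form.
  have low : ∀ (X : Fin 4 → ℝ) p, ∑ k, (∑ l, J k l y * X l) * h k p y
      = -∑ m, J m p y * ∑ l, X l * h l m y := by
    intro X p
    have e1 : ∑ k, (∑ l, J k l y * X l) * h k p y = ∑ l, X l * Sig l p y := by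
      simp only [hS y hy, Finset.sum_mul, Finset.mul_sum]
      rw [Finset.sum_comm]
      exact Finset.sum_congr rfl fun _ _ => Finset.sum_congr rfl fun _ _ => by ring
    rw [e1, sum_mul_sum_swap, ← Finset.sum_neg_distrib]
    refine Finset.sum_congr rfl fun l _ => ?_
    rw [ha y hy l p, hS y hy p l, mul_neg]
    simp only [hg.symm y hy l]
  refine eq_zero_of_closed_of_integrable (A := fun e i j => nabla2 h Sig e i j y)
    (J := fun k i => J k i y) haA (hsq y hy)
    (fun i j k => by rw [hg.cyclic_nabla2 hy (ha y hy), hc]) (fun i j k => ?_) (fun i j p => ?_) i j e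
  · have h1 : ∑ m, (∑ l, (nablaEnd h J i m l y * J l k y + J m l y * nablaEnd h J i l k y))
        * h m j y = 0 := by
      simp only [hg.nablaEnd_sq hy hJ hsq, zero_mul, Finset.sum_const_zero]
    simp only [Finset.sum_add_distrib, add_mul, low, ← hA] at h1
    have h2 : ∑ m, (∑ l, nablaEnd h J i m l y * J l k y) * h m j y
        = ∑ l, J l k y * nabla2 h Sig i l j y := by
      simp only [hA, Finset.sum_mul, Finset.mul_sum]
      rw [Finset.sum_comm]
      exact Finset.sum_congr rfl fun _ _ => Finset.sum_congr rfl fun _ _ => by ring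
    have h3 : ∑ l, J l k y * nabla2 h Sig i l j y = -∑ l, J l k y * nabla2 h Sig i j l y := by
      rw [← Finset.sum_neg_distrib]
      exact Finset.sum_congr rfl fun m _ => by rw [haA i m j]; ring
    linarith
  · have h1 : ∑ k, nijenhuis J i j k y * h k p y = 0 := by
      simp only [hN, zero_mul, Finset.sum_const_zero]
    have h2 : ∀ i j, ∑ k, (∑ l, J l i y * nablaEnd h J l k j y) * h k p y
        = ∑ l, J l i y * nabla2 h Sig l j p y := by
      intro i j
      simp only [hA, Finset.sum_mul, Finset.mul_sum]
      rw [Finset.sum_comm]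
      exact Finset.sum_congr rfl fun _ _ => Finset.sum_congr rfl fun _ _ => by ring
    simp only [hg.nijenhuis_eq hy, Finset.sum_sub_distrib, sub_mul, mul_sub, h2, low, ← hA] at h1
    linarith

/-- A parallel two-form gives an integrable almost complex structure. -/
theorem MetricOn.nijenhuis_eq_zero (hg : MetricOn h V) (hy : y ∈ V) (hJ : ∀ k i, Sm V (J k i))
    (hS : ∀ z ∈ V, ∀ i j, Sig i j z = ∑ k, J k i z * h k j z)
    (hp : ∀ e i j, nabla2 h Sig e i j y = 0) (i j k : Fin 4) : nijenhuis J i j k y = 0 := by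
  have hB : ∀ e k i, nablaEnd h J e k i y = 0 := by
    intro e k i
    have h1 := hg.raise_lower hy (fun k => nablaEnd h J e k i y) k
    have h2 : ∀ m, ∑ l, h m l y * nablaEnd h J e l i y = 0 := by
      intro m
      rw [← hp e i m, hg.nabla2_eq_sum hy hJ hS]
      exact Finset.sum_congr rfl fun l _ => by rw [hg.symm y hy m l]; ring
    simp only [h2, mul_zero, Finset.sum_const_zero] at h1
    exact h1.symm
  simp [hg.nijenhuis_eq hy, hB]

end

/-! ### The parallel section of a metric conformal to a Kähler metric -/

section

variable {h Sig om rho : Fin 4 → Fin 4 → E4 → ℝ} {K : Fin 4 → E4 → ℝ} {u : E4 → ℝ}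
  {V V' : Set E4} {F : E4 → E4} {y : E4}

theorem CoordChange.contract_pb1 (hF : CoordChange F V' V) (hy : y ∈ V')
    (g T : Fin 4 → Fin 4 → E4 → ℝ) (U : Fin 4 → E4 → ℝ) (a : Fin 4) :
    contract (pb2 F g) (pb2 F T) (pb1 F U) a y = pb1 F (contract g T U) a y := by
  have h1 : ∀ c d, pb2 F T a c y * pb1 F U d y = ∑ k, jac F k c y * ∑ l, jac F l d y *
      ((∑ i, jac F i a y * T i k (F y)) * U l (F y)) := by
    intro c d
    rw [pb2, sum_mul_sum_swap, pb1, sum_mul_sum_nested]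
  simp only [contract, h1]
  rw [hF.contract_pb hy fun k l => (∑ i, jac F i a y * T i k (F y)) * U l (F y)]
  simp only [pb1, contract, Finset.mul_sum, Finset.sum_mul]
  rw [Finset.sum_comm_cycle]
  exact Finset.sum_congr rfl fun _ _ => Finset.sum_congr rfl fun _ _ =>
    Finset.sum_congr rfl fun _ _ => by ring

/-- The third component of the parallel section of the metric `u² h`, for a Kähler metric `h` with
Kähler form `Σ`. -/
def confRho (h Sig : Fin 4 → Fin 4 → E4 → ℝ) (u : E4 → ℝ) (i j : Fin 4) (y : E4) : ℝ :=
  u y * (pairContract h (schouten h) Sig i j y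
    + (logPd u i y * contract h Sig (logPd u) j y - contract h Sig (logPd u) i y * logPd u j y)
    -- This term cancels the self-dual part of the wedge product and, being a multiple of the
    -- self-dual form Σ, leaves the anti-self-dual part alone. The result is an honest
    -- anti-self-dual form.
    + (1 / 2) * (∑ k, ∑ l, metricInv h k l y * (logPd u k y * logPd u l y)) * Sig i j y)

theorem CoordChange.confRho_pb (hF : CoordChange F V' V) (hg : MetricOn h V) (hu : Sm V u)
    (hy : y ∈ V') (a b : Fin 4) :
    confRho (pb2 F h) (pb2 F Sig) (fun z => u (F z)) a b y = pb2 F (confRho h Sig u) a b y := by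
  have h1 : ∀ a, logPd (fun z => u (F z)) a y = pb1 F (logPd u) a y := hF.logPd_pb hu hy
  have h2 : ∀ a, contract (pb2 F h) (pb2 F Sig) (logPd fun z => u (F z)) a y
      = pb1 F (contract h Sig (logPd u)) a y := by
    intro a
    rw [← hF.contract_pb1 hy]
    simp only [contract, h1]
  have h3 : ∑ k, ∑ l, metricInv (pb2 F h) k l y * (logPd (fun z => u (F z)) k y
      * logPd (fun z => u (F z)) l y)
      = ∑ k, ∑ l, metricInv h k l (F y) * (logPd u k (F y) * logPd u l (F y)) := by
    simp only [h1, pb1, sum_mul_sum_nested]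
    exact hF.contract_pb hy fun k l => logPd u k (F y) * logPd u l (F y)
  have h4 : pairContract (pb2 F h) (schouten (pb2 F h)) (pb2 F Sig) a b y
      = pb2 F (pairContract h (schouten h) Sig) a b y := by
    rw [← hF.pairContract_pb hy]
    simp only [pairContract, hF.schouten_pb hg hy]
  have h5 : ∀ X Y : Fin 4 → E4 → ℝ, pb1 F X a y * pb1 F Y b y
      = ∑ i, jac F i a y * ∑ j, jac F j b y * (X i (F y) * Y j (F y)) := fun X Y => by
    rw [pb1, pb1, sum_mul_sum_nested]
  obtain ⟨N, hN⟩ : ∃ N, N = ∑ k, ∑ l, metricInv h k l (F y) * (logPd u k (F y) * logPd u l (F y)) :=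
    ⟨_, rfl⟩
  rw [confRho, h1, h1, h2, h2, h3, h4, h5, h5]
  simp only [pb2, ← hN, Finset.mul_sum, ← Finset.sum_sub_distrib, ← Finset.sum_add_distrib, confRho]
  exact Finset.sum_congr rfl fun _ _ => Finset.sum_congr rfl fun _ _ => by ring

/-- The self-dual part of `U ∧ (U ⌟ s)` for a self-dual two-form `s`. -/
theorem DualRel.wedge_contract {s : Fin 4 → Fin 4 → ℝ} (hs : DualRel 1 s)
    (hb : ∀ i j, s i j = -s j i) (U : Fin 4 → ℝ) :
    DualRel (-1) fun i j => U i * (∑ k, s j k * U k) - (∑ k, s i k * U k) * U j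
      + (1 / 2) * (∑ k, U k * U k) * s i j := by
  obtain ⟨q1, q2, q3⟩ := hs
  have z : ∀ i, s i i = 0 := fun i => by linarith [hb i i]
  rw [DualRel]
  simp only [Fin.sum_univ_four, z, hb 1 0, hb 2 0, hb 3 0, hb 2 1, hb 3 1, hb 3 2, q1, q2, q3]
  refine ⟨by ring, by ring, by ring⟩

/-- Both summands are anti-self-dual: P·Σ by the curvature of h, and the corrected wedge by
`DualRel.wedge_contract`. -/
theorem KahlerLike.sdPart_confRho_zero (hk : KahlerLike h Sig V) (hn : NormalAt h V)
    (A B : Fin 2) : sdPart unitFrame (fun i j => (confRho h Sig u i j 0 : ℂ)) A B = 0 := by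
  have h0 := hn.zero_mem
  obtain ⟨-, c2, c3, -⟩ := hk.curvature_zero hn
  have hs : DualRel 1 fun i j => Sig i j 0 := by
    rw [← frameComp_unitFrame fun i j => Sig i j 0]
    exact (asdPart_eq_zero_iff (hk.antisymm 0 h0)).1 (hk.selfDual 0 h0 _ hn.isOrientedFrame)
  have hw := hs.wedge_contract (hk.antisymm 0 h0) fun k => logPd u k 0
  have h1 : ∀ i j, confRho h Sig u i j 0 = u 0 * (pairContract h (schouten h) Sig i j 0
      + (logPd u i 0 * (∑ k, Sig j k 0 * logPd u k 0)
        - (∑ k, Sig i k 0 * logPd u k 0) * logPd u j 0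
        + (1 / 2) * (∑ k, logPd u k 0 * logPd u k 0) * Sig i j 0)) := by
    intro i j
    simp only [confRho, contract, hn.inv_eq, sum_unitFrame_mul]
    ring
  refine (sdPart_eq_zero_iff fun i j => ?_).2 ?_ A B
  · rw [h1, h1, c2 i j, hk.antisymm 0 h0 i j]; ring
  · rw [frameComp_unitFrame]
    obtain ⟨p1, p2, p3⟩ := c3
    obtain ⟨q1, q2, q3⟩ := hw
    simp only [DualRel, h1, p1, p2, p3, q1, q2, q3]
    refine ⟨by ring, by ring, by ring⟩

theorem KahlerLike.sdPart_confRho (hk : KahlerLike h Sig V) (hu : Sm V u) (hy : y ∈ V)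
    {E : Fin 4 → Fin 4 → ℝ} (hE : IsOrientedFrame h y E)
    (A B : Fin 2) : sdPart E (fun i j => (confRho h Sig u i j y : ℂ)) A B = 0 := by
  obtain ⟨F, V', hF, rfl, rfl, hn⟩ := hk.metricOn.exists_normal hy hE
  have h1 := (hk.pb hF).sdPart_confRho_zero hn (u := fun z => u (F z)) A B
  simpa only [hF.confRho_pb hk.metricOn hu hn.zero_mem, ofReal_pb2, sdPart_pb] using h1

theorem isOrientedFrame_smul_of_conf {g : Fin 4 → Fin 4 → E4 → ℝ} {E : Fin 4 → Fin 4 → ℝ}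
    (hu : 0 < u y) (hE : IsOrientedFrame (confMetric u g) y E) :
    IsOrientedFrame g y (u y • E) := by
  refine ⟨fun a b => ?_, ?_⟩
  · rw [← hE.1 a b]
    exact Finset.sum_congr rfl fun i _ => Finset.sum_congr rfl fun j _ => by
      simp only [confMetric, Pi.smul_apply, smul_eq_mul]; ring
  · rw [show Matrix.of (u y • E) = u y • Matrix.of E from rfl, Matrix.det_smul]
    exact mul_pos (pow_pos hu _) hE.2

theorem tractorD_eq_zero_of_smul {g : Fin 4 → Fin 4 → E4 → ℝ}
    (hpos : ∀ z ∈ V, 0 < u z) (hy : y ∈ V)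
    (hz : ∀ E, IsOrientedFrame g y E → ∀ A A',
      tractorD (confMetric u g) om K rho ((u y)⁻¹ • E) y A A' = 0)
    {E : Fin 4 → Fin 4 → ℝ} (hE : IsOrientedFrame (confMetric u g) y E) (A A' : Fin 2) :
    tractorD (confMetric u g) om K rho E y A A' = 0 := by
  have h1 := hz _ (isOrientedFrame_smul_of_conf (hpos y hy) hE) A A'
  rwa [smul_smul, inv_mul_cancel₀ (hpos y hy).ne', one_smul] at h1

theorem rescale_zero (Om : ℂ) (Up : Fin 2 → Fin 2 → ℂ) : rescale Om Up 0 = 0 := by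
  have h : ∀ A, raise (0 : Fin 2 → ℂ) A = 0 := fun A => by simp [raise]
  refine Prod.ext ?_ (Prod.ext ?_ ?_) <;> funext A B <;> simp [rescale, raise]

theorem KahlerLike.sectionOn_conf (hk : KahlerLike h Sig V) (hu : Sm V u) (hpos : ∀ z ∈ V, 0 < u z)
    (hom : ∀ z ∈ V, ∀ i j, om i j z = u z ^ 3 * Sig i j z)
    (hK : ∀ z ∈ V, ∀ j, K j z = u z * contract h Sig (logPd u) j z)
    (hrho : ∀ z ∈ V, ∀ i j, rho i j z = confRho h Sig u i j z) :
    SectionOn (confMetric u h) om K rho V := by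
  have hV := hk.metricOn.isOpen
  have hl : ∀ i, Sm V (logPd u i) := fun i => hu.logPd hV hpos i
  have hc : ∀ j, Sm V (contract h Sig (logPd u) j) := fun j =>
    Sm.sum fun k _ => Sm.sum fun l _ => (hk.metricOn.sm_inv k l).mul ((hk.sm j k).mul (hl l))
  have ha := fun z hz => hk.sectionOn.antisymm_rho z hz
  refine ⟨fun i j => ?_, fun i => ?_, fun i j => ?_, fun z hz i j => ?_, fun z hz i j => ?_,
    fun z hz E hE A B => ?_, fun z hz E hE A B => ?_⟩
  · exact ((hu.pow 3).mul (hk.sm i j)).congr fun z hz => hom z hz i j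
  · exact (hu.mul (hc i)).congr fun z hz => hK z hz i
  · refine (hu.mul (((hk.sm_pairContract i j).add (((hl i).mul (hc j)).sub ((hc i).mul (hl j)))).add
      (((contDiffOn_const (c := (1 / 2 : ℝ))).mul (Sm.sum fun k _ => Sm.sum fun l _ =>
        (hk.metricOn.sm_inv k l).mul ((hl k).mul (hl l)))).mul (hk.sm i j)))).congr
      fun z hz => hrho z hz i j
  · rw [hom z hz, hom z hz, hk.antisymm z hz]; ring
  · rw [hrho z hz, hrho z hz, confRho, confRho, ha z hz i j, hk.antisymm z hz i j]; ring
  · have h1 := hk.selfDual z hz _ (isOrientedFrame_smul_of_conf (hpos z hz) hE) A B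
    rw [asdPart_smul, mul_eq_zero] at h1
    simp only [hom z hz, Complex.ofReal_mul, asdPart_mul_left]
    rcases h1 with h1 | h1
    · exact absurd h1 (pow_ne_zero 2 (by exact_mod_cast (hpos z hz).ne'))
    · rw [h1, mul_zero]
  · have h1 := hk.sdPart_confRho hu hz (isOrientedFrame_smul_of_conf (hpos z hz) hE) A B
    rw [sdPart_smul, mul_eq_zero] at h1
    simp only [hrho z hz]
    rcases h1 with h1 | h1
    · exact absurd h1 (pow_ne_zero 2 (by exact_mod_cast (hpos z hz).ne'))
    · exact h1

/-- The discrepancy between `confRho` and the transformation rule is a multiple of Σ, which has no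
anti-self-dual part. -/
theorem KahlerLike.rescalingOn_conf (hk : KahlerLike h Sig V)
    (hom : ∀ z ∈ V, ∀ i j, om i j z = u z ^ 3 * Sig i j z)
    (hK : ∀ z ∈ V, ∀ j, K j z = u z * contract h Sig (logPd u) j z)
    (hrho : ∀ z ∈ V, ∀ i j, rho i j z = confRho h Sig u i j z) :
    RescalingOn h Sig (fun _ _ => 0) (pairContract h (schouten h) Sig) om K rho u V where
  om_eq := hom
  K_eq z hz j := by rw [hK z hz, zero_add]
  rho_eq z hz E hE A B := by
    have h1 : ∀ i j, (rho i j z - u z * (pairContract h (schouten h) Sig i j z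
        + (logPd u i z * shiftForm h Sig (fun _ _ => 0) (logPd u) j z
          - shiftForm h Sig (fun _ _ => 0) (logPd u) i z * logPd u j z)))
        = u z * ((1 / 2) * (∑ k, ∑ l, metricInv h k l z * (logPd u k z * logPd u l z)))
          * Sig i j z := by
      intro i j
      rw [hrho z hz, confRho, shiftForm, shiftForm]
      ring
    simp only [h1, Complex.ofReal_mul _ (Sig _ _ _), asdPart_mul_left, hk.selfDual z hz E hE,
      mul_zero]

/-- A metric conformal to a Kähler metric has a parallel section. -/
theorem KahlerLike.tractorD_conf_eq_zero (hk : KahlerLike h Sig V) (hu : Sm V u)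
    (hpos : ∀ z ∈ V, 0 < u z)
    (hom : ∀ z ∈ V, ∀ i j, om i j z = u z ^ 3 * Sig i j z)
    (hK : ∀ z ∈ V, ∀ j, K j z = u z * contract h Sig (logPd u) j z)
    (hrho : ∀ z ∈ V, ∀ i j, rho i j z = confRho h Sig u i j z)
    (hy : y ∈ V) {E : Fin 4 → Fin 4 → ℝ} (hE : IsOrientedFrame (confMetric u h) y E)
    (A A' : Fin 2) : tractorD (confMetric u h) om K rho E y A A' = 0 := by
  refine tractorD_eq_zero_of_smul hpos hy (fun E' hE' A A' => ?_) hE A A'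
  rw [tractorD_conf hk.metricOn hu hpos hk.sectionOn (hk.sectionOn_conf hu hpos hom hK hrho)
    (hk.rescalingOn_conf hom hK hrho) hy hE', hk.tractorD_eq_zero hy hE', rescale_zero, smul_zero]

end

/-! ### The Kähler metric of a parallel section -/

/-- `(1/4) ω_{ij} ω^{ij}`. -/
def lenSq (g om : Fin 4 → Fin 4 → E4 → ℝ) (y : E4) : ℝ :=
  (1 / 4) * ∑ i, ∑ j, metricInv g i j y * pairContract g om om i j y

section

variable {g om rho : Fin 4 → Fin 4 → E4 → ℝ} {K : Fin 4 → E4 → ℝ} {u : E4 → ℝ}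
  {V V' : Set E4} {F : E4 → E4} {y : E4}

theorem CoordChange.lenSq_pb (hF : CoordChange F V' V) (hy : y ∈ V')
    (g om : Fin 4 → Fin 4 → E4 → ℝ) :
    lenSq (pb2 F g) (pb2 F om) y = lenSq g om (F y) := by
  simp only [lenSq, hF.pairContract_pb hy]
  congr 1
  exact hF.contract_pb hy fun i j => pairContract g om om i j (F y)

theorem MetricOn.sm_lenSq (hg : MetricOn g V) (hom : ∀ i j, Sm V (om i j)) : Sm V (lenSq g om) :=
  (contDiffOn_const (c := (1 / 4 : ℝ))).mul (Sm.sum fun i _ => Sm.sum fun j _ =>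
    (hg.sm_inv i j).mul (Sm.sum fun k _ => Sm.sum fun l _ => (hg.sm_inv k l).mul
      ((hom i k).mul (hom j l))))

/-- Self-dual forms are imaginary quaternions: the square of one is minus its norm times the
identity. -/
theorem DualRel.mul_transpose {s : Fin 4 → Fin 4 → ℝ} (hs : DualRel 1 s)
    (hb : ∀ i j, s i j = -s j i) (i j : Fin 4) :
    ∑ k, s i k * s j k = (s 0 1 ^ 2 + s 0 2 ^ 2 + s 0 3 ^ 2) * unitFrame i j := by
  obtain ⟨q1, q2, q3⟩ := hs
  have z : ∀ i, s i i = 0 := fun i => by linarith [hb i i]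
  simp only [Fin.sum_univ_four]
  fin_cases i <;> fin_cases j <;>
    simp [unitFrame, z, hb 1 0, hb 2 0, hb 3 0, hb 2 1, hb 3 1, hb 3 2, q1, q2, q3] <;> ring

/-- Shows that the spinor norm of a real form is real and nonnegative, and normalises it against
`lenSq`. -/
theorem normSq_of_dualRel {s : Fin 4 → Fin 4 → ℝ} (hs : DualRel 1 s) (hb : ∀ i j, s i j = -s j i) :
    normSq (sdPart unitFrame fun i j => (s i j : ℂ))
      = 2 * ((s 0 1 ^ 2 + s 0 2 ^ 2 + s 0 3 ^ 2 : ℝ) : ℂ) := by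
  obtain ⟨q1, q2, q3⟩ := hs
  have hb' : ∀ i j, (s i j : ℂ) = -(s j i : ℂ) := fun i j => by rw [hb]; push_cast; rfl
  have h1 := sdPart_symm unitFrame hb' 1 0
  simp only [normSq, raise, Fin.sum_univ_two, h1, sdPart_unitFrame_zero_zero hb',
    sdPart_unitFrame_one_one hb', sdPart_unitFrame_zero_one hb', q1, q2, q3]
  simp only [eps, Matrix.of_apply, Matrix.cons_val', Matrix.cons_val_zero, Matrix.cons_val_one,
    Matrix.cons_val_fin_one]
  push_cast
  linear_combination (-(2 : ℂ) * (s 2 3 : ℂ) ^ 2 - 2 * (s 1 2 : ℂ) ^ 2) * Complex.I_sq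

theorem dualRel_of_asdPart (ha : ∀ i j, om i j 0 = -om j i 0)
    (hsd : ∀ A B, asdPart unitFrame (fun i j => (om i j 0 : ℂ)) A B = 0) :
    DualRel 1 fun i j => om i j 0 := by
  rw [← frameComp_unitFrame fun i j => om i j 0]
  exact (asdPart_eq_zero_iff ha).1 hsd

theorem NormalAt.lenSq_eq (hn : NormalAt g V) (ha : ∀ i j, om i j 0 = -om j i 0)
    (hsd : ∀ A B, asdPart unitFrame (fun i j => (om i j 0 : ℂ)) A B = 0) :
    lenSq g om 0 = om 0 1 0 ^ 2 + om 0 2 0 ^ 2 + om 0 3 0 ^ 2 := by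
  simp only [lenSq, hn.inv_eq, sum_unitFrame_mul, hn.pairContract_eq,
    (dualRel_of_asdPart ha hsd).mul_transpose ha]
  simp [unitFrame]
  ring

/-- A self-dual two-form of positive length is a multiple of an almost complex structure. -/
theorem SectionOn.pairContract_eq (hs : SectionOn g om K rho V) (hg : MetricOn g V) (hy : y ∈ V)
    (i j : Fin 4) : pairContract g om om i j y = lenSq g om y * g i j y := by
  obtain ⟨E, hE⟩ := hg.exists_frame hy
  obtain ⟨F, V', hF, rfl, rfl, hn⟩ := hg.exists_normal hy hE
  have h0 := hn.zero_mem
  have hs' := hs.pb hF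
  have ha := hs'.antisymm_om 0 h0
  have hsd := hs'.selfDual 0 h0 _ hn.isOrientedFrame
  exact hF.eq_of_pb2 h0 (S := pairContract g om om) (T := fun i j _ => lenSq g om (F 0) * g i j (F 0))
    (fun a b => by
      rw [← hF.pairContract_pb h0, ← hF.lenSq_pb h0, hn.pairContract_eq,
        (dualRel_of_asdPart ha hsd).mul_transpose ha, ← hn.lenSq_eq ha hsd, ← hn.g_eq]
      simp only [pb2, Finset.mul_sum]
      exact Finset.sum_congr rfl fun _ _ => Finset.sum_congr rfl fun _ _ => by ring) i j

/-- At the origin of normal coordinates the length is a sum of squares, and nondegeneracy excludes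
zero. -/
theorem SectionOn.lenSq_pos (hs : SectionOn g om K rho V) (hg : MetricOn g V) (hy : y ∈ V)
    (hne : ∀ E, IsOrientedFrame g y E → normSq (sdPart E fun i j => (om i j y : ℂ)) ≠ 0) :
    0 < lenSq g om y := by
  obtain ⟨E, hE⟩ := hg.exists_frame hy
  obtain ⟨F, V', hF, rfl, rfl, hn⟩ := hg.exists_normal hy hE
  have h0 := hn.zero_mem
  have hs' := hs.pb hF
  have ha := hs'.antisymm_om 0 h0
  have hsd := hs'.selfDual 0 h0 _ hn.isOrientedFrame
  have h1 := hne _ hE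
  rw [← sdPart_pb] at h1
  simp only [← ofReal_pb2] at h1
  rw [normSq_of_dualRel (dualRel_of_asdPart ha hsd) ha, ← hn.lenSq_eq ha hsd, hF.lenSq_pb h0] at h1
  refine lt_of_le_of_ne ?_ fun h => h1 (by rw [← h]; simp)
  rw [← hF.lenSq_pb h0, hn.lenSq_eq ha hsd]
  positivity

theorem pb2_zero (F : E4 → E4) : pb2 F (fun _ _ _ => 0) = fun _ _ _ => 0 := by
  funext i j z; simp [pb2]

/-- The first component of the derivative is conformally invariant. -/
theorem SectionOn.tractorD_fst_conf (hs : SectionOn g om K rho V) (hg : MetricOn g V)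
    (hu : Sm V u) (hpos : ∀ z ∈ V, 0 < u z) (hy : y ∈ V)
    (hp : ∀ E, IsOrientedFrame g y E → ∀ A A', (tractorD g om K rho E y A A').1 = 0)
    {E : Fin 4 → Fin 4 → ℝ} (hE : IsOrientedFrame (confMetric u g) y E) (A A' : Fin 2) :
    (tractorD (confMetric u g) (fun i j z => u z ^ 3 * om i j z)
      (fun j z => u z * (K j z + contract g om (logPd u) j z)) (fun _ _ _ => 0) E y A A').1 = 0 := by
  have hE' := isOrientedFrame_smul_of_conf (hpos y hy) hE
  have hEE : (u y)⁻¹ • u y • E = E := by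
    rw [smul_smul, inv_mul_cancel₀ (hpos y hy).ne', one_smul]
  rw [← hEE]
  have h1 := hp _ hE' A A'
  obtain ⟨F, V', hF, rfl, hFE, hn⟩ := hg.exists_normal hy hE'
  rw [← hFE] at h1 ⊢
  have h0 := hn.zero_mem
  have hl := fun i => Sm.logPd hu hg.isOpen hpos i
  have hK' : ∀ j, Sm V fun z => u z * (K j z + contract g om (logPd u) j z) := fun j =>
    hu.mul ((hs.sm_K j).add (Sm.sum fun k _ => Sm.sum fun l _ => (hg.sm_inv k l).mul
      ((hs.sm_om j k).mul (hl l))))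
  -- The third component does not enter the first row, so zero serves in place of a rescaled ρ.
  have h2 := hn.tractorD_fst_conf (rho' := fun _ _ _ => 0)
    (om' := pb2 F fun i j z => u z ^ 3 * om i j z)
    (K' := pb1 F fun j z => u z * (K j z + contract g om (logPd u) j z))
    (hF.sm_comp hu) (fun z hz => hpos _ (hF.mapsTo hz)) (hs.pb hF)
    (fun z hz i j => by
      simp only [pb2, Finset.mul_sum]
      exact Finset.sum_congr rfl fun _ _ => Finset.sum_congr rfl fun _ _ => by ring)
    (fun z hz j => by
      have e : contract (pb2 F g) (pb2 F om) (logPd fun z => u (F z)) j z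
          = pb1 F (contract g om (logPd u)) j z := by
        rw [← hF.contract_pb1 hz]
        simp only [contract, hF.logPd_pb hu hz]
      rw [e]
      simp only [pb1, ← Finset.sum_add_distrib, Finset.mul_sum]
      exact Finset.sum_congr rfl fun _ _ => by ring) A A'
  rw [← pb2_confMetric, ← pb2_zero F, hF.tractorD_pb (hg.conf hu hpos) h0
    (fun i j => (hu.pow 3).mul (hs.sm_om i j)) hK' (fun _ _ => contDiffOn_const),
    hF.tractorD_pb hg h0 hs.sm_om hs.sm_K hs.sm_rho, pushFrame_smul, h1] at h2
  exact h2

theorem eq_zero_of_det {a b c x y : ℂ} (hd : a * c - b ^ 2 ≠ 0) (h1 : a * y = b * x)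
    (h2 : c * x = b * y) : x = 0 ∧ y = 0 := by
  constructor
  · exact (mul_eq_zero.1 (show (a * c - b ^ 2) * x = 0 by linear_combination a * h2 + b * h1)
      ).resolve_left hd
  · exact (mul_eq_zero.1 (show (a * c - b ^ 2) * y = 0 by linear_combination b * h2 + c * h1)
      ).resolve_left hd

/-- The polarised norm on self-dual forms. All rows of such a form have the same length, so the row
0 computes it. -/
theorem spinDot_sd {s t : Fin 4 → Fin 4 → ℂ} (hs : ∀ i j, s i j = -s j i)
    (ht : ∀ i j, t i j = -t j i) (hs1 : ∀ A B, asdPart unitFrame s A B = 0)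
    (ht1 : ∀ A B, asdPart unitFrame t A B = 0) :
    sdPart unitFrame s 0 0 * sdPart unitFrame t 1 1 + sdPart unitFrame s 1 1 * sdPart unitFrame t 0 0
      - 2 * (sdPart unitFrame s 0 1 * sdPart unitFrame t 0 1) = 2 * ∑ k, s 0 k * t 0 k := by
  obtain ⟨p1, p2, p3⟩ := (asdPart_unitFrame_eq_zero_iff hs).1 hs1
  obtain ⟨q1, q2, q3⟩ := (asdPart_unitFrame_eq_zero_iff ht).1 ht1
  have z : s 0 0 = 0 := by linear_combination (1 / 2) * hs 0 0
  simp only [sdPart_unitFrame_zero_zero hs, sdPart_unitFrame_one_one hs,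
    sdPart_unitFrame_zero_one hs, sdPart_unitFrame_zero_zero ht, sdPart_unitFrame_one_one ht,
    sdPart_unitFrame_zero_one ht, Fin.sum_univ_four, p1, p2, p3, q1, q2, q3, z]
  linear_combination (-2 * (s 2 3 * t 2 3) - 2 * (s 1 2 * t 1 2)) * Complex.I_sq

/-- A self-dual two-form of unit length with vanishing first prolongation component is parallel. -/
theorem NormalAt.pd_eq_zero (hn : NormalAt g V) (hs : SectionOn g om K rho V)
    (hlen : ∀ z ∈ V, ∀ i j, pairContract g om om i j z = g i j z)
    (hp : ∀ A A', (tractorD g om K rho unitFrame 0 A A').1 = 0) (e i j : Fin 4) :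
    pd e (om i j) 0 = 0 := by
  have h0 := hn.zero_mem
  have ha : ∀ i j, (om i j 0 : ℂ) = -(om j i 0 : ℂ) := fun i j => by
    rw [hs.antisymm_om 0 h0]; push_cast; rfl
  have hsd := hs.selfDual 0 h0 _ hn.isOrientedFrame
  have hda : ∀ e i j, (pd e (om i j) 0 : ℂ) = -(pd e (om j i) 0 : ℂ) := fun e i j => by
    rw [hn.metricOn.pd_antisymm h0 hs.antisymm_om hs.sm_om]; push_cast; rfl
  have hda' : ∀ A A' i j, ∑ e, tetrad unitFrame A A' e * (pd e (om i j) 0 : ℂ)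
      = -∑ e, tetrad unitFrame A A' e * (pd e (om j i) 0 : ℂ) := fun A A' i j => by
    rw [← Finset.sum_neg_distrib]
    exact Finset.sum_congr rfl fun e _ => by rw [hda]; ring
  have hdsd : ∀ A A' P Q, asdPart unitFrame
      (fun i j => ∑ e, tetrad unitFrame A A' e * (pd e (om i j) 0 : ℂ)) P Q = 0 := by
    intro A A' P Q
    simp only [asdPart_sum, asdPart_mul_left, hn.asdPart_pd hs.sm_om hs.antisymm_om hs.selfDual,
      mul_zero, Finset.sum_const_zero]
  have hnorm : ∑ k, (om 0 k 0 : ℂ) * (om 0 k 0 : ℂ) = 1 := by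
    have h1 := hlen 0 h0 0 0
    rw [hn.pairContract_eq, hn.g_zero, if_pos rfl] at h1
    exact_mod_cast h1
  -- The determinant of the symmetric spinor ω_{A'B'} is half its norm, which unit length makes
  -- nonzero.
  have hdet : sdPart unitFrame (fun i j => (om i j 0 : ℂ)) 0 0
      * sdPart unitFrame (fun i j => (om i j 0 : ℂ)) 1 1
      - sdPart unitFrame (fun i j => (om i j 0 : ℂ)) 0 1 ^ 2 ≠ 0 := by
    have h1 := spinDot_sd ha ha hsd hsd
    rw [hnorm] at h1
    intro h2
    have h3 : (2 : ℂ) = 0 := by linear_combination 2 * h2 - h1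
    exact two_ne_zero h3
  -- Unit length makes ω orthogonal to its derivatives.
  have hdot : ∀ A A', ∑ k, (om 0 k 0 : ℂ) * ∑ e, tetrad unitFrame A A' e * (pd e (om 0 k) 0 : ℂ)
      = 0 := by
    intro A A'
    rw [sum_mul_sum_swap]
    refine Finset.sum_eq_zero fun e _ => ?_
    have h1 := (hn.hasPd_pairContract hs.sm_om hs.sm_om e 0 0).pd_eq
    rw [pd_congr_on hn.metricOn.isOpen h0 fun z hz => hlen z hz 0 0, hn.pd_g] at h1
    have h2 : ∑ k, om 0 k 0 * pd e (om 0 k) 0 = 0 := by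
      have h3 : ∑ k, (pd e (om 0 k) 0 * om 0 k 0 + om 0 k 0 * pd e (om 0 k) 0)
          = 2 * ∑ k, om 0 k 0 * pd e (om 0 k) 0 := by
        rw [Finset.mul_sum]
        exact Finset.sum_congr rfl fun _ _ => by ring
      linarith
    have h4 : ∑ k, (om 0 k 0 : ℂ) * (pd e (om 0 k) 0 : ℂ) = 0 := by exact_mod_cast h2
    rw [h4, mul_zero]
  have hw : ∀ A A' B' C', sdPart unitFrame
      (fun i j => ∑ e, tetrad unitFrame A A' e * (pd e (om i j) 0 : ℂ)) B' C'
      = eps A' B' * spin1 unitFrame (fun i => (K i 0 : ℂ)) A C'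
        + eps A' C' * spin1 unitFrame (fun i => (K i 0 : ℂ)) A B' := by
    intro A A' B' C'
    have h1 := congrFun (congrFun (hp A A') B') C'
    simp only [tractorD, tractorAt, hn.nabla2_eq] at h1
    change _ = (0 : ℂ) at h1
    linear_combination h1
  -- By the first row ∇ω is made of ε and K, so orthogonality to ω reads ω_{A'}{}^{B'}K_{AB'} = 0.
  -- For fixed A this is a 2×2 system with nonzero determinant.
  have hK : ∀ A B', spin1 unitFrame (fun i => (K i 0 : ℂ)) A B' = 0 := by
    intro A
    have h1 := fun A' => spinDot_sd ha (hda' A A') hsd (hdsd A A')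
    simp only [hdot, hw] at h1
    have h2 := h1 0
    have h3 := h1 1
    simp only [eps, Matrix.of_apply, Matrix.cons_val', Matrix.cons_val_zero, Matrix.cons_val_one,
      Matrix.cons_val_fin_one] at h2 h3
    have h4 := eq_zero_of_det hdet (x := spin1 unitFrame (fun i => (K i 0 : ℂ)) A 0)
      (y := spin1 unitFrame (fun i => (K i 0 : ℂ)) A 1) (by linear_combination (1 / 2) * h2)
      (by linear_combination (-1 / 2) * h3)
    intro B'
    fin_cases B'
    exacts [h4.1, h4.2]
  -- With K = 0 the self-dual part of ∇ω vanishes; the anti-self-dual part vanishes because ω is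
  -- self-dual.
  have hT : ∀ A A', (fun i j => ∑ e, tetrad unitFrame A A' e * (pd e (om i j) 0 : ℂ)) = 0 := by
    intro A A'
    refine eq_zero_of_parts (hda' A A') (hdsd A A') fun B' C' => ?_
    rw [hw, hK, hK, mul_zero, mul_zero, add_zero]
  exact congrFun (spin1_unitFrame_eq_zero (X := fun e => pd e (om i j) 0) fun A A' =>
    congrFun (congrFun (hT A A') i) j) e

/-- The conformal factor for which a self-dual two-form acquires unit length. -/
def unitFactor (g om : Fin 4 → Fin 4 → E4 → ℝ) (y : E4) : ℝ := (Real.sqrt (lenSq g om y))⁻¹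

theorem unitFactor_pos (h : 0 < lenSq g om y) : 0 < unitFactor g om y :=
  inv_pos.2 (Real.sqrt_pos.2 h)

theorem unitFactor_sq_mul (h : 0 < lenSq g om y) : unitFactor g om y ^ 2 * lenSq g om y = 1 := by
  rw [unitFactor, inv_pow, Real.sq_sqrt h.le, inv_mul_cancel₀ h.ne']

theorem MetricOn.sm_unitFactor (hg : MetricOn g V) (hom : ∀ i j, Sm V (om i j))
    (hpos : ∀ z ∈ V, 0 < lenSq g om z) : Sm V (unitFactor g om) :=
  ((hg.sm_lenSq hom).sqrt fun z hz => (hpos z hz).ne').inv fun z hz =>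
    (Real.sqrt_pos.2 (hpos z hz)).ne'

theorem pairContract_conf (hg : MetricOn g V) (hy : y ∈ V) (hu : u y ≠ 0) (i j : Fin 4) :
    pairContract (confMetric u g) (fun i j z => u z ^ 3 * om i j z) (fun i j z => u z ^ 3 * om i j z)
      i j y = u y ^ 4 * pairContract g om om i j y := by
  simp only [pairContract, hg.metricInv_conf hy hu, Finset.mul_sum]
  exact Finset.sum_congr rfl fun _ _ => Finset.sum_congr rfl fun _ _ => by field_simp

/-- Zero is a placeholder for the third component: what follows uses the first row only. -/
theorem SectionOn.conf (hs : SectionOn g om K rho V) (hg : MetricOn g V)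
    (hu : Sm V u) (hpos : ∀ z ∈ V, 0 < u z) :
    SectionOn (confMetric u g) (fun i j z => u z ^ 3 * om i j z)
      (fun j z => u z * (K j z + contract g om (logPd u) j z)) (fun _ _ _ => 0) V where
  sm_om i j := (hu.pow 3).mul (hs.sm_om i j)
  sm_K j := hu.mul ((hs.sm_K j).add (Sm.sum fun k _ => Sm.sum fun l _ => (hg.sm_inv k l).mul
      ((hs.sm_om j k).mul (Sm.logPd hu hg.isOpen hpos l))))
  sm_rho _ _ := contDiffOn_const
  antisymm_om z hz i j := by rw [hs.antisymm_om z hz]; ring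
  antisymm_rho z hz i j := by simp
  selfDual z hz E hE A B := by
    have h1 := hs.selfDual z hz _ (isOrientedFrame_smul_of_conf (hpos z hz) hE) A B
    rw [asdPart_smul, mul_eq_zero] at h1
    simp only [Complex.ofReal_mul, asdPart_mul_left]
    rcases h1 with h1 | h1
    · exact absurd h1 (pow_ne_zero 2 (by exact_mod_cast (hpos z hz).ne'))
    · rw [h1, mul_zero]
  antiSelfDual z hz E hE A B := by simp [sdPart, spin2]

theorem SectionOn.nabla2_eq_zero (hs : SectionOn g om K rho V) (hg : MetricOn g V)
    (hlen : ∀ z ∈ V, ∀ i j, pairContract g om om i j z = g i j z)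
    (hp : ∀ E, IsOrientedFrame g y E → ∀ A A', (tractorD g om K rho E y A A').1 = 0)
    (hy : y ∈ V) (e i j : Fin 4) : nabla2 g om e i j y = 0 := by
  obtain ⟨E, hE⟩ := hg.exists_frame hy
  obtain ⟨F, V', hF, rfl, rfl, hn⟩ := hg.exists_normal hy hE
  have h0 := hn.zero_mem
  have h1 := hn.pd_eq_zero (hs.pb hF)
    (fun z hz i j => by
      rw [hF.pairContract_pb hz]
      simp only [pb2, hlen _ (hF.mapsTo hz)])
    (fun A A' => by
      rw [hF.tractorD_pb hg h0 hs.sm_om hs.sm_K hs.sm_rho]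
      exact hp _ hE A A')
  have h2 : ∀ q, (fun i j => nabla2 g om q i j (F 0)) = fun _ _ => 0 := by
    have h3 : ∀ i j, (fun q => nabla2 g om q i j (F 0)) = fun _ => 0 := by
      intro i j
      refine hF.eq_of_sum_jac h0 fun e => ?_
      have h4 := hF.eq_of_pb2 h0
        (S := fun i j z => ∑ q, jac F q e 0 * nabla2 g om q i j z) (T := fun _ _ _ => 0)
        (fun a b => by
          have h5 := h1 e a b
          rw [← hn.nabla2_eq, hF.nabla2_pb hg h0 hs.sm_om] at h5
          rw [pb2_zero, ← h5]
          simp only [pb2, Finset.mul_sum]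
          rw [Finset.sum_comm_cycle]
          exact Finset.sum_congr rfl fun _ _ => Finset.sum_congr rfl fun _ _ =>
            Finset.sum_congr rfl fun _ _ => by ring) i j
      simpa using h4
    intro q
    funext i j
    exact congrFun (h3 i j) q
  exact congrFun (congrFun (h2 e) i) j

/-- A nondegenerate parallel section defines a parallel two-form of unit length for a conformally
related metric. -/
theorem SectionOn.nabla2_conf_eq_zero (hs : SectionOn g om K rho V) (hg : MetricOn g V)
    (hpos : ∀ z ∈ V, 0 < lenSq g om z)
    (hp : ∀ z ∈ V, ∀ E, IsOrientedFrame g z E → ∀ A A', (tractorD g om K rho E z A A').1 = 0)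
    (hu : ∀ z ∈ V, u z = unitFactor g om z) (hy : y ∈ V) (e i j : Fin 4) :
    nabla2 (confMetric u g) (fun i j z => u z ^ 3 * om i j z) e i j y = 0 := by
  have hsu : Sm V u := (hg.sm_unitFactor hs.sm_om hpos).congr hu
  have hu0 : ∀ z ∈ V, 0 < u z := fun z hz => by rw [hu z hz]; exact unitFactor_pos (hpos z hz)
  refine (hs.conf hg hsu hu0).nabla2_eq_zero (hg.conf hsu hu0) (fun z hz i j => ?_)
    (fun E hE A A' => hs.tractorD_fst_conf hg hsu hu0 hy (hp y hy) hE A A') hy e i j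
  rw [pairContract_conf hg hz (hu0 z hz).ne', hs.pairContract_eq hg hz, confMetric, hu z hz]
  linear_combination unitFactor g om z ^ 2 * g i j z * unitFactor_sq_mul (hpos z hz)

end

/-! ### Charts -/

section Charts

variable {M : Type*} [TopologicalSpace M] {e e' : OpenPartialHomeomorph M E4} {x : M} {y : E4}
  {U : Set M}

/-- The transition map between two charts. -/
def transition (e e' : OpenPartialHomeomorph M E4) (y : E4) : E4 := e (e'.symm y)

/-- The set of coordinates in the chart `e'` of the points of `U` in the domain of `e`. -/
def overlap (e e' : OpenPartialHomeomorph M E4) (U : Set M) : Set E4 :=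
  e'.target ∩ e'.symm ⁻¹' (e.source ∩ U)

theorem isOpen_overlap (hU : IsOpen U) : IsOpen (overlap e e' U) :=
  e'.isOpen_inter_preimage_symm (e.open_source.inter hU)

theorem isOpen_coordSet (hU : IsOpen U) : IsOpen (coordSet e U) :=
  e.isOpen_inter_preimage_symm hU

theorem transition_self (hy : y ∈ e.target) : transition e e y = y := e.right_inv hy

theorem jac_transition_self (hx : x ∈ e.source)
    (k i : Fin 4) : jac (transition e e) k i (e x) = unitFrame k i := by
  rw [jac, pd_congr_on e.open_target (e.map_source hx) (h := fun z => transition e e z k)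
    (f := fun z => z k) fun z hz => by rw [transition_self hz], (hasPd_coord k).pd_eq]
  rfl

variable [ChartedSpace E4 M]

/-- The derivative of a chart, as an endomorphism of the model space. -/
def chartDeriv (e : OpenPartialHomeomorph M E4) (x : M) : E4 →L[ℝ] E4 := mfderiv (𝓡 4) (𝓡 4) e x

/-- The derivative of the inverse of a chart, as an endomorphism of the model space. -/
def chartSymmDeriv (e : OpenPartialHomeomorph M E4) (y : E4) : E4 →L[ℝ] E4 :=
  mfderiv (𝓡 4) (𝓡 4) e.symm y

/-- `coordVec`, as an element of the model space. -/
def coordVec' (e : OpenPartialHomeomorph M E4) (i : Fin 4) (y : E4) : E4 :=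
  chartSymmDeriv e y (EuclideanSpace.single i 1)

/-- The coordinate covectors `dx^k`. -/
def coordCov (e : OpenPartialHomeomorph M E4) (k : Fin 4) (x : M) : E4 →L[ℝ] ℝ :=
  (EuclideanSpace.proj k : E4 →L[ℝ] ℝ).comp (chartDeriv e x)

theorem clm_apply_eq_sum {F : Type*} [AddCommGroup F] [Module ℝ F] [TopologicalSpace F]
    (L : E4 →L[ℝ] F) (w : E4) : L w = ∑ k, w k • L (EuclideanSpace.single k 1) := by
  conv_lhs => rw [← sum_single_smul w, map_sum]
  exact Finset.sum_congr rfl fun k _ => by rw [map_smul]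

theorem mdifferentiableAt_chart (he : e ∈ IsManifold.maximalAtlas (𝓡 4) ∞ M) (hx : x ∈ e.source) :
    MDifferentiableAt (𝓡 4) (𝓡 4) e x :=
  ((contMDiffOn_of_mem_maximalAtlas he).contMDiffAt (e.open_source.mem_nhds hx)).mdifferentiableAt
    (by simp)

theorem mdifferentiableAt_chart_symm (he : e ∈ IsManifold.maximalAtlas (𝓡 4) ∞ M)
    (hy : y ∈ e.target) : MDifferentiableAt (𝓡 4) (𝓡 4) e.symm y :=
  ((contMDiffOn_symm_of_mem_maximalAtlas he).contMDiffAt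
    (e.open_target.mem_nhds hy)).mdifferentiableAt (by simp)

theorem contDiffOn_transition (he : e ∈ IsManifold.maximalAtlas (𝓡 4) ∞ M)
    (he' : e' ∈ IsManifold.maximalAtlas (𝓡 4) ∞ M) :
    ContDiffOn ℝ ∞ (transition e e') (overlap e e' U) := by
  rw [← contMDiffOn_iff_contDiffOn]
  exact (contMDiffOn_of_mem_maximalAtlas he).comp
    ((contMDiffOn_symm_of_mem_maximalAtlas he').mono Set.inter_subset_left) fun y hy => hy.2.1

theorem jac_transition (he : e ∈ IsManifold.maximalAtlas (𝓡 4) ∞ M)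
    (he' : e' ∈ IsManifold.maximalAtlas (𝓡 4) ∞ M) (hx : x ∈ e.source) (hx' : x ∈ e'.source)
    (k i : Fin 4) : jac (transition e e') k i (e' x)
      = fderiv ℝ (transition e e') (e' x) (EuclideanSpace.single i 1) k := by
  have hy : e' x ∈ overlap e e' Set.univ :=
    ⟨e'.map_source hx', by simpa [e'.left_inv hx'] using hx⟩
  have h1 := ((contDiffOn_transition he he' (U := Set.univ)).contDiffAt
    ((isOpen_overlap isOpen_univ).mem_nhds hy)).differentiableAt (by simp)
  have h2 := ((EuclideanSpace.proj k : E4 →L[ℝ] ℝ).hasFDerivAt.comp (e' x) h1.hasFDerivAt).fderiv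
  change fderiv ℝ ((EuclideanSpace.proj k : E4 →L[ℝ] ℝ) ∘ transition e e') (e' x) _ = _
  rw [h2]
  rfl

theorem coordVec'_transition (he : e ∈ IsManifold.maximalAtlas (𝓡 4) ∞ M)
    (he' : e' ∈ IsManifold.maximalAtlas (𝓡 4) ∞ M) (hx : x ∈ e.source) (hx' : x ∈ e'.source)
    (i : Fin 4) : coordVec' e' i (e' x)
      = ∑ k, jac (transition e e') k i (e' x) • coordVec' e k (e x) := by
  have hy : e' x ∈ overlap e e' Set.univ :=
    ⟨e'.map_source hx', by simpa [e'.left_inv hx'] using hx⟩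
  have hV := isOpen_overlap (e := e) (e' := e') isOpen_univ
  have h1 := ((contDiffOn_transition he he' (U := Set.univ)).contDiffAt
    (hV.mem_nhds hy)).differentiableAt (by simp)
  have hF : transition e e' (e' x) = e x := by rw [transition, e'.left_inv hx']
  have h2 : mfderiv (𝓡 4) (𝓡 4) e'.symm (e' x)
      = mfderiv (𝓡 4) (𝓡 4) (e.symm ∘ transition e e') (e' x) := by
    refine Filter.EventuallyEq.mfderiv_eq (Filter.eventuallyEq_of_mem (hV.mem_nhds hy) ?_)
    intro z hz
    exact (e.left_inv hz.2.1).symm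
  have h3 := mfderiv_comp_apply (I := 𝓡 4) (I' := 𝓡 4) (I'' := 𝓡 4) (x := e' x) (g := e.symm)
    (f := transition e e') (by rw [hF]; exact mdifferentiableAt_chart_symm he (e.map_source hx))
    h1.mdifferentiableAt (EuclideanSpace.single i (1 : ℝ) : E4)
  have h4 : coordVec' e' i (e' x) = chartSymmDeriv e (e x)
      (fderiv ℝ (transition e e') (e' x) (EuclideanSpace.single i 1)) := by
    rw [← hF, ← mfderiv_eq_fderiv]
    refine Eq.trans ?_ h3
    exact congrArg (fun L : E4 →L[ℝ] E4 => L (EuclideanSpace.single i 1)) h2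
  rw [h4, clm_apply_eq_sum]
  exact Finset.sum_congr rfl fun k _ => by rw [jac_transition he he' hx hx']; rfl

theorem coordCov_coordVec' (he : e ∈ IsManifold.maximalAtlas (𝓡 4) ∞ M)
    (he' : e' ∈ IsManifold.maximalAtlas (𝓡 4) ∞ M) (hx : x ∈ e.source) (hx' : x ∈ e'.source)
    (k i : Fin 4) : coordCov e k x (coordVec' e' i (e' x)) = jac (transition e e') k i (e' x) := by
  have h3 := mfderiv_comp_apply (I := 𝓡 4) (I' := 𝓡 4) (I'' := 𝓡 4) (x := e' x) (g := e)
    (f := e'.symm) (by rw [e'.left_inv hx']; exact mdifferentiableAt_chart he hx)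
    (mdifferentiableAt_chart_symm he' (e'.map_source hx')) (EuclideanSpace.single i (1 : ℝ) : E4)
  rw [jac_transition he he' hx hx', ← mfderiv_eq_fderiv]
  -- The points e'⁻¹(e'(x)) and x are equal only propositionally; abstracting the base point allows
  -- substitution.
  have h4 : ∀ x' : M, x' = x → coordCov e k x (coordVec' e' i (e' x))
      = (chartDeriv e x' (coordVec' e' i (e' x))) k := by
    rintro _ rfl
    rfl
  rw [h4 _ (e'.left_inv hx')]
  exact congrArg (fun v : E4 => v k) h3.symm

theorem sum_coordCov_smul (he : e ∈ IsManifold.maximalAtlas (𝓡 4) ∞ M) (hx : x ∈ e.source)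
    (v : E4) : ∑ k, coordCov e k x v • coordVec' e k (e x) = v := by
  have h2 := mfderiv_comp_apply (I := 𝓡 4) (I' := 𝓡 4) (I'' := 𝓡 4) (x := x) (g := e.symm)
    (f := e) (mdifferentiableAt_chart_symm he (e.map_source hx)) (mdifferentiableAt_chart he hx) v
  have h3 : mfderiv (𝓡 4) (𝓡 4) (e.symm ∘ e) x = mfderiv (𝓡 4) (𝓡 4) (id : M → M) x :=
    Filter.EventuallyEq.mfderiv_eq (Filter.eventuallyEq_of_mem (e.open_source.mem_nhds hx)
      fun z hz => e.left_inv hz)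
  have h4 : (mfderiv (𝓡 4) (𝓡 4) (e.symm ∘ e) x : E4 →L[ℝ] E4) v = v := by
    have h5 := congrArg (fun L : E4 →L[ℝ] E4 => L v) h3
    refine h5.trans ?_
    have h6 := mfderiv_id (I := 𝓡 4) (x := x)
    exact congrArg (fun L : E4 →L[ℝ] E4 => L v) h6
  exact ((clm_apply_eq_sum (chartSymmDeriv e (e x)) _).symm.trans h2.symm).trans h4

theorem coordChange_transition {O : OrientedAtlas M} (he : e ∈ O.charts) (he' : e' ∈ O.charts)
    (hU : IsOpen U) : CoordChange (transition e e') (overlap e e' U) (coordSet e U) where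
  isOpen := isOpen_overlap hU
  isOpen_target := isOpen_coordSet hU
  smooth k := ((EuclideanSpace.proj k : E4 →L[ℝ] ℝ).contDiff.comp_contDiffOn
    (contDiffOn_transition (O.smooth e he) (O.smooth e' he')))
  mapsTo y hy := ⟨e.map_source hy.2.1, by
    change e.symm (e (e'.symm y)) ∈ U
    rw [e.left_inv hy.2.1]; exact hy.2.2⟩
  det_pos y hy := by
    have h1 := O.det_pos e' he' e he y (by
      rw [OpenPartialHomeomorph.trans_source]
      exact ⟨hy.1, hy.2.1⟩)
    -- The orientation of the atlas is stated with the determinant of a linear map; this matrix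
    -- represents that map in the standard basis.
    have h2 : Matrix.of (fun k a => pd a (fun x => transition e e' x k) y)
        = LinearMap.toMatrix (EuclideanSpace.basisFun (Fin 4) ℝ).toBasis
          (EuclideanSpace.basisFun (Fin 4) ℝ).toBasis (fderiv ℝ (transition e e') y : E4 →ₗ[ℝ] E4) := by
      ext k a
      have h3 := jac_transition (O.smooth e he) (O.smooth e' he') hy.2.1 (e'.map_target hy.1) k a
      rw [e'.right_inv hy.1] at h3
      rw [LinearMap.toMatrix_apply]
      simpa [jac] using h3
    rw [h2, LinearMap.det_toMatrix]
    exact h1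

end Charts

/-! ### Tensor fields in charts -/

section Tensors

variable {M : Type*} [TopologicalSpace M] [ChartedSpace E4 M]
  {e e' : OpenPartialHomeomorph M E4} {x : M} {y : E4} {U : Set M}

/-- The value of a two-tensor, on the model space. -/
def tensorAt (T : TwoTensor M) (x : M) : E4 →L[ℝ] E4 →L[ℝ] ℝ := T x

/-- The value of a one-form, on the model space. -/
def formAt (K : OneForm M) (x : M) : E4 →L[ℝ] ℝ := K x

/-- The value of a field of endomorphisms, on the model space. -/
def endAt (J : EndField M) (x : M) : E4 →L[ℝ] E4 := J x

theorem clm_apply_sum₂ (B : E4 →L[ℝ] E4 →L[ℝ] ℝ) (a b : Fin 4 → ℝ) (v w : Fin 4 → E4) :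
    B (∑ i, a i • v i) (∑ j, b j • w j) = ∑ i, a i * ∑ j, b j * B (v i) (w j) := by
  simp only [map_sum, map_smul, sum_apply, smul_apply, smul_eq_mul, Finset.mul_sum]
  rw [Finset.sum_comm]
  exact Finset.sum_congr rfl fun _ _ => Finset.sum_congr rfl fun _ _ => by ring

theorem comp2_eq (T : TwoTensor M) (hx : x ∈ e.source) (i j : Fin 4) :
    comp2 e T i j (e x)
      = tensorAt T x (coordVec' e i (e x)) (coordVec' e j (e x)) := by
  have h : ∀ x', x' = x → tensorAt T x' (coordVec' e i (e x)) (coordVec' e j (e x))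
      = tensorAt T x (coordVec' e i (e x)) (coordVec' e j (e x)) := by
    rintro _ rfl
    rfl
  exact h _ (e.left_inv hx)

theorem comp1_eq (K : OneForm M) (hx : x ∈ e.source) (i : Fin 4) :
    comp1 e K i (e x) = formAt K x (coordVec' e i (e x)) := by
  have h : ∀ x', x' = x → formAt K x' (coordVec' e i (e x))
      = formAt K x (coordVec' e i (e x)) := by
    rintro _ rfl
    rfl
  exact h _ (e.left_inv hx)

theorem compEnd_eq (J : EndField M) (hx : x ∈ e.source) (k i : Fin 4) :
    compEnd e J k i (e x) = coordCov e k x (endAt J x (coordVec' e i (e x))) := by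
  have h : ∀ x', x' = x → coordCov e k x' (endAt J x' (coordVec' e i (e x)))
      = coordCov e k x (endAt J x (coordVec' e i (e x))) := by
    rintro _ rfl
    rfl
  exact h _ (e.left_inv hx)

theorem comp2_transition (he : e ∈ IsManifold.maximalAtlas (𝓡 4) ∞ M)
    (he' : e' ∈ IsManifold.maximalAtlas (𝓡 4) ∞ M) (T : TwoTensor M) (hy : y ∈ overlap e e' U)
    (a b : Fin 4) : comp2 e' T a b y = pb2 (transition e e') (comp2 e T) a b y := by
  obtain ⟨hy', hx, -⟩ := hy
  have hx' := e'.map_target hy'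
  obtain ⟨x, rfl⟩ : ∃ x, e'.symm y = x := ⟨_, rfl⟩
  have h0 := e'.right_inv hy'
  generalize e'.symm y = x at hx hx' h0
  subst h0
  have hF : transition e e' (e' x) = e x := by rw [transition, e'.left_inv hx']
  rw [comp2_eq T hx', pb2, hF]
  simp only [comp2_eq T hx, coordVec'_transition he he' hx hx', clm_apply_sum₂]

theorem tensorAt_eq_sum (T : TwoTensor M) (he : e ∈ IsManifold.maximalAtlas (𝓡 4) ∞ M)
    (hx : x ∈ e.source) (v w : E4) : tensorAt T x v w
      = ∑ i, coordCov e i x v * ∑ j, coordCov e j x w * comp2 e T i j (e x) := by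
  conv_lhs => rw [← sum_coordCov_smul he hx v, ← sum_coordCov_smul he hx w]
  simp only [comp2_eq T hx, clm_apply_sum₂]

variable (O : OrientedAtlas M)

/-- A chart around a point. -/
def OrientedAtlas.chartAt (x : M) : OpenPartialHomeomorph M E4 := (O.cover x).choose

theorem OrientedAtlas.chartAt_mem (x : M) : O.chartAt x ∈ O.charts := (O.cover x).choose_spec.1

theorem OrientedAtlas.mem_chartAt (x : M) : x ∈ (O.chartAt x).source := (O.cover x).choose_spec.2

variable {O}

/-- Components that transform correctly define a two-tensor. -/
theorem exists_twoTensor (R : OpenPartialHomeomorph M E4 → Fin 4 → Fin 4 → E4 → ℝ)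
    (hR : ∀ e ∈ O.charts, ∀ e' ∈ O.charts, ∀ y ∈ overlap e e' U, ∀ a b,
      R e' a b y = pb2 (transition e e') (R e) a b y) :
    ∃ T : TwoTensor M, ∀ e ∈ O.charts, ∀ y ∈ coordSet e U, ∀ a b, comp2 e T a b y = R e a b y := by
  -- At each point the tensor is written in the one chart chosen there. The choice need not vary
  -- continuously, since the transformation law gives the correct components in every chart.
  obtain ⟨T, hT⟩ : ∃ T : TwoTensor M, ∀ x, tensorAt T x = ∑ i, ∑ j,
      R (O.chartAt x) i j (O.chartAt x x) •
        (coordCov (O.chartAt x) i x).smulRight (coordCov (O.chartAt x) j x) :=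
    ⟨fun x => (∑ i, ∑ j, R (O.chartAt x) i j (O.chartAt x x) •
      (coordCov (O.chartAt x) i x).smulRight (coordCov (O.chartAt x) j x) :
        E4 →L[ℝ] E4 →L[ℝ] ℝ), fun _ => rfl⟩
  refine ⟨T, fun e he y hy a b => ?_⟩
  obtain ⟨x, hx, rfl⟩ : ∃ x ∈ e.source, e x = y := ⟨_, e.map_target hy.1, e.right_inv hy.1⟩
  have hxU : x ∈ U := by simpa [e.left_inv hx] using hy.2
  have hc := O.chartAt_mem x
  have hxc := O.mem_chartAt x
  have hF : transition (O.chartAt x) e (e x) = O.chartAt x x := by rw [transition, e.left_inv hx]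
  rw [hR _ hc e he (e x) ⟨e.map_source hx, by simpa [e.left_inv hx] using ⟨hxc, hxU⟩⟩, comp2_eq _ hx]
  simp only [hT, pb2, hF, sum_apply, smul_apply, ContinuousLinearMap.smulRight_apply, smul_eq_mul,
    coordCov_coordVec' (O.smooth _ hc) (O.smooth e he) hxc hx, Finset.mul_sum]
  exact Finset.sum_congr rfl fun _ _ => Finset.sum_congr rfl fun _ _ => by ring

theorem exists_oneForm (R : OpenPartialHomeomorph M E4 → Fin 4 → E4 → ℝ)
    (hR : ∀ e ∈ O.charts, ∀ e' ∈ O.charts, ∀ y ∈ overlap e e' U, ∀ a,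
      R e' a y = pb1 (transition e e') (R e) a y) :
    ∃ K : OneForm M, ∀ e ∈ O.charts, ∀ y ∈ coordSet e U, ∀ a, comp1 e K a y = R e a y := by
  obtain ⟨K, hK⟩ : ∃ K : OneForm M, ∀ x, formAt K x = ∑ i, R (O.chartAt x) i (O.chartAt x x) •
      coordCov (O.chartAt x) i x :=
    ⟨fun x => (∑ i, R (O.chartAt x) i (O.chartAt x x) • coordCov (O.chartAt x) i x :
      E4 →L[ℝ] ℝ), fun _ => rfl⟩
  refine ⟨K, fun e he y hy a => ?_⟩
  obtain ⟨x, hx, rfl⟩ : ∃ x ∈ e.source, e x = y := ⟨_, e.map_target hy.1, e.right_inv hy.1⟩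
  have hxU : x ∈ U := by simpa [e.left_inv hx] using hy.2
  have hc := O.chartAt_mem x
  have hxc := O.mem_chartAt x
  have hF : transition (O.chartAt x) e (e x) = O.chartAt x x := by rw [transition, e.left_inv hx]
  rw [hR _ hc e he (e x) ⟨e.map_source hx, by simpa [e.left_inv hx] using ⟨hxc, hxU⟩⟩, comp1_eq _ hx]
  simp only [hK, pb1, hF, sum_apply, smul_apply, smul_eq_mul,
    coordCov_coordVec' (O.smooth _ hc) (O.smooth e he) hxc hx]
  exact Finset.sum_congr rfl fun _ _ => by ring

theorem exists_function (R : OpenPartialHomeomorph M E4 → E4 → ℝ)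
    (hR : ∀ e ∈ O.charts, ∀ e' ∈ O.charts, ∀ y ∈ overlap e e' U,
      R e' y = R e (transition e e' y)) :
    ∃ f : M → ℝ, ∀ e ∈ O.charts, ∀ y ∈ coordSet e U, f (e.symm y) = R e y := by
  refine ⟨fun x => R (O.chartAt x) (O.chartAt x x), fun e he y hy => ?_⟩
  exact (hR _ (O.chartAt_mem _) e he y ⟨hy.1, O.mem_chartAt _, hy.2⟩).symm

theorem comp2_antisymm {T : TwoTensor M} (h : ∀ x ∈ U, ∀ v, T x v v = 0) (hy : y ∈ coordSet e U)
    (i j : Fin 4) : comp2 e T i j y = -comp2 e T j i y := by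
  have h1 := h _ hy.2 (coordVec e i y + coordVec e j y)
  simp only [map_add, add_apply, h _ hy.2, zero_add, add_zero] at h1
  exact eq_neg_of_add_eq_zero_right h1

theorem apply_self_of_comp2_antisymm {T : TwoTensor M}
    (h : ∀ e ∈ O.charts, ∀ y ∈ coordSet e U, ∀ i j, comp2 e T i j y = -comp2 e T j i y)
    (hx : x ∈ U) (v : TangentSpace (𝓡 4) x) : T x v v = 0 := by
  have hxc := O.mem_chartAt x
  have h1 := tensorAt_eq_sum T (O.smooth _ (O.chartAt_mem x)) hxc v v
  have h2 := h _ (O.chartAt_mem x) (O.chartAt x x) ⟨(O.chartAt x).map_source hxc, by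
    simpa [(O.chartAt x).left_inv hxc] using hx⟩
  have h3 : tensorAt T x v v = -tensorAt T x v v := by
    conv_rhs => rw [h1]
    rw [h1]
    conv_lhs => rw [sum_mul_sum_swap]
    simp only [← Finset.sum_neg_distrib, ← mul_neg]
    exact Finset.sum_congr rfl fun i _ => congrArg _
      (Finset.sum_congr rfl fun j _ => by rw [h2 j i])
  have h4 : tensorAt T x v v = 0 := by linarith
  exact h4

/-! ### The metric in charts -/

theorem metricOn_comp2 [IsManifold (𝓡 4) ∞ M]
    (g : Bundle.ContMDiffRiemannianMetric (𝓡 4) ∞ E4 (fun x : M => TangentSpace (𝓡 4) x))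
    (he : e ∈ IsManifold.maximalAtlas (𝓡 4) ∞ M) : MetricOn (comp2 e g.inner) e.target where
  isOpen := e.open_target
  smooth i j := by
    -- Coordinate vector fields are smooth as maps into the tangent bundle, being the tangent map of
    -- the inverse chart applied to constant vectors. Smoothness of the components then follows from
    -- evaluation of a smooth section of bilinear forms.
    have hv : ∀ i, ContMDiffOn (𝓡 4) (𝓡 4).tangent ∞ (fun y : E4 =>
        (⟨e.symm y, coordVec e i y⟩ : TangentBundle (𝓡 4) M)) e.target := by
      intro i
      have h1 := (contMDiffOn_symm_of_mem_maximalAtlas he).contMDiffOn_tangentMapWithin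
        (m := ∞) (by simp) e.open_target.uniqueMDiffOn
      have h2 : ContMDiff (𝓡 4) (𝓡 4).tangent ∞ (fun y : E4 =>
          (⟨y, EuclideanSpace.single i (1 : ℝ)⟩ : TangentBundle (𝓡 4) E4)) :=
        contMDiff_vectorSpace_iff_contDiff.2 contDiff_const
      refine ((h1.comp h2.contMDiffOn (s := e.target) fun y hy => hy)).congr fun y hy => ?_
      simp only [Function.comp_apply]
      rw [tangentMapWithin, mfderivWithin_of_isOpen e.open_target hy]
      rfl
    refine contMDiffOn_iff_contDiffOn.1 fun y hy => ?_
    have h3 : ContMDiffWithinAt (𝓡 4) ((𝓡 4).prod 𝓘(ℝ)) ∞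
        (fun z => Bundle.TotalSpace.mk' ℝ (E := Bundle.Trivial M ℝ) (e.symm z)
          (g.inner (e.symm z) (coordVec e i z) (coordVec e j z))) e.target y := by
      apply ContMDiffWithinAt.clm_bundle_apply₂ (F₁ := E4) (F₂ := E4)
      · exact g.contMDiff.contMDiffAt.comp_contMDiffWithinAt y
          (contMDiffOn_symm_of_mem_maximalAtlas he y hy)
      · exact hv i y hy
      · exact hv j y hy
    simp only [Bundle.contMDiffWithinAt_totalSpace] at h3
    exact h3.2
  symm y hy i j := g.symm _ _ _
  pos y hy v hv := by
    obtain ⟨x, hx, rfl⟩ : ∃ x ∈ e.source, e x = y := ⟨_, e.map_target hy, e.right_inv hy⟩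
    have h1 := clm_apply_sum₂ (tensorAt g.inner x) v v (fun i => coordVec' e i (e x))
      fun i => coordVec' e i (e x)
    have h2 : ∑ i, v i • coordVec' e i (e x) ≠ 0 := by
      intro h0
      refine hv (funext fun k => ?_)
      have h3 := congrArg (coordCov e k x) h0
      simpa [coordCov_coordVec' he he hx hx, jac_transition_self hx, unitFrame] using h3
    have h3 : 0 < tensorAt g.inner x (∑ i, v i • coordVec' e i (e x))
        (∑ i, v i • coordVec' e i (e x)) := g.pos x _ h2
    rw [h1] at h3
    simp only [comp2_eq _ hx]
    refine h3.trans_eq ?_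
    simp only [Finset.mul_sum]
    exact Finset.sum_congr rfl fun _ _ => Finset.sum_congr rfl fun _ _ => by ring

end Tensors

/-! ### Locality of the curvature -/

section Congr

variable {g g' S S' T T' : Fin 4 → Fin 4 → E4 → ℝ} {u u' : E4 → ℝ} {V : Set E4} {y : E4}

theorem metricInv_congr (h : ∀ i j, g' i j y = g i j y) (i j : Fin 4) :
    metricInv g' i j y = metricInv g i j y := by
  simp only [metricInv, h]

theorem pairContract_congr (h : ∀ i j, g' i j y = g i j y) (hS : ∀ i j, S' i j y = S i j y)
    (hT : ∀ i j, T' i j y = T i j y) (i j : Fin 4) :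
    pairContract g' S' T' i j y = pairContract g S T i j y := by
  simp only [pairContract, metricInv_congr h, hS, hT]

theorem lenSq_congr (h : ∀ i j, g' i j y = g i j y) (hS : ∀ i j, S' i j y = S i j y) :
    lenSq g' S' y = lenSq g S y := by
  simp only [lenSq, metricInv_congr h, pairContract_congr h hS hS]

theorem logPd_congr_on (hV : IsOpen V) (hu : ∀ z ∈ V, u' z = u z) (hy : y ∈ V) (i : Fin 4) :
    logPd u' i y = logPd u i y := by
  rw [logPd, logPd, hu y hy, pd_congr_on hV hy hu]

/-- The curvature depends on second derivatives, so agreement of the metrics on an open set is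
required, unlike for the algebraic contractions above. -/
theorem schouten_congr_on (hV : IsOpen V) (h : ∀ z ∈ V, ∀ i j, g' i j z = g i j z) (hy : y ∈ V)
    (i j : Fin 4) : schouten g' i j y = schouten g i j y := by
  have h1 : ∀ z ∈ V, ∀ k i j, christoffel g' k i j z = christoffel g k i j z := by
    intro z hz k i j
    simp only [christoffel, metricInv_congr (h z hz),
      pd_congr_on hV hz fun w hw => h w hw _ _]
  have h2 : ∀ a b, ricci g' a b y = ricci g a b y := by
    intro a b
    simp only [ricci, riemannUp, h1 y hy, pd_congr_on hV hy fun w hw => h1 w hw _ _ _]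
  simp only [schouten_eq, scalarCurv, h2, metricInv_congr (h y hy), h y hy]

theorem contract_congr_on (hV : IsOpen V) (h : ∀ z ∈ V, ∀ i j, g' i j z = g i j z)
    (hS : ∀ z ∈ V, ∀ i j, S' i j z = S i j z) (hu : ∀ z ∈ V, u' z = u z) (hy : y ∈ V) (i : Fin 4) :
    contract g' S' (logPd u') i y = contract g S (logPd u) i y := by
  simp only [contract, metricInv_congr (h y hy), hS y hy, logPd_congr_on hV hu hy]

theorem confRho_congr_on (hV : IsOpen V) (h : ∀ z ∈ V, ∀ i j, g' i j z = g i j z)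
    (hS : ∀ z ∈ V, ∀ i j, S' i j z = S i j z) (hu : ∀ z ∈ V, u' z = u z) (hy : y ∈ V)
    (i j : Fin 4) : confRho g' S' u' i j y = confRho g S u i j y := by
  simp only [confRho, contract_congr_on hV h hS hu hy, metricInv_congr (h y hy), hS y hy, hu y hy,
    logPd_congr_on hV hu hy,
    pairContract_congr (h y hy) (schouten_congr_on hV h hy) (hS y hy)]

end Congr

/-! ### Almost complex structures in charts -/

section

variable {M : Type*} [TopologicalSpace M] [ChartedSpace E4 M] {O : OrientedAtlas M}
  {e : OpenPartialHomeomorph M E4} {x : M} {y : E4} {U : Set M}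

theorem endAt_coordVec' (J : EndField M) (he : e ∈ IsManifold.maximalAtlas (𝓡 4) ∞ M)
    (hx : x ∈ e.source) (i : Fin 4) :
    endAt J x (coordVec' e i (e x)) = ∑ k, compEnd e J k i (e x) • coordVec' e k (e x) := by
  simp only [compEnd_eq J hx]
  exact (sum_coordCov_smul he hx _).symm

theorem comp2_kahlerForm (h : TwoTensor M) (J : EndField M)
    (he : e ∈ IsManifold.maximalAtlas (𝓡 4) ∞ M) (hy : y ∈ e.target) (i j : Fin 4) :
    comp2 e (kahlerForm h J) i j y = ∑ k, compEnd e J k i y * comp2 e h k j y := by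
  obtain ⟨x, hx, rfl⟩ : ∃ x ∈ e.source, e x = y := ⟨_, e.map_target hy, e.right_inv hy⟩
  rw [comp2_eq _ hx]
  change tensorAt h x (endAt J x _) _ = _
  rw [endAt_coordVec' J he hx]
  simp only [comp2_eq h hx, map_sum, map_smul, sum_apply, smul_apply, smul_eq_mul]

/-- The tensor `h(J·, J·)`. -/
def pullbackEnd (h : TwoTensor M) (J : EndField M) : TwoTensor M :=
  fun x => (tensorAt h x).bilinearComp (endAt J x) (endAt J x)

theorem comp2_pullbackEnd (h : TwoTensor M) (J : EndField M)
    (he : e ∈ IsManifold.maximalAtlas (𝓡 4) ∞ M) (hy : y ∈ e.target) (i j : Fin 4) :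
    comp2 e (pullbackEnd h J) i j y
      = ∑ k, compEnd e J k i y * ∑ l, compEnd e J l j y * comp2 e h k l y := by
  obtain ⟨x, hx, rfl⟩ : ∃ x ∈ e.source, e x = y := ⟨_, e.map_target hy, e.right_inv hy⟩
  rw [comp2_eq _ hx]
  change tensorAt h x (endAt J x _) (endAt J x _) = _
  rw [endAt_coordVec' J he hx, endAt_coordVec' J he hx, clm_apply_sum₂]
  simp only [comp2_eq h hx]

theorem tensor_congr {S T : TwoTensor M}
    (h : ∀ e ∈ O.charts, ∀ y ∈ coordSet e U, ∀ i j, comp2 e S i j y = comp2 e T i j y)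
    (hx : x ∈ U) (v w : TangentSpace (𝓡 4) x) : S x v w = T x v w := by
  have hxc := O.mem_chartAt x
  have he := O.chartAt_mem x
  have h1 := tensorAt_eq_sum S (O.smooth _ he) hxc v w
  simp only [h _ he (O.chartAt x x) ⟨(O.chartAt x).map_source hxc, by
    simpa [(O.chartAt x).left_inv hxc] using hx⟩] at h1
  exact h1.trans (tensorAt_eq_sum T (O.smooth _ he) hxc v w).symm

/-- Since Σ is J with an index lowered, contracting two copies of Σ gives h(J·, J·). It translates
between unit length of Σ and the Hermitian condition. -/
theorem MetricOn.pairContract_of_end {h Sig J : Fin 4 → Fin 4 → E4 → ℝ} {V : Set E4}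
    (hg : MetricOn h V) (hy : y ∈ V) (hS : ∀ i j, Sig i j y = ∑ k, J k i y * h k j y)
    (i j : Fin 4) :
    pairContract h Sig Sig i j y = ∑ k, J k i y * ∑ l, J l j y * h k l y := by
  have h1 : ∀ l, J l i y = ∑ k, metricInv h l k y * Sig i k y := by
    intro l
    rw [← hg.raise_lower hy (fun k => J k i y) l]
    refine Finset.sum_congr rfl fun k _ => ?_
    rw [hS]
    congr 1
    exact Finset.sum_congr rfl fun m _ => by rw [hg.symm y hy k m]; ring
  have h2 : ∀ k, ∑ l, J l j y * h k l y = Sig j k y := fun k => by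
    rw [hS]
    exact Finset.sum_congr rfl fun l _ => by rw [hg.symm y hy k l]
  simp only [h2, h1, pairContract, Finset.sum_mul]
  rw [Finset.sum_comm]
  refine Finset.sum_congr rfl fun k _ => Finset.sum_congr rfl fun l _ => ?_
  rw [hg.inv_symm hy]
  ring

theorem contMDiffOn_of_charts {f : M → ℝ} (hU : IsOpen U)
    (h : ∀ e ∈ O.charts, ContDiffOn ℝ ∞ (fun y => f (e.symm y)) (coordSet e U)) :
    ContMDiffOn (𝓡 4) 𝓘(ℝ, ℝ) ∞ f U := by
  intro x hx
  have hxc := O.mem_chartAt x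
  have he := O.chartAt_mem x
  have hy : O.chartAt x x ∈ coordSet (O.chartAt x) U :=
    ⟨(O.chartAt x).map_source hxc, by simpa [(O.chartAt x).left_inv hxc] using hx⟩
  have h1 : ContMDiffAt (𝓡 4) 𝓘(ℝ, ℝ) ∞ (fun y => f ((O.chartAt x).symm y)) (O.chartAt x x) :=
    ((h _ he).contDiffAt ((isOpen_coordSet hU).mem_nhds hy)).contMDiffAt
  have h2 := (contMDiffOn_of_mem_maximalAtlas (O.smooth _ he)).contMDiffAt
    ((O.chartAt x).open_source.mem_nhds hxc)
  refine ((h1.comp x h2).congr_of_eventuallyEq ?_).contMDiffWithinAt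
  exact Filter.eventuallyEq_of_mem ((O.chartAt x).open_source.mem_nhds hxc) fun z hz => by
    simp [(O.chartAt x).left_inv hz]

theorem IsConformalFactorOn.sm {Om : M → ℝ} (h : IsConformalFactorOn U Om)
    (he : e ∈ IsManifold.maximalAtlas (𝓡 4) ∞ M) : Sm (coordSet e U) fun y => Om (e.symm y) := by
  rw [Sm, ← contMDiffOn_iff_contDiffOn]
  exact h.1.comp ((contMDiffOn_symm_of_mem_maximalAtlas he).mono Set.inter_subset_left)
    fun y hy => hy.2

end

section

variable {M : Type*} [TopologicalSpace M] [ChartedSpace E4 M] {O : OrientedAtlas M}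
  {e : OpenPartialHomeomorph M E4} {x : M} {y : E4} {U : Set M}

/-! ### From a Kähler metric to a parallel section -/

theorem comp2_congr {h h' : TwoTensor M} (hh : ∀ x ∈ U, h x = h' x) (hy : y ∈ coordSet e U)
    (i j : Fin 4) : comp2 e h i j y = comp2 e h' i j y := by
  simp only [comp2, hh _ hy.2]

theorem isOrientedFrame_congr {g g' : Fin 4 → Fin 4 → E4 → ℝ} {E : Fin 4 → Fin 4 → ℝ}
    (h : ∀ i j, g i j y = g' i j y) : IsOrientedFrame g y E ↔ IsOrientedFrame g' y E := by
  simp only [IsOrientedFrame, h]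

theorem IsKahlerOn.congr (hU : IsOpen U) {h h' : TwoTensor M} {J : EndField M}
    (hk : IsKahlerOn O U h J) (hh : ∀ x ∈ U, h x = h' x) : IsKahlerOn O U h' J := by
  have hS : ∀ x ∈ U, kahlerForm h J x = kahlerForm h' J x := fun x hx => by
    simp only [kahlerForm, hh x hx]
  refine ⟨hk.smooth, hk.sq, fun x hx v w => ?_, hk.integrable, fun e he y hy i j k => ?_,
    fun e he y hy E hE A B => ?_⟩
  · rw [← hh x hx]; exact hk.hermitian x hx v w
  · simp only [← pd_congr_on (isOpen_coordSet hU) hy fun z hz => comp2_congr hS hz _ _]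
    exact hk.closed e he y hy i j k
  · simp only [← comp2_congr hS hy]
    exact hk.selfDual e he y hy E ((isOrientedFrame_congr (comp2_congr hh hy)).2 hE) A B

/-- A metric that is conformal to Kähler is so with a conformal factor that is positive at all
points of the manifold. -/
theorem IsConformalToKahlerOn.exists_pos (hU : IsOpen U) {g : TwoTensor M}
    (h : IsConformalToKahlerOn O U g) : ∃ (Om : M → ℝ) (J : EndField M),
      (∀ x, 0 < Om x) ∧ IsConformalFactorOn U Om ∧ IsKahlerOn O U (rescaledMetric Om g) J := by
  classical
  obtain ⟨Om, J, hOm, hk⟩ := h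
  -- The value 1 off `U` keeps the factor invertible everywhere, so that rescaling can be undone as
  -- an identity of functions.
  have h1 : ∀ x ∈ U, (if x ∈ U then Om x else 1) = Om x := fun x hx => if_pos hx
  refine ⟨fun x => if x ∈ U then Om x else 1, J, fun x => ?_,
    ⟨hOm.1.congr h1, fun x hx => ?_⟩, hk.congr hU fun x hx => ?_⟩
  · by_cases hx : x ∈ U
    · simpa [hx] using hOm.2 x hx
    · simp [hx]
  · exact (hOm.2 x hx).trans_eq (h1 x hx).symm
  · simp only [rescaledMetric, h1 x hx]

variable [IsManifold (𝓡 4) ∞ M]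
  {g : Bundle.ContMDiffRiemannianMetric (𝓡 4) ∞ E4 (fun x : M => TangentSpace (𝓡 4) x)}
  {Om : M → ℝ} {J : EndField M}

theorem metricOn_rescaled (hU : IsOpen U) (hOm : IsConformalFactorOn U Om) (he : e ∈ O.charts) :
    MetricOn (comp2 e (rescaledMetric Om g.inner)) (coordSet e U) :=
  ((metricOn_comp2 g (O.smooth e he)).mono (isOpen_coordSet hU) Set.inter_subset_left).conf
    (hOm.sm (O.smooth e he)) fun _ hz => hOm.2 _ hz.2

/-- Length and antisymmetry of the form come from the Hermitian condition and J² = −1, its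
parallelism from closedness and integrability, and the Weyl condition from conformal invariance. -/
theorem IsKahlerOn.kahlerLike (hk : IsKahlerOn O U (rescaledMetric Om g.inner) J) (hU : IsOpen U)
    (hOm : IsConformalFactorOn U Om) (ha : IsAntiSelfDual O g.inner) (he : e ∈ O.charts) :
    KahlerLike (comp2 e (rescaledMetric Om g.inner))
      (comp2 e (kahlerForm (rescaledMetric Om g.inner) J)) (coordSet e U) := by
  have hM := O.smooth e he
  have hg := metricOn_rescaled (g := g) hU hOm he
  have hS : ∀ z ∈ coordSet e U, ∀ i j, comp2 e (kahlerForm (rescaledMetric Om g.inner) J) i j z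
      = ∑ k, compEnd e J k i z * comp2 e (rescaledMetric Om g.inner) k j z := fun z hz =>
    comp2_kahlerForm _ J hM hz.1
  have hsm : ∀ i j, Sm (coordSet e U) (comp2 e (kahlerForm (rescaledMetric Om g.inner) J) i j) :=
    fun i j => (Sm.sum fun k _ => (hk.smooth e he k i).mul (hg.smooth k j)).congr
      fun z hz => hS z hz i j
  have hherm : ∀ z ∈ coordSet e U, ∀ i j, comp2 e (pullbackEnd (rescaledMetric Om g.inner) J) i j z
      = comp2 e (rescaledMetric Om g.inner) i j z := fun z hz i j =>
    hk.hermitian _ hz.2 _ _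
  have hanti : ∀ z ∈ coordSet e U, ∀ i j, comp2 e (kahlerForm (rescaledMetric Om g.inner) J) i j z
      = -comp2 e (kahlerForm (rescaledMetric Om g.inner) J) j i z := by
    refine fun z hz => comp2_antisymm (fun x hx v => ?_) hz
    have h1 := hk.hermitian x hx (J x v) v
    rw [hk.sq x hx, map_neg] at h1
    have h2 : rescaledMetric Om g.inner x v (J x v) = rescaledMetric Om g.inner x (J x v) v :=
      congrArg (Om x ^ 2 * ·) (g.symm x _ _)
    have h3 : rescaledMetric Om g.inner x (J x v) v = 0 := by
      have h4 : -rescaledMetric Om g.inner x v (J x v) = rescaledMetric Om g.inner x (J x v) v := h1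
      linarith
    exact h3
  have hsq : ∀ z ∈ coordSet e U, ∀ k i, ∑ l, compEnd e J k l z * compEnd e J l i z
      = -unitFrame k i := by
    intro z hz k i
    obtain ⟨x, hx, rfl⟩ : ∃ x ∈ e.source, e x = z := ⟨_, e.map_target hz.1, e.right_inv hz.1⟩
    have hxU : x ∈ U := by simpa [e.left_inv hx] using hz.2
    have h1 : endAt J x (endAt J x (coordVec' e i (e x))) = -coordVec' e i (e x) :=
      hk.sq x hxU _
    have h2 := congrArg (coordCov e k x) h1
    rw [endAt_coordVec' J hM hx, map_neg, coordCov_coordVec' hM hM hx hx, jac_transition_self hx,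
      map_sum, map_sum] at h2
    rw [← h2]
    exact Finset.sum_congr rfl fun l _ => by
      rw [map_smul, map_smul, smul_eq_mul, compEnd_eq J hx, mul_comm]
  refine ⟨hg, hsm, hanti, hk.selfDual e he, fun z hz i j => ?_, fun z hz => ?_,
    fun z hz E hE A' B' C' D' => ?_⟩
  · rw [hg.pairContract_of_end hz (hS z hz), ← hherm z hz, comp2_pullbackEnd _ J hM hz.1]
  · exact hg.nabla2_eq_zero hz (hk.smooth e he) hS hsm hanti hsq (hk.integrable e he z hz)
      (hk.closed e he z hz)
  -- The self-dual Weyl spinors of g and Ω²g in proportional frames differ by a nonzero factor.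
  · have hg0 := (metricOn_comp2 g hM).mono (isOpen_coordSet hU) (Set.inter_subset_left (t := _))
    have h1 := ha e he z hz.1 _ (isOrientedFrame_smul_of_conf (hOm.2 _ hz.2) hE)
    have h2 : ∀ a b c d, weyl (comp2 e (rescaledMetric Om g.inner)) a b c d z
        = Om (e.symm z) ^ 2 * weyl (comp2 e g.inner) a b c d z :=
      hg0.weyl_conf (hOm.sm hM) (fun _ hw => hOm.2 _ hw.2) hz
    have h3 := h1 A' B' C' D'
    have h4 : (Om (e.symm z) : ℂ) ≠ 0 := by exact_mod_cast (hOm.2 _ hz.2).ne'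
    simp only [psiPrimed, weylSD_eq, sdPart_smul, sdPart_mul_left] at h3
    simp only [psiPrimed, weylSD_eq, h2, Complex.ofReal_mul, sdPart_mul_left]
    rw [(mul_eq_zero.1 ((mul_eq_zero.1 h3).resolve_left (pow_ne_zero 2 h4))).resolve_left
      (pow_ne_zero 2 h4), mul_zero]

end

/-! ### Length of the rescaled Kähler form -/

section

variable {g h Sig om rho : Fin 4 → Fin 4 → E4 → ℝ} {K : Fin 4 → E4 → ℝ} {u : E4 → ℝ}
  {V V' : Set E4} {F : E4 → E4} {y : E4}

theorem SectionOn.normSq_eq (hs : SectionOn g om K rho V) (hg : MetricOn g V) (hy : y ∈ V)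
    {E : Fin 4 → Fin 4 → ℝ} (hE : IsOrientedFrame g y E) :
    normSq (sdPart E fun i j => (om i j y : ℂ)) = 2 * (lenSq g om y : ℂ) := by
  obtain ⟨F, V', hF, rfl, rfl, hn⟩ := hg.exists_normal hy hE
  have h0 := hn.zero_mem
  have hs' := hs.pb hF
  have ha := hs'.antisymm_om 0 h0
  have hsd := hs'.selfDual 0 h0 _ hn.isOrientedFrame
  rw [← sdPart_pb]
  simp only [← ofReal_pb2]
  rw [normSq_of_dualRel (dualRel_of_asdPart ha hsd) ha, ← hn.lenSq_eq ha hsd, hF.lenSq_pb h0]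

theorem MetricOn.diag_pos (hg : MetricOn g V) (hy : y ∈ V) (i : Fin 4) : 0 < g i i y := by
  have h1 := hg.pos y hy (Pi.single i 1) (by simp)
  simpa [Pi.single_apply] using h1

/-- Gives nondegeneracy of the resulting section: ω = u³Σ has length u in the metric u²h. -/
theorem KahlerLike.lenSq_conf (hk : KahlerLike h Sig V) (hu : Sm V u) (hpos : ∀ z ∈ V, 0 < u z)
    (hs : SectionOn (confMetric u h) (fun i j z => u z ^ 3 * Sig i j z) K rho V) (hy : y ∈ V) :
    lenSq (confMetric u h) (fun i j z => u z ^ 3 * Sig i j z) y = u y ^ 2 := by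
  have hg := hk.metricOn.conf hu hpos
  have h1 := hs.pairContract_eq hg hy 0 0
  rw [pairContract_conf hk.metricOn hy (hpos y hy).ne', hk.norm y hy] at h1
  refine mul_right_cancel₀ (hg.diag_pos hy 0).ne' (h1.symm.trans ?_)
  rw [confMetric]
  ring

theorem CoordChange.contract_logPd_pb (hF : CoordChange F V' V) (hu : Sm V u) (hy : y ∈ V')
    (a : Fin 4) : contract (pb2 F h) (pb2 F Sig) (logPd fun z => u (F z)) a y
      = pb1 F (contract h Sig (logPd u)) a y := by
  rw [← hF.contract_pb1 hy]
  simp only [contract, hF.logPd_pb hu hy]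

end

/-! ### Sections over a manifold, and the passage from Kähler metrics to parallel sections -/

section

variable {M : Type*} [TopologicalSpace M] [ChartedSpace E4 M] {O : OrientedAtlas M}
  {e : OpenPartialHomeomorph M E4} {x : M} {y : E4} {U : Set M}

theorem isSectionOn_of_charts {g om rho : TwoTensor M} {K : OneForm M}
    (h : ∀ e ∈ O.charts, SectionOn (comp2 e g) (comp2 e om) (comp1 e K) (comp2 e rho)
      (coordSet e U)) : IsSectionOn O U g om K rho where
  smooth_om e he := (h e he).sm_om
  smooth_K e he := (h e he).sm_K
  smooth_rho e he := (h e he).sm_rho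
  alt_om _ := apply_self_of_comp2_antisymm fun e he => (h e he).antisymm_om
  alt_rho _ := apply_self_of_comp2_antisymm fun e he => (h e he).antisymm_rho
  selfDual_om e he := (h e he).selfDual
  antiSelfDual_rho e he := (h e he).antiSelfDual

theorem IsSectionOn.sectionOn {g om rho : TwoTensor M} {K : OneForm M}
    (h : IsSectionOn O U g om K rho) (he : e ∈ O.charts) :
    SectionOn (comp2 e g) (comp2 e om) (comp1 e K) (comp2 e rho) (coordSet e U) where
  sm_om := h.smooth_om e he
  sm_K := h.smooth_K e he
  sm_rho := h.smooth_rho e he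
  antisymm_om _ := comp2_antisymm h.alt_om
  antisymm_rho _ := comp2_antisymm h.alt_rho
  selfDual := h.selfDual_om e he
  antiSelfDual := h.antiSelfDual_rho e he

variable [IsManifold (𝓡 4) ∞ M]
  {g : Bundle.ContMDiffRiemannianMetric (𝓡 4) ∞ E4 (fun x : M => TangentSpace (𝓡 4) x)}
  {Om : M → ℝ} {J : EndField M}

/-- With H = Ω²g Kähler and u = Ω⁻¹, so that g = u²H, the section of g is the rescaling by u of the
section (Σ, 0, P·Σ) of H. -/
theorem IsConformalToKahlerOn.hasParallelSectionOn (hU : IsOpen U) (ha : IsAntiSelfDual O g.inner)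
    (h : IsConformalToKahlerOn O U g.inner) : HasParallelSectionOn O U g.inner := by
  obtain ⟨Om, J, hpos, hOm, hk⟩ := h.exists_pos hU
  obtain ⟨H, hH⟩ : ∃ H, H = rescaledMetric Om g.inner := ⟨_, rfl⟩
  obtain ⟨S, hS⟩ : ∃ S, S = kahlerForm H J := ⟨_, rfl⟩
  have hkl : ∀ e ∈ O.charts, KahlerLike (comp2 e H) (comp2 e S) (coordSet e U) := fun e he => by
    rw [hS, hH]; exact hk.kahlerLike hU hOm ha he
  obtain ⟨u, hu⟩ : ∃ u : OpenPartialHomeomorph M E4 → E4 → ℝ,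
    ∀ e y, u e y = (Om (e.symm y))⁻¹ := ⟨_, fun _ _ => rfl⟩
  have hsu : ∀ e ∈ O.charts, Sm (coordSet e U) (u e) := fun e he =>
    ((hOm.sm (O.smooth e he)).inv fun z _ => (hpos _).ne').congr fun z _ => hu e z
  have hu0 : ∀ e y, 0 < u e y := fun e y => by rw [hu]; exact inv_pos.2 (hpos _)
  -- Because Ω is positive on the whole manifold, this holds as an identity of functions and can be
  -- rewritten inside derivatives.
  have hconf : ∀ e, confMetric (u e) (comp2 e H) = comp2 e g.inner := by
    intro e
    funext i j z
    have h1 : comp2 e H i j z = Om (e.symm z) ^ 2 * comp2 e g.inner i j z := by rw [hH]; rfl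
    have h2 := (hpos (e.symm z)).ne'
    rw [confMetric, h1, hu]
    field_simp
  have hut : ∀ e e', ∀ z ∈ overlap e e' U, u e' z = u e (transition e e' z) := by
    intro e e' z hz
    rw [hu, hu, transition, e.left_inv hz.2.1]
  have ht : ∀ T : TwoTensor M, ∀ e ∈ O.charts, ∀ e' ∈ O.charts, ∀ z ∈ overlap e e' U, ∀ i j,
      comp2 e' T i j z = pb2 (transition e e') (comp2 e T) i j z := fun T e he e' he' z hz =>
    comp2_transition (O.smooth e he) (O.smooth e' he') T hz
  -- The form ω is a pointwise multiple of Σ and needs no charts. K and ρ contain derivatives of u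
  -- and of the metric and are glued from their components.
  obtain ⟨om, hom⟩ : ∃ om : TwoTensor M, ∀ e i j z, comp2 e om i j z
      = u e z ^ 3 * comp2 e S i j z :=
    ⟨fun x => ((Om x)⁻¹) ^ 3 • S x, fun e i j z => by rw [hu]; rfl⟩
  obtain ⟨K, hK⟩ := exists_oneForm (O := O) (U := U)
    (fun e a y => u e y * contract (comp2 e H) (comp2 e S) (logPd (u e)) a y)
    fun e he e' he' z hz a => by
      have hF := coordChange_transition he he' hU
      rw [contract_congr_on (isOpen_overlap hU) (ht H e he e' he') (ht S e he e' he') (hut e e') hz,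
        hF.contract_logPd_pb (hsu e he) hz, hut e e' z hz]
      simp only [pb1, Finset.mul_sum]
      exact Finset.sum_congr rfl fun _ _ => by ring
  obtain ⟨rho, hrho⟩ := exists_twoTensor (O := O) (U := U)
    (fun e => confRho (comp2 e H) (comp2 e S) (u e))
    fun e he e' he' z hz a b => by
      have hF := coordChange_transition he he' hU
      rw [confRho_congr_on (isOpen_overlap hU) (ht H e he e' he') (ht S e he e' he') (hut e e') hz,
        hF.confRho_pb (hkl e he).metricOn (hsu e he) hz]
  have hsec : ∀ e ∈ O.charts, SectionOn (comp2 e g.inner) (comp2 e om) (comp1 e K) (comp2 e rho)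
      (coordSet e U) := fun e he => by
    rw [← hconf]
    exact (hkl e he).sectionOn_conf (hsu e he) (fun z _ => hu0 e z) (fun z _ i j => hom e i j z)
      (hK e he) (hrho e he)
  refine ⟨om, K, rho, isSectionOn_of_charts hsec, fun e he y hy E hE A A' => ?_,
    fun e he y hy E hE => ?_⟩
  · rw [← hconf] at hE ⊢
    exact (hkl e he).tractorD_conf_eq_zero (hsu e he) (fun z _ => hu0 e z)
      (fun z _ i j => hom e i j z) (hK e he) (hrho e he) hy hE A A'
  · have h1 := hsec e he
    have hom' : comp2 e om = fun i j z => u e z ^ 3 * comp2 e S i j z := by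
      funext i j z; exact hom e i j z
    rw [← hconf] at h1 hE
    rw [h1.normSq_eq ((hkl e he).metricOn.conf (hsu e he) fun z _ => hu0 e z) hy hE]
    rw [hom'] at h1 ⊢
    rw [(hkl e he).lenSq_conf (hsu e he) (fun z _ => hu0 e z) h1 hy]
    have h2 : (u e y : ℂ) ≠ 0 := by exact_mod_cast (hu0 e y).ne'
    push_cast
    exact mul_ne_zero two_ne_zero (pow_ne_zero 2 h2)

end

section

variable {M : Type*} [TopologicalSpace M] [ChartedSpace E4 M] [IsManifold (𝓡 4) ∞ M]
  {O : OrientedAtlas M} {e : OpenPartialHomeomorph M E4} {x : M} {y : E4} {U : Set M}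
  {g : Bundle.ContMDiffRiemannianMetric (𝓡 4) ∞ E4 (fun x : M => TangentSpace (𝓡 4) x)}
  {Om : M → ℝ} {om rho om' rho' : TwoTensor M} {K K' : OneForm M}

/-! ### Conformal invariance -/

theorem IsRescalingOn.isRescalingDOn (hU : IsOpen U) (hOm : IsConformalFactorOn U Om)
    (hs : IsSectionOn O U g.inner om K rho)
    (hs' : IsSectionOn O U (rescaledMetric Om g.inner) om' K' rho')
    (h : IsRescalingOn O U g.inner Om om K rho om' K' rho') :
    IsRescalingDOn O U g.inner Om om K rho om' K' rho' := by
  intro e he y hy E hE A A'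
  have hg := (metricOn_comp2 g (O.smooth e he)).mono (isOpen_coordSet hU)
    (Set.inter_subset_left (t := e.symm ⁻¹' U))
  have hu := hOm.sm (O.smooth e he)
  have hpos : ∀ z ∈ coordSet e U, 0 < Om (e.symm z) := fun z hz => hOm.2 _ hz.2
  exact tractorD_conf hg hu hpos (hs.sectionOn he) (hs'.sectionOn he)
    ((rescalingOn_iff hg hpos (hs.sectionOn he) (hs'.sectionOn he)).2 fun z hz E hE =>
      h e he z hz E hE) hy hE A A'

/-! ### From a parallel section to a Kähler metric -/

/-- Raising an index of a two-tensor. -/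
theorem exists_endField (g : Bundle.ContMDiffRiemannianMetric (𝓡 4) ∞ E4
    (fun x : M => TangentSpace (𝓡 4) x)) (T : TwoTensor M) :
    ∃ J : EndField M, ∀ x v w, tensorAt g.inner x (endAt J x v) w = tensorAt T x v w := by
  have key : ∀ x, ∃ L : E4 →L[ℝ] E4, ∀ v w, tensorAt g.inner x (L v) w = tensorAt T x v w := by
    intro x
    -- The Euclidean Riesz isomorphism only serves to turn v ↦ g(v, ·) into an endomorphism.
    -- Positivity makes it injective, and finite dimension then gives an inverse.
    let D := (InnerProductSpace.toDual ℝ E4).symm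
    let A : E4 →ₗ[ℝ] E4 := D.toLinearEquiv.toLinearMap ∘ₗ (tensorAt g.inner x).toLinearMap
    have hA : Function.Injective A := by
      rw [← LinearMap.ker_eq_bot, LinearMap.ker_eq_bot']
      intro v hv
      by_contra hne
      have h1 : tensorAt g.inner x v = 0 := D.map_eq_zero_iff.1 hv
      have h2 : 0 < tensorAt g.inner x v v := g.pos x v hne
      rw [h1] at h2
      exact lt_irrefl _ h2
    let B := LinearEquiv.ofInjectiveEndo A hA
    let L : E4 →ₗ[ℝ] E4 := B.symm.toLinearMap ∘ₗ D.toLinearEquiv.toLinearMap ∘ₗ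
      (tensorAt T x).toLinearMap
    refine ⟨LinearMap.toContinuousLinearMap L, fun v w => ?_⟩
    have h1 : A (L v) = D (tensorAt T x v) := B.apply_symm_apply _
    have h2 : tensorAt g.inner x (L v) = tensorAt T x v := D.injective h1
    exact congrArg (fun f : E4 →L[ℝ] ℝ => f w) h2
  choose J hJ using key
  exact ⟨J, hJ⟩

/-- The Kähler metric is |ω|⁻²g with form |ω|⁻³ω. Its form is parallel, from which both
integrability and closedness follow. -/
theorem HasParallelSectionOn.isConformalToKahlerOn (hU : IsOpen U)
    (h : HasParallelSectionOn O U g.inner) : IsConformalToKahlerOn O U g.inner := by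
  obtain ⟨om, K, rho, hs, hp, hn⟩ := h
  have hg : ∀ e ∈ O.charts, MetricOn (comp2 e g.inner) (coordSet e U) := fun e he =>
    (metricOn_comp2 g (O.smooth e he)).mono (isOpen_coordSet hU) Set.inter_subset_left
  have hsec := fun e he => hs.sectionOn (e := e) he
  have hlen : ∀ e ∈ O.charts, ∀ z ∈ coordSet e U, 0 < lenSq (comp2 e g.inner) (comp2 e om) z :=
    fun e he z hz => (hsec e he).lenSq_pos (hg e he) hz (hn e he z hz)
  -- Ω = |ω|⁻¹ is read off in any chart, the length being invariant under changes of coordinates.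
  obtain ⟨Om, hOmc⟩ := exists_function (O := O) (U := U)
    (fun e => unitFactor (comp2 e g.inner) (comp2 e om)) fun e he e' he' z hz => by
      have hF := coordChange_transition he he' hU
      rw [unitFactor, unitFactor, ← hF.lenSq_pb hz,
        lenSq_congr (comp2_transition (O.smooth e he) (O.smooth e' he') _ hz)
          (comp2_transition (O.smooth e he) (O.smooth e' he') _ hz)]
  have hsm : ∀ e ∈ O.charts, Sm (coordSet e U) fun y => Om (e.symm y) := fun e he =>
    ((hg e he).sm_unitFactor (hsec e he).sm_om (hlen e he)).congr fun z hz => hOmc e he z hz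
  have hpos : ∀ e ∈ O.charts, ∀ z ∈ coordSet e U, 0 < Om (e.symm z) := fun e he z hz => by
    rw [hOmc e he z hz]; exact unitFactor_pos (hlen e he z hz)
  have hOm : IsConformalFactorOn U Om := ⟨contMDiffOn_of_charts hU hsm, fun x hx => by
    have hxc := O.mem_chartAt x
    have h1 := hpos _ (O.chartAt_mem x) (O.chartAt x x) ⟨(O.chartAt x).map_source hxc, by
      simpa [(O.chartAt x).left_inv hxc] using hx⟩
    rwa [(O.chartAt x).left_inv hxc] at h1⟩
  -- Raising the index with g requires g(J·, ·) = Ωω, so that Ω²g(J·, ·) is the rescaled form Ω³ω.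
  obtain ⟨J, hJ⟩ := exists_endField g fun x => Om x • om x
  obtain ⟨H, hH⟩ : ∃ H, H = rescaledMetric Om g.inner := ⟨_, rfl⟩
  have hS : ∀ e i j z, comp2 e (kahlerForm H J) i j z = Om (e.symm z) ^ 3 * comp2 e om i j z := by
    intro e i j z
    have h1 := hJ (e.symm z) (coordVec e i z) (coordVec e j z)
    have h2 : comp2 e (kahlerForm H J) i j z = Om (e.symm z) ^ 2 *
        tensorAt g.inner (e.symm z) (endAt J (e.symm z) (coordVec e i z)) (coordVec e j z) := by
      rw [hH]; rfl
    have h3 : tensorAt (fun x => Om x • om x) (e.symm z) (coordVec e i z) (coordVec e j z)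
        = Om (e.symm z) * comp2 e om i j z := rfl
    rw [h2, h1, h3]
    ring
  have hHc : ∀ e, comp2 e H = confMetric (fun y => Om (e.symm y)) (comp2 e g.inner) := fun e => by
    rw [hH]; rfl
  have hgH : ∀ e ∈ O.charts, MetricOn (comp2 e H) (coordSet e U) := fun e he => by
    rw [hHc]; exact (hg e he).conf (hsm e he) (hpos e he)
  have hSJ : ∀ e ∈ O.charts, ∀ z ∈ coordSet e U, ∀ i j, comp2 e (kahlerForm H J) i j z
      = ∑ k, compEnd e J k i z * comp2 e H k j z := fun e he z hz =>
    comp2_kahlerForm H J (O.smooth e he) hz.1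
  have hsecS : ∀ e ∈ O.charts, SectionOn (comp2 e H) (comp2 e (kahlerForm H J))
      (fun j z => Om (e.symm z) * (comp1 e K j z
        + contract (comp2 e g.inner) (comp2 e om) (logPd fun y => Om (e.symm y)) j z))
      (fun _ _ _ => 0) (coordSet e U) := fun e he => by
    rw [hHc, show comp2 e (kahlerForm H J) = fun i j z => Om (e.symm z) ^ 3 * comp2 e om i j z from
      funext fun i => funext fun j => funext fun z => hS e i j z]
    exact (hsec e he).conf (hg e he) (hsm e he) (hpos e he)
  have hJsm : ∀ e ∈ O.charts, ∀ k i, Sm (coordSet e U) (compEnd e J k i) := fun e he k i => by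
    refine (Sm.sum (s := Finset.univ) fun m _ =>
      ((hgH e he).sm_inv k m).mul ((hsecS e he).sm_om i m)).congr fun z hz => ?_
    rw [← (hgH e he).raise_lower hz (fun l => compEnd e J l i z) k]
    refine Finset.sum_congr rfl fun m _ => ?_
    rw [hSJ e he z hz]
    congr 1
    exact Finset.sum_congr rfl fun l _ => by rw [(hgH e he).symm z hz m l]; ring
  have hpar : ∀ e ∈ O.charts, ∀ z ∈ coordSet e U, ∀ q i j,
      nabla2 (comp2 e H) (comp2 e (kahlerForm H J)) q i j z = 0 := fun e he z hz q i j => by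
    rw [hHc, show comp2 e (kahlerForm H J) = fun i j z => Om (e.symm z) ^ 3 * comp2 e om i j z from
      funext fun i => funext fun j => funext fun z => hS e i j z]
    exact (hsec e he).nabla2_conf_eq_zero (hg e he) (hlen e he)
      (fun w hw E hE A A' => by rw [hp e he w hw E hE A A']; rfl) (hOmc e he) hz q i j
  have hnorm : ∀ e ∈ O.charts, ∀ z ∈ coordSet e U, ∀ i j,
      comp2 e (pullbackEnd H J) i j z = comp2 e H i j z := fun e he z hz i j => by
    rw [comp2_pullbackEnd H J (O.smooth e he) hz.1,
      ← (hgH e he).pairContract_of_end hz (hSJ e he z hz) i j, hHc,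
      pairContract_congr (S := fun i j z => Om (e.symm z) ^ 3 * comp2 e om i j z)
        (T := fun i j z => Om (e.symm z) ^ 3 * comp2 e om i j z) (fun _ _ => rfl)
        (fun i j => hS e i j z) (fun i j => hS e i j z),
      pairContract_conf (hg e he) hz (hpos e he z hz).ne', (hsec e he).pairContract_eq (hg e he) hz,
      confMetric, hOmc e he z hz]
    linear_combination unitFactor (comp2 e g.inner) (comp2 e om) z ^ 2 * comp2 e g.inner i j z *
      unitFactor_sq_mul (hlen e he z hz)
  have hherm : ∀ x ∈ U, ∀ v w, tensorAt H x (endAt J x v) (endAt J x w) = tensorAt H x v w :=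
    fun x hx v w => tensor_congr hnorm hx v w
  have halt : ∀ x ∈ U, ∀ v, tensorAt H x (endAt J x v) v = 0 := fun x hx v =>
    apply_self_of_comp2_antisymm (T := kahlerForm H J) (fun e he => (hsecS e he).antisymm_om) hx v
  -- J is both orthogonal and skew for H, so H(J²v + v, w) = 0 for all w; positivity concludes.
  have hsq : ∀ x ∈ U, ∀ v, endAt J x (endAt J x v) = -v := fun x hx v => by
    have h1 : ∀ a b, tensorAt H x (endAt J x a) b = -tensorAt H x (endAt J x b) a := fun a b => by
      have h2 := halt x hx (a + b)
      simp only [map_add, add_apply, halt x hx, zero_add, add_zero] at h2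
      linarith
    have h2 : ∀ a b, tensorAt H x a b = tensorAt H x b a := fun a b => by
      rw [hH]; exact congrArg (Om x ^ 2 * ·) (g.symm x _ _)
    have h3 : ∀ w, tensorAt H x (endAt J x (endAt J x v) + v) w = 0 := fun w => by
      rw [map_add, add_apply, h1, hherm x hx, h2 w v, neg_add_cancel]
    by_contra hne
    have h4 : 0 < Om x ^ 2 * tensorAt g.inner x (endAt J x (endAt J x v) + v)
        (endAt J x (endAt J x v) + v) :=
      mul_pos (pow_pos (hOm.2 x hx) 2) (g.pos x _ fun h0 => hne (eq_neg_of_add_eq_zero_left h0))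
    have h5 := h3 (endAt J x (endAt J x v) + v)
    rw [hH] at h5
    exact h4.ne' h5
  refine ⟨Om, J, hOm, hH ▸ ⟨hJsm, hsq, hherm, fun e he z hz =>
    (hgH e he).nijenhuis_eq_zero hz (hJsm e he) (hSJ e he) (hpar e he z hz),
    fun e he z hz i j k => ?_, fun e he => (hsecS e he).selfDual⟩⟩
  rw [← (hgH e he).cyclic_nabla2 hz ((hsecS e he).antisymm_om z hz)]
  simp only [hpar e he z hz, add_zero]

end

end ConfKahler

end

/-! ### The theorem -/

open ConfKahler in
theorem mainTheorem2 {M : Type*} [TopologicalSpace M] [ChartedSpace E4 M]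
    [IsManifold (𝓡 4) ∞ M] (O : OrientedAtlas M)
    (g : Bundle.ContMDiffRiemannianMetric (𝓡 4) ∞ E4 (fun x : M => TangentSpace (𝓡 4) x))
    (hg : IsAntiSelfDual O g.inner) :
    -- `g` is locally conformal to Kähler iff there are local parallel sections
    ((∀ p : M, ∃ U : Set M, IsOpen U ∧ p ∈ U ∧ IsConformalToKahlerOn O U g.inner) ↔
      ∀ p : M, ∃ U : Set M, IsOpen U ∧ p ∈ U ∧ HasParallelSectionOn O U g.inner) ∧
    -- the same on every given open set, in particular on a neighbourhood of a point and on `M`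
    (∀ U : Set M, IsOpen U →
      (IsConformalToKahlerOn O U g.inner ↔ HasParallelSectionOn O U g.inner)) ∧
    -- the connection is conformally invariant
    (∀ U : Set M, IsOpen U → ∀ Om : M → ℝ, IsConformalFactorOn U Om →
      ∀ (om : TwoTensor M) (K : OneForm M) (rho : TwoTensor M)
        (om' : TwoTensor M) (K' : OneForm M) (rho' : TwoTensor M),
        IsSectionOn O U g.inner om K rho →
        IsSectionOn O U (rescaledMetric Om g.inner) om' K' rho' →
        IsRescalingOn O U g.inner Om om K rho om' K' rho' →
        IsRescalingDOn O U g.inner Om om K rho om' K' rho') := by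
  have key : ∀ U : Set M, IsOpen U →
      (IsConformalToKahlerOn O U g.inner ↔ HasParallelSectionOn O U g.inner) := fun U hU =>
    ⟨fun h => h.hasParallelSectionOn hU hg, fun h => h.isConformalToKahlerOn hU⟩
  refine ⟨⟨fun h p => ?_, fun h p => ?_⟩, key, fun U hU Om hOm om K rho om' K' rho' hs hs' h =>
    h.isRescalingDOn hU hOm hs hs'⟩
  · obtain ⟨U, hU, hp, hk⟩ := h p
    exact ⟨U, hU, hp, (key U hU).1 hk⟩
  · obtain ⟨U, hU, hp, hk⟩ := h p
    exact ⟨U, hU, hp, (key U hU).2 hk⟩
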